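/- **Setting.** Let $d\ge 3$ and $\langle y\rangle:=\sqrt{1+|y|^2}$. Let $\mu\in(-\infty,1]$ and let $B:\mathbb R^d\times S^{d-1}\to\mathbb R_+$ be measurable, continuous in its first variable, with $B(v-v_*,\omega)=B(v_*-v,\omega)=B(v_*'-v',\omega)$ for all $v,v_*,\omega$, where $v'=v-\langle v-v_*,\omega\rangle\omega$ and $v_*'=v_*+\langle v-v_*,\omega\rangle\omega$, and with $C_B^{-1}\langle v\rangle^\mu\le B(v,\omega)\le C_B\langle v\rangle^\mu$ for some $C_B>0$. Let $k(y)=C_k\exp(-\gamma\langle y\rangle)$ with $C_k,\gamma>0$. Write $f=f(x,v)$, $f_*=f(x_*,v_*)$, $f'=f(x,v')$, $f'_*=f(x_*,v_*')$, $\bar\nabla\varphi=\varphi'+\varphi'_*-\varphi-\varphi_*$, $Bk=B(v-v_*,\omega)k(x-x_*)$ and $d\sigma=dx\,dx_*\,dv\,dv_*\,d\omega$ on $\mathbb R^{4d}\times S^{d-1}$. The fuzzy Boltzmann equation is $\partial_tf+v\cdot\nabla_xf=Q(f)$ with $Q(f)=\int_{\mathbb R^{2d}\times S^{d-1}}(f'f'_*-ff_*)Bk\,dx_*dv_*d\omega$.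 A weak solution on $[0,T]$ with initial value $f_0\in L^1(\mathbb R^{2d})$ is a curve $f\in C([0,T];L^1(\mathbb R^{2d}))$ such that, for all $\varphi\in C_c^\infty([0,T)\times\mathbb R^{2d})$, the collision integral below is well defined and $$-\int_{\mathbb R^{2d}}\varphi(0)f_0\,dx\,dv-\int_0^T\!\!\int_{\mathbb R^{2d}}(\partial_t+v\cdot\nabla_x)\varphi\, f_t\,dx\,dv\,dt=-\frac14\int_0^T\!\!\int_{\mathbb R^{4d}\times S^{d-1}}\bar\nabla\varphi\,\big(f_t'(f_t)'_*-f_t(f_t)_*\big)Bk\,d\sigma\,dt .$$ Put $[f_t](x,v):=f_t(x+tv,v)$, $\|f\|_{L^1_{p,0}}=\int\langle x\rangle^p|f|$, $\|f\|_{L^1_{0,q}}=\int\langle v\rangle^q|f|$, $\|f\|_{L^1_{p,q}}=\|f\|_{L^1_{p,0}}+\|f\|_{L^1_{0,q}}$ (with $L^1_{p,q}$, $L^1_{0,q}$ the sets of $f \in L^1$ where these are finite), $\mathcal H(f)=\int f\log f$ (set to $+\infty$ if $(f\log f)^+$ is not integrable), and $\mathcal D(f)=\frac14\int(f'f'_*-ff_*)\big(\log(f'f'_*)-\log(ff_*)\big)Bk\,d\sigma\in[0,\infty]$,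 where $(a-b)(\log a-\log b)$ is $0$ for $a=b=0$ and $+\infty$ if exactly one of $a,b$ is $0$. **Theorem.** Constants below may depend on $d,B,k,\mu$, but not on $f_0$; they depend on $T$ only where a subscript $T$ is written. (1) *Case $\mu\le 0$.* For every $f_0\in L^1(\mathbb R^{2d};\mathbb R_+)$ there is a global curve $(f_t)_{t\ge0}$ such that for every $T>0$: $f$ is a weak solution on $[0,T]$ with initial value $f_0$, it is the only one, it is nonnegative, $t\mapsto[f_t]$ belongs to $C^1([0,T];L^1(\mathbb R^{2d}))$, and $\|f_t\|_{L^1}=\|f_0\|_{L^1}$ for $t\in[0,T]$. Moreover, for all $t\in[0,T]$: - if $f_0\in L^1_{0,2}$, then $f_t\in L^1_{0,2}$ and $\int(v,|v|^2)f_t\,dx\,dv=\int(v,|v|^2)f_0\,dx\,dv$; - if $f_0\in L^1_{2,2}$, then $\|f_t\|_{L^1_{2,0}}\le C_T\|f_0\|_{L^1_{2,2}}$; - if $f_0\in L^1_{2,2}$ and $\mathcal H(f_0)<\infty$, then $\mathcal H(f_t)$ is finite, $\mathcal H(f_t)-\mathcal H(f_0)+\int_0^t\mathcal D(f_s)\,ds\le0$,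 and $\int_0^T\mathcal D(f_s)\,ds<\infty$. (2) *Case $\mu\in(0,1]$.* For every nonnegative $f_0\in L^1_{2,2+\mu}(\mathbb R^{2d})$ with $\mathcal H(f_0)<\infty$ there is a global curve $(f_t)_{t\ge0}$ such that for every $T>0$: $f$ is a weak solution on $[0,T]$ with initial value $f_0$, it lies in $L^\infty([0,T];L^1_{2,2+\mu})$ and is the only weak solution in that class, it is nonnegative, and $t\mapsto[f_t]$ belongs to $C^1([0,T];L^1(\mathbb R^{2d}))$. Moreover, for all $t\in[0,T]$, $\int(1,v,|v|^2)f_t\,dx\,dv=\int(1,v,|v|^2)f_0\,dx\,dv$, $\|f_t\|_{L^1_{2,0}}\le C_T\|f_0\|_{L^1_{2,2}}$, $$\|f_t\|_{L^1_{0,2+\mu}}\le K\,\|f_0\|_{L^1_{0,2+\mu}}\exp\big(C'_T\|f_0\|_{L^1_{0,2}}\big),$$ $\mathcal H(f_t)$ is finite, $\mathcal H(f_t)-\mathcal H(f_0)+\int_0^t\mathcal D(f_s)\,ds\le0$, and $\int_0^T\mathcal D(f_s)\,ds<\infty$. -/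

import Mathlib

open MeasureTheory Set
open scoped ENNReal

noncomputable section

namespace FuzzyBoltzmann

/-- The space `ℝᵈ` of positions or of velocities, with its Euclidean norm. -/
abbrev Vec (d : ℕ) : Type := EuclideanSpace ℝ (Fin d)

/-- The phase space `ℝ²ᵈ`; a point is `z = (x, v)` = (position, velocity). -/
abbrev Phase (d : ℕ) : Type := Vec d × Vec d

/-- The unit sphere `S^{d-1}`. -/
abbrev Sph (d : ℕ) : Type := Metric.sphere (0 : Vec d) 1

/-- The Banach space `L¹(ℝ²ᵈ)` of real functions (modulo a.e. equality) for Lebesgue measure. -/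
abbrev L1 (d : ℕ) : Type := Lp ℝ 1 (volume : Measure (Phase d))

variable {d : ℕ}

/-- The Japanese bracket `⟨y⟩ = √(1 + |y|²)`. -/
def jb (y : Vec d) : ℝ := Real.sqrt (1 + ‖y‖ ^ 2)

/-- The post-collisional velocity `v' = v - ⟨v - v_*, ω⟩ ω`. -/
def postV (v vs : Vec d) (ω : Sph d) : Vec d := v - (inner ℝ (v - vs) (ω : Vec d)) • (ω : Vec d)

/-- The post-collisional velocity `v_*' = v_* + ⟨v - v_*, ω⟩ ω`. -/
def postVs (v vs : Vec d) (ω : Sph d) : Vec d := vs + (inner ℝ (v - vs) (ω : Vec d)) • (ω : Vec d)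

/-- The assumptions on the collision kernel `B : ℝᵈ × S^{d-1} → ℝ₊` with growth exponent `μ`. -/
structure IsCollisionKernel (μ : ℝ) (B : Vec d → Sph d → ℝ) : Prop where
  measurable : Measurable (fun p : Vec d × Sph d => B p.1 p.2)
  continuous : ∀ ω, Continuous (fun y => B y ω)
  symm : ∀ v vs ω, B (v - vs) ω = B (vs - v) ω
  collision_invariant : ∀ v vs ω, B (v - vs) ω = B (postVs v vs ω - postV v vs ω) ω
  bounds : ∃ C : ℝ, 0 < C ∧ ∀ v ω, C⁻¹ * jb v ^ μ ≤ B v ω ∧ B v ω ≤ C * jb v ^ μ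

/-- The spatial kernel is `k(y) = C exp (-γ ⟨y⟩)` with `C, γ > 0`. -/
def IsSpatialKernel (k : Vec d → ℝ) : Prop :=
  ∃ C γ : ℝ, 0 < C ∧ 0 < γ ∧ ∀ y, k y = C * Real.exp (-γ * jb y)

/-- The space `ℝ⁴ᵈ × S^{d-1}` of collisions; a point is `((x, v), (x_*, v_*), ω)`. -/
abbrev Coll (d : ℕ) : Type := Phase d × Phase d × Sph d

/-- The measure `dσ = dx dv dx_* dv_* dω`, where `dω` is the surface measure of the sphere. -/
def collMeasure (d : ℕ) : Measure (Coll d) :=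
  (volume : Measure (Phase d)).prod
    ((volume : Measure (Phase d)).prod (volume : Measure (Vec d)).toSphere)

/-- The state `(x, v')` of the first particle after the collision. -/
def post (c : Coll d) : Phase d := (c.1.1, postV c.1.2 c.2.1.2 c.2.2)

/-- The state `(x_*, v_*')` of the second particle after the collision. -/
def postS (c : Coll d) : Phase d := (c.2.1.1, postVs c.1.2 c.2.1.2 c.2.2)

/-- The weight `B(v - v_*, ω) k(x - x_*)`. -/
def weight (B : Vec d → Sph d → ℝ) (k : Vec d → ℝ) (c : Coll d) : ℝ :=
  B (c.1.2 - c.2.1.2) c.2.2 * k (c.1.1 - c.2.1.1)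

/-- `f f_* = f(x, v) f(x_*, v_*)`. -/
def preProd (f : Phase d → ℝ) (c : Coll d) : ℝ := f c.1 * f c.2.1

/-- `f' f_*' = f(x, v') f(x_*, v_*')`. -/
def postProd (f : Phase d → ℝ) (c : Coll d) : ℝ := f (post c) * f (postS c)

/-- The collision gradient `φ' + φ_*' - φ - φ_*`. -/
def collGrad (φ : Phase d → ℝ) (c : Coll d) : ℝ := φ (post c) + φ (postS c) - φ c.1 - φ c.2.1

/-- Test functions of class `C_c^∞([0, T) × ℝ²ᵈ)`: restrictions to nonnegative times of smooth
functions on `ℝ × ℝ²ᵈ` with compact support in `(-∞, T) × ℝ²ᵈ`. -/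
def IsTest (T : ℝ) (φ : ℝ × Phase d → ℝ) : Prop :=
  ContDiff ℝ (⊤ : ℕ∞) φ ∧ HasCompactSupport φ ∧ tsupport φ ⊆ Iio T ×ˢ univ

/-- The transport derivative `(∂_t + v · ∇_x) φ` at `(t, (x, v))`. -/
def transportDeriv (φ : ℝ × Phase d → ℝ) (t : ℝ) (z : Phase d) : ℝ :=
  fderiv ℝ φ (t, z) (1, 0) + fderiv ℝ φ (t, z) (0, (z.2, 0))

/-- The integrand of the collision term of the weak formulation at one time:
`(φ' + φ_*' - φ - φ_*) (f' f_*' - f f_*) B k`. -/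
def collIntegrand (B : Vec d → Sph d → ℝ) (k : Vec d → ℝ) (φ f : Phase d → ℝ) (c : Coll d) : ℝ :=
  collGrad φ c * (postProd f c - preProd f c) * weight B k c

/-- `f ∈ C([0, T]; L¹(ℝ²ᵈ))` is a weak solution on `[0, T]` of `∂_t f + v · ∇_x f = Q(f)` with
initial value `f₀`. The first two clauses on `φ` say that the collision term is well defined.
Only the values `f t` with `t ∈ [0, T]` matter. -/
def IsWeakSolution (B : Vec d → Sph d → ℝ) (k : Vec d → ℝ) (T : ℝ) (f₀ : L1 d) (f : ℝ → L1 d) :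
    Prop :=
  ContinuousOn f (Icc 0 T) ∧
  ∀ φ : ℝ × Phase d → ℝ, IsTest T φ →
    (∀ᵐ t ∂(volume.restrict (Icc 0 T)),
      Integrable (collIntegrand B k (fun z => φ (t, z)) (f t)) (collMeasure d)) ∧
    IntervalIntegrable
      (fun t => ∫ c, collIntegrand B k (fun z => φ (t, z)) (f t) c ∂(collMeasure d)) volume 0 T ∧
    - (∫ z, φ (0, z) * f₀ z) - (∫ t in (0 : ℝ)..T, ∫ z, transportDeriv φ t z * f t z)
      = - (1 / 4 : ℝ) *
        ∫ t in (0 : ℝ)..T, ∫ c, collIntegrand B k (fun z => φ (t, z)) (f t) c ∂(collMeasure d)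

theorem measurePreserving_shift (d : ℕ) (t : ℝ) :
    MeasurePreserving (fun z : Phase d => (z.1 + t • z.2, z.2))
      (volume : Measure (Phase d)) (volume : Measure (Phase d)) := by
  have h : MeasurePreserving (fun p : Vec d × Vec d => (p.1, p.2 + t • p.1))
      ((volume : Measure (Vec d)).prod volume) ((volume : Measure (Vec d)).prod volume) := by
    refine (MeasurePreserving.id (volume : Measure (Vec d))).skew_product
      (g := fun a b => b + t • a) (by fun_prop) (Filter.Eventually.of_forall fun a => ?_)
    exact (measurePreserving_add_right (volume : Measure (Vec d)) (t • a)).map_eq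
  exact (Measure.measurePreserving_swap.comp h).comp Measure.measurePreserving_swap

/-- `[f]_t`, the pull-back of `f` along free transport for time `t`: `(x, v) ↦ f(x + t v, v)`. -/
def alongChar (t : ℝ) (f : L1 d) : L1 d :=
  Lp.compMeasurePreserving (fun z : Phase d => (z.1 + t • z.2, z.2)) (measurePreserving_shift d t) f

/-- `‖f‖_{L¹_{p,0}} = ∫ ⟨x⟩ᵖ |f| dx dv`, with values in `[0, ∞]`. -/
def normX (p : ℝ) (f : Phase d → ℝ) : ℝ≥0∞ := ∫⁻ z, ENNReal.ofReal (jb z.1 ^ p * |f z|)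

/-- `‖f‖_{L¹_{0,q}} = ∫ ⟨v⟩^q |f| dx dv`, with values in `[0, ∞]`. -/
def normV (q : ℝ) (f : Phase d → ℝ) : ℝ≥0∞ := ∫⁻ z, ENNReal.ofReal (jb z.2 ^ q * |f z|)

/-- `‖f‖_{L¹_{p,q}} = ‖f‖_{L¹_{p,0}} + ‖f‖_{L¹_{0,q}}`. -/
def normXV (p q : ℝ) (f : Phase d → ℝ) : ℝ≥0∞ := normX p f + normV q f

/-- `f ∈ L^∞([0, T]; L¹_{p,q}(ℝ²ᵈ))` for a curve `f` in `L¹`. -/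
def IsEssBounded (p q T : ℝ) (f : ℝ → L1 d) : Prop :=
  ∃ M : ℝ, ∀ᵐ t ∂(volume.restrict (Icc 0 T)), normXV p q (f t) ≤ ENNReal.ofReal M

open Classical in
/-- The Boltzmann-Shannon entropy `∫ f log f`, set to `+∞` if the positive part of `f log f` is
not integrable. -/
def entropy (f : Phase d → ℝ) : EReal :=
  if ∫⁻ z, ENNReal.ofReal (f z * Real.log (f z)) = ⊤ then ⊤
  else ((∫⁻ z, ENNReal.ofReal (f z * Real.log (f z)) : ℝ≥0∞) : EReal)
    - ((∫⁻ z, ENNReal.ofReal (-(f z * Real.log (f z))) : ℝ≥0∞) : EReal)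

open Classical in
/-- `(a - b) (log a - log b)` for `a, b ≥ 0`, extended by `0` if `a = b = 0` and by `+∞` if exactly
one of `a, b` vanishes. -/
def dissDensity (a b : ℝ) : ℝ≥0∞ :=
  if 0 < a ∧ 0 < b then ENNReal.ofReal ((a - b) * (Real.log a - Real.log b))
  else if a = 0 ∧ b = 0 then 0 else ⊤

/-- The entropy dissipation
`𝒟(f) = ¼ ∫ (f' f_*' - f f_*) (log (f' f_*') - log (f f_*)) B k dσ` in `[0, ∞]`. -/
def dissipation (B : Vec d → Sph d → ℝ) (k : Vec d → ℝ) (f : Phase d → ℝ) : ℝ≥0∞ :=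
  ENNReal.ofReal (1 / 4) *
    ∫⁻ c, dissDensity (postProd f c) (preProd f c) * ENNReal.ofReal (weight B k c) ∂(collMeasure d)

/-- Conservation of momentum and kinetic energy between `f` and `g`; the finiteness of
`∫ ⟨v⟩² |g|` makes the integrals meaningful. -/
def SameMomentumEnergy (f g : L1 d) : Prop :=
  normV 2 g < ⊤ ∧ (∫ z, g z • z.2 = ∫ z, f z • z.2) ∧
    (∫ z, ‖z.2‖ ^ 2 * g z = ∫ z, ‖z.2‖ ^ 2 * f z)

/-- The entropy inequality `H(f_t) - H(f₀) + ∫₀ᵗ 𝒟(f_s) ds ≤ 0` on `[0, T]`, with `H(f_t)` finite,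
together with `∫₀ᵀ 𝒟(f_s) ds < ∞`. -/
def EntropyInequality (B : Vec d → Sph d → ℝ) (k : Vec d → ℝ) (T : ℝ) (f₀ : L1 d) (f : ℝ → L1 d) :
    Prop :=
  (∀ t ∈ Icc (0 : ℝ) T, ⊥ < entropy (f t) ∧ entropy (f t) < ⊤ ∧
    entropy (f t) - entropy f₀ + ((∫⁻ s in Icc 0 t, dissipation B k (f s) : ℝ≥0∞) : EReal) ≤ 0) ∧
  ∫⁻ s in Icc 0 T, dissipation B k (f s) < ⊤

end FuzzyBoltzmann

end

open FuzzyBoltzmann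

/-! Along free characteristics the equation becomes an ordinary differential equation in `L¹`: the
derivative of `alongChar t (f t)` is `alongChar t (Q (f t))`, and `IsMild` is its integrated form.
The transport of test functions shows that mild solutions are weak (`IsMild.isWeakSolution`).
Conversely, a weak solution whose collision term is continuous in time is mild
(`isMild_of_isWeakSolution`). So existence and uniqueness may be treated for mild solutions.

The structure of the collisions enters through `collMap`: it preserves the measure `collMeasure`, is
an involution, and conserves momentum and kinetic energy. This gives the weak form of `Q` with its
factor 1/4, and all conservation laws.

For `μ ≤ 0` the weight `B k` is bounded and `Q` is locally Lipschitz on `L¹`. Adding a multiple `λ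
f` to both sides makes the right-hand side nonnegative on nonnegative functions of fixed mass, and a
damped Picard iteration stays in that set (`exists_mild`). Uniqueness is Gronwall's lemma.

For `0 < μ` the weight is truncated to bounded regions. The data are truncated as well and mixed
with a positive density. Three estimates are uniform in the truncation: conservation of energy;
propagation of moments in velocity, where by a Povzner-type inequality the top moments cancel in a
collision (`collGrad_kin_rpow_mul_le`); and growth of the position moment by transport alone. The
differences of the approximations are measured in `∫ ⟨v⟩² |f - g|`. There the sign of `f - g` makes
the dangerous power of the velocity cancel (`HasGrowth.integral_sign_mul_le`), and the moment of
order `2 + μ` is exactly what remains. With the tail estimate for the truncated weights this makes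
the approximations a Cauchy sequence (`IsApprox.exists_cauchy_bound`), and it also gives uniqueness.
The same construction with `ν = 0` yields the conservation laws and the entropy inequality when `μ ≤
0`.

For the entropy, the collision operator is replaced by `Q (min f R)` and `y log y` by a profile
whose derivative is `1 + log (min y R)`. On the states that collide, the solution is bounded below
by a positive constant, so the entropy identity is exact (`IsMild.truncated_entropy`). First `R →
∞`, then the truncation of weight and data is removed. In both limits the dissipation is lower
semicontinuous (`dissW_le_liminf`). The entropy is controlled by Fatou's lemma after an integrable
correction, for which the second limit uses the moments (`integral_mul_log_le_of_tendsto`). -/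

open FuzzyBoltzmann

/-! ### Geometry of collisions and invariance of the collision measure. -/

namespace FuzzyBoltzmann

open Filter Topology

variable {d : ℕ}

/-- The measure `dx_* dv_* dω` on the second particle and the direction of the collision. -/
noncomputable def partnerMeasure (d : ℕ) : Measure (Phase d × Sph d) :=
  (volume : Measure (Phase d)).prod (volume : Measure (Vec d)).toSphere

instance : (volume : Measure (Phase d)).IsAddHaarMeasure :=
  inferInstanceAs ((volume : Measure (Vec d)).prod volume).IsAddHaarMeasure

instance : SigmaFinite (volume : Measure (Phase d)) :=
  inferInstanceAs (SigmaFinite ((volume : Measure (Vec d)).prod volume))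

instance : IsFiniteMeasure (volume : Measure (Vec d)).toSphere := inferInstance

instance : SFinite (partnerMeasure d) := by unfold partnerMeasure; infer_instance

theorem collMeasure_eq : collMeasure d = (volume : Measure (Phase d)).prod (partnerMeasure d) := rfl

/-- The collision involution `(x, v, x_*, v_*, ω) ↦ (x, v', x_*, v_*', ω)`. -/
noncomputable def collMap (c : Coll d) : Coll d := (post c, postS c, c.2.2)

/-- The exchange of the two colliding particles. -/
def swapColl (c : Coll d) : Coll d := (c.2.1, c.1, c.2.2)

/-- A collision reflects the relative velocity in the hyperplane orthogonal to the unit vector `ω`,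
so its component along `ω` changes sign. This is why a second collision with the same `ω` undoes the
first. -/
theorem inner_post (v vs : Vec d) (ω : Sph d) :
    inner ℝ (postV v vs ω - postVs v vs ω) (ω : Vec d) = - inner ℝ (v - vs) (ω : Vec d) := by
  have hω : ‖(ω : Vec d)‖ = 1 := by simp
  have : postV v vs ω - postVs v vs ω
      = (v - vs) - (2 * inner ℝ (v - vs) (ω : Vec d)) • (ω : Vec d) := by
    simp only [postV, postVs]; module
  rw [this, inner_sub_left, inner_smul_left, real_inner_self_eq_norm_sq, hω]
  simp; ring

theorem collMap_collMap (c : Coll d) : collMap (collMap c) = c := by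
  obtain ⟨⟨x, v⟩, ⟨xs, vs⟩, ω⟩ := c
  have h := inner_post v vs ω
  have h1 : postV (postV v vs ω) (postVs v vs ω) ω = v := by
    rw [postV, h]; simp [postV]
  have h2 : postVs (postV v vs ω) (postVs v vs ω) ω = vs := by
    rw [postVs, h]; simp [postVs]
  simp only [collMap, post, postS, h1, h2]

theorem swapColl_swapColl (c : Coll d) : swapColl (swapColl c) = c := rfl

theorem postV_comm (v vs : Vec d) (ω : Sph d) : postV vs v ω = postVs v vs ω := by
  simp only [postV, postVs, inner_sub_left]; module

theorem post_swapColl (c : Coll d) : post (swapColl c) = postS c := by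
  simp [post, postS, swapColl, postV_comm]

theorem norm_sq_post (v vs : Vec d) (ω : Sph d) :
    ‖postV v vs ω‖ ^ 2 + ‖postVs v vs ω‖ ^ 2 = ‖v‖ ^ 2 + ‖vs‖ ^ 2 := by
  have hω : ‖(ω : Vec d)‖ = 1 := by simp
  rw [postV, postVs, norm_sub_sq_real, norm_add_sq_real, norm_smul, inner_smul_right,
    inner_smul_right, hω, inner_sub_left]
  simp only [Real.norm_eq_abs, mul_one, sq_abs]
  ring

theorem postV_add_postVs (v vs : Vec d) (ω : Sph d) : postV v vs ω + postVs v vs ω = v + vs := by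
  simp only [postV, postVs]; module

theorem continuous_collMap : Continuous (collMap : Coll d → Coll d) := by
  unfold collMap post postS postV postVs
  fun_prop

theorem continuous_swapColl : Continuous (swapColl : Coll d → Coll d) := by
  unfold swapColl; fun_prop

theorem continuous_post : Continuous (post : Coll d → Phase d) := continuous_collMap.fst

/-- The action of a collision with direction `ω` on pairs of states, as a linear map. -/
noncomputable def collLin (ω : Sph d) : (Phase d × Phase d) →ₗ[ℝ] (Phase d × Phase d) where
  toFun p := ((p.1.1, postV p.1.2 p.2.2 ω), (p.2.1, postVs p.1.2 p.2.2 ω))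
  map_add' p q := by
    simp only [postV, postVs, inner_sub_left, inner_add_left, Prod.fst_add, Prod.snd_add,
      Prod.mk_add_mk, Prod.mk.injEq, true_and]
    constructor <;> module
  map_smul' a p := by
    simp only [postV, postVs, inner_sub_left, inner_smul_left, Prod.smul_fst, Prod.smul_snd,
      Prod.smul_mk, Prod.mk.injEq, true_and, RingHom.id_apply, conj_trivial]
    constructor <;> module

theorem collLin_comp_self (ω : Sph d) : collLin ω ∘ₗ collLin ω = LinearMap.id := by
  refine LinearMap.ext fun p => ?_
  have := collMap_collMap (p.1, p.2, ω)
  simp only [collMap, post, postS, Prod.mk.injEq] at this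
  simp only [collLin, LinearMap.comp_apply, LinearMap.coe_mk, AddHom.coe_mk, LinearMap.id_apply]
  exact Prod.ext this.1 this.2.1

/-- An involution has determinant `1` or `-1`, so Lebesgue measure is preserved and no Jacobian has
to be computed. -/
theorem measurePreserving_collLin (ω : Sph d) :
    Measure.map (collLin ω) ((volume : Measure (Phase d)).prod (volume : Measure (Phase d)))
      = (volume : Measure (Phase d)).prod volume := by
  have h : LinearMap.det (collLin ω) * LinearMap.det (collLin ω) = 1 := by
    rw [← LinearMap.det_comp, collLin_comp_self, LinearMap.det_id]
  have h0 : LinearMap.det (collLin ω) ≠ 0 := fun h0 => by simp [h0] at h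
  have h1 : |(LinearMap.det (collLin ω))⁻¹| = 1 := by
    rw [abs_inv, inv_eq_one]
    rcases mul_self_eq_one_iff.1 h with h | h <;> simp [h]
  have : ((volume : Measure (Phase d)).prod (volume : Measure (Phase d))).IsAddHaarMeasure :=
    Measure.prod.instIsAddHaarMeasure _ _
  rw [Measure.map_linearMap_addHaar_eq_smul_addHaar _ h0, h1]
  simp

/-- For fixed `ω` the map is linear and measure preserving, so it is a skew product over the sphere.
The other maps in the composition only reorder the factors. -/
theorem measurePreserving_collMap :
    MeasurePreserving (collMap : Coll d → Coll d) (collMeasure d) (collMeasure d) := by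
  set P : Measure (Phase d) := volume
  set S : Measure (Sph d) := (volume : Measure (Vec d)).toSphere
  have h1 : MeasurePreserving (MeasurableEquiv.prodAssoc : (Phase d × Phase d) × Sph d ≃ᵐ _)
      ((P.prod P).prod S) (P.prod (P.prod S)) := measurePreserving_prodAssoc P P S
  have h2 : MeasurePreserving (fun p : Sph d × (Phase d × Phase d) => (p.1, collLin p.1 p.2))
      (S.prod (P.prod P)) (S.prod (P.prod P)) := by
    refine (MeasurePreserving.id S).skew_product (g := fun ω p => collLin ω p) ?_
      (Eventually.of_forall fun ω => measurePreserving_collLin ω)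
    apply Continuous.measurable
    simp only [collLin, LinearMap.coe_mk, AddHom.coe_mk, postV, postVs]
    fun_prop
  have h3 := h1.comp (Measure.measurePreserving_swap.comp
    (h2.comp (Measure.measurePreserving_swap.comp (h1.symm _))))
  exact h3

theorem measurePreserving_swapColl :
    MeasurePreserving (swapColl : Coll d → Coll d) (collMeasure d) (collMeasure d) := by
  set P : Measure (Phase d) := volume
  set S : Measure (Sph d) := (volume : Measure (Vec d)).toSphere
  have h1 : MeasurePreserving (MeasurableEquiv.prodAssoc : (Phase d × Phase d) × Sph d ≃ᵐ _)
      ((P.prod P).prod S) (P.prod (P.prod S)) := measurePreserving_prodAssoc P P S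
  have h2 : MeasurePreserving (Prod.map Prod.swap id : (Phase d × Phase d) × Sph d → _)
      ((P.prod P).prod S) ((P.prod P).prod S) :=
    (Measure.measurePreserving_swap (μ := P) (ν := P)).prod (MeasurePreserving.id S)
  exact h1.comp (h2.comp (h1.symm _))

/-- Collision weights: measurable, nonnegative, and invariant under collisions and under the
exchange of particles. -/
structure IsCollWeight (W : Coll d → ℝ) : Prop where
  measurable : Measurable W
  nonneg : ∀ c, 0 ≤ W c
  collMap : ∀ c, W (collMap c) = W c
  swap : ∀ c, W (swapColl c) = W c

/-- Together with the next three results this transfers almost-everywhere statements on phase space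
to each of the four states of a collision. Only null sets matter here, so quasi-preservation is
enough. -/
theorem quasi_fst : Measure.QuasiMeasurePreserving (fun c : Coll d => c.1) (collMeasure d) volume :=
  Measure.quasiMeasurePreserving_fst

theorem quasi_snd :
    Measure.QuasiMeasurePreserving (fun c : Coll d => c.2.1) (collMeasure d) volume := by
  have h : Measure.QuasiMeasurePreserving (fun c : Coll d => (swapColl c).1) (collMeasure d)
    volume := quasi_fst.comp measurePreserving_swapColl.quasiMeasurePreserving
  exact h

theorem quasi_post :
    Measure.QuasiMeasurePreserving (post : Coll d → Phase d) (collMeasure d) volume :=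
  quasi_fst.comp measurePreserving_collMap.quasiMeasurePreserving

theorem quasi_postS :
    Measure.QuasiMeasurePreserving (postS : Coll d → Phase d) (collMeasure d) volume :=
  quasi_snd.comp measurePreserving_collMap.quasiMeasurePreserving

theorem postProd_eq (f : Phase d → ℝ) (c : Coll d) : postProd f c = preProd f (collMap c) := rfl

/-- The total surface of the sphere. -/
noncomputable def sphArea (d : ℕ) : ℝ := ((volume : Measure (Vec d)).toSphere).real univ

theorem sphArea_nonneg : 0 ≤ sphArea d := measureReal_nonneg

/-- Tensor products of integrable functions are integrable on the collision space. -/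
theorem integrable_tensor {f g : Phase d → ℝ} (hf : Integrable f) (hg : Integrable g) :
    Integrable (fun c : Coll d => f c.1 * g c.2.1) (collMeasure d) :=
  hf.mul_prod (hg.comp_fst (volume : Measure (Vec d)).toSphere)

theorem integral_tensor (f g : Phase d → ℝ) :
    ∫ c, f c.1 * g c.2.1 ∂collMeasure d = sphArea d * ((∫ z, f z) * ∫ z, g z) := by
  have h := integral_prod_mul (μ := (volume : Measure (Phase d))) (ν := partnerMeasure d) f
    (fun p => g p.1)
  have h2 : ∫ p, g p.1 ∂partnerMeasure d = sphArea d * ∫ z, g z := by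
    have := integral_prod_mul (μ := (volume : Measure (Phase d)))
      (ν := (volume : Measure (Vec d)).toSphere) g (fun _ => 1)
    simp only [mul_one, integral_const, smul_eq_mul] at this
    rw [partnerMeasure, this, sphArea, mul_comm]
  rw [collMeasure_eq, h, h2]; ring

end FuzzyBoltzmann

/-! ### The collision operator of a rate, its weak forms and its `L¹` bounds. -/

namespace FuzzyBoltzmann

open Filter Topology

variable {d : ℕ}

/-- The density `z ↦ ∫ (K (Θ (z, p)) - K (z, p)) dp` produced by the collision rate `K`, where `Θ`
is the collision involution. -/
noncomputable def collFun (K : Coll d → ℝ) (z : Phase d) : ℝ :=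
  ∫ p, (K (collMap (z, p)) - K (z, p)) ∂partnerMeasure d

theorem integrable_comp_collMap {K : Coll d → ℝ} (hK : Integrable K (collMeasure d)) :
    Integrable (fun c => K (collMap c)) (collMeasure d) :=
  measurePreserving_collMap.integrable_comp_of_integrable hK

theorem integrable_comp_swapColl {K : Coll d → ℝ} (hK : Integrable K (collMeasure d)) :
    Integrable (fun c => K (swapColl c)) (collMeasure d) :=
  measurePreserving_swapColl.integrable_comp_of_integrable hK

/-- The collision map as a measurable equivalence. -/
noncomputable def collEquiv : Coll d ≃ᵐ Coll d where
  toFun := collMap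
  invFun := collMap
  left_inv := collMap_collMap
  right_inv := collMap_collMap
  measurable_toFun := continuous_collMap.measurable
  measurable_invFun := continuous_collMap.measurable

/-- The exchange of particles as a measurable equivalence. -/
def swapEquiv : Coll d ≃ᵐ Coll d where
  toFun := swapColl
  invFun := swapColl
  left_inv := swapColl_swapColl
  right_inv := swapColl_swapColl
  measurable_toFun := continuous_swapColl.measurable
  measurable_invFun := continuous_swapColl.measurable

theorem integral_comp_collMap (K : Coll d → ℝ) :
    ∫ c, K (collMap c) ∂collMeasure d = ∫ c, K c ∂collMeasure d :=
  measurePreserving_collMap.integral_comp collEquiv.measurableEmbedding K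

theorem integral_comp_swapColl (K : Coll d → ℝ) :
    ∫ c, K (swapColl c) ∂collMeasure d = ∫ c, K c ∂collMeasure d :=
  measurePreserving_swapColl.integral_comp swapEquiv.measurableEmbedding K

theorem lintegral_comp_collMap (K : Coll d → ℝ≥0∞) :
    ∫⁻ c, K (collMap c) ∂collMeasure d = ∫⁻ c, K c ∂collMeasure d :=
  measurePreserving_collMap.lintegral_comp_emb collEquiv.measurableEmbedding K

theorem integrable_collFun {K : Coll d → ℝ} (hK : Integrable K (collMeasure d)) :
    Integrable (collFun K) :=
  ((integrable_comp_collMap hK).sub hK).integral_prod_left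

open Classical in
/-- The collision operator associated with the collision rate `K`, with values in `L¹`. -/
noncomputable def collOp (K : Coll d → ℝ) : L1 d :=
  if h : Integrable K (collMeasure d) then (integrable_collFun h).toL1 _ else 0

theorem coeFn_collOp {K : Coll d → ℝ} (hK : Integrable K (collMeasure d)) :
    collOp K =ᵐ[volume] collFun K := by
  rw [collOp, dif_pos hK]; exact (integrable_collFun hK).coeFn_toL1

theorem integrable_slices {K : Coll d → ℝ} (hK : Integrable K (collMeasure d)) :
    ∀ᵐ z : Phase d, Integrable (fun p => K (z, p)) (partnerMeasure d) :=
  hK.prod_right_ae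

theorem collOp_sub {K L : Coll d → ℝ} (hK : Integrable K (collMeasure d))
    (hL : Integrable L (collMeasure d)) :
    collOp K - collOp L = collOp (fun c => K c - L c) := by
  refine Lp.ext ?_
  filter_upwards [Lp.coeFn_sub (collOp K) (collOp L), coeFn_collOp hK, coeFn_collOp hL,
    coeFn_collOp (hK.sub hL), integrable_slices ((integrable_comp_collMap hK).sub hK),
    integrable_slices ((integrable_comp_collMap hL).sub hL)] with z h1 h2 h3 h4 h5 h6
  have h4' : collOp (fun c => K c - L c) z = collFun (fun c => K c - L c) z := h4
  rw [h1, Pi.sub_apply, h2, h3, h4', collFun, collFun, collFun]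
  have h7 := integral_sub h5 h6
  simp only [Pi.sub_apply] at h7
  rw [← h7]
  congr 1; ext p; ring

/-- Integration of the collision operator against a test function. -/
theorem integral_mul_collOp {K : Coll d → ℝ} (hK : Integrable K (collMeasure d))
    {ψ : Phase d → ℝ} (h1 : Integrable (fun c => ψ c.1 * K c) (collMeasure d))
    (h2 : Integrable (fun c => ψ (post c) * K c) (collMeasure d)) :
    Integrable (fun z => ψ z * collOp K z) ∧
      ∫ z, ψ z * collOp K z = ∫ c, (ψ (post c) - ψ c.1) * K c ∂collMeasure d := by
  have h3 : Integrable (fun c => ψ c.1 * K (collMap c)) (collMeasure d) := by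
    refine (integrable_comp_collMap h2).congr (Eventually.of_forall fun c => ?_)
    have : post (collMap c) = c.1 := congrArg Prod.fst (collMap_collMap c)
    simp only [this]
  have h4 : (fun z => ψ z * collOp K z) =ᵐ[volume]
      fun z => ∫ p, (ψ z * K (collMap (z, p)) - ψ z * K (z, p)) ∂partnerMeasure d := by
    filter_upwards [coeFn_collOp hK] with z hz
    rw [hz, collFun, ← integral_const_mul]
    simp only [mul_sub]
  refine ⟨(h3.sub h1).integral_prod_left.congr h4.symm, ?_⟩
  rw [integral_congr_ae h4]
  have h5 := integral_prod _ (show Integrable (fun c : Coll d => ψ c.1 * K (collMap c) - ψ c.1 * K c)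
    ((volume : Measure (Phase d)).prod (partnerMeasure d)) from h3.sub h1)
  rw [← h5, ← collMeasure_eq, integral_sub h3 h1]
  -- The involution moves the collision map from the rate to the test function: this is the gain
  -- term.
  have h6 : ∫ c, ψ c.1 * K (collMap c) ∂collMeasure d = ∫ c, ψ (post c) * K c ∂collMeasure d := by
    rw [← integral_comp_collMap]
    simp only [collMap_collMap]
    rfl
  rw [h6, ← integral_sub h2 h1]
  simp only [sub_mul]

/-- Weighted bounds for the collision operator. -/
theorem lintegral_collOp_le {K : Coll d → ℝ} (hK : Integrable K (collMeasure d))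
    {w : Phase d → ℝ≥0∞} (hw : Measurable w) :
    ∫⁻ z, w z * ‖collOp K z‖ₑ ≤ ∫⁻ c, (w c.1 + w (post c)) * ‖K c‖ₑ ∂collMeasure d := by
  have hKm := hK.aestronglyMeasurable.enorm
  have hKm' : AEMeasurable (fun c => ‖K (collMap c)‖ₑ) (collMeasure d) :=
    (integrable_comp_collMap hK).aestronglyMeasurable.enorm
  have hw1 : Measurable fun c : Coll d => w c.1 := hw.comp measurable_fst
  calc ∫⁻ z, w z * ‖collOp K z‖ₑ
      ≤ ∫⁻ z, ∫⁻ p, w z * (‖K (collMap (z, p))‖ₑ + ‖K (z, p)‖ₑ) ∂partnerMeasure d := by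
        refine lintegral_mono_ae ?_
        filter_upwards [coeFn_collOp hK, integrable_slices hK,
          integrable_slices (integrable_comp_collMap hK)] with z hz h1 h2
        have h3 : AEMeasurable (fun p => ‖K (collMap (z, p))‖ₑ + ‖K (z, p)‖ₑ) (partnerMeasure d) :=
          h2.aestronglyMeasurable.enorm.add h1.aestronglyMeasurable.enorm
        rw [lintegral_const_mul'' _ h3, hz]
        gcongr
        refine (enorm_integral_le_lintegral_enorm _).trans (lintegral_mono fun p => ?_)
        exact enorm_sub_le
    _ = ∫⁻ c, w c.1 * (‖K (collMap c)‖ₑ + ‖K c‖ₑ) ∂collMeasure d := by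
        rw [collMeasure_eq, lintegral_prod]
        exact hw1.aemeasurable.mul (hKm'.add hKm)
    _ = ∫⁻ c, w (post c) * ‖K c‖ₑ ∂collMeasure d + ∫⁻ c, w c.1 * ‖K c‖ₑ ∂collMeasure d := by
        simp only [mul_add]
        have h := lintegral_add_left' (hw1.aemeasurable.mul hKm')
          (fun c : Coll d => w c.1 * ‖K c‖ₑ)
        simp only [Pi.mul_apply] at h
        rw [h]
        congr 1
        rw [← lintegral_comp_collMap]
        simp only [collMap_collMap]
        rfl
    _ = _ := by
        have h := lintegral_add_right' (fun c : Coll d => w (post c) * ‖K c‖ₑ)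
          (hw1.aemeasurable.mul hKm)
        simp only [Pi.mul_apply] at h
        rw [← h]
        simp only [add_mul, add_comm]

theorem enorm_L1 (f : L1 d) : ‖f‖ₑ = ∫⁻ z, ‖f z‖ₑ := by
  rw [Lp.enorm_def, eLpNorm_one_eq_lintegral_enorm]

theorem norm_L1 (f : L1 d) : ‖f‖ = ∫ z, |f z| := by
  rw [L1.norm_eq_integral_norm]; rfl

theorem integrable_L1 (f : L1 d) : Integrable f := L1.integrable_coeFn f

/-- Gain and loss each contribute `∫ |K|`, because the collision map preserves the measure. For a
non-integrable rate the operator is `0` by default, so no hypothesis on `K` is required. -/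
theorem norm_collOp_le (K : Coll d → ℝ) : ‖collOp K‖ ≤ 2 * ∫ c, |K c| ∂collMeasure d := by
  by_cases hK : Integrable K (collMeasure d)
  · have h := lintegral_collOp_le hK (w := fun _ => 1) measurable_const
    simp only [one_mul] at h
    rw [← enorm_L1, lintegral_const_mul'' _ hK.aestronglyMeasurable.enorm,
      ← ofReal_integral_norm_eq_lintegral_enorm hK, ← ofReal_norm,
      show (1 + 1 : ℝ≥0∞) = ENNReal.ofReal 2 by norm_num, ← ENNReal.ofReal_mul (by norm_num)] at h
    exact (ENNReal.ofReal_le_ofReal_iff (by positivity)).1 h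
  · rw [collOp, dif_neg hK, norm_zero]; positivity

theorem integral_collOp (K : Coll d → ℝ) : ∫ z, collOp K z = 0 := by
  by_cases hK : Integrable K (collMeasure d)
  · have h := (integral_mul_collOp hK (ψ := fun _ => 1) (by simpa using hK) (by simpa using hK)).2
    simpa using h
  · rw [collOp, dif_neg hK, integral_congr_ae (Lp.coeFn_zero _ _ _)]; simp

theorem collGrad_collMap (ψ : Phase d → ℝ) (c : Coll d) :
    collGrad ψ (collMap c) = - collGrad ψ c := by
  have h1 : post (collMap c) = c.1 := congrArg Prod.fst (collMap_collMap c)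
  have h2 : postS (collMap c) = c.2.1 := congrArg (fun c => c.2.1) (collMap_collMap c)
  simp only [collGrad, h1, h2]
  simp only [collMap]; ring

/-- Symmetrised integration of the collision operator against a test function. -/
theorem integral_mul_collOp_symm {K : Coll d → ℝ} (hK : Integrable K (collMeasure d))
    (hs : ∀ᵐ c ∂collMeasure d, K (swapColl c) = K c)
    {ψ : Phase d → ℝ} (h1 : Integrable (fun c => ψ c.1 * K c) (collMeasure d))
    (h2 : Integrable (fun c => ψ (post c) * K c) (collMeasure d)) :
    Integrable (fun z => ψ z * collOp K z) ∧
      Integrable (fun c => collGrad ψ c * K c) (collMeasure d) ∧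
      ∫ z, ψ z * collOp K z = (1 / 2) * ∫ c, collGrad ψ c * K c ∂collMeasure d := by
  obtain ⟨h3, h4⟩ := integral_mul_collOp hK h1 h2
  have hd : Integrable (fun c => (ψ (post c) - ψ c.1) * K c) (collMeasure d) := by
    have := h2.sub h1
    simp only [sub_mul]; exact this
  -- Exchanging the particles gives the same integral with the test function at the states of the
  -- second particle. The average of the two expressions produces `collGrad` and the factor 1/2.
  have he : (fun c => (ψ (post (swapColl c)) - ψ (swapColl c).1) * K (swapColl c))
      =ᵐ[collMeasure d] fun c => (ψ (postS c) - ψ c.2.1) * K c := by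
    filter_upwards [hs] with c hc
    rw [post_swapColl, hc]; rfl
  have hd' := (integrable_comp_swapColl hd).congr he
  have h5 : (fun c => collGrad ψ c * K c)
      = fun c => (ψ (post c) - ψ c.1) * K c + (ψ (postS c) - ψ c.2.1) * K c := by
    ext c; simp only [collGrad]; ring
  refine ⟨h3, ?_, ?_⟩
  · rw [h5]; exact hd.add hd'
  · rw [h5, integral_add hd hd', ← integral_congr_ae he,
      integral_comp_swapColl (fun c => (ψ (post c) - ψ c.1) * K c), h4]
    ring

/-- The collision rate `W f f_*`. -/
def rate (W : Coll d → ℝ) (f : Phase d → ℝ) (c : Coll d) : ℝ := W c * preProd f c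

/-- The collision operator `Q(f)` with weight `W`. -/
noncomputable def collQ (W : Coll d → ℝ) (f : Phase d → ℝ) : L1 d := collOp (rate W f)

theorem rate_swapColl {W : Coll d → ℝ} (hW : IsCollWeight W) (f : Phase d → ℝ) (c : Coll d) :
    rate W f (swapColl c) = rate W f c := by
  rw [rate, rate, hW.swap]
  simp only [preProd, swapColl]; ring

theorem rate_collMap {W : Coll d → ℝ} (hW : IsCollWeight W) (f : Phase d → ℝ) (c : Coll d) :
    rate W f (collMap c) = W c * postProd f c := by
  rw [rate, hW.collMap, postProd_eq]

/-- The weak form of the collision operator in terms of `f' f_*' - f f_*`. -/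
theorem integral_collIntegrand {W : Coll d → ℝ} (hW : IsCollWeight W) {f : Phase d → ℝ}
    (hf : Integrable (rate W f) (collMeasure d)) {ψ : Phase d → ℝ}
    (h1 : Integrable (fun c => ψ c.1 * rate W f c) (collMeasure d))
    (h2 : Integrable (fun c => ψ (post c) * rate W f c) (collMeasure d)) :
    Integrable (fun c => collGrad ψ c * (postProd f c - preProd f c) * W c) (collMeasure d) ∧
      ∫ z, ψ z * collQ W f z
        = - (1 / 4) * ∫ c, collGrad ψ c * (postProd f c - preProd f c) * W c ∂collMeasure d := by
  obtain ⟨h3, h4, h5⟩ := integral_mul_collOp_symm hf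
    (Eventually.of_forall (rate_swapColl hW f)) h1 h2
  have h6 := integrable_comp_collMap h4
  -- The gradient is odd under the collision map, so both terms on the right integrate to `-∫
  -- collGrad ψ * rate`. Their sum is `-2` times that integral, and `1/2` turns into `-1/4`.
  have h7 : (fun c => collGrad ψ c * (postProd f c - preProd f c) * W c)
      = fun c => -(collGrad ψ (collMap c) * rate W f (collMap c)) - collGrad ψ c * rate W f c := by
    ext c; rw [collGrad_collMap, rate_collMap hW, rate]; ring
  refine ⟨by rw [h7]; exact h6.neg.sub h4, ?_⟩
  have h8 : Integrable (fun c => -(collGrad ψ (collMap c) * rate W f (collMap c)))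
    (collMeasure d) := h6.neg
  rw [collQ, h5, h7, integral_sub h8 h4, integral_neg,
    integral_comp_collMap (fun c => collGrad ψ c * rate W f c)]
  ring

/-- Pairing with a bounded measurable function is a continuous linear form on `L¹`. -/
theorem exists_pairing {ψ : Phase d → ℝ} (hψ : AEStronglyMeasurable ψ volume) {C : ℝ}
    (hC : ∀ z, |ψ z| ≤ C) : ∃ ℓ : L1 d →L[ℝ] ℝ, ∀ f : L1 d, ℓ f = ∫ z, ψ z * f z := by
  have hi : ∀ f : L1 d, Integrable (fun z => ψ z * f z) := fun f =>
    (integrable_L1 f).bdd_mul hψ (Eventually.of_forall fun z => by simpa using hC z)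
  refine ⟨LinearMap.mkContinuous
    { toFun := fun f => ∫ z, ψ z * f z
      map_add' := fun f g => ?_
      map_smul' := fun a f => ?_ } C fun f => ?_, fun f => rfl⟩
  · rw [← integral_add (hi f) (hi g)]
    refine integral_congr_ae ?_
    filter_upwards [Lp.coeFn_add f g] with z hz
    rw [hz, Pi.add_apply, mul_add]
  · rw [RingHom.id_apply, smul_eq_mul, ← integral_const_mul]
    refine integral_congr_ae ?_
    filter_upwards [Lp.coeFn_smul a f] with z hz
    rw [hz, Pi.smul_apply, smul_eq_mul]; ring
  · simp only [LinearMap.coe_mk, AddHom.coe_mk]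
    rw [norm_L1, ← integral_const_mul]
    refine (norm_integral_le_integral_norm _).trans
      (integral_mono (hi f).norm ((integrable_L1 f).abs.const_mul C) fun z => ?_)
    simp only [norm_mul, Real.norm_eq_abs]
    exact mul_le_mul_of_nonneg_right (hC z) (abs_nonneg _)

theorem integrable_mul_L1 {ψ : Phase d → ℝ} (hψ : AEStronglyMeasurable ψ volume) {C : ℝ}
    (hC : ∀ z, |ψ z| ≤ C) (f : L1 d) : Integrable (fun z => ψ z * f z) :=
  (integrable_L1 f).bdd_mul hψ (Eventually.of_forall fun z => by simpa using hC z)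

end FuzzyBoltzmann

/-! ### Free transport on `L¹`, and the collision operator for bounded weights. -/

namespace FuzzyBoltzmann

open Filter Topology

variable {d : ℕ}

/-- Free transport of the phase space for time `t`. -/
def shift (t : ℝ) (z : Phase d) : Phase d := (z.1 + t • z.2, z.2)

theorem continuous_shift_uncurry : Continuous fun p : ℝ × Phase d => shift p.1 p.2 := by
  unfold shift; fun_prop

theorem continuous_shift (t : ℝ) : Continuous (shift t : Phase d → Phase d) := by
  unfold shift; fun_prop

theorem mp_shift (t : ℝ) :
    MeasurePreserving (shift t : Phase d → Phase d) volume volume := measurePreserving_shift d t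

theorem shift_shift (s t : ℝ) (z : Phase d) : shift s (shift t z) = shift (s + t) z := by
  simp only [shift, Prod.mk.injEq, and_true]; module

theorem shift_zero (z : Phase d) : shift 0 z = z := by simp [shift]

theorem shift_neg_shift (t : ℝ) (z : Phase d) : shift (-t) (shift t z) = z := by
  rw [shift_shift, neg_add_cancel, shift_zero]

theorem shift_shift_neg (t : ℝ) (z : Phase d) : shift t (shift (-t) z) = z := by
  rw [shift_shift, add_neg_cancel, shift_zero]

/-- Free transport as a measurable equivalence. -/
def shiftEquiv (t : ℝ) : Phase d ≃ᵐ Phase d where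
  toFun := shift t
  invFun := shift (-t)
  left_inv := shift_neg_shift t
  right_inv := shift_shift_neg t
  measurable_toFun := (continuous_shift t).measurable
  measurable_invFun := (continuous_shift (-t)).measurable

theorem integral_comp_shift {E : Type*} [NormedAddCommGroup E] [NormedSpace ℝ E] (t : ℝ)
    (g : Phase d → E) : ∫ z, g (shift t z) = ∫ z, g z :=
  (mp_shift t).integral_comp (shiftEquiv t).measurableEmbedding g

theorem ae_comp_shift {p : Phase d → Prop} (t : ℝ) (h : ∀ᵐ z, p z) : ∀ᵐ z, p (shift t z) :=
  (mp_shift t).quasiMeasurePreserving.ae h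

theorem coeFn_alongChar (t : ℝ) (f : L1 d) :
    alongChar t f =ᵐ[volume] fun z => f (shift t z) :=
  Lp.coeFn_compMeasurePreserving f (measurePreserving_shift d t)

theorem alongChar_add (t : ℝ) (f g : L1 d) :
    alongChar t (f + g) = alongChar t f + alongChar t g := map_add _ f g

theorem alongChar_sub (t : ℝ) (f g : L1 d) :
    alongChar t (f - g) = alongChar t f - alongChar t g := map_sub _ f g

theorem norm_alongChar (t : ℝ) (f : L1 d) : ‖alongChar t f‖ = ‖f‖ :=
  Lp.norm_compMeasurePreserving f (measurePreserving_shift d t)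

theorem alongChar_alongChar (s t : ℝ) (f : L1 d) :
    alongChar s (alongChar t f) = alongChar (t + s) f := by
  refine Lp.ext ?_
  filter_upwards [coeFn_alongChar s (alongChar t f), ae_comp_shift s (coeFn_alongChar t f),
    coeFn_alongChar (t + s) f] with z h1 h2 h3
  rw [h1, h2, h3, shift_shift]

theorem alongChar_zero (f : L1 d) : alongChar 0 f = f := by
  refine Lp.ext ?_
  filter_upwards [coeFn_alongChar 0 f] with z h1
  rw [h1, shift_zero]

theorem alongChar_neg_self (t : ℝ) (f : L1 d) : alongChar (-t) (alongChar t f) = f := by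
  rw [alongChar_alongChar, add_neg_cancel, alongChar_zero]

theorem alongChar_self_neg (t : ℝ) (f : L1 d) : alongChar t (alongChar (-t) f) = f := by
  rw [alongChar_alongChar, neg_add_cancel, alongChar_zero]

/-- Composition of `L¹` functions with continuous measure-preserving maps is jointly continuous when
the maps carry the compact-open topology, and the shifts depend continuously on time in that
topology. -/
theorem continuous_alongChar : Continuous fun p : ℝ × L1 d => alongChar p.1 p.2 := by
  have h : Continuous fun t : ℝ => (⟨shift t, continuous_shift t⟩ : C(Phase d, Phase d)) :=
    ContinuousMap.continuous_of_continuous_uncurry _ continuous_shift_uncurry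
  have h2 := Lp.compMeasurePreserving_continuous (volume : Measure (Phase d))
    (volume : Measure (Phase d)) ℝ (p := 1) (by simp)
  have h3 : Continuous fun p : ℝ × L1 d => ((p.2, ⟨⟨shift p.1, continuous_shift p.1⟩, mp_shift p.1⟩) :
      L1 d × {f : C(Phase d, Phase d) // MeasurePreserving f volume volume}) := by
    refine continuous_snd.prodMk (Continuous.subtype_mk (h.comp continuous_fst) _)
  exact h2.comp h3

theorem continuousOn_alongChar {F : ℝ → L1 d} {τ : ℝ → ℝ} {s : Set ℝ} (hτ : ContinuousOn τ s)
    (hF : ContinuousOn F s) : ContinuousOn (fun t => alongChar (τ t) (F t)) s := by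
  have h := (continuous_alongChar (d := d)).comp_continuousOn (hτ.prodMk hF)
  simpa only [Function.comp_def] using h

theorem integral_mul_alongChar (t : ℝ) (ψ : Phase d → ℝ) (f : L1 d) :
    ∫ z, ψ z * alongChar t f z = ∫ z, ψ (shift (-t) z) * f z := by
  rw [← integral_comp_shift t (fun z => ψ (shift (-t) z) * f z)]
  refine integral_congr_ae ?_
  filter_upwards [coeFn_alongChar t f] with z hz
  rw [hz, shift_neg_shift]

theorem alongChar_nonneg (t : ℝ) {f : L1 d} (hf : 0 ≤ f) : 0 ≤ alongChar t f := by
  rw [← Lp.coeFn_nonneg] at hf ⊢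
  filter_upwards [coeFn_alongChar t f, ae_comp_shift t hf] with z h1 h2
  rw [h1]; exact h2

theorem alongChar_smul (t a : ℝ) (f : L1 d) : alongChar t (a • f) = a • alongChar t f := by
  refine Lp.ext ?_
  filter_upwards [coeFn_alongChar t (a • f), ae_comp_shift t (Lp.coeFn_smul a f),
    Lp.coeFn_smul a (alongChar t f), coeFn_alongChar t f] with z h1 h2 h3 h4
  rw [h1, h2, h3]; simp only [Pi.smul_apply, h4]

/-- Allows inequalities between elements of `L¹` to be multiplied by the exponential factors of the
Picard scheme. -/
instance : IsOrderedModule ℝ (L1 d) := by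
  refine IsOrderedModule.of_smul_nonneg fun a ha f hf => ?_
  rw [← Lp.coeFn_nonneg] at hf ⊢
  filter_upwards [Lp.coeFn_smul a f, hf] with z h1 h2
  rw [h1]; exact mul_nonneg ha h2

theorem norm_eq_integral_of_nonneg {f : L1 d} (hf : 0 ≤ f) : ‖f‖ = ∫ z, f z := by
  rw [norm_L1]
  refine integral_congr_ae ?_
  filter_upwards [(Lp.coeFn_nonneg f).2 hf] with z hz
  exact abs_of_nonneg hz

/-- The integral as a continuous linear form on `L¹`. -/
theorem exists_integralCLM : ∃ ℓ : L1 d →L[ℝ] ℝ, ∀ f : L1 d, ℓ f = ∫ z, f z := by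
  obtain ⟨ℓ, h⟩ := exists_pairing (d := d) (ψ := fun _ => 1) aestronglyMeasurable_const (C := 1)
    (by simp)
  exact ⟨ℓ, fun f => by rw [h]; simp⟩

/-! ### Truncations and collision rates of bounded weights -/

/-- Truncation profiles: monotone 1-Lipschitz functions with `0 ≤ T y ≤ y` for `y ≥ 0`. -/
structure IsTruncation (τ : ℝ → ℝ) : Prop where
  lipschitz : LipschitzWith 1 τ
  nonneg : ∀ y, 0 ≤ y → 0 ≤ τ y
  le_self : ∀ y, 0 ≤ y → τ y ≤ y

theorem IsTruncation.zero {τ : ℝ → ℝ} (h : IsTruncation τ) : τ 0 = 0 :=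
  le_antisymm (h.le_self 0 le_rfl) (h.nonneg 0 le_rfl)

theorem IsTruncation.abs_sub_le {τ : ℝ → ℝ} (h : IsTruncation τ) (x y : ℝ) :
    |τ x - τ y| ≤ |x - y| := by
  have := h.lipschitz.dist_le_mul x y
  simpa [Real.dist_eq] using this

theorem IsTruncation.abs_le {τ : ℝ → ℝ} (h : IsTruncation τ) (x : ℝ) : |τ x| ≤ |x| := by
  simpa [h.zero] using h.abs_sub_le x 0

theorem isTruncation_id : IsTruncation id :=
  ⟨LipschitzWith.id, fun _ h => h, fun _ _ => le_rfl⟩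

theorem isTruncation_min {R : ℝ} (hR : 0 ≤ R) : IsTruncation (fun y => min y R) :=
  ⟨LipschitzWith.id.min_const R, fun _ h => le_min h hR, fun _ _ => min_le_left _ _⟩

theorem IsTruncation.integrable {τ : ℝ → ℝ} (h : IsTruncation τ) (f : L1 d) :
    Integrable (fun z => τ (f z)) :=
  (integrable_L1 f).mono (h.lipschitz.continuous.comp_aestronglyMeasurable
    (integrable_L1 f).aestronglyMeasurable) (Eventually.of_forall fun _ => h.abs_le _)

theorem integrable_rate {W : Coll d → ℝ} (hW : IsCollWeight W) {Λ : ℝ} (hΛ : ∀ c, W c ≤ Λ)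
    {f : Phase d → ℝ} (hf : Integrable f) : Integrable (rate W f) (collMeasure d) := by
  refine (integrable_tensor hf hf).bdd_mul (c := Λ) hW.measurable.aestronglyMeasurable
    (Eventually.of_forall fun c => ?_)
  rw [Real.norm_eq_abs, abs_of_nonneg (hW.nonneg c)]; exact hΛ c

/-- The rate is quadratic: `f f_* - g g_* = (f - g) g_* + f (f_* - g_*)`, and each product
integrates to a product of `L¹` norms. -/
theorem integral_abs_rate_sub_le {W : Coll d → ℝ} (hW : IsCollWeight W) {Λ : ℝ} (hΛ : ∀ c, W c ≤ Λ)
    {f g : Phase d → ℝ} (hf : Integrable f) (hg : Integrable g) :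
    ∫ c, |rate W f c - rate W g c| ∂collMeasure d
      ≤ Λ * sphArea d * ((∫ z, |f z - g z|) * ((∫ z, |f z|) + ∫ z, |g z|)) := by
  have hΛ0 : ∀ c, |W c| ≤ Λ := fun c => by rw [abs_of_nonneg (hW.nonneg c)]; exact hΛ c
  have hd := (hf.sub hg).abs
  have h1 := (integrable_tensor hd hg.abs).add (integrable_tensor hf.abs hd)
  have h2 : ∀ c : Coll d, |rate W f c - rate W g c|
      ≤ Λ * (|f c.1 - g c.1| * |g c.2.1| + |f c.1| * |f c.2.1 - g c.2.1|) := fun c => by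
    have : rate W f c - rate W g c
        = W c * ((f c.1 - g c.1) * g c.2.1 + f c.1 * (f c.2.1 - g c.2.1)) := by
      simp only [rate, preProd]; ring
    rw [this, abs_mul]
    refine mul_le_mul (hΛ0 c) ?_ (abs_nonneg _) ((abs_nonneg _).trans (hΛ0 c))
    rw [← abs_mul, ← abs_mul]
    exact abs_add_le _ _
  refine (integral_mono_of_nonneg (Eventually.of_forall fun c => abs_nonneg _)
    (h1.const_mul Λ) (Eventually.of_forall h2)).trans_eq ?_
  have e1 := integral_tensor (fun z => |f z - g z|) (fun z => |g z|)
  have e2 := integral_tensor (fun z => |f z|) (fun z => |f z - g z|)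
  have e3 := integral_add (integrable_tensor hd hg.abs) (integrable_tensor hf.abs hd)
  simp only [Pi.sub_apply] at e3
  rw [integral_const_mul]
  simp only [Pi.add_apply, Pi.sub_apply]
  rw [e3, e1, e2]; ring

theorem norm_collQ_sub_le {W : Coll d → ℝ} {V : Coll d → ℝ} {f g : Phase d → ℝ}
    (hf : Integrable (rate W f) (collMeasure d)) (hg : Integrable (rate V g) (collMeasure d)) :
    ‖collQ W f - collQ V g‖ ≤ 2 * ∫ c, |rate W f c - rate V g c| ∂collMeasure d := by
  rw [collQ, collQ, collOp_sub hf hg]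
  exact norm_collOp_le _

theorem IsTruncation.integral_abs_sub_le {τ : ℝ → ℝ} (h : IsTruncation τ) (f g : L1 d) :
    ∫ z, |τ (f z) - τ (g z)| ≤ ‖f - g‖ := by
  rw [norm_L1]
  refine integral_mono_ae ((h.integrable f).sub (h.integrable g)).abs (integrable_L1 _).abs ?_
  filter_upwards [Lp.coeFn_sub f g] with z hz
  rw [hz]; exact h.abs_sub_le _ _

theorem IsTruncation.integral_abs_le {τ : ℝ → ℝ} (h : IsTruncation τ) (f : L1 d) :
    ∫ z, |τ (f z)| ≤ ‖f‖ := by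
  rw [norm_L1]
  exact integral_mono (h.integrable f).abs (integrable_L1 _).abs fun z => h.abs_le _

/-- The truncated collision operator with bounded weight is locally Lipschitz on `L¹`. -/
theorem norm_collQ_truncation_sub_le {W : Coll d → ℝ} (hW : IsCollWeight W) {Λ : ℝ} (hΛ0 : 0 ≤ Λ)
    (hΛ : ∀ c, W c ≤ Λ) {τ : ℝ → ℝ} (hτ : IsTruncation τ) (f g : L1 d) :
    ‖collQ W (fun z => τ (f z)) - collQ W (fun z => τ (g z))‖
      ≤ 2 * (Λ * sphArea d * (‖f - g‖ * (‖f‖ + ‖g‖))) := by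
  refine (norm_collQ_sub_le (integrable_rate hW hΛ (hτ.integrable f))
    (integrable_rate hW hΛ (hτ.integrable g))).trans ?_
  have := integral_abs_rate_sub_le hW hΛ (hτ.integrable f) (hτ.integrable g)
  have h1 := hτ.integral_abs_sub_le f g
  have h2 := hτ.integral_abs_le f
  have h3 := hτ.integral_abs_le g
  have := sphArea_nonneg (d := d)
  refine mul_le_mul_of_nonneg_left (‹_ ≤ Λ * sphArea d * _›.trans ?_) (by norm_num)
  gcongr

/-- The loss term is at most `Λ |S^{d-1}| ‖f‖ f`. -/
theorem collQ_truncation_add_nonneg {W : Coll d → ℝ} (hW : IsCollWeight W) {Λ : ℝ} (hΛ0 : 0 ≤ Λ)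
    (hΛ : ∀ c, W c ≤ Λ) {τ : ℝ → ℝ} (hτ : IsTruncation τ) {f : L1 d} (hf : 0 ≤ f) :
    0 ≤ collQ W (fun z => τ (f z)) + (Λ * sphArea d * ‖f‖) • f := by
  rw [← Lp.coeFn_nonneg] at hf ⊢
  have hr := integrable_rate hW hΛ (hτ.integrable f)
  have hc : ∀ᵐ c : Coll d ∂collMeasure d, 0 ≤ f c.1 ∧ 0 ≤ f c.2.1 :=
    (quasi_fst.ae hf).and (quasi_snd.ae hf)
  have hc' : ∀ᵐ c : Coll d ∂collMeasure d, 0 ≤ f (collMap c).1 ∧ 0 ≤ f (collMap c).2.1 :=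
    measurePreserving_collMap.quasiMeasurePreserving.ae hc
  have hp : ∫ p : Phase d × Sph d, f p.1 ∂partnerMeasure d = sphArea d * ‖f‖ := by
    have h := integral_prod_mul (μ := (volume : Measure (Phase d)))
      (ν := (volume : Measure (Vec d)).toSphere) f (fun _ => 1)
    simp only [mul_one, integral_const, smul_eq_mul] at h
    rw [partnerMeasure, h, sphArea, mul_comm, norm_eq_integral_of_nonneg ((Lp.coeFn_nonneg f).1 hf)]
  have hfp : Integrable (fun p : Phase d × Sph d => f p.1) (partnerMeasure d) :=
    (integrable_L1 f).comp_fst _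
  filter_upwards [Lp.coeFn_add (collQ W fun z => τ (f z)) ((Λ * sphArea d * ‖f‖) • f),
    Lp.coeFn_smul (Λ * sphArea d * ‖f‖) f, coeFn_collOp hr, integrable_slices hr,
    integrable_slices (integrable_comp_collMap hr), hf,
    Measure.ae_ae_of_ae_prod hc, Measure.ae_ae_of_ae_prod hc'] with z h1 h2 h3 h4 h5 h6 h7 h8
  rw [h1, Pi.add_apply, h2, collQ, h3, collFun, Pi.smul_apply, smul_eq_mul]
  -- The gain is nonnegative and is dropped. What remains is the loss, at most `Λ f(z) f_*`, whose
  -- integral over the partner is `Λ |S^{d-1}| ‖f‖ f(z)`.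
  have h9 : ∫ p, (-(Λ * f z * f p.1)) ∂partnerMeasure d
      ≤ ∫ p, (rate W (fun z => τ (f z)) (collMap (z, p)) - rate W (fun z => τ (f z)) (z, p))
        ∂partnerMeasure d := by
    refine integral_mono_ae (hfp.const_mul _).neg (h5.sub h4) ?_
    filter_upwards [h7, h8] with p h7 h8
    have a1 : 0 ≤ rate W (fun z => τ (f z)) (collMap (z, p)) :=
      mul_nonneg (hW.nonneg _) (mul_nonneg (hτ.nonneg _ h8.1) (hτ.nonneg _ h8.2))
    have a2 : rate W (fun z => τ (f z)) (z, p) ≤ Λ * (f z * f p.1) := by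
      refine mul_le_mul (hΛ _) ?_ (mul_nonneg (hτ.nonneg _ h7.1) (hτ.nonneg _ h7.2)) hΛ0
      exact mul_le_mul (hτ.le_self _ h7.1) (hτ.le_self _ h7.2) (hτ.nonneg _ h7.2) h7.1
    linarith
  rw [integral_neg, integral_const_mul, hp] at h9
  have : (0 : Phase d → ℝ) z = 0 := rfl
  rw [this]; linarith

end FuzzyBoltzmann

/-! ### Damped Picard iteration and global mild solutions for bounded weights. -/

namespace FuzzyBoltzmann

open Filter Topology

variable {d : ℕ}

section Picard

variable {X : Type*} [NormedAddCommGroup X] [NormedSpace ℝ X]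

/-- One step of the damped Picard iteration. -/
noncomputable def picardStep (P : ℝ → X → X) (lam : ℝ) (x₀ : X) (x : ℝ → X) (t : ℝ) : X :=
  Real.exp (-lam * max t 0) • (x₀ + ∫ s in (0 : ℝ)..max t 0, Real.exp (lam * s) • P s (x s))

/-- Since time enters through `max t 0`, a step is a continuous curve on the whole line, constant
for negative times, and one-sided statements are avoided. -/
theorem continuous_picardStep {P : ℝ → X → X} (hP : Continuous fun p : ℝ × X => P p.1 p.2)
    (lam : ℝ) (x₀ : X) {x : ℝ → X} (hx : Continuous x) : Continuous (picardStep P lam x₀ x) := by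
  have h1 : Continuous fun s => Real.exp (lam * s) • P s (x s) :=
    (by fun_prop : Continuous fun s => Real.exp (lam * s)).smul (hP.comp (continuous_id.prodMk hx))
  have h2 : Continuous fun t => ∫ s in (0 : ℝ)..t, Real.exp (lam * s) • P s (x s) :=
    intervalIntegral.continuous_primitive (fun a b => h1.intervalIntegrable a b) 0
  have h3 : Continuous fun t : ℝ => max t 0 := by fun_prop
  exact (by fun_prop : Continuous fun t : ℝ => Real.exp (-lam * max t 0)).smul
    (continuous_const.add (h2.comp h3))

/-- In the norm `sup exp(-2Lt) ‖·‖` the step is a contraction with factor 1/2 for all times at once,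
because `∫₀ᵗ L exp(2Ls) ds ≤ exp(2Lt) / 2`. The damping does no harm: `exp(-λt) exp(λs) ≤ 1` for `s
≤ t`. -/
theorem norm_picardStep_sub_le {P : ℝ → X → X} (hP : Continuous fun p : ℝ × X => P p.1 p.2)
    {lam : ℝ} (hlam : 0 ≤ lam) (x₀ : X) {K : Set X} {L : ℝ} (hL : 0 < L)
    (hLip : ∀ s, ∀ x ∈ K, ∀ y ∈ K, ‖P s x - P s y‖ ≤ L * ‖x - y‖)
    {x y : ℝ → X} (hx : Continuous x) (hy : Continuous y) (hxK : ∀ t, x t ∈ K) (hyK : ∀ t, y t ∈ K)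
    {M : ℝ} (hM : ∀ t, 0 ≤ t → ‖x t - y t‖ ≤ M * Real.exp (2 * L * t)) {t : ℝ} (ht : 0 ≤ t) :
    ‖picardStep P lam x₀ x t - picardStep P lam x₀ y t‖ ≤ M / 2 * Real.exp (2 * L * t) := by
  have hM0 : 0 ≤ M := by simpa using (norm_nonneg _).trans (hM 0 le_rfl)
  have hc : ∀ z : ℝ → X, Continuous z → Continuous fun s => Real.exp (lam * s) • P s (z s) :=
    fun z hz => (by fun_prop : Continuous fun s => Real.exp (lam * s)).smul
      (hP.comp (continuous_id.prodMk hz))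
  have e1 : picardStep P lam x₀ x t - picardStep P lam x₀ y t
      = Real.exp (-lam * t) • ∫ s in (0 : ℝ)..t, Real.exp (lam * s) • (P s (x s) - P s (y s)) := by
    simp only [picardStep, max_eq_left ht]
    rw [← smul_sub, add_sub_add_left_eq_sub, ← intervalIntegral.integral_sub
      ((hc x hx).intervalIntegrable _ _) ((hc y hy).intervalIntegrable _ _)]
    simp only [smul_sub]
  have e2 : ∫ s in (0 : ℝ)..t, Real.exp (2 * L * s) = (Real.exp (2 * L * t) - 1) / (2 * L) := by
    have : ∀ s ∈ uIcc 0 t, HasDerivAt (fun s => Real.exp (2 * L * s) / (2 * L))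
        (Real.exp (2 * L * s)) s := fun s _ => by
      have h := (((hasDerivAt_id s).const_mul (2 * L)).exp).div_const (2 * L)
      convert! h using 1
      simp only [id, mul_one]; field_simp
    rw [intervalIntegral.integral_eq_sub_of_hasDerivAt this
      ((by fun_prop : Continuous fun s => Real.exp (2 * L * s)).intervalIntegrable _ _)]
    simp; ring
  have e3 : ‖∫ s in (0 : ℝ)..t, Real.exp (lam * s) • (P s (x s) - P s (y s))‖
      ≤ ∫ s in (0 : ℝ)..t, Real.exp (lam * t) * (L * M) * Real.exp (2 * L * s) := by
    refine intervalIntegral.norm_integral_le_of_norm_le ht ?_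
      ((by fun_prop : Continuous fun s => Real.exp (lam * t) * (L * M) *
        Real.exp (2 * L * s)).intervalIntegrable _ _)
    refine Eventually.of_forall fun s hs => ?_
    rw [norm_smul, Real.norm_eq_abs, Real.abs_exp, mul_assoc]
    have := hLip s _ (hxK s) _ (hyK s)
    have h2 := hM s hs.1.le
    refine mul_le_mul (Real.exp_le_exp.2 (mul_le_mul_of_nonneg_left hs.2 hlam)) (this.trans ?_)
      (norm_nonneg _) (Real.exp_pos _).le
    rw [mul_assoc]; gcongr
  rw [intervalIntegral.integral_const_mul, e2] at e3
  rw [e1, norm_smul, Real.norm_eq_abs, Real.abs_exp]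
  have h4 : Real.exp (-lam * t) * Real.exp (lam * t) = 1 := by
    rw [← Real.exp_add]; simp
  calc _ ≤ Real.exp (-lam * t) * (Real.exp (lam * t) * (L * M) *
        ((Real.exp (2 * L * t) - 1) / (2 * L))) := by gcongr
    _ = (Real.exp (-lam * t) * Real.exp (lam * t)) * (M / 2 * (Real.exp (2 * L * t) - 1)) := by
        field_simp
    _ ≤ _ := by rw [h4, one_mul]; gcongr; linarith

/-- Global solvability of a damped integral equation on a bounded closed set which the equation
leaves invariant and on which the right-hand side is Lipschitz. -/
theorem exists_picard_fixedPoint [CompleteSpace X] {P : ℝ → X → X} (hP : Continuous fun p : ℝ × X => P p.1 p.2)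
    {lam : ℝ} (hlam : 0 ≤ lam) {x₀ : X} {K : Set X} (hK : IsClosed K) {ρ : ℝ}
    (hρ : ∀ x ∈ K, ‖x‖ ≤ ρ) (hx₀ : x₀ ∈ K) {L : ℝ} (hL : 0 < L)
    (hLip : ∀ s, ∀ x ∈ K, ∀ y ∈ K, ‖P s x - P s y‖ ≤ L * ‖x - y‖)
    (hinv : ∀ x : ℝ → X, Continuous x → (∀ t, x t ∈ K) → ∀ t, picardStep P lam x₀ x t ∈ K) :
    ∃ x : ℝ → X, Continuous x ∧ (∀ t, x t ∈ K) ∧ ∀ t, x t = picardStep P lam x₀ x t := by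
  let u : ℕ → ℝ → X := fun n => (picardStep P lam x₀)^[n] (fun _ => x₀)
  have hu : ∀ n, u (n + 1) = picardStep P lam x₀ (u n) := fun n =>
    Function.iterate_succ_apply' _ _ _
  have huc : ∀ n, Continuous (u n) ∧ ∀ t, u n t ∈ K := by
    intro n
    induction n with
    | zero => exact ⟨continuous_const, fun _ => hx₀⟩
    | succ n ih =>
      rw [hu]
      exact ⟨continuous_picardStep hP lam x₀ ih.1, hinv _ ih.1 ih.2⟩
  have hρ0 : 0 ≤ ρ := (norm_nonneg _).trans (hρ _ hx₀)
  have hneg : ∀ n t, u n t = u n (max t 0) := by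
    intro n t
    cases n with
    | zero => rfl
    | succ n => simp only [hu, picardStep, max_assoc, max_self]
  -- All iterates lie in `K`, a set of radius `ρ`, so the first difference is at most `2 ρ`; each
  -- further step halves the bound.
  have hd : ∀ n t, 0 ≤ t → ‖u n t - u (n + 1) t‖ ≤ 2 * ρ / 2 ^ n * Real.exp (2 * L * t) := by
    intro n
    induction n with
    | zero =>
      intro t ht
      have h1 := norm_sub_le (u 0 t) (u 1 t)
      have h2 := hρ _ ((huc 0).2 t)
      have h3 := hρ _ ((huc 1).2 t)
      have h4 : 1 ≤ Real.exp (2 * L * t) := Real.one_le_exp (by positivity)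
      simp only [pow_zero, div_one]
      nlinarith
    | succ n ih =>
      intro t ht
      have := norm_picardStep_sub_le hP hlam x₀ hL hLip (huc n).1 (huc (n + 1)).1 (huc n).2
        (huc (n + 1)).2 ih ht
      rw [← hu, ← hu] at this
      rwa [pow_succ, ← div_div]
  -- The same bound in the form `C / 2 / 2 ^ n` of the criterion for geometric sequences, which is
  -- why `2 ρ` becomes `4 ρ`.
  have hd' : ∀ n t, dist (u n t) (u (n + 1) t)
      ≤ (4 * ρ * Real.exp (2 * L * max t 0)) / 2 / 2 ^ n := by
    intro n t
    rw [dist_eq_norm, hneg n t, hneg (n + 1) t]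
    refine (hd n _ (le_max_right _ _)).trans_eq ?_
    ring
  choose x hx using fun t => cauchySeq_tendsto_of_complete (cauchySeq_of_le_geometric_two (hd' · t))
  have hdx : ∀ n t, dist (u n t) (x t) ≤ (4 * ρ * Real.exp (2 * L * max t 0)) / 2 ^ n := fun n t =>
    dist_le_of_le_geometric_two_of_tendsto (hd' · t) (hx t) n
  have hunif : ∀ T, TendstoUniformlyOn u x atTop (Iic T) := by
    intro T
    rw [Metric.tendstoUniformlyOn_iff]
    intro ε hε
    have h1 : Tendsto (fun n : ℕ => (4 * ρ * Real.exp (2 * L * max T 0)) / 2 ^ n) atTop (𝓝 0) :=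
      tendsto_const_nhds.div_atTop (tendsto_pow_atTop_atTop_of_one_lt one_lt_two)
    filter_upwards [h1.eventually_lt_const hε] with n hn t ht
    rw [dist_comm]
    refine (hdx n t).trans_lt (lt_of_le_of_lt ?_ hn)
    have : t ≤ T := ht
    gcongr
  have hxc : Continuous x := by
    refine continuous_iff_continuousAt.2 fun t => ?_
    exact ((hunif (t + 1)).continuousOn (Frequently.of_forall fun n =>
      (huc n).1.continuousOn)).continuousAt (Iic_mem_nhds (by linarith))
  have hxK : ∀ t, x t ∈ K := fun t => hK.mem_of_tendsto (hx t)
    (Eventually.of_forall fun n => (huc n).2 t)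
  have hxn : ∀ t, x t = x (max t 0) := fun t => tendsto_nhds_unique (hx t)
    ((hx (max t 0)).congr fun n => (hneg n t).symm)
  refine ⟨x, hxc, hxK, fun t => ?_⟩
  have h1 : Tendsto (fun n => u (n + 1) t) atTop (𝓝 (x t)) := (tendsto_add_atTop_iff_nat 1).2 (hx t)
  refine tendsto_nhds_unique h1 ?_
  rw [tendsto_iff_dist_tendsto_zero]
  have hle : ∀ n, dist (u (n + 1) t) (picardStep P lam x₀ x t)
      ≤ (4 * ρ * Real.exp (2 * L * max t 0)) / 2 ^ n := by
    intro n
    have h2 : ∀ s, 0 ≤ s → ‖u n s - x s‖ ≤ (4 * ρ / 2 ^ n) * Real.exp (2 * L * s) := by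
      intro s hs
      have := hdx n s
      rw [max_eq_left hs, dist_eq_norm] at this
      refine this.trans_eq ?_
      ring
    have h3 := norm_picardStep_sub_le hP hlam x₀ hL hLip (huc n).1 hxc (huc n).2 hxK h2
      (le_max_right t 0)
    have h4 : ∀ y : ℝ → X, picardStep P lam x₀ y (max t 0) = picardStep P lam x₀ y t := fun y => by
      simp only [picardStep, max_assoc, max_self]
    rw [h4, h4, ← hu, ← dist_eq_norm] at h3
    refine h3.trans ?_
    have h5 : 0 ≤ 4 * ρ / 2 ^ n := by positivity
    calc 4 * ρ / 2 ^ n / 2 * Real.exp (2 * L * max t 0)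
        ≤ 4 * ρ / 2 ^ n * Real.exp (2 * L * max t 0) := by
          gcongr ?_ * _; exact half_le_self h5
      _ = _ := by ring
  refine squeeze_zero (fun _ => dist_nonneg) hle ?_
  exact tendsto_const_nhds.div_atTop (tendsto_pow_atTop_atTop_of_one_lt one_lt_two)

/-- Undoes the damping: by variation of constants, `exp(-λt) y(t)` has derivative `P - λ x`, and
this derivative is integrated back. -/
theorem integral_eq_of_picard_fixedPoint [CompleteSpace X] {P : ℝ → X → X}
    (hP : Continuous fun p : ℝ × X => P p.1 p.2) {lam : ℝ} {x₀ : X} {x : ℝ → X} (hx : Continuous x)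
    (h : ∀ t, x t = picardStep P lam x₀ x t) {t : ℝ} (ht : 0 ≤ t) :
    x t = x₀ + ∫ s in (0 : ℝ)..t, (P s (x s) - lam • x s) := by
  have hPx : Continuous fun s => P s (x s) := hP.comp (continuous_id.prodMk hx)
  have h1 : Continuous fun s => Real.exp (lam * s) • P s (x s) :=
    (by fun_prop : Continuous fun s => Real.exp (lam * s)).smul hPx
  let y : ℝ → X := fun t => x₀ + ∫ s in (0 : ℝ)..t, Real.exp (lam * s) • P s (x s)
  have hy : ∀ t, HasDerivAt y (Real.exp (lam * t) • P t (x t)) t := fun t =>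
    (intervalIntegral.integral_hasDerivAt_right (h1.intervalIntegrable _ _)
      (h1.stronglyMeasurableAtFilter _ _) h1.continuousAt).const_add x₀
  have hz : ∀ t, HasDerivAt (fun t => Real.exp (-lam * t) • y t)
      (P t (x t) - lam • (Real.exp (-lam * t) • y t)) t := fun t => by
    have h2 : HasDerivAt (fun t => Real.exp (-lam * t)) (Real.exp (-lam * t) * (-lam)) t := by
      simpa using ((hasDerivAt_id t).const_mul (-lam)).exp
    convert! h2.smul (hy t) using 1
    rw [smul_smul (Real.exp (-lam * t)) (Real.exp (lam * t)), ← Real.exp_add, smul_smul]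
    simp only [neg_mul, neg_add_cancel, Real.exp_zero, one_smul]
    module
  have hxz : ∀ t, 0 ≤ t → x t = Real.exp (-lam * t) • y t := fun t ht => by
    rw [h t, picardStep, max_eq_left ht]
  have hyc : Continuous y := continuous_iff_continuousAt.2 fun t => (hy t).continuousAt
  have h3 := intervalIntegral.integral_eq_sub_of_hasDerivAt (a := 0) (b := t) (fun s _ => hz s)
    ((hPx.sub (((by fun_prop : Continuous fun s => Real.exp (-lam * s)).smul hyc).const_smul
      lam)).intervalIntegrable _ _)
  have h4 : y 0 = x₀ := by simp [y]
  rw [hxz t ht]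
  rw [h4] at h3
  simp only [mul_zero, Real.exp_zero, one_smul] at h3
  rw [eq_sub_iff_add_eq] at h3
  rw [← h3, add_comm]
  congr 1
  refine intervalIntegral.integral_congr fun s hs => ?_
  rw [uIcc_of_le ht] at hs
  simp only [hxz s hs.1]

end Picard

/-- Mild solutions on `[0, T]` of the equation with collision operator `Q(τ ∘ f)`. -/
structure IsMild (W : Coll d → ℝ) (τ : ℝ → ℝ) (T : ℝ) (f₀ : L1 d) (f : ℝ → L1 d) : Prop where
  continuousOn : ContinuousOn f (Icc 0 T)
  integrable_rate : ∀ t ∈ Icc 0 T, Integrable (rate W fun z => τ (f t z)) (collMeasure d)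
  continuousOn_collQ : ContinuousOn (fun t => collQ W fun z => τ (f t z)) (Icc 0 T)
  eq : ∀ t ∈ Icc 0 T, alongChar t (f t)
    = f₀ + ∫ s in (0 : ℝ)..t, alongChar s (collQ W fun z => τ (f s z))

theorem continuous_collQ_truncation {W : Coll d → ℝ} (hW : IsCollWeight W) {Λ : ℝ} (hΛ0 : 0 ≤ Λ)
    (hΛ : ∀ c, W c ≤ Λ) {τ : ℝ → ℝ} (hτ : IsTruncation τ) :
    Continuous fun f : L1 d => collQ W fun z => τ (f z) := by
  refine continuous_iff_continuousAt.2 fun f => ?_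
  rw [ContinuousAt, tendsto_iff_norm_sub_tendsto_zero]
  refine squeeze_zero (fun _ => norm_nonneg _)
    (fun g => norm_collQ_truncation_sub_le hW hΛ0 hΛ hτ g f) ?_
  have : Continuous fun g : L1 d => 2 * (Λ * sphArea d * (‖g - f‖ * (‖g‖ + ‖f‖))) := by fun_prop
  simpa using this.tendsto f

/-- Global nonnegative mass-preserving mild solutions for bounded weights. -/
theorem exists_mild {W : Coll d → ℝ} (hW : IsCollWeight W) {Λ : ℝ} (hΛ0 : 0 ≤ Λ)
    (hΛ : ∀ c, W c ≤ Λ) {τ : ℝ → ℝ} (hτ : IsTruncation τ) {f₀ : L1 d} (hf₀ : 0 ≤ f₀) :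
    ∃ f : ℝ → L1 d, (∀ T, IsMild W τ T f₀ f) ∧ ∀ t, 0 ≤ t → 0 ≤ f t ∧ ‖f t‖ = ‖f₀‖ ∧
      Real.exp (-(Λ * sphArea d * ‖f₀‖) * t) • f₀ ≤ alongChar t (f t) := by
  set ρ := ‖f₀‖ with hρ
  have hS := sphArea_nonneg (d := d)
  -- The bound for the loss rate at mass `ρ`. Adding `lam • F` to the collision term makes the
  -- right-hand side nonnegative on `K`, by `collQ_truncation_add_nonneg`.
  set lam := Λ * sphArea d * ρ with hlam
  have hlam0 : 0 ≤ lam := by positivity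
  obtain ⟨Q, hQd⟩ : ∃ Q : L1 d → L1 d, Q = fun f => collQ W fun z => τ (f z) := ⟨_, rfl⟩
  have hQ : Continuous Q := hQd ▸ continuous_collQ_truncation hW hΛ0 hΛ hτ
  obtain ⟨P, hPd⟩ : ∃ P : ℝ → L1 d → L1 d,
    ∀ s F, P s F = alongChar s (Q (alongChar (-s) F)) + lam • F := ⟨_, fun _ _ => rfl⟩
  have hP : Continuous fun p : ℝ × L1 d => P p.1 p.2 := by
    simp only [hPd]
    have h1 : Continuous fun p : ℝ × L1 d => alongChar (-p.1) p.2 :=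
      continuous_alongChar.comp (continuous_fst.neg.prodMk continuous_snd)
    exact (continuous_alongChar.comp (continuous_fst.prodMk (hQ.comp h1))).add
      (continuous_snd.const_smul lam)
  -- Fixing the mass exactly, and not merely bounding it, keeps `lam` the same for all iterates.
  let K : Set (L1 d) := {F | 0 ≤ F ∧ ‖F‖ = ρ}
  have hK : IsClosed K := (isClosed_Ici (a := (0 : L1 d))).inter
    (isClosed_eq continuous_norm continuous_const)
  have hPnn : ∀ s, ∀ F ∈ K, 0 ≤ P s F := by
    rintro s F ⟨h1, h2⟩
    have h3 := collQ_truncation_add_nonneg hW hΛ0 hΛ hτ (alongChar_nonneg (-s) h1)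
    rw [norm_alongChar, h2, ← hlam] at h3
    have h4 := alongChar_nonneg s h3
    rw [alongChar_add, alongChar_smul, alongChar_self_neg] at h4
    rw [hPd, hQd]; exact h4
  obtain ⟨ℓ, hℓ⟩ := exists_integralCLM (d := d)
  -- Transport preserves integrals and collisions create no mass, so only the damping term
  -- contributes. Hence the mass of a step is `exp(-λt) (ρ + ρ (exp(λt) - 1)) = ρ`.
  have hPl : ∀ s, ∀ F ∈ K, ℓ (P s F) = lam * ρ := by
    rintro s F ⟨h1, h2⟩
    have h3 : ℓ (alongChar s (Q (alongChar (-s) F))) = 0 := by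
      rw [hℓ]
      have := integral_mul_alongChar s (fun _ => 1) (Q (alongChar (-s) F))
      simp only [one_mul] at this
      rw [this, hQd]; exact integral_collOp _
    rw [hPd, map_add, h3, map_smul, hℓ, ← norm_eq_integral_of_nonneg h1, h2, smul_eq_mul, zero_add]
  have hinv : ∀ x : ℝ → L1 d, Continuous x → (∀ t, x t ∈ K) → ∀ t,
      picardStep P lam f₀ x t ∈ K ∧
        Real.exp (-lam * max t 0) • f₀ ≤ picardStep P lam f₀ x t := by
    intro x hx hxK t
    have hr : 0 ≤ max t 0 := le_max_right _ _
    have hc : Continuous fun s => Real.exp (lam * s) • P s (x s) :=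
      (by fun_prop : Continuous fun s => Real.exp (lam * s)).smul
        (hP.comp (continuous_id.prodMk hx))
    have h1 : 0 ≤ ∫ s in (0 : ℝ)..max t 0, Real.exp (lam * s) • P s (x s) := by
      rw [intervalIntegral.integral_of_le hr]
      exact integral_nonneg fun s => smul_nonneg (Real.exp_pos _).le (hPnn s _ (hxK s))
    -- Dropping the nonnegative integral gives an exponential lower bound by the data. It is used
    -- much later, to keep logarithms bounded below.
    have h2 : Real.exp (-lam * max t 0) • f₀ ≤ picardStep P lam f₀ x t := by
      rw [picardStep, smul_add]
      exact le_add_of_nonneg_right (smul_nonneg (Real.exp_pos _).le h1)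
    have h3 : 0 ≤ picardStep P lam f₀ x t := (smul_nonneg (Real.exp_pos _).le hf₀).trans h2
    refine ⟨⟨h3, ?_⟩, h2⟩
    rw [norm_eq_integral_of_nonneg h3, ← hℓ, picardStep, map_smul, map_add,
      ← ℓ.intervalIntegral_comp_comm (hc.intervalIntegrable _ _)]
    simp only [map_smul, hPl _ _ (hxK _), smul_eq_mul]
    rw [hℓ, ← norm_eq_integral_of_nonneg hf₀, ← hρ]
    have e2 : ∫ s in (0 : ℝ)..max t 0, Real.exp (lam * s) * (lam * ρ)
        = ρ * (Real.exp (lam * max t 0) - 1) := by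
      have : ∀ s ∈ uIcc 0 (max t 0), HasDerivAt (fun s => ρ * Real.exp (lam * s))
          (Real.exp (lam * s) * (lam * ρ)) s := fun s _ => by
        have h := (((hasDerivAt_id s).const_mul lam).exp).const_mul ρ
        convert! h using 1
        simp only [id, mul_one]; ring
      rw [intervalIntegral.integral_eq_sub_of_hasDerivAt this
        ((by fun_prop : Continuous fun s => Real.exp (lam * s) * (lam * ρ)).intervalIntegrable _ _)]
      simp; ring
    rw [e2]
    have h4 : Real.exp (-lam * max t 0) * Real.exp (lam * max t 0) = 1 := by
      rw [← Real.exp_add]; simp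
    linear_combination ρ * h4
  -- The summand `1` only makes the Lipschitz constant positive.
  have hLip : ∀ s, ∀ F ∈ K, ∀ G ∈ K, ‖P s F - P s G‖
      ≤ (2 * (Λ * sphArea d * (ρ + ρ)) + lam + 1) * ‖F - G‖ := by
    rintro s F ⟨_, hF⟩ G ⟨_, hG⟩
    have h1 : P s F - P s G = alongChar s (Q (alongChar (-s) F) - Q (alongChar (-s) G))
        + lam • (F - G) := by
      simp only [hPd, alongChar_sub, smul_sub]; abel
    have h2 := norm_collQ_truncation_sub_le hW hΛ0 hΛ hτ (alongChar (-s) F) (alongChar (-s) G)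
    rw [← alongChar_sub, norm_alongChar, norm_alongChar, norm_alongChar, hF, hG] at h2
    rw [h1]
    refine (norm_add_le _ _).trans ?_
    rw [norm_alongChar, norm_smul, Real.norm_eq_abs, abs_of_nonneg hlam0]
    have := norm_nonneg (F - G)
    simp only [hQd]
    linarith
  obtain ⟨x, hx, hxK, hfix⟩ := exists_picard_fixedPoint hP hlam0 hK (ρ := ρ) (fun F hF => hF.2.le)
    ⟨hf₀, rfl⟩ (by positivity) hLip (fun x hx hxK t => (hinv x hx hxK t).1)
  have hfc : Continuous fun t => alongChar (-t) (x t) :=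
    continuous_alongChar.comp (continuous_neg.prodMk hx)
  refine ⟨fun t => alongChar (-t) (x t), fun T => ⟨hfc.continuousOn, fun t _ =>
    integrable_rate hW hΛ (hτ.integrable _), (hQd ▸ hQ.comp hfc).continuousOn, fun t ht => ?_⟩,
    fun t ht => ⟨alongChar_nonneg _ (hxK t).1, by rw [norm_alongChar]; exact (hxK t).2, ?_⟩⟩
  · rw [alongChar_self_neg, integral_eq_of_picard_fixedPoint hP hx hfix ht.1]
    simp only [hPd, add_sub_cancel_right, hQd]
  · rw [alongChar_self_neg, hfix t]
    have := (hinv x hx hxK t).2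
    rwa [max_eq_left ht] at this

end FuzzyBoltzmann

/-! ### Gronwall's inequality and the chain rule for nonlinear functionals on `L¹`. -/

namespace FuzzyBoltzmann

open Filter Topology

variable {d : ℕ}

/-- Integral form of Gronwall's inequality. -/
theorem gronwall_integral {y : ℝ → ℝ} {T A C : ℝ} (hC : 0 ≤ C) (hy : ContinuousOn y (Icc 0 T))
    (h : ∀ t ∈ Icc 0 T, y t ≤ A + C * ∫ s in (0 : ℝ)..t, y s) :
    ∀ t ∈ Icc 0 T, y t ≤ A * Real.exp (C * t) := by
  intro t ht
  have hT : 0 ≤ T := ht.1.trans ht.2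
  -- Extension by constants beyond `[0, T]`, so that the primitive is differentiable at every time.
  let Y : ℝ → ℝ := IccExtend hT ((Icc 0 T).domRestrict y)
  have hYc : Continuous Y := (continuousOn_iff_continuous_domRestrict.1 hy).Icc_extend'
  have hYe : ∀ s ∈ Icc 0 T, Y s = y s := fun s hs => by
    simp only [Y, IccExtend_of_mem hT _ hs, domRestrict_apply]
  let z : ℝ → ℝ := fun t => A + C * ∫ s in (0 : ℝ)..t, Y s
  have hz : ∀ t, HasDerivAt z (C * Y t) t := fun t =>
    ((intervalIntegral.integral_hasDerivAt_right (hYc.intervalIntegrable _ _)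
      (hYc.stronglyMeasurableAtFilter _ _) hYc.continuousAt).const_mul C).const_add A
  have hle : ∀ t ∈ Icc 0 T, y t ≤ z t := fun t ht => by
    refine (h t ht).trans_eq ?_
    simp only [z]
    congr 2
    refine intervalIntegral.integral_congr fun s hs => ?_
    rw [uIcc_of_le ht.1] at hs
    exact (hYe s ⟨hs.1, hs.2.trans ht.2⟩).symm
  have hg := le_gronwallBound_of_liminf_deriv_right_le (f := z) (f' := fun t => C * Y t) (δ := A)
    (K := C) (ε := 0) (a := 0) (b := T)
    (fun t _ => (hz t).continuousAt.continuousWithinAt)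
    (fun x _ r hr => by
      have h1 := (hz x).hasDerivWithinAt (s := Ioi x)
      rw [hasDerivWithinAt_iff_tendsto_slope' (by simp)] at h1
      have h2 := (h1.eventually_lt_const hr).frequently
      simpa only [slope_def_field, div_eq_inv_mul] using h2)
    (by simp [z]) (fun x hx => by
      have hx' : x ∈ Icc 0 T := ⟨hx.1, hx.2.le⟩
      rw [add_zero, hYe x hx']
      exact mul_le_mul_of_nonneg_left (hle x hx') hC) t ht
  rw [gronwallBound_ε0, sub_zero] at hg
  exact (hle t ht).trans hg

/-! ### Differentiating nonlinear functionals along curves in `L¹` -/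

theorem integrable_tail_tendsto {g : Phase d → ℝ} (hg : Integrable g) :
    Tendsto (fun N : ℕ => ∫ z, (|g z| - min |g z| N)) atTop (𝓝 0) := by
  have : Tendsto (fun N : ℕ => ∫ z, (|g z| - min |g z| N)) atTop (𝓝 (∫ z : Phase d, (0 : ℝ))) := by
    refine tendsto_integral_of_dominated_convergence (fun z => |g z|) (fun N => ?_) hg.abs
      (fun N => Eventually.of_forall fun z => ?_) (Eventually.of_forall fun z => ?_)
    · exact hg.abs.aestronglyMeasurable.sub
        (hg.abs.aestronglyMeasurable.inf aestronglyMeasurable_const)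
    · rw [Real.norm_eq_abs, abs_of_nonneg (by simp)]
      have : 0 ≤ min |g z| N := le_min (abs_nonneg _) (Nat.cast_nonneg _)
      linarith
    · refine tendsto_const_nhds.congr' ?_
      filter_upwards [eventually_ge_atTop ⌈|g z|⌉₊] with N hN
      have : |g z| ≤ N := (Nat.le_ceil _).trans (by exact_mod_cast hN)
      simp [this]
  simpa using this

/-- Superposition with a bounded Lipschitz function is continuous on `L¹` against a fixed integrable
density. -/
theorem tendsto_integral_mul_comp {ι : Type*} {l : Filter ι} {F : ι → L1 d} {F₀ : L1 d}
    (hF : Tendsto F l (𝓝 F₀)) {θ : ℝ → ℝ} {L M : ℝ}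
    (hL : ∀ x y, |θ x - θ y| ≤ L * |x - y|)
    (hM : ∀ y, |θ y| ≤ M) {g : Phase d → ℝ} (hg : Integrable g) :
    Tendsto (fun i => ∫ z, |g z| * |θ (F i z) - θ (F₀ z)|) l (𝓝 0) := by
  have hM0 : 0 ≤ M := (abs_nonneg _).trans (hM 0)
  -- The density `|g|` is split at height `N`. Below `N` the Lipschitz bound gives an `L¹` distance;
  -- above `N` the boundedness of `θ` leaves a tail that is small uniformly in `i`.
  have hbound : ∀ i (N : ℕ), ∫ z, |g z| * |θ (F i z) - θ (F₀ z)|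
      ≤ N * L * ‖F i - F₀‖ + 2 * M * ∫ z, (|g z| - min |g z| N) := by
    intro i N
    have hd : Integrable (fun z => |F i z - F₀ z|) := ((integrable_L1 _).sub (integrable_L1 _)).abs
    have htail : Integrable (fun z => |g z| - min |g z| N) := by
      refine hg.abs.mono (hg.abs.aestronglyMeasurable.sub
        (hg.abs.aestronglyMeasurable.inf aestronglyMeasurable_const))
        (Eventually.of_forall fun z => ?_)
      rw [Real.norm_eq_abs, abs_of_nonneg (by simp), Real.norm_eq_abs, abs_abs]
      have : 0 ≤ min |g z| N := le_min (abs_nonneg _) (Nat.cast_nonneg _)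
      linarith
    have e1 : ‖F i - F₀‖ = ∫ z, |F i z - F₀ z| := by
      rw [norm_L1]
      refine integral_congr_ae ?_
      filter_upwards [Lp.coeFn_sub (F i) F₀] with z hz
      rw [hz, Pi.sub_apply]
    rw [e1, ← integral_const_mul, ← integral_const_mul, ← integral_add (hd.const_mul _)
      (htail.const_mul _)]
    refine integral_mono_of_nonneg (Eventually.of_forall fun z => by positivity)
      ((hd.const_mul _).add (htail.const_mul _)) (Eventually.of_forall fun z => ?_)
    have h1 := hL (F i z) (F₀ z)
    have h2 : |θ (F i z) - θ (F₀ z)| ≤ 2 * M := by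
      have := abs_sub (θ (F i z)) (θ (F₀ z))
      linarith [hM (F i z), hM (F₀ z)]
    have h3 : min |g z| N ≤ N := min_le_right _ _
    have h4 : 0 ≤ min |g z| N := le_min (abs_nonneg _) (Nat.cast_nonneg _)
    have h5 : 0 ≤ |g z| - min |g z| N := by simp
    have h6 : 0 ≤ |θ (F i z) - θ (F₀ z)| := abs_nonneg _
    calc |g z| * |θ (F i z) - θ (F₀ z)|
        = min |g z| N * |θ (F i z) - θ (F₀ z)|
          + (|g z| - min |g z| N) * |θ (F i z) - θ (F₀ z)| := by ring
      _ ≤ N * (L * |F i z - F₀ z|) + (|g z| - min |g z| N) * (2 * M) :=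
          add_le_add (mul_le_mul h3 h1 h6 (by positivity)) (mul_le_mul_of_nonneg_left h2 h5)
      _ = _ := by ring
  refine (tendsto_order.2 ⟨fun a ha => Eventually.of_forall fun i =>
    ha.trans_le (integral_nonneg fun z => by positivity), fun ε hε => ?_⟩)
  have ht := (integrable_tail_tendsto hg).const_mul (2 * M)
  rw [mul_zero] at ht
  obtain ⟨N, hN⟩ := (ht.eventually_lt_const (half_pos hε)).exists
  have h2 : Tendsto (fun i => N * L * ‖F i - F₀‖) l (𝓝 0) := by
    simpa using (tendsto_iff_norm_sub_tendsto_zero.1 hF).const_mul (N * L)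
  filter_upwards [h2.eventually_lt_const (half_pos hε)] with i hi
  linarith [hbound i N]

/-- Smooth profiles: `β` vanishes at `0` and has a bounded Lipschitz derivative `β'`. -/
structure IsProfile (β β' : ℝ → ℝ) (L M : ℝ) : Prop where
  zero : β 0 = 0
  hasDerivAt : ∀ y, HasDerivAt β (β' y) y
  lip_nonneg : 0 ≤ L
  lipschitz : ∀ x y, |β' x - β' y| ≤ L * |x - y|
  bounded : ∀ y, |β' y| ≤ M

section Profile

variable {β β' : ℝ → ℝ} {L M : ℝ}

theorem IsProfile.continuous (h : IsProfile β β' L M) : Continuous β :=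
  continuous_iff_continuousAt.2 fun y => (h.hasDerivAt y).continuousAt

theorem IsProfile.continuous_deriv (h : IsProfile β β' L M) : Continuous β' := by
  have : LipschitzWith L.toNNReal β' := LipschitzWith.of_dist_le_mul fun x y => by
    rw [Real.dist_eq, Real.dist_eq, Real.coe_toNNReal _ h.lip_nonneg]; exact h.lipschitz x y
  exact this.continuous

theorem IsProfile.abs_sub_le (h : IsProfile β β' L M) (x y : ℝ) :
    |β x - β y| ≤ M * |x - y| := by
  have := Convex.norm_image_sub_le_of_norm_hasDerivWithin_le (f := β) (f' := β') (s := univ)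
    (fun y _ => (h.hasDerivAt y).hasDerivWithinAt) (fun y _ => h.bounded y) convex_univ
    (mem_univ y) (mem_univ x)
  simpa using this

theorem IsProfile.abs_le (h : IsProfile β β' L M) (y : ℝ) : |β y| ≤ M * |y| := by
  simpa [h.zero] using h.abs_sub_le y 0

/-- Both bounds for the remainder are kept. The square of an `L¹` increment need not be integrable,
while the linear bound alone is not of smaller order; their minimum is integrable and small. -/
theorem IsProfile.taylor (h : IsProfile β β' L M) (a b : ℝ) :
    |β b - β a - β' a * (b - a)| ≤ min (2 * M) (L * |b - a|) * |b - a| := by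
  have hM : 0 ≤ M := (abs_nonneg _).trans (h.bounded 0)
  have hd : ∀ y ∈ uIcc a b,
      HasDerivWithinAt (fun y => β y - β' a * y) (β' y - β' a) (uIcc a b) y := fun y _ => by
    have := (h.hasDerivAt y).sub ((hasDerivAt_id y).const_mul (β' a))
    rw [mul_one] at this
    exact this.hasDerivWithinAt
  have := Convex.norm_image_sub_le_of_norm_hasDerivWithin_le hd (C := min (2 * M) (L * |b - a|))
    (fun y hy => ?_) (convex_uIcc a b) left_mem_uIcc right_mem_uIcc
  · simp only [Real.norm_eq_abs] at this
    refine le_trans (le_of_eq ?_) this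
    congr 1; ring
  · rw [Real.norm_eq_abs]
    refine le_min ?_ ((h.lipschitz y a).trans (mul_le_mul_of_nonneg_left
      (abs_sub_left_of_mem_uIcc hy) h.lip_nonneg))
    have h1 := abs_sub (β' y) (β' a)
    linarith [h.bounded y, h.bounded a]

theorem IsProfile.integrable (h : IsProfile β β' L M) (F : L1 d) :
    Integrable (fun z => β (F z)) :=
  ((integrable_L1 F).abs.const_mul M).mono
    (h.continuous.comp_aestronglyMeasurable (integrable_L1 F).aestronglyMeasurable)
    (Eventually.of_forall fun z => by
      rw [Real.norm_eq_abs, Real.norm_eq_abs]; exact (h.abs_le _).trans (le_abs_self _))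

theorem IsProfile.integrable_deriv_mul (h : IsProfile β β' L M) (F G : L1 d) :
    Integrable (fun z => β' (F z) * G z) :=
  (integrable_L1 G).bdd_mul (c := M) (h.continuous_deriv.comp_aestronglyMeasurable
    (integrable_L1 F).aestronglyMeasurable) (Eventually.of_forall fun _ => h.bounded _)

variable {w : Phase d → ℝ} {Cw : ℝ}

theorem integrable_weight_mul (hw : AEStronglyMeasurable w volume) (hC : ∀ z, |w z| ≤ Cw)
    {g : Phase d → ℝ} (hg : Integrable g) : Integrable (fun z => w z * g z) :=
  hg.bdd_mul (c := Cw) hw (Eventually.of_forall hC)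

theorem abs_integral_weight_mul_le (hC : ∀ z, |w z| ≤ Cw)
    {g h : Phase d → ℝ} (hh : Integrable h) (hgh : ∀ᵐ z, |g z| ≤ h z) :
    |∫ z, w z * g z| ≤ Cw * ∫ z, h z := by
  rw [← integral_const_mul, ← Real.norm_eq_abs]
  refine norm_integral_le_of_norm_le (hh.const_mul Cw) ?_
  filter_upwards [hgh] with z hz
  rw [Real.norm_eq_abs, abs_mul]
  exact mul_le_mul (hC z) hz (abs_nonneg _) ((abs_nonneg _).trans (hC z))

/-- The chain rule for `t ↦ ∫ w β(F_t)`. -/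
theorem IsProfile.hasDerivWithinAt_integral (h : IsProfile β β' L M)
    (hw : AEStronglyMeasurable w volume) (hC : ∀ z, |w z| ≤ Cw) {F : ℝ → L1 d} {G : L1 d}
    {s : Set ℝ} {t : ℝ} (hF : HasDerivWithinAt F G s t) :
    HasDerivWithinAt (fun t => ∫ z, w z * β (F t z)) (∫ z, w z * (β' (F t z) * G z)) s t := by
  have hM : 0 ≤ M := (abs_nonneg _).trans (h.bounded 0)
  have hcont : Tendsto (fun r => F r - F t) (𝓝[s] t) (𝓝 0) := by
    simpa using (hF.continuousWithinAt.tendsto.sub_const (F t))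
  -- The Taylor remainder is at most `θ(Δ) |Δ|` with `Δ = F r - F t`. Writing `Δ` as the error of
  -- differentiability plus `(r - t) G` leaves a term of order `o(r - t)` and `|r - t| ∫ |G| θ(Δ)`.
  -- The last integral tends to zero by `tendsto_integral_mul_comp`.
  let θ : ℝ → ℝ := fun y => min (2 * M) (L * |y|)
  have hθ0 : ∀ y, 0 ≤ θ y := fun y =>
    le_min (by positivity) (mul_nonneg h.lip_nonneg (abs_nonneg _))
  have hθL : ∀ x y, |θ x - θ y| ≤ L * |x - y| := fun x y => by
    refine (abs_min_sub_min_le_max _ _ _ _).trans ?_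
    simp only [sub_self, abs_zero]
    rw [max_eq_right (abs_nonneg _), ← mul_sub, abs_mul, abs_of_nonneg h.lip_nonneg]
    exact mul_le_mul_of_nonneg_left (abs_abs_sub_abs_le_abs_sub x y) h.lip_nonneg
  have hθM : ∀ y, |θ y| ≤ 2 * M := fun y => by
    rw [abs_of_nonneg (hθ0 y)]; exact min_le_left _ _
  have he := tendsto_integral_mul_comp hcont hθL hθM (integrable_L1 G)
  have hθz : θ 0 = 0 := by simp [θ, hM]
  set e : ℝ → ℝ := fun r => ∫ z, |G z| * |θ ((F r - F t) z) - θ ((0 : L1 d) z)| with hedef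
  rw [hasDerivWithinAt_iff_isLittleO] at hF ⊢
  have hbd : ∀ r, ‖(∫ z, w z * β (F r z)) - (∫ z, w z * β (F t z))
      - (r - t) • ∫ z, w z * (β' (F t z) * G z)‖
      ≤ Cw * (3 * M * ‖F r - F t - (r - t) • G‖ + |r - t| * e r) := by
    intro r
    have i1 := integrable_weight_mul hw hC (h.integrable (F r))
    have i2 := integrable_weight_mul hw hC (h.integrable (F t))
    have i3 := integrable_weight_mul hw hC (h.integrable_deriv_mul (F t) G)
    have i12 : Integrable (fun z => w z * β (F r z) - w z * β (F t z)) := i1.sub i2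
    rw [← integral_sub i1 i2, smul_eq_mul, ← integral_const_mul,
      ← integral_sub i12 (i3.const_mul (r - t))]
    have e1 : ∀ z, w z * β (F r z) - w z * β (F t z) - (r - t) * (w z * (β' (F t z) * G z))
        = w z * (β (F r z) - β (F t z) - (r - t) * (β' (F t z) * G z)) := fun z => by ring
    simp only [e1]
    have j1 : Integrable (fun z => |(F r - F t - (r - t) • G) z|) := (integrable_L1 _).abs
    have j2 : Integrable (fun z => |G z| * |θ ((F r - F t) z) - θ ((0 : L1 d) z)|) := by
      have hθc : Continuous θ := by fun_prop
      have hm : AEStronglyMeasurable (fun z => |θ ((F r - F t) z) - θ ((0 : L1 d) z)|) volume :=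
        ((hθc.comp_aestronglyMeasurable (integrable_L1 _).aestronglyMeasurable).sub
        (hθc.comp_aestronglyMeasurable (integrable_L1 (0 : L1 d)).aestronglyMeasurable)).norm
      refine (integrable_L1 G).abs.mul_bdd (c := 4 * M) hm (Eventually.of_forall fun z => ?_)
      rw [Real.norm_eq_abs, abs_abs]
      have := abs_sub (θ ((F r - F t) z)) (θ ((0 : L1 d) z))
      linarith [hθM ((F r - F t) z), hθM ((0 : L1 d) z)]
    have j : Integrable (fun z => 3 * M * |(F r - F t - (r - t) • G) z|
        + |r - t| * (|G z| * |θ ((F r - F t) z) - θ ((0 : L1 d) z)|)) :=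
      (j1.const_mul _).add (j2.const_mul _)
    rw [norm_L1, hedef, ← integral_const_mul, ← integral_const_mul,
      ← integral_add (j1.const_mul _) (j2.const_mul _)]
    refine abs_integral_weight_mul_le hC j ?_
    filter_upwards [Lp.coeFn_sub (F r - F t) ((r - t) • G), Lp.coeFn_sub (F r) (F t),
      Lp.coeFn_smul (r - t) G, Lp.coeFn_zero ℝ 1 (volume : Measure (Phase d))] with z h1 h2 h3 h4
    have h4' : (0 : L1 d) z = 0 := h4
    rw [h1, Pi.sub_apply, h2, h3, h4', Pi.sub_apply, Pi.smul_apply, smul_eq_mul, hθz, sub_zero,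
      abs_of_nonneg (hθ0 _)]
    set Δ := F r z - F t z with hΔ
    have t1 := h.taylor (F t z) (F r z)
    rw [← hΔ] at t1
    have t2 : |Δ| ≤ |Δ - (r - t) * G z| + |r - t| * |G z| := by
      rw [← abs_mul]
      have := abs_add_le (Δ - (r - t) * G z) ((r - t) * G z)
      rwa [sub_add_cancel] at this
    have t3 : min (2 * M) (L * |Δ|) * |Δ| ≤ min (2 * M) (L * |Δ|) *
      (|Δ - (r - t) * G z| + |r - t| * |G z|) := mul_le_mul_of_nonneg_left t2 (hθ0 Δ)
    have t4 : |β' (F t z) * (Δ - (r - t) * G z)| ≤ M * |Δ - (r - t) * G z| := by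
      rw [abs_mul]; exact mul_le_mul_of_nonneg_right (h.bounded _) (abs_nonneg _)
    have t5 : min (2 * M) (L * |Δ|) * |Δ - (r - t) * G z| ≤ 2 * M * |Δ - (r - t) * G z| :=
      mul_le_mul_of_nonneg_right (min_le_left _ _) (abs_nonneg _)
    have e2 : β (F r z) - β (F t z) - (r - t) * (β' (F t z) * G z)
        = (β (F r z) - β (F t z) - β' (F t z) * Δ) + β' (F t z) * (Δ - (r - t) * G z) := by ring
    rw [e2]
    refine (abs_add_le _ _).trans ?_
    simp only [θ]
    linarith
  have hCw : 0 ≤ Cw := (abs_nonneg _).trans (hC 0)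
  rw [Asymptotics.isLittleO_iff] at hF ⊢
  intro c hc
  have hc1 : 0 < c / ((Cw + 1) * (3 * M + 1)) := by positivity
  -- Both errors are made smaller than `c1`, and the constants `Cw` and `3 * M` of `hbd` are
  -- absorbed by its denominator; the added ones keep that denominator positive.
  filter_upwards [hF hc1, he.eventually_lt_const hc1] with r h1 h2
  refine (hbd r).trans ?_
  rw [Real.norm_eq_abs (r - t)] at h1 ⊢
  set c1 := c / ((Cw + 1) * (3 * M + 1)) with hc1d
  have h3 : c = c1 * ((Cw + 1) * (3 * M + 1)) := by rw [hc1d]; field_simp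
  have h4 : 0 ≤ |r - t| := abs_nonneg _
  calc Cw * (3 * M * ‖F r - F t - (r - t) • G‖ + |r - t| * e r)
      ≤ Cw * (3 * M * (c1 * |r - t|) + |r - t| * c1) := by gcongr
    _ = (c1 * |r - t|) * (Cw * (3 * M + 1)) := by ring
    _ ≤ (c1 * |r - t|) * ((Cw + 1) * (3 * M + 1)) := by gcongr; linarith
    _ = c * |r - t| := by rw [h3]; ring

theorem IsProfile.continuous_integral_deriv (h : IsProfile β β' L M)
    (hw : AEStronglyMeasurable w volume) (hC : ∀ z, |w z| ≤ Cw) {F G : ℝ → L1 d}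
    (hF : Continuous F) (hG : Continuous G) :
    Continuous fun t => ∫ z, w z * (β' (F t z) * G t z) := by
  refine continuous_iff_continuousAt.2 fun t => ?_
  have he := tendsto_integral_mul_comp (hF.tendsto t) h.lipschitz h.bounded (integrable_L1 (G t))
  have hg := (tendsto_iff_norm_sub_tendsto_zero.1 (hG.tendsto t)).const_mul M
  rw [mul_zero] at hg
  have hs := (hg.add he).const_mul Cw
  rw [add_zero, mul_zero] at hs
  rw [ContinuousAt, tendsto_iff_norm_sub_tendsto_zero]
  refine squeeze_zero (fun _ => norm_nonneg _) (fun r => ?_) hs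
  have i1 := integrable_weight_mul hw hC (h.integrable_deriv_mul (F r) (G r))
  have i2 := integrable_weight_mul hw hC (h.integrable_deriv_mul (F t) (G t))
  have j1 : Integrable (fun z => |(G r - G t) z|) := (integrable_L1 _).abs
  have j2 : Integrable (fun z => |G t z| * |β' (F r z) - β' (F t z)|) := by
    have hm : AEStronglyMeasurable (fun z => |β' (F r z) - β' (F t z)|) volume :=
      ((h.continuous_deriv.comp_aestronglyMeasurable (integrable_L1 _).aestronglyMeasurable).sub
      (h.continuous_deriv.comp_aestronglyMeasurable (integrable_L1 _).aestronglyMeasurable)).norm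
    refine (integrable_L1 (G t)).abs.mul_bdd (c := 2 * M) hm (Eventually.of_forall fun z => ?_)
    rw [Real.norm_eq_abs, abs_abs]
    have := abs_sub (β' (F r z)) (β' (F t z))
    linarith [h.bounded (F r z), h.bounded (F t z)]
  rw [← integral_sub i1 i2, norm_L1, ← integral_const_mul, ← integral_add (j1.const_mul _) j2]
  simp only [← mul_sub]
  refine abs_integral_weight_mul_le hC ((j1.const_mul _).add j2) ?_
  filter_upwards [Lp.coeFn_sub (G r) (G t)] with z h1
  rw [h1, Pi.sub_apply]
  have e : β' (F r z) * G r z - β' (F t z) * G t z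
      = β' (F r z) * (G r z - G t z) + G t z * (β' (F r z) - β' (F t z)) := by ring
  rw [e]
  refine (abs_add_le _ _).trans ?_
  rw [abs_mul, abs_mul]
  gcongr
  exact h.bounded _

/-- The integrated chain rule for `t ↦ ∫ w β(F_t)`. -/
theorem IsProfile.integral_sub_eq (h : IsProfile β β' L M)
    (hw : AEStronglyMeasurable w volume) (hC : ∀ z, |w z| ≤ Cw) {F G : ℝ → L1 d}
    (hF : ∀ t, HasDerivAt F (G t) t) (hG : Continuous G) (a b : ℝ) :
    (∫ z, w z * β (F b z)) - ∫ z, w z * β (F a z)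
      = ∫ s in a..b, ∫ z, w z * (β' (F s z) * G s z) := by
  have hFc : Continuous F := continuous_iff_continuousAt.2 fun t => (hF t).continuousAt
  refine (intervalIntegral.integral_eq_sub_of_hasDerivAt
    (f := fun t => ∫ z, w z * β (F t z)) (fun t _ => ?_)
    ((h.continuous_integral_deriv hw hC hFc hG).intervalIntegrable a b)).symm
  have := h.hasDerivWithinAt_integral hw hC (hF t).hasDerivWithinAt (s := univ)
  simpa using this

end Profile

/-- A smooth approximation of the absolute value. -/
noncomputable def absApprox (δ y : ℝ) : ℝ := Real.sqrt (y ^ 2 + δ ^ 2) - δ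

/-- The derivative of `absApprox δ`. -/
noncomputable def signApprox (δ y : ℝ) : ℝ := y / Real.sqrt (y ^ 2 + δ ^ 2)

theorem isProfile_absApprox {δ : ℝ} (hδ : 0 < δ) :
    IsProfile (absApprox δ) (signApprox δ) (2 / δ) 1 where
  zero := by simp [absApprox, Real.sqrt_sq hδ.le]
  hasDerivAt y := by
    have h0 : y ^ 2 + δ ^ 2 ≠ 0 := by positivity
    have h := (((hasDerivAt_pow 2 y).add_const (δ ^ 2)).sqrt h0).sub_const δ
    convert! h using 1
    simp only [signApprox]; field_simp; norm_num; ring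
  lip_nonneg := by positivity
  lipschitz x y := by
    have hx : 0 < Real.sqrt (x ^ 2 + δ ^ 2) := Real.sqrt_pos.2 (by positivity)
    have hy : 0 < Real.sqrt (y ^ 2 + δ ^ 2) := Real.sqrt_pos.2 (by positivity)
    have hxδ : δ ≤ Real.sqrt (x ^ 2 + δ ^ 2) := Real.le_sqrt_of_sq_le (by nlinarith [sq_nonneg x])
    have hyx : |y| ≤ Real.sqrt (y ^ 2 + δ ^ 2) :=
      Real.le_sqrt_of_sq_le (by rw [sq_abs]; nlinarith [sq_nonneg δ])
    have hx2 := Real.sq_sqrt (show 0 ≤ x ^ 2 + δ ^ 2 by positivity)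
    have hy2 := Real.sq_sqrt (show 0 ≤ y ^ 2 + δ ^ 2 by positivity)
    have hxx : |x| ≤ Real.sqrt (x ^ 2 + δ ^ 2) :=
      Real.le_sqrt_of_sq_le (by rw [sq_abs]; nlinarith [sq_nonneg δ])
    simp only [signApprox]
    set p := Real.sqrt (x ^ 2 + δ ^ 2)
    set q := Real.sqrt (y ^ 2 + δ ^ 2)
    have h1 : |q - p| ≤ |x - y| := by
      have e : (q - p) * (q + p) = (y - x) * (y + x) := by linear_combination hy2 - hx2
      have h2 : |q - p| * (q + p) = |x - y| * |y + x| := by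
        rw [← abs_of_pos (add_pos hy hx), ← abs_mul, e, abs_mul, abs_sub_comm y x]
      have h3 : |y + x| ≤ q + p := (abs_add_le _ _).trans (add_le_add hyx hxx)
      have h4 : |x - y| * |y + x| ≤ |x - y| * (q + p) := by gcongr
      exact le_of_mul_le_mul_right (h2.trans_le h4) (add_pos hy hx)
    have e : x / p - y / q = (x - y) / p + y / q * ((q - p) / p) := by field_simp; ring
    rw [e]
    refine (abs_add_le _ _).trans ?_
    have h5 : |y / q| ≤ 1 := by rw [abs_div, abs_of_pos hy]; exact (div_le_one hy).2 hyx
    rw [abs_mul, abs_div (x - y), abs_div (q - p), abs_of_pos hx]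
    have h6 : |x - y| / p ≤ |x - y| / δ := by gcongr
    have h7 : |q - p| / p ≤ |x - y| / δ := by gcongr
    have h8 : |y / q| * (|q - p| / p) ≤ 1 * (|x - y| / δ) := by gcongr
    calc _ ≤ |x - y| / δ + 1 * (|x - y| / δ) := add_le_add h6 h8
      _ = _ := by ring
  bounded y := by
    have hy : 0 < Real.sqrt (y ^ 2 + δ ^ 2) := Real.sqrt_pos.2 (by positivity)
    have hyx : |y| ≤ Real.sqrt (y ^ 2 + δ ^ 2) :=
      Real.le_sqrt_of_sq_le (by rw [sq_abs]; nlinarith [sq_nonneg δ])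
    rw [signApprox, abs_div, abs_of_pos hy]; exact (div_le_one hy).2 hyx

theorem absApprox_nonneg (δ y : ℝ) : 0 ≤ absApprox δ y :=
  sub_nonneg.2 (Real.le_sqrt_of_sq_le (by nlinarith [sq_nonneg y]))

theorem absApprox_le {δ : ℝ} (hδ : 0 < δ) (y : ℝ) : absApprox δ y ≤ |y| := by
  have := (isProfile_absApprox hδ).abs_le y
  rw [one_mul] at this
  exact (le_abs_self _).trans this

theorem tendsto_absApprox {δ : ℕ → ℝ} (hδ : Tendsto δ atTop (𝓝 0)) (y : ℝ) :
    Tendsto (fun n => absApprox (δ n) y) atTop (𝓝 |y|) := by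
  have h : Continuous fun δ => absApprox δ y := by unfold absApprox; fun_prop
  have := (h.tendsto 0).comp hδ
  simpa [absApprox, Real.sqrt_sq_eq_abs, Function.comp_def] using this

theorem tendsto_signApprox {δ : ℕ → ℝ} (hδ : Tendsto δ atTop (𝓝 0)) (y : ℝ) :
    Tendsto (fun n => signApprox (δ n) y) atTop (𝓝 (Real.sign y)) := by
  by_cases hy : y = 0
  · simp [hy, signApprox]
  · have h : ContinuousAt (fun δ => signApprox δ y) 0 := by
      unfold signApprox
      refine continuousAt_const.div (by fun_prop) ?_
      simp [Real.sqrt_sq_eq_abs, hy]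
    have h2 := h.tendsto.comp hδ
    have : signApprox 0 y = Real.sign y := by
      simp only [signApprox, ne_eq, OfNat.ofNat_ne_zero, not_false_eq_true, zero_pow, add_zero,
        Real.sqrt_sq_eq_abs]
      rcases lt_or_gt_of_ne hy with h | h
      · rw [Real.sign_of_neg h, abs_of_neg h]; field_simp
      · rw [Real.sign_of_pos h, abs_of_pos h]; field_simp
    rwa [this] at h2

end FuzzyBoltzmann

/-! ### Weighted `L¹` norms along differentiable curves. -/

namespace FuzzyBoltzmann

open Filter Topology

variable {d : ℕ}

theorem abs_sign_le_one (y : ℝ) : |Real.sign y| ≤ 1 := by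
  rcases Real.sign_apply_eq y with h | h | h <;> simp [h]

theorem abs_weight_sign_mul_le {w : ℝ} (hw : 0 ≤ w) (x y : ℝ) :
    |w * (Real.sign x * y)| ≤ w * |y| := by
  rw [abs_mul, abs_mul, abs_of_nonneg hw]
  have h2 : |Real.sign x| * |y| ≤ 1 * |y| := by gcongr; exact abs_sign_le_one x
  rw [one_mul] at h2
  exact mul_le_mul_of_nonneg_left h2 hw

/-- A pointwise limit of nonnegative integrable functions with bounded integrals is integrable. -/
theorem integrable_of_tendsto_of_integral_le {α : Type*} [MeasurableSpace α] {μ : Measure α}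
    {u : ℕ → α → ℝ} {g : α → ℝ} (hu : ∀ n, Integrable (u n) μ) (hu0 : ∀ n, ∀ᵐ z ∂μ, 0 ≤ u n z)
    (hg : ∀ᵐ z ∂μ, Tendsto (fun n => u n z) atTop (𝓝 (g z))) {b : ℕ → ℝ} {B : ℝ}
    (hb : ∀ n, ∫ z, u n z ∂μ ≤ b n) (hB : Tendsto b atTop (𝓝 B)) :
    Integrable g μ ∧ ∫ z, g z ∂μ ≤ B := by
  have hgm : AEStronglyMeasurable g μ :=
    aestronglyMeasurable_of_tendsto_ae atTop (fun n => (hu n).aestronglyMeasurable) hg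
  have hg0 : 0 ≤ᵐ[μ] g := by
    filter_upwards [hg, ae_all_iff.2 hu0] with z h1 h2
    exact ge_of_tendsto' h1 h2
  have hb0 : ∀ n, 0 ≤ b n := fun n => (integral_nonneg_of_ae (hu0 n)).trans (hb n)
  have hB0 : 0 ≤ B := ge_of_tendsto' hB hb0
  have h1 : ∫⁻ z, ENNReal.ofReal (g z) ∂μ ≤ ENNReal.ofReal B := by
    calc ∫⁻ z, ENNReal.ofReal (g z) ∂μ
        = ∫⁻ z, liminf (fun n => ENNReal.ofReal (u n z)) atTop ∂μ := by
          refine lintegral_congr_ae ?_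
          filter_upwards [hg] with z hz
          exact (((ENNReal.continuous_ofReal.tendsto _).comp hz).liminf_eq).symm
      _ ≤ liminf (fun n => ∫⁻ z, ENNReal.ofReal (u n z) ∂μ) atTop :=
          lintegral_liminf_le' fun n => (hu n).aestronglyMeasurable.aemeasurable.ennreal_ofReal
      _ ≤ liminf (fun n => ENNReal.ofReal (b n)) atTop := by
          refine liminf_le_liminf (Eventually.of_forall fun n => ?_)
          rw [← ofReal_integral_eq_lintegral_ofReal (hu n) (hu0 n)]
          exact ENNReal.ofReal_le_ofReal (hb n)
      _ = ENNReal.ofReal B := ((ENNReal.continuous_ofReal.tendsto _).comp hB).liminf_eq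
  have hgi : Integrable g μ := by
    refine ⟨hgm, ?_⟩
    rw [hasFiniteIntegral_iff_ofReal hg0]
    exact h1.trans_lt ENNReal.ofReal_lt_top
  refine ⟨hgi, ?_⟩
  rw [← ofReal_integral_eq_lintegral_ofReal hgi hg0] at h1
  exact (ENNReal.ofReal_le_ofReal_iff hB0).1 h1

/-- Weighted `L¹` norms of a differentiable curve are controlled by the sign-weighted integrals of
its derivative. -/
theorem weighted_abs_le {F G : ℝ → L1 d} (hF : ∀ t, HasDerivAt F (G t) t) (hG : Continuous G)
    {w : Phase d → ℝ} (hw : Measurable w) (hw0 : ∀ z, 0 ≤ w z) {T M : ℝ}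
    (hM : ∀ s ∈ Icc 0 T, Integrable (fun z => w z * |G s z|) ∧ ∫ z, w z * |G s z| ≤ M)
    (h0 : Integrable (fun z => w z * |F 0 z|)) {t : ℝ} (ht : t ∈ Icc 0 T) :
    Integrable (fun z => w z * |F t z|) ∧
      IntervalIntegrable (fun s => ∫ z, w z * (Real.sign (F s z) * G s z)) volume 0 t ∧
      ∫ z, w z * |F t z| ≤ (∫ z, w z * |F 0 z|)
        + ∫ s in (0 : ℝ)..t, ∫ z, w z * (Real.sign (F s z) * G s z) := by
  have hFc : Continuous F := continuous_iff_continuousAt.2 fun t => (hF t).continuousAt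
  -- The weight is cut at height `n` and the absolute value smoothed at scale `δ n`, so the chain
  -- rule for bounded weights applies. As `n → ∞`, the right side converges by dominated convergence
  -- with the bound `M`, and the left side is handled by Fatou's lemma.
  let δ : ℕ → ℝ := fun n => 1 / ((n : ℝ) + 1)
  have hδ0 : ∀ n, 0 < δ n := fun n => by positivity
  have hδ : Tendsto δ atTop (𝓝 0) := tendsto_one_div_add_atTop_nhds_zero_nat
  let wn : ℕ → Phase d → ℝ := fun n z => min (w z) n
  have hwn0 : ∀ n z, 0 ≤ wn n z := fun n z => le_min (hw0 z) (Nat.cast_nonneg n)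
  have hwnw : ∀ n z, wn n z ≤ w z := fun n z => min_le_left _ _
  have hwnm : ∀ n, AEStronglyMeasurable (wn n) volume := fun n =>
    (hw.min measurable_const).aestronglyMeasurable
  have hwnC : ∀ n z, |wn n z| ≤ n := fun n z => by
    rw [abs_of_nonneg (hwn0 n z)]; exact min_le_right _ _
  have hwnt : ∀ z, Tendsto (fun n => wn n z) atTop (𝓝 (w z)) := fun z => by
    refine tendsto_const_nhds.congr' ?_
    filter_upwards [eventually_ge_atTop ⌈w z⌉₊] with n hn
    exact (min_eq_left ((Nat.le_ceil _).trans (by exact_mod_cast hn))).symm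
  have hp := fun n => isProfile_absApprox (hδ0 n)
  let v : ℕ → ℝ → ℝ := fun n s => ∫ z, wn n z * (signApprox (δ n) (F s z) * G s z)
  have hvc : ∀ n, Continuous (v n) := fun n =>
    (hp n).continuous_integral_deriv (hwnm n) (hwnC n) hFc hG
  have hpt : ∀ n s z, ‖wn n z * (signApprox (δ n) (F s z) * G s z)‖ ≤ w z * |G s z| := by
    intro n s z
    rw [Real.norm_eq_abs, abs_mul, abs_mul, abs_of_nonneg (hwn0 n z)]
    have h1 := (hp n).bounded (F s z)
    have h2 : |signApprox (δ n) (F s z)| * |G s z| ≤ 1 * |G s z| := by gcongr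
    rw [one_mul] at h2
    exact mul_le_mul (hwnw n z) h2 (by positivity) (hw0 z)
  have hvt : ∀ s ∈ Icc 0 T, Tendsto (fun n => v n s) atTop
      (𝓝 (∫ z, w z * (Real.sign (F s z) * G s z))) := fun s hs =>
    tendsto_integral_of_dominated_convergence _ (fun n => (integrable_weight_mul (hwnm n) (hwnC n)
        ((hp n).integrable_deriv_mul (F s) (G s))).aestronglyMeasurable) (hM s hs).1
      (fun n => Eventually.of_forall fun z => hpt n s z)
      (Eventually.of_forall fun z => (hwnt z).mul ((tendsto_signApprox hδ _).mul_const _))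
  have hvM : ∀ n, ∀ s ∈ Icc 0 T, ‖v n s‖ ≤ M := fun n s hs =>
    (norm_integral_le_of_norm_le (hM s hs).1 (Eventually.of_forall fun z => hpt n s z)).trans
      (hM s hs).2
  have hsub : uIoc 0 t ⊆ Icc 0 T := fun s hs => by
    rw [uIoc_of_le ht.1] at hs; exact ⟨hs.1.le, hs.2.trans ht.2⟩
  have hlim : Tendsto (fun n => ∫ s in (0 : ℝ)..t, v n s) atTop
      (𝓝 (∫ s in (0 : ℝ)..t, ∫ z, w z * (Real.sign (F s z) * G s z))) := by
    refine intervalIntegral.tendsto_integral_filter_of_dominated_convergence (fun _ => M)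
      (Eventually.of_forall fun n => (hvc n).aestronglyMeasurable)
      (Eventually.of_forall fun n => Eventually.of_forall fun s hs => hvM n s (hsub hs))
      intervalIntegrable_const (Eventually.of_forall fun s hs => hvt s (hsub hs))
  have hii : IntervalIntegrable (fun s => ∫ z, w z * (Real.sign (F s z) * G s z)) volume 0 t := by
    have hm : AEStronglyMeasurable (fun s => ∫ z, w z * (Real.sign (F s z) * G s z))
        (volume.restrict (uIoc 0 t)) := by
      refine aestronglyMeasurable_of_tendsto_ae atTop
        (fun n => (hvc n).aestronglyMeasurable.restrict) ?_
      exact (ae_restrict_iff' measurableSet_uIoc).2 (Eventually.of_forall fun s hs =>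
        hvt s (hsub hs))
    refine (intervalIntegrable_const (c := M)).mono_fun hm ?_
    refine (ae_restrict_iff' measurableSet_uIoc).2 (Eventually.of_forall fun s hs => ?_)
    have := le_of_tendsto' (hvt s (hsub hs)).norm (fun n => hvM n s (hsub hs))
    exact this.trans (le_abs_self M)
  have hineq : ∀ n, ∫ z, wn n z * absApprox (δ n) (F t z)
      ≤ (∫ z, w z * |F 0 z|) + ∫ s in (0 : ℝ)..t, v n s := by
    intro n
    have h1 := (hp n).integral_sub_eq (hwnm n) (hwnC n) hF hG 0 t
    have h2 : ∫ z, wn n z * absApprox (δ n) (F 0 z) ≤ ∫ z, w z * |F 0 z| := by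
      refine integral_mono (integrable_weight_mul (hwnm n) (hwnC n) ((hp n).integrable _)) h0
        fun z => ?_
      exact mul_le_mul (hwnw n z) (absApprox_le (hδ0 n) _) (absApprox_nonneg _ _) (hw0 z)
    linarith
  obtain ⟨h1, h2⟩ := integrable_of_tendsto_of_integral_le
    (fun n => integrable_weight_mul (hwnm n) (hwnC n) ((hp n).integrable (F t)))
    (fun n => Eventually.of_forall fun z => mul_nonneg (hwn0 n z) (absApprox_nonneg _ _))
    (Eventually.of_forall fun z => (hwnt z).mul (tendsto_absApprox hδ _)) hineq
    (tendsto_const_nhds.add hlim)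
  exact ⟨h1, hii, h2⟩

/-- `weighted_abs_le` for the curve restarted at time `r` with `F r` subtracted. It makes the
weighted norm Lipschitz in time, hence continuous, as Gronwall's inequality requires. -/
theorem weighted_abs_sub_le {F G : ℝ → L1 d} (hF : ∀ t, HasDerivAt F (G t) t) (hG : Continuous G)
    {w : Phase d → ℝ} (hw : Measurable w) (hw0 : ∀ z, 0 ≤ w z) {T M : ℝ}
    (hM : ∀ s ∈ Icc 0 T, Integrable (fun z => w z * |G s z|) ∧ ∫ z, w z * |G s z| ≤ M)
    {r t : ℝ} (hr : 0 ≤ r) (hrt : r ≤ t) (ht : t ≤ T) :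
    Integrable (fun z => w z * |(F t - F r) z|) ∧ ∫ z, w z * |(F t - F r) z| ≤ M * (t - r) := by
  have hF' : ∀ s, HasDerivAt (fun s => F (r + s) - F r) (G (r + s)) s := fun s =>
    ((hF (r + s)).comp_const_add r s).sub_const _
  have hG' : Continuous fun s => G (r + s) := hG.comp (by fun_prop)
  have hz : (fun z => w z * |(F (r + 0) - F r) z|) =ᵐ[volume] 0 := by
    have h : F (r + 0) - F r = 0 := by simp
    rw [h]
    filter_upwards [Lp.coeFn_zero ℝ 1 (volume : Measure (Phase d))] with z hz
    rw [hz]; simp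
  have hM' : ∀ s ∈ Icc 0 (T - r), Integrable (fun z => w z * |G (r + s) z|) ∧
      ∫ z, w z * |G (r + s) z| ≤ M := fun s hs => hM _ ⟨by linarith [hs.1], by linarith [hs.2]⟩
  obtain ⟨h1, h2, h3⟩ := weighted_abs_le hF' hG' hw hw0 hM'
    ((integrable_zero _ _ _).congr hz.symm) (t := t - r) ⟨by linarith, by linarith⟩
  rw [integral_congr_ae hz] at h3
  simp only [add_sub_cancel] at h1 h3
  refine ⟨h1, h3.trans ?_⟩
  simp only [Pi.zero_apply, integral_zero, zero_add]
  have h4 : ∀ s ∈ Icc 0 (t - r), ∫ z, w z * (Real.sign ((F (r + s) - F r) z) * G (r + s) z) ≤ M :=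
    fun s hs => by
      have hs' := hM' s ⟨hs.1, by linarith [hs.2]⟩
      refine (Real.le_norm_self _).trans (le_trans ?_ hs'.2)
      refine norm_integral_le_of_norm_le hs'.1 (Eventually.of_forall fun z => ?_)
      exact abs_weight_sign_mul_le (hw0 z) _ _
  have := intervalIntegral.integral_mono_on (by linarith) h2 (intervalIntegrable_const (c := M)) h4
  simpa [mul_comm] using this

/-- Gronwall's inequality in weighted `L¹` norms. -/
theorem weighted_gronwall {F G : ℝ → L1 d} (hF : ∀ t, HasDerivAt F (G t) t) (hG : Continuous G)
    {w : Phase d → ℝ} (hw : Measurable w) (hw0 : ∀ z, 0 ≤ w z) {T M : ℝ}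
    (hM : ∀ s ∈ Icc 0 T, Integrable (fun z => w z * |G s z|) ∧ ∫ z, w z * |G s z| ≤ M)
    (h0 : Integrable (fun z => w z * |F 0 z|)) {C e : ℝ} (hC : 0 ≤ C) (he : 0 ≤ e)
    (hle : ∀ s ∈ Icc 0 T, Integrable (fun z => w z * |F s z|) →
      ∫ z, w z * (Real.sign (F s z) * G s z) ≤ C * (∫ z, w z * |F s z|) + e)
    {t : ℝ} (ht : t ∈ Icc 0 T) :
    Integrable (fun z => w z * |F t z|) ∧
      ∫ z, w z * |F t z| ≤ ((∫ z, w z * |F 0 z|) + e * T) * Real.exp (C * t) := by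
  have hi : ∀ t ∈ Icc 0 T, Integrable (fun z => w z * |F t z|) := fun t ht =>
    (weighted_abs_le hF hG hw hw0 hM h0 ht).1
  refine ⟨hi t ht, ?_⟩
  have hM0 : 0 ≤ M := by
    have h := hM t ht
    exact (integral_nonneg fun z => mul_nonneg (hw0 z) (abs_nonneg _)).trans h.2
  have hlip : ∀ r ∈ Icc 0 T, ∀ t ∈ Icc 0 T, r ≤ t →
      |(∫ z, w z * |F t z|) - (∫ z, w z * |F r z|)| ≤ M * (t - r) := by
    intro r hr t ht hrt
    obtain ⟨h1, h2⟩ := weighted_abs_sub_le hF hG hw hw0 hM hr.1 hrt ht.2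
    rw [← integral_sub (hi t ht) (hi r hr), ← Real.norm_eq_abs]
    refine (norm_integral_le_of_norm_le h1 ?_).trans h2
    filter_upwards [Lp.coeFn_sub (F t) (F r)] with z hz
    rw [hz, ← mul_sub, Real.norm_eq_abs, abs_mul, abs_of_nonneg (hw0 z)]
    exact mul_le_mul_of_nonneg_left (abs_abs_sub_abs_le_abs_sub _ _) (hw0 z)
  have hcont : ContinuousOn (fun t => ∫ z, w z * |F t z|) (Icc 0 T) := by
    have : LipschitzOnWith M.toNNReal (fun t => ∫ z, w z * |F t z|) (Icc 0 T) := by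
      refine LipschitzOnWith.of_dist_le_mul fun r hr t ht => ?_
      rw [Real.dist_eq, Real.dist_eq, Real.coe_toNNReal _ hM0]
      rcases le_total r t with h | h
      · rw [abs_sub_comm, abs_sub_comm r t, abs_of_nonneg (sub_nonneg.2 h)]
        exact hlip r hr t ht h
      · rw [abs_of_nonneg (sub_nonneg.2 h)]
        exact hlip t ht r hr h
    exact this.continuousOn
  refine gronwall_integral hC hcont (fun t ht => ?_) t ht
  obtain ⟨_, h2, h3⟩ := weighted_abs_le hF hG hw hw0 hM h0 ht
  refine h3.trans ?_
  have hci : IntervalIntegrable (fun t => ∫ z, w z * |F t z|) volume 0 t := by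
    refine ContinuousOn.intervalIntegrable (hcont.mono ?_)
    rw [uIcc_of_le ht.1]; exact Icc_subset_Icc_right ht.2
  have h4 := intervalIntegral.integral_mono_on ht.1 h2
    ((hci.const_mul C).add (intervalIntegrable_const (c := e)))
    (fun s hs => hle s ⟨hs.1, hs.2.trans ht.2⟩ (hi s ⟨hs.1, hs.2.trans ht.2⟩))
  rw [intervalIntegral.integral_add (hci.const_mul C) intervalIntegrable_const,
    intervalIntegral.integral_const_mul, intervalIntegral.integral_const, smul_eq_mul,
    sub_zero] at h4
  have h5 : t * e ≤ e * T := by rw [mul_comm]; exact mul_le_mul_of_nonneg_left ht.2 he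
  linarith

end FuzzyBoltzmann

/-! ### From mild solutions to weak solutions. -/

namespace FuzzyBoltzmann

open Filter Topology

variable {d : ℕ}

/-- A mild solution, read along characteristics, extends to a `C¹` curve on the whole line. -/
theorem exists_extension {T : ℝ} (hT : 0 ≤ T) {f₀ : L1 d} {H : ℝ → L1 d}
    (hH : ContinuousOn H (Icc 0 T)) :
    ∃ F G : ℝ → L1 d, (∀ t, HasDerivAt F (G t) t) ∧ Continuous G ∧ F 0 = f₀ ∧
      ∀ t ∈ Icc 0 T, F t = f₀ + (∫ s in (0 : ℝ)..t, H s) ∧ G t = H t := by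
  let G : ℝ → L1 d := IccExtend hT ((Icc 0 T).domRestrict H)
  have hGc : Continuous G := (continuousOn_iff_continuous_domRestrict.1 hH).Icc_extend'
  have hGe : ∀ s ∈ Icc 0 T, G s = H s := fun s hs => by
    simp only [G, IccExtend_of_mem hT _ hs, domRestrict_apply]
  refine ⟨fun t => f₀ + ∫ s in (0 : ℝ)..t, G s, G, fun t =>
    (intervalIntegral.integral_hasDerivAt_right (hGc.intervalIntegrable _ _)
      (hGc.stronglyMeasurableAtFilter _ _) hGc.continuousAt).const_add f₀, hGc, by simp,
    fun t ht => ⟨?_, hGe t ht⟩⟩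
  simp only
  congr 1
  refine intervalIntegral.integral_congr fun s hs => ?_
  rw [uIcc_of_le ht.1] at hs
  exact hGe s ⟨hs.1, hs.2.trans ht.2⟩

theorem IsMild.exists_extension {W : Coll d → ℝ} {τ : ℝ → ℝ} {T : ℝ} (hT : 0 ≤ T) {f₀ : L1 d}
    {f : ℝ → L1 d} (h : IsMild W τ T f₀ f) :
    ∃ F G : ℝ → L1 d, (∀ t, HasDerivAt F (G t) t) ∧ Continuous G ∧ F 0 = f₀ ∧
      ∀ t ∈ Icc 0 T, F t = alongChar t (f t) ∧
        G t = alongChar t (collQ W fun z => τ (f t z)) := by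
  obtain ⟨F, G, h1, h2, h3, h4⟩ := FuzzyBoltzmann.exists_extension hT (f₀ := f₀)
    (continuousOn_alongChar continuousOn_id h.continuousOn_collQ)
  exact ⟨F, G, h1, h2, h3, fun t ht => ⟨(h4 t ht).1.trans (h.eq t ht).symm, (h4 t ht).2⟩⟩

theorem IsMild.contDiffOn {W : Coll d → ℝ} {τ : ℝ → ℝ} {T : ℝ} (hT : 0 ≤ T) {f₀ : L1 d}
    {f : ℝ → L1 d} (h : IsMild W τ T f₀ f) :
    ContDiffOn ℝ 1 (fun t => alongChar t (f t)) (Icc 0 T) := by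
  obtain ⟨F, G, h1, h2, -, h4⟩ := h.exists_extension hT
  have hF : ContDiff ℝ 1 F := by
    rw [contDiff_one_iff_deriv]
    refine ⟨fun t => (h1 t).differentiableAt, ?_⟩
    have : deriv F = G := funext fun t => (h1 t).deriv
    rwa [this]
  exact hF.contDiffOn.congr fun t ht => (h4 t ht).1.symm

theorem IsMild.zero_eq {W : Coll d → ℝ} {τ : ℝ → ℝ} {T : ℝ} (hT : 0 ≤ T) {f₀ : L1 d}
    {f : ℝ → L1 d} (h : IsMild W τ T f₀ f) : f 0 = f₀ := by
  have := h.eq 0 ⟨le_rfl, hT⟩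
  simpa [alongChar_zero] using this

/-- Pairings with bounded continuous time-dependent functions are continuous in time. -/
theorem continuous_integral_pairing {ψ : ℝ × Phase d → ℝ} (hψ : Continuous ψ) {C : ℝ}
    (hC : ∀ p, |ψ p| ≤ C) {F : ℝ → L1 d} (hF : Continuous F) :
    Continuous fun t => ∫ z, ψ (t, z) * F t z := by
  refine continuous_iff_continuousAt.2 fun t => ?_
  have hm : ∀ s, AEStronglyMeasurable (fun z => ψ (s, z)) volume := fun s =>
    (hψ.comp (by fun_prop : Continuous fun z : Phase d => (s, z))).aestronglyMeasurable
  have h1 : Tendsto (fun s => ∫ z, ψ (s, z) * F t z) (𝓝 t) (𝓝 (∫ z, ψ (t, z) * F t z)) := by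
    refine tendsto_integral_filter_of_dominated_convergence (fun z => C * |F t z|)
      (Eventually.of_forall fun s => (hm s).mul (integrable_L1 _).aestronglyMeasurable)
      (Eventually.of_forall fun s => Eventually.of_forall fun z => ?_)
      ((integrable_L1 _).abs.const_mul C) (Eventually.of_forall fun z => ?_)
    · rw [Real.norm_eq_abs, abs_mul]; exact mul_le_mul_of_nonneg_right (hC _) (abs_nonneg _)
    · exact ((hψ.comp (by fun_prop : Continuous fun s : ℝ => (s, z))).tendsto t).mul_const _
  have h2 : Tendsto (fun s => C * ‖F s - F t‖) (𝓝 t) (𝓝 0) := by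
    simpa using (tendsto_iff_norm_sub_tendsto_zero.1 (hF.tendsto t)).const_mul C
  have h3 : Tendsto (fun s => ∫ z, ψ (s, z) * (F s - F t) z) (𝓝 t) (𝓝 0) := by
    refine squeeze_zero_norm (fun s => ?_) h2
    rw [norm_L1]
    exact abs_integral_weight_mul_le (fun z => hC (s, z)) (integrable_L1 _).abs
      (Eventually.of_forall fun z => le_rfl)
  have h4 := h1.add h3
  rw [add_zero] at h4
  refine h4.congr fun s => ?_
  rw [← integral_add (integrable_mul_L1 (hm s) (fun z => hC (s, z)) _)
    (integrable_mul_L1 (hm s) (fun z => hC (s, z)) _)]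
  refine integral_congr_ae ?_
  filter_upwards [Lp.coeFn_sub (F s) (F t)] with z hz
  rw [hz, Pi.sub_apply]; ring

/-- Product rule for pairings of a curve in `L¹` with a time-dependent test function. -/
theorem hasDerivAt_integral_pairing {ψ ψ' : ℝ × Phase d → ℝ} (hψ : Continuous ψ)
    (hψ' : Continuous ψ') (hd : ∀ t z, HasDerivAt (fun s => ψ (s, z)) (ψ' (t, z)) t) {C C' : ℝ}
    (hC : ∀ p, |ψ p| ≤ C) (hC' : ∀ p, |ψ' p| ≤ C') {F : ℝ → L1 d} {G : L1 d} {t : ℝ}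
    (hF : HasDerivAt F G t) :
    HasDerivAt (fun t => ∫ z, ψ (t, z) * F t z)
      ((∫ z, ψ' (t, z) * F t z) + ∫ z, ψ (t, z) * G z) t := by
  have hm : ∀ s, AEStronglyMeasurable (fun z => ψ (s, z)) volume := fun s =>
    (hψ.comp (by fun_prop : Continuous fun z : Phase d => (s, z))).aestronglyMeasurable
  have hm' : ∀ s, AEStronglyMeasurable (fun z => ψ' (s, z)) volume := fun s =>
    (hψ'.comp (by fun_prop : Continuous fun z : Phase d => (s, z))).aestronglyMeasurable
  -- The pairing is split as `ψ_s F_t + ψ_s (F_s - F_t)`. In the first term only the test function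
  -- moves. In the second the factor `F_s - F_t` vanishes at `s = t`, so the derivative is that of
  -- `F` paired with `ψ_t`.
  have h1 : HasDerivAt (fun s => ∫ z, ψ (s, z) * F t z) (∫ z, ψ' (t, z) * F t z) t := by
    refine (hasDerivAt_integral_of_dominated_loc_of_deriv_le (s := univ)
      (bound := fun z => C' * |F t z|) (F' := fun s z => ψ' (s, z) * F t z) univ_mem
      (Eventually.of_forall fun s => (hm s).mul (integrable_L1 _).aestronglyMeasurable)
      (integrable_mul_L1 (hm t) (fun z => hC (t, z)) _)
      ((hm' t).mul (integrable_L1 _).aestronglyMeasurable)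
      (Eventually.of_forall fun z s _ => ?_)
      ((integrable_L1 _).abs.const_mul C') (Eventually.of_forall fun z s _ => ?_)).2
    · rw [Real.norm_eq_abs, abs_mul]; exact mul_le_mul_of_nonneg_right (hC' _) (abs_nonneg _)
    · exact (hd s z).mul_const _
  have h2 : HasDerivAt (fun s => ∫ z, ψ (s, z) * (F s - F t) z) (∫ z, ψ (t, z) * G z) t := by
    have hG := (continuous_integral_pairing hψ hC (F := fun _ => G) continuous_const).tendsto t
    rw [hasDerivAt_iff_isLittleO] at hF ⊢
    rw [Asymptotics.isLittleO_iff] at hF ⊢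
    intro c hc
    have hC0 : 0 ≤ C := (abs_nonneg _).trans (hC (0, 0))
    have hc1 : 0 < c / (2 * (C + 1)) := by positivity
    have hG' := (tendsto_iff_norm_sub_tendsto_zero.1 hG).eventually_lt_const (half_pos hc)
    filter_upwards [hF hc1, hG'] with s h3 h4
    have hz : ∫ z, ψ (t, z) * (F t - F t) z = 0 := by
      rw [sub_self]
      refine (integral_congr_ae (g := 0) ?_).trans (by simp)
      filter_upwards [Lp.coeFn_zero ℝ 1 (volume : Measure (Phase d))] with z hz
      rw [hz]; simp
    have e : (∫ z, ψ (s, z) * (F s - F t) z) - (∫ z, ψ (t, z) * (F t - F t) z)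
        - (s - t) • ∫ z, ψ (t, z) * G z
        = (∫ z, ψ (s, z) * (F s - F t - (s - t) • G) z)
          + (s - t) * ((∫ z, ψ (s, z) * G z) - ∫ z, ψ (t, z) * G z) := by
      have e1 : ∫ z, ψ (s, z) * (F s - F t - (s - t) • G) z
          = (∫ z, ψ (s, z) * (F s - F t) z) - (s - t) * ∫ z, ψ (s, z) * G z := by
        rw [← integral_const_mul, ← integral_sub (integrable_mul_L1 (hm s) (fun z => hC (s, z)) _)
          ((integrable_mul_L1 (hm s) (fun z => hC (s, z)) _).const_mul _)]
        refine integral_congr_ae ?_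
        filter_upwards [Lp.coeFn_sub (F s - F t) ((s - t) • G), Lp.coeFn_smul (s - t) G]
          with z h1 h2
        rw [h1, Pi.sub_apply, h2, Pi.smul_apply, smul_eq_mul]; ring
      rw [hz, e1, smul_eq_mul]; ring
    rw [e]
    refine (norm_add_le _ _).trans ?_
    have h5 : ‖∫ z, ψ (s, z) * (F s - F t - (s - t) • G) z‖ ≤ C * ‖F s - F t - (s - t) • G‖ := by
      rw [norm_L1]
      exact abs_integral_weight_mul_le (fun z => hC (s, z)) (integrable_L1 _).abs
        (Eventually.of_forall fun z => le_rfl)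
    rw [norm_mul]
    have h6 : C * (c / (2 * (C + 1)) * ‖s - t‖) ≤ c / 2 * ‖s - t‖ := by
      have : C * (c / (2 * (C + 1))) ≤ c / 2 := by
        rw [mul_div_assoc', div_le_div_iff₀ (by positivity) (by positivity)]; nlinarith
      rw [← mul_assoc]; gcongr
    have h7 : C * ‖F s - F t - (s - t) • G‖ ≤ C * (c / (2 * (C + 1)) * ‖s - t‖) := by gcongr
    have h8 : ‖s - t‖ * ‖(∫ z, ψ (s, z) * G z) - ∫ z, ψ (t, z) * G z‖ ≤ ‖s - t‖ * (c / 2) := by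
      gcongr
    linarith
  refine (h1.add h2).congr_of_eventuallyEq (Eventually.of_forall fun s => ?_)
  simp only [Pi.add_apply]
  rw [← integral_add (integrable_mul_L1 (hm s) (fun z => hC (s, z)) _)
    (integrable_mul_L1 (hm s) (fun z => hC (s, z)) _)]
  refine integral_congr_ae ?_
  filter_upwards [Lp.coeFn_sub (F s) (F t)] with z hz
  rw [hz, Pi.sub_apply]; ring

/-! ### Test functions -/

theorem transportDeriv_eq (φ : ℝ × Phase d → ℝ) (t : ℝ) (z : Phase d) :
    transportDeriv φ t z = fderiv ℝ φ (t, z) (1, (z.2, 0)) := by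
  rw [transportDeriv, ← map_add]; simp

theorem hasDerivAt_along_shift {φ : ℝ × Phase d → ℝ} (hφ : Differentiable ℝ φ) (t : ℝ)
    (z : Phase d) : HasDerivAt (fun s => φ (s, shift s z)) (transportDeriv φ t (shift t z)) t := by
  rw [transportDeriv_eq]
  have h1 : HasDerivAt (fun s : ℝ => (s, shift s z)) ((1 : ℝ), (z.2, (0 : Vec d))) t := by
    refine (hasDerivAt_id t).prodMk ?_
    have h2 : HasDerivAt (fun s : ℝ => z.1 + s • z.2) z.2 t := by
      simpa using ((hasDerivAt_id t).smul_const z.2).const_add z.1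
    exact h2.prodMk (hasDerivAt_const t z.2)
  exact (hφ (t, shift t z)).hasFDerivAt.comp_hasDerivAt t h1

theorem IsTest.differentiable {T : ℝ} {φ : ℝ × Phase d → ℝ} (h : IsTest T φ) :
    Differentiable ℝ φ := h.1.differentiable (by simp)

theorem IsTest.continuous_transportDeriv {T : ℝ} {φ : ℝ × Phase d → ℝ} (h : IsTest T φ) :
    Continuous fun p : ℝ × Phase d => transportDeriv φ p.1 p.2 := by
  have h1 : Continuous (fderiv ℝ φ) := h.1.continuous_fderiv (by simp)
  simp only [transportDeriv_eq]
  have h2 : Continuous fun p : ℝ × Phase d => ((1 : ℝ), (p.2.2, (0 : Vec d))) := by fun_prop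
  exact h1.clm_apply h2

theorem IsTest.exists_bound {T : ℝ} {φ : ℝ × Phase d → ℝ} (h : IsTest T φ) :
    ∃ C, ∀ p, |φ p| ≤ C :=
  h.2.1.exists_bound_of_continuous h.1.continuous

theorem IsTest.exists_bound_transportDeriv {T : ℝ} {φ : ℝ × Phase d → ℝ} (h : IsTest T φ) :
    ∃ C, ∀ p : ℝ × Phase d, |transportDeriv φ p.1 p.2| ≤ C := by
  refine HasCompactSupport.exists_bound_of_continuous ?_ h.continuous_transportDeriv
  refine (h.2.1.fderiv ℝ).mono fun p hp => ?_
  rw [Function.mem_support] at hp ⊢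
  intro h0
  rw [transportDeriv_eq, h0] at hp
  exact hp rfl

theorem IsTest.eq_zero {T : ℝ} {φ : ℝ × Phase d → ℝ} (h : IsTest T φ) (z : Phase d) :
    φ (T, z) = 0 := by
  by_contra hne
  exact lt_irrefl T (h.2.2 (subset_tsupport φ hne)).1

/-- The weak formulation for a curve which is `C¹` along characteristics. -/
theorem weak_identity {T : ℝ} {φ : ℝ × Phase d → ℝ} (hφ : IsTest T φ)
    {F G : ℝ → L1 d} (hF : ∀ t, HasDerivAt F (G t) t) (hG : Continuous G) :
    (- (∫ z, φ (0, z) * F 0 z)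
      - (∫ t in (0 : ℝ)..T, ∫ z, transportDeriv φ t z * alongChar (-t) (F t) z)
      = ∫ t in (0 : ℝ)..T, ∫ z, φ (t, z) * alongChar (-t) (G t) z) ∧
    Continuous (fun t => ∫ z, transportDeriv φ t z * alongChar (-t) (F t) z) ∧
    Continuous (fun t => ∫ z, φ (t, z) * alongChar (-t) (G t) z) := by
  have hFc : Continuous F := continuous_iff_continuousAt.2 fun t => (hF t).continuousAt
  obtain ⟨C, hC⟩ := hφ.exists_bound
  obtain ⟨C', hC'⟩ := hφ.exists_bound_transportDeriv
  have hsh : Continuous fun p : ℝ × Phase d => (p.1, shift p.1 p.2) :=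
    continuous_fst.prodMk continuous_shift_uncurry
  -- Pulled back along characteristics, the transport derivative of `φ` is an ordinary time
  -- derivative. The weak identity is then the fundamental theorem of calculus for `∫ ψ_t F_t`,
  -- whose value at `T` is zero.
  let ψ : ℝ × Phase d → ℝ := fun p => φ (p.1, shift p.1 p.2)
  let ψ' : ℝ × Phase d → ℝ := fun p => transportDeriv φ p.1 (shift p.1 p.2)
  have hψ : Continuous ψ := hφ.1.continuous.comp hsh
  have hψ' : Continuous ψ' := hφ.continuous_transportDeriv.comp hsh
  have hd := fun t => hasDerivAt_integral_pairing hψ hψ'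
    (fun t z => hasDerivAt_along_shift hφ.differentiable t z)
    (fun p => hC _) (fun p => hC' (p.1, shift p.1 p.2)) (hF t)
  have c1 := continuous_integral_pairing hψ' (fun p => hC' (p.1, shift p.1 p.2)) hFc
  have c2 := continuous_integral_pairing hψ (fun p => hC _) hG
  have hftc := intervalIntegral.integral_eq_sub_of_hasDerivAt (a := 0) (b := T) (fun t _ => hd t)
    ((c1.add c2).intervalIntegrable _ _)
  rw [intervalIntegral.integral_add (c1.intervalIntegrable _ _) (c2.intervalIntegrable _ _)]
    at hftc
  have e1 : ∀ t, ∫ z, transportDeriv φ t z * alongChar (-t) (F t) z = ∫ z, ψ' (t, z) * F t z :=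
    fun t => by rw [integral_mul_alongChar, neg_neg]
  have e2 : ∀ t, ∫ z, φ (t, z) * alongChar (-t) (G t) z = ∫ z, ψ (t, z) * G t z :=
    fun t => by rw [integral_mul_alongChar (-t) (fun z => φ (t, z)), neg_neg]
  simp only [e1, e2]
  refine ⟨?_, c1, c2⟩
  have h0 : ∫ z, ψ (T, z) * F T z = 0 := by simp [ψ, hφ.eq_zero]
  have h1 : ∫ z, ψ (0, z) * F 0 z = ∫ z, φ (0, z) * F 0 z := by simp [ψ, shift_zero]
  rw [h0, h1] at hftc
  linarith

/-- Mild solutions are weak solutions. -/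
theorem IsMild.isWeakSolution {B : Vec d → Sph d → ℝ} {k : Vec d → ℝ}
    (hW : IsCollWeight (weight B k)) {T : ℝ} (hT : 0 ≤ T) {f₀ : L1 d} {f : ℝ → L1 d}
    (h : IsMild (weight B k) id T f₀ f) : IsWeakSolution B k T f₀ f := by
  obtain ⟨F, G, h1, h2, h3, h4⟩ := h.exists_extension hT
  refine ⟨h.continuousOn, fun φ hφ => ?_⟩
  obtain ⟨C, hC⟩ := hφ.exists_bound
  have hφm : ∀ t, Measurable fun z => φ (t, z) := fun t =>
    (hφ.1.continuous.comp (by fun_prop : Continuous fun z : Phase d => (t, z))).measurable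
  have hi := fun t ht => integral_collIntegrand hW (h.integrable_rate t ht) (ψ := fun z => φ (t, z))
    ((h.integrable_rate t ht).bdd_mul (c := C) ((hφm t).comp measurable_fst).aestronglyMeasurable
      (Eventually.of_forall fun c => hC _))
    ((h.integrable_rate t ht).bdd_mul (c := C)
      ((hφm t).comp continuous_post.measurable).aestronglyMeasurable
      (Eventually.of_forall fun c => hC _))
  obtain ⟨w1, w2, w3⟩ := weak_identity hφ h1 h2
  -- The factor `-4` inverts the `-1/4` of the symmetrised weak form.
  have e1 : ∀ t ∈ Icc 0 T, ∫ c, collIntegrand B k (fun z => φ (t, z)) (f t) c ∂collMeasure d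
      = -4 * ∫ z, φ (t, z) * alongChar (-t) (G t) z := by
    intro t ht
    have := (hi t ht).2
    rw [(h4 t ht).2, alongChar_neg_self, this]
    simp only [id, collIntegrand]; ring
  have e2 : ∀ t ∈ Icc 0 T, ∫ z, transportDeriv φ t z * alongChar (-t) (F t) z
      = ∫ z, transportDeriv φ t z * f t z := by
    intro t ht
    rw [(h4 t ht).1, alongChar_neg_self]
  refine ⟨(ae_restrict_iff' measurableSet_Icc).2 (Eventually.of_forall fun t ht => (hi t ht).1),
    ?_, ?_⟩
  · refine ((w3.const_mul (-4)).intervalIntegrable 0 T).congr ?_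
    intro t ht
    rw [uIoc_of_le hT] at ht
    exact (e1 t ⟨ht.1.le, ht.2⟩).symm
  · have i1 : ∫ t in (0 : ℝ)..T, ∫ c, collIntegrand B k (fun z => φ (t, z)) (f t) c ∂collMeasure d
        = ∫ t in (0 : ℝ)..T, -4 * ∫ z, φ (t, z) * alongChar (-t) (G t) z :=
      intervalIntegral.integral_congr fun t ht => e1 t (by rwa [uIcc_of_le hT] at ht)
    have i2 : ∫ t in (0 : ℝ)..T, ∫ z, transportDeriv φ t z * f t z
        = ∫ t in (0 : ℝ)..T, ∫ z, transportDeriv φ t z * alongChar (-t) (F t) z :=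
      intervalIntegral.integral_congr fun t ht => (e2 t (by rwa [uIcc_of_le hT] at ht)).symm
    rw [i1, i2, intervalIntegral.integral_const_mul, ← w1, h3]
    ring

end FuzzyBoltzmann

/-! ### From weak solutions to mild solutions. -/

namespace FuzzyBoltzmann

open Filter Topology

variable {d : ℕ}

/-- Every test function in `(0, T)` is, on `(0, T)`, the derivative of a smooth function with
compact support in `(-∞, T)`. -/
theorem exists_antideriv_test {T : ℝ} (hT : 0 < T) {θ : ℝ → ℝ} (hθ : ContDiff ℝ (⊤ : ℕ∞) θ)
    (hc : HasCompactSupport θ) (hs : tsupport θ ⊆ Ioo 0 T) :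
    ∃ η : ℝ → ℝ, ContDiff ℝ (⊤ : ℕ∞) η ∧ (∃ b < T, ∀ t, t ∉ Icc (-1) b → η t = 0) ∧
      ∀ t ∈ Ioo 0 T, HasDerivAt η (θ t) t := by
  -- Inserting `T / 2` makes the compact set nonempty, so that a greatest element exists even if `θ
  -- = 0`.
  obtain ⟨b, hb⟩ := (hc.insert (T / 2)).exists_isGreatest (insert_nonempty _ _)
  have hbT : b < T := by
    rcases hb.1 with h | h
    · rw [h]; linarith
    · exact (hs h).2
  have hθb : ∀ s, b < s → θ s = 0 := fun s hs' => by
    by_contra hne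
    exact absurd (hb.2 (mem_insert_of_mem _ (subset_tsupport θ hne))) (not_le.2 hs')
  let I : ℝ → ℝ := fun t => ∫ s in T..t, θ s
  have hI : ∀ t, HasDerivAt I (θ t) t := fun t =>
    intervalIntegral.integral_hasDerivAt_right (hθ.continuous.intervalIntegrable _ _)
      (hθ.continuous.stronglyMeasurableAtFilter _ _) hθ.continuous.continuousAt
  have hIs : ContDiff ℝ (⊤ : ℕ∞) I := by
    rw [contDiff_infty_iff_deriv]
    refine ⟨fun t => (hI t).differentiableAt, ?_⟩
    rwa [funext fun t => (hI t).deriv]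
  -- The primitive taken from `T` vanishes to the right of the support of `θ`. The transition factor
  -- is `1` for `t ≥ 0` and removes the primitive before time `-1`.
  refine ⟨fun t => Real.smoothTransition (t + 1) * I t,
    (Real.smoothTransition.contDiff.comp (by fun_prop)).mul hIs, ⟨b, hbT, fun t ht => ?_⟩,
    fun t ht => ?_⟩
  · rw [mem_Icc, not_and_or, not_le, not_le] at ht
    rcases ht with ht | ht
    · show Real.smoothTransition (t + 1) * I t = 0
      rw [Real.smoothTransition.zero_of_nonpos (by linarith), zero_mul]
    · have : I t = 0 := by
        refine intervalIntegral.integral_zero_ae (Eventually.of_forall fun s hs => hθb s ?_)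
        rcases le_total T t with h | h
        · rw [uIoc_of_le h] at hs; exact hbT.trans hs.1
        · rw [uIoc_of_ge h] at hs; exact ht.trans hs.1
      show Real.smoothTransition (t + 1) * I t = 0
      rw [this, mul_zero]
  · refine (hI t).congr_of_eventuallyEq ?_
    filter_upwards [lt_mem_nhds ht.1] with s hs
    rw [Real.smoothTransition.one_of_one_le (by linarith), one_mul]

/-- Test functions of product form along characteristics. -/
theorem isTest_product {T b : ℝ} (hb : b < T) {η : ℝ → ℝ} (hη : ContDiff ℝ (⊤ : ℕ∞) η)
    (hη0 : ∀ t, t ∉ Icc (-1) b → η t = 0) {ψ : Phase d → ℝ} (hψ : ContDiff ℝ (⊤ : ℕ∞) ψ)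
    (hψc : HasCompactSupport ψ) :
    IsTest T (fun p : ℝ × Phase d => η p.1 * ψ (shift (-p.1) p.2)) := by
  have hsm : ContDiff ℝ (⊤ : ℕ∞) fun p : ℝ × Phase d => η p.1 * ψ (shift (-p.1) p.2) := by
    have h1 : ContDiff ℝ (⊤ : ℕ∞) fun p : ℝ × Phase d => shift (-p.1) p.2 := by
      unfold shift; fun_prop
    exact (hη.comp contDiff_fst).mul (hψ.comp h1)
  let K : Set (ℝ × Phase d) := (fun p : ℝ × Phase d => (p.1, shift p.1 p.2)) ''
    (Icc (-1) b ×ˢ tsupport ψ)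
  have hK : IsCompact K := (isCompact_Icc.prod hψc).image
    (continuous_fst.prodMk continuous_shift_uncurry)
  have hz : ∀ p ∉ K, η p.1 * ψ (shift (-p.1) p.2) = 0 := by
    intro p hp
    by_contra hne
    refine hp ⟨(p.1, shift (-p.1) p.2), ⟨?_, ?_⟩, ?_⟩
    · by_contra h; exact hne (by rw [hη0 _ h, zero_mul])
    · exact subset_tsupport ψ (right_ne_zero_of_mul hne)
    · simp only [shift_shift_neg]
  refine ⟨hsm, HasCompactSupport.intro hK hz, ?_⟩
  have hsub : tsupport (fun p : ℝ × Phase d => η p.1 * ψ (shift (-p.1) p.2)) ⊆ K :=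
    closure_minimal (fun p hp => by by_contra h; exact hp (hz p h)) hK.isClosed
  refine hsub.trans ?_
  rintro _ ⟨p, hp, rfl⟩
  exact ⟨lt_of_le_of_lt hp.1.2 hb, mem_univ _⟩

/-- The factor `ψ (shift (-t) z)` is constant along characteristics, so only `η` is differentiated.
-/
theorem transportDeriv_product {η : ℝ → ℝ} {ψ : Phase d → ℝ}
    (h : Differentiable ℝ fun p : ℝ × Phase d => η p.1 * ψ (shift (-p.1) p.2)) {t η' : ℝ}
    (hη : HasDerivAt η η' t) (z : Phase d) :
    transportDeriv (fun p : ℝ × Phase d => η p.1 * ψ (shift (-p.1) p.2)) t z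
      = η' * ψ (shift (-t) z) := by
  have h1 := hasDerivAt_along_shift h t (shift (-t) z)
  simp only [shift_shift_neg, shift_neg_shift] at h1
  exact h1.unique (hη.mul_const _)

/-- Weak solutions whose collision operator is continuous in time are mild solutions. -/
theorem isMild_of_isWeakSolution {B : Vec d → Sph d → ℝ} {k : Vec d → ℝ}
    (hW : IsCollWeight (weight B k)) {T : ℝ} (hT : 0 < T) {f₀ : L1 d} {g : ℝ → L1 d}
    (h : IsWeakSolution B k T f₀ g)
    (hi : ∀ t ∈ Icc 0 T, Integrable (rate (weight B k) (g t)) (collMeasure d))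
    (hc : ContinuousOn (fun t => collQ (weight B k) (g t)) (Icc 0 T)) :
    IsMild (weight B k) id T f₀ g := by
  refine ⟨h.1, hi, hc, ?_⟩
  obtain ⟨F, G, h1, h2, h3, h4⟩ := FuzzyBoltzmann.exists_extension hT.le (f₀ := f₀)
    (continuousOn_alongChar continuousOn_id hc)
  have hFc : Continuous F := continuous_iff_continuousAt.2 fun t => (h1 t).continuousAt
  let D : ℝ → L1 d := fun t => alongChar t (g t) - F t
  have hDc : ContinuousOn D (Icc 0 T) :=
    (continuousOn_alongChar continuousOn_id h.1).sub hFc.continuousOn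
  -- The solution and the curve `F` built from its own collision term satisfy weak formulations with
  -- the same data and the same collision integral, which cancel in the difference `D`.
  have key : ∀ φ, IsTest T φ →
      ∫ t in (0 : ℝ)..T, ∫ z, transportDeriv φ t z * alongChar (-t) (D t) z = 0 := by
    intro φ hφ
    obtain ⟨C, hC⟩ := hφ.exists_bound
    obtain ⟨C', hC'⟩ := hφ.exists_bound_transportDeriv
    have hφm : ∀ t, Measurable fun z => φ (t, z) := fun t =>
      (hφ.1.continuous.comp (by fun_prop : Continuous fun z : Phase d => (t, z))).measurable
    have hφm' : ∀ t, Measurable fun z => transportDeriv φ t z := fun t =>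
      (hφ.continuous_transportDeriv.comp
        (by fun_prop : Continuous fun z : Phase d => (t, z))).measurable
    have hi' := fun t ht => integral_collIntegrand hW (hi t ht) (ψ := fun z => φ (t, z))
      ((hi t ht).bdd_mul (c := C) ((hφm t).comp measurable_fst).aestronglyMeasurable
        (Eventually.of_forall fun c => hC _))
      ((hi t ht).bdd_mul (c := C)
        ((hφm t).comp continuous_post.measurable).aestronglyMeasurable
        (Eventually.of_forall fun c => hC _))
    obtain ⟨w1, w2, w3⟩ := weak_identity hφ h1 h2
    obtain ⟨-, -, w4⟩ := h.2 φ hφ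
    have e1 : ∀ t ∈ Icc 0 T, ∫ c, collIntegrand B k (fun z => φ (t, z)) (g t) c ∂collMeasure d
        = -4 * ∫ z, φ (t, z) * alongChar (-t) (G t) z := by
      intro t ht
      rw [(h4 t ht).2, id, alongChar_neg_self, (hi' t ht).2]
      simp only [collIntegrand]; ring
    have i1 : ∫ t in (0 : ℝ)..T, ∫ c, collIntegrand B k (fun z => φ (t, z)) (g t) c ∂collMeasure d
        = ∫ t in (0 : ℝ)..T, -4 * ∫ z, φ (t, z) * alongChar (-t) (G t) z :=
      intervalIntegral.integral_congr fun t ht => e1 t (by rwa [uIcc_of_le hT.le] at ht)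
    have e2 : ∀ t ∈ Icc 0 T, ∫ z, transportDeriv φ t z * alongChar (-t) (D t) z
        = (∫ z, transportDeriv φ t z * g t z)
          - ∫ z, transportDeriv φ t z * alongChar (-t) (F t) z := by
      intro t ht
      simp only [D]
      rw [alongChar_sub, alongChar_neg_self, ← integral_sub
        (integrable_mul_L1 (hφm' t).aestronglyMeasurable (fun z => hC' (t, z)) _)
        (integrable_mul_L1 (hφm' t).aestronglyMeasurable (fun z => hC' (t, z)) _)]
      refine integral_congr_ae ?_
      filter_upwards [Lp.coeFn_sub (g t) (alongChar (-t) (F t))] with z hz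
      rw [hz, Pi.sub_apply]; ring
    have cD : ContinuousOn (fun t => ∫ z, transportDeriv φ t z * alongChar (-t) (D t) z)
        (Icc 0 T) := by
      obtain ⟨Dt, hDt, hDe⟩ : ∃ Dt : ℝ → L1 d, Continuous Dt ∧ ∀ t ∈ Icc 0 T,
          Dt t = alongChar (-t) (D t) :=
        ⟨_, (continuousOn_iff_continuous_domRestrict.1 (continuousOn_alongChar
          (continuousOn_id.neg) hDc)).Icc_extend' (h := hT.le), fun t ht => by
          rw [IccExtend_of_mem hT.le _ ht]; rfl⟩
      refine (continuous_integral_pairing hφ.continuous_transportDeriv hC' hDt).continuousOn.congr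
        fun t ht => ?_
      simp only [hDe t ht]
    have i2 : ∫ t in (0 : ℝ)..T, ∫ z, transportDeriv φ t z * g t z
        = (∫ t in (0 : ℝ)..T, ∫ z, transportDeriv φ t z * alongChar (-t) (D t) z)
          + ∫ t in (0 : ℝ)..T, ∫ z, transportDeriv φ t z * alongChar (-t) (F t) z := by
      have hu : uIcc 0 T = Icc 0 T := uIcc_of_le hT.le
      rw [← intervalIntegral.integral_add
        (ContinuousOn.intervalIntegrable (hu ▸ cD)) (w2.intervalIntegrable _ _)]
      refine intervalIntegral.integral_congr fun t ht => ?_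
      have := e2 t (hu ▸ ht)
      linarith
    rw [i1, i2, intervalIntegral.integral_const_mul, ← w1, h3] at w4
    linarith
  have hD0 : ∀ t ∈ Icc 0 T, D t = 0 := by
    -- For the test function `η(t) ψ(shift (-t) z)` with `η' = θ`, `key` reads `∫ θ(t) (∫ ψ D_t) dt
    -- = 0`. The fundamental lemma gives `∫ ψ D_t = 0` for almost every `t`, and continuity gives it
    -- for all `t`. A second use of that lemma, in phase space, gives `D_t = 0`.
    have hψ0 : ∀ ψ : Phase d → ℝ, ContDiff ℝ (⊤ : ℕ∞) ψ → HasCompactSupport ψ →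
        ∀ t ∈ Icc 0 T, ∫ z, ψ z * D t z = 0 := by
      intro ψ hψ hψc
      obtain ⟨C, hC⟩ := hψc.exists_bound_of_continuous hψ.continuous
      obtain ⟨ℓ, hℓ⟩ := exists_pairing (d := d) hψ.continuous.aestronglyMeasurable hC
      have hce : ContinuousOn (fun t => ∫ z, ψ z * D t z) (Icc 0 T) := by
        simp only [← hℓ]; exact ℓ.continuous.comp_continuousOn hDc
      have hae : ∀ᵐ t : ℝ, t ∈ Ioo 0 T → ∫ z, ψ z * D t z = 0 := by
        refine isOpen_Ioo.ae_eq_zero_of_integral_contDiff_smul_eq_zero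
          ((hce.mono Ioo_subset_Icc_self).locallyIntegrableOn measurableSet_Ioo)
          fun θ hθ hθc hθs => ?_
        obtain ⟨η, hη, ⟨b, hb, hη0⟩, hηd⟩ := exists_antideriv_test hT hθ hθc hθs
        have htest := isTest_product (d := d) hb hη hη0 hψ hψc
        have hk := key _ htest
        rw [← hk, intervalIntegral.integral_of_le hT.le, integral_Ioc_eq_integral_Ioo,
          ← setIntegral_eq_integral_of_forall_compl_eq_zero (s := Ioo 0 T)]
        · refine setIntegral_congr_fun measurableSet_Ioo fun t ht => ?_
          rw [integral_mul_alongChar (-t)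
            (fun z => transportDeriv (fun p : ℝ × Phase d => η p.1 * ψ (shift (-p.1) p.2)) t z),
            neg_neg, smul_eq_mul, ← integral_const_mul]
          refine integral_congr_ae (Eventually.of_forall fun z => ?_)
          simp only
          rw [transportDeriv_product htest.differentiable (hηd t ht), shift_neg_shift, mul_assoc]
        · intro t ht
          have : θ t = 0 := by
            by_contra hne
            exact ht (hθs (subset_tsupport θ hne))
          rw [this, zero_smul]
      refine Measure.eqOn_Icc_of_ae_eq volume hT.ne ?_ hce continuousOn_const
      rw [← restrict_Ioo_eq_restrict_Icc]
      exact (ae_restrict_iff' measurableSet_Ioo).2 hae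
    intro t ht
    have := ae_eq_zero_of_integral_contDiff_smul_eq_zero (integrable_L1 (D t)).locallyIntegrable
      (fun ψ hψ hψc => by simpa using hψ0 ψ hψ hψc t ht)
    refine Lp.ext ?_
    filter_upwards [this, Lp.coeFn_zero ℝ 1 (volume : Measure (Phase d))] with z h1 h2
    rw [h1, h2]; rfl
  intro t ht
  have := sub_eq_zero.1 (hD0 t ht)
  rw [this, (h4 t ht).1]
  rfl

end FuzzyBoltzmann

/-! ### Weights of bounded support: conservation laws and moments in velocity. -/

namespace FuzzyBoltzmann

open Filter Topology

variable {d : ℕ}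

/-- The square `1 + |v|²` of the bracket of the velocity. -/
noncomputable def kin (z : Phase d) : ℝ := 1 + ‖z.2‖ ^ 2

/-- The square `1 + |x|²` of the bracket of the position. -/
noncomputable def pos (z : Phase d) : ℝ := 1 + ‖z.1‖ ^ 2

theorem one_le_kin (z : Phase d) : 1 ≤ kin z := by unfold kin; nlinarith [sq_nonneg ‖z.2‖]

theorem one_le_pos (z : Phase d) : 1 ≤ pos z := by unfold pos; nlinarith [sq_nonneg ‖z.1‖]

theorem kin_pos (z : Phase d) : 0 < kin z := one_pos.trans_le (one_le_kin z)

theorem continuous_kin : Continuous (kin : Phase d → ℝ) := by unfold kin; fun_prop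

theorem continuous_pos : Continuous (pos : Phase d → ℝ) := by unfold pos; fun_prop

theorem kin_shift (t : ℝ) (z : Phase d) : kin (shift t z) = kin z := rfl

theorem kin_post (c : Coll d) : kin (post c) + kin (postS c) = kin c.1 + kin c.2.1 := by
  have := norm_sq_post c.1.2 c.2.1.2 c.2.2
  simp only [kin, post, postS]; linarith

theorem collGrad_kin (c : Coll d) : collGrad kin c = 0 := by
  have := kin_post c
  simp only [collGrad]; linarith

/-- Bounded collision weights that only see collisions in the ball of radius `n`. -/
structure IsCutoff (n : ℝ) (W : Coll d → ℝ) : Prop extends IsCollWeight W where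
  bounded : ∃ Λ, 0 ≤ Λ ∧ ∀ c, W c ≤ Λ
  supp : ∀ c, W c ≠ 0 → (‖c.1.1‖ ≤ n ∧ ‖c.1.2‖ ≤ n) ∧ (‖c.2.1.1‖ ≤ n ∧ ‖c.2.1.2‖ ≤ n)

theorem IsCutoff.supp_post {n : ℝ} {W : Coll d → ℝ} (h : IsCutoff n W) {c : Coll d} (hc : W c ≠ 0) :
    (‖(post c).1‖ ≤ n ∧ ‖(post c).2‖ ≤ n) ∧ (‖(postS c).1‖ ≤ n ∧ ‖(postS c).2‖ ≤ n) :=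
  h.supp (collMap c) (by rwa [h.collMap])

/-- The weight is invariant under collisions, so the gain vanishes at a state together with the
loss: collisions change nothing outside the ball. -/
theorem IsCutoff.collQ_eq_zero {n : ℝ} {W : Coll d → ℝ} (h : IsCutoff n W) (f : Phase d → ℝ) :
    ∀ᵐ z : Phase d, ¬ (‖z.1‖ ≤ n ∧ ‖z.2‖ ≤ n) → collQ W f z = 0 := by
  by_cases hi : Integrable (rate W f) (collMeasure d)
  · filter_upwards [coeFn_collOp hi] with z hz hn
    rw [collQ, hz, collFun]
    have : ∀ p, W (z, p) = 0 := fun p => by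
      by_contra hne; exact hn (h.supp _ hne).1
    have e : ∀ p, rate W f (collMap (z, p)) - rate W f (z, p) = 0 := fun p => by
      rw [rate_collMap h.toIsCollWeight, rate, this]; simp
    simp [e]
  · filter_upwards [Lp.coeFn_zero ℝ 1 (volume : Measure (Phase d))] with z hz _
    rw [collQ, collOp, dif_neg hi, hz]; rfl

/-- The weak form of the collision operator for bounded test functions. -/
theorem integral_mul_collQ {W : Coll d → ℝ} (hW : IsCollWeight W) {f : Phase d → ℝ}
    (hf : Integrable (rate W f) (collMeasure d)) {ψ : Phase d → ℝ} (hψ : Measurable ψ) {C : ℝ}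
    (hC : ∀ z, |ψ z| ≤ C) :
    Integrable (fun c => collGrad ψ c * rate W f c) (collMeasure d) ∧
      ∫ z, ψ z * collQ W f z = (1 / 2) * ∫ c, collGrad ψ c * rate W f c ∂collMeasure d :=
  (integral_mul_collOp_symm hf (Eventually.of_forall fun c => rate_swapColl hW f c)
    (hf.bdd_mul (c := C) (hψ.comp measurable_fst).aestronglyMeasurable
      (Eventually.of_forall fun _ => hC _))
    (hf.bdd_mul (c := C) (hψ.comp continuous_post.measurable).aestronglyMeasurable
      (Eventually.of_forall fun _ => hC _))).2

/-- Evolution of the integral against a bounded test function that is constant along free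
transport. -/
theorem IsMild.integral_mul_eq {W : Coll d → ℝ} {τ : ℝ → ℝ} {T : ℝ} {f₀ : L1 d} {f : ℝ → L1 d}
    (h : IsMild W τ T f₀ f) {ψ : Phase d → ℝ} (hψ : Measurable ψ) {C : ℝ}
    (hC : ∀ z, |ψ z| ≤ C) (hs : ∀ t z, ψ (shift t z) = ψ z) :
    ContinuousOn (fun t => ∫ z, ψ z * f t z) (Icc 0 T) ∧
    ContinuousOn (fun s => ∫ z, ψ z * collQ W (fun z => τ (f s z)) z) (Icc 0 T) ∧
    ∀ t ∈ Icc 0 T, ∫ z, ψ z * f t z = (∫ z, ψ z * f₀ z)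
      + ∫ s in (0 : ℝ)..t, ∫ z, ψ z * collQ W (fun z => τ (f s z)) z := by
  obtain ⟨ℓ, hℓ⟩ := exists_pairing (d := d) hψ.aestronglyMeasurable hC
  -- A functional invariant under the shifts does not see the transport, so only the collision term
  -- remains in the mild equation.
  have hA : ∀ t g, ℓ (alongChar t g) = ℓ g := fun t g => by
    rw [hℓ, hℓ, integral_mul_alongChar]
    simp only [hs]
  refine ⟨?_, ?_, fun t ht => ?_⟩
  · simp only [← hℓ]; exact ℓ.continuous.comp_continuousOn h.continuousOn
  · simp only [← hℓ]; exact ℓ.continuous.comp_continuousOn h.continuousOn_collQ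
  · have e := congrArg ℓ (h.eq t ht)
    have hc := continuousOn_alongChar continuousOn_id h.continuousOn_collQ
    rw [map_add, hA, ← ContinuousLinearMap.intervalIntegral_comp_comm] at e
    · simp only [hA] at e
      simpa only [hℓ] using e
    · refine ContinuousOn.intervalIntegrable ?_
      rw [uIcc_of_le ht.1]
      exact hc.mono (Icc_subset_Icc_right ht.2)

section Cutoff

variable {n T : ℝ} {W : Coll d → ℝ} {f₀ : L1 d} {f : ℝ → L1 d}

/-- Truncation of a function to the velocities in the ball of radius `N`. -/
noncomputable def velCut (N : ℝ) (χ : Phase d → ℝ) : Phase d → ℝ :=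
  {z : Phase d | ‖z.2‖ ≤ N}.indicator χ

theorem measurableSet_vel (N : ℝ) : MeasurableSet {z : Phase d | ‖z.2‖ ≤ N} :=
  measurableSet_le (by fun_prop) measurable_const

theorem velCut_of_le {N : ℝ} {z : Phase d} (h : ‖z.2‖ ≤ N) (χ : Phase d → ℝ) :
    velCut N χ z = χ z := indicator_of_mem (s := {z : Phase d | ‖z.2‖ ≤ N}) h χ

theorem measurable_velCut {χ : Phase d → ℝ} (h : Measurable χ) (N : ℝ) :
    Measurable (velCut N χ) := h.indicator (measurableSet_vel N)

theorem velCut_shift {χ : Phase d → ℝ} (h : ∀ t z, χ (shift t z) = χ z) (N t : ℝ) (z : Phase d) :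
    velCut N χ (shift t z) = velCut N χ z := by
  simp only [velCut, indicator, mem_ofPred_eq, h]; rfl

theorem abs_velCut_le (N : ℝ) (χ : Phase d → ℝ) (z : Phase d) : |velCut N χ z| ≤ |χ z| := by
  unfold velCut; by_cases h : z ∈ {z : Phase d | ‖z.2‖ ≤ N}
  · rw [indicator_of_mem h]
  · rw [indicator_of_notMem h, abs_zero]; exact abs_nonneg _

theorem tendsto_velCut (χ : Phase d → ℝ) (z : Phase d) :
    Tendsto (fun N : ℕ => velCut N χ z) atTop (𝓝 (χ z)) := by
  refine tendsto_const_nhds.congr' ?_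
  filter_upwards [eventually_ge_atTop ⌈‖z.2‖⌉₊] with N hN
  rw [velCut_of_le ((Nat.le_ceil _).trans (by exact_mod_cast hN))]

theorem tendsto_integral_velCut {χ : Phase d → ℝ} (hχ : Measurable χ) {g : Phase d → ℝ}
    (h : Integrable (fun z => χ z * g z)) (hg : AEStronglyMeasurable g volume) :
    Tendsto (fun N : ℕ => ∫ z, velCut N χ z * g z) atTop (𝓝 (∫ z, χ z * g z)) := by
  refine tendsto_integral_of_dominated_convergence (fun z => ‖χ z * g z‖)
    (fun N => (measurable_velCut hχ _).aestronglyMeasurable.mul hg) h.norm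
    (fun N => Eventually.of_forall fun z => ?_) (Eventually.of_forall fun z => ?_)
  · rw [norm_mul, norm_mul]
    exact mul_le_mul_of_nonneg_right (abs_velCut_le _ _ _) (norm_nonneg _)
  · exact (tendsto_velCut χ z).mul_const _

theorem abs_velCut_le_of_kin {χ : Phase d → ℝ} {p : ℝ → ℝ} (hp : Monotone p) (hp0 : ∀ y, 0 ≤ p y)
    (h : ∀ z, |χ z| ≤ p (kin z)) (N : ℝ) (z : Phase d) : |velCut N χ z| ≤ p (1 + N ^ 2) := by
  by_cases hz : ‖z.2‖ ≤ N
  · rw [velCut_of_le hz]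
    refine (h z).trans (hp ?_)
    unfold kin
    gcongr
  · rw [velCut, indicator_of_notMem (s := {z : Phase d | ‖z.2‖ ≤ N}) hz, abs_zero]
    exact hp0 _

/-- Conservation laws of the truncated problem. -/
theorem IsMild.integral_velCut_eq (hW : IsCutoff n W) (h : IsMild W id T f₀ f) {χ : Phase d → ℝ}
    (hχ : Measurable χ) (hs : ∀ t z, χ (shift t z) = χ z) (hg : ∀ c, collGrad χ c = 0)
    (hk : ∀ z, |χ z| ≤ kin z) {N : ℝ} (hN : n ≤ N) {t : ℝ} (ht : t ∈ Icc 0 T) :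
    ∫ z, velCut N χ z * f t z = ∫ z, velCut N χ z * f₀ z := by
  have hb := abs_velCut_le_of_kin (p := fun y => max y 0) (fun _ _ h => max_le_max_right _ h)
    (fun _ => le_max_right _ _) (fun z => (hk z).trans (le_max_left _ _)) N
  obtain ⟨-, -, h3⟩ := h.integral_mul_eq (measurable_velCut hχ N) hb (velCut_shift hs N)
  rw [h3 t ht, add_eq_left]
  refine intervalIntegral.integral_zero_ae (Eventually.of_forall fun s hs' => ?_)
  rw [uIoc_of_le ht.1] at hs'
  have := h.integrable_rate s ⟨hs'.1.le, hs'.2.trans ht.2⟩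
  rw [(integral_mul_collQ hW.toIsCollWeight this (measurable_velCut hχ N) hb).2]
  -- Where `W ≠ 0`, all four velocities have norm at most `n ≤ N`. There the cut function agrees
  -- with `χ`, whose gradient vanishes.
  have e : ∀ c, collGrad (velCut N χ) c * rate W (fun z => id (f s z)) c = 0 := fun c => by
    by_cases hc : W c = 0
    · rw [rate, hc]; ring
    · obtain ⟨⟨-, h1⟩, -, h2⟩ := hW.supp c hc
      obtain ⟨⟨-, h1'⟩, -, h2'⟩ := hW.supp_post hc
      have := hg c
      rw [collGrad] at this ⊢
      rw [velCut_of_le (h1.trans hN), velCut_of_le (h2.trans hN), velCut_of_le (h1'.trans hN),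
        velCut_of_le (h2'.trans hN), this, zero_mul]
  rw [integral_congr_ae (Eventually.of_forall e)]
  simp

theorem ae_nonneg {g : L1 d} (hg : 0 ≤ g) : ∀ᵐ z, 0 ≤ g z := by
  filter_upwards [(Lp.coeFn_nonneg g).2 hg] with z hz using hz

/-- A bound for all truncated integrals of a nonnegative function bounds the integral. -/
theorem integrable_of_velCut_le {χ : Phase d → ℝ} (hχ : Measurable χ) (hχ0 : ∀ z, 0 ≤ χ z)
    {p : ℝ → ℝ} (hp : Monotone p) (hp0 : ∀ y, 0 ≤ p y) (h : ∀ z, |χ z| ≤ p (kin z))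
    {g : L1 d} (hg : 0 ≤ g) {b : ℕ → ℝ} {A : ℝ}
    (hb : ∀ᶠ N : ℕ in atTop, ∫ z, velCut N χ z * g z ≤ b N) (hA : Tendsto b atTop (𝓝 A)) :
    Integrable (fun z => χ z * g z) ∧ ∫ z, χ z * g z ≤ A := by
  obtain ⟨N₀, hN₀⟩ := eventually_atTop.1 hb
  refine integrable_of_tendsto_of_integral_le (u := fun N z => velCut (N + N₀ : ℕ) χ z * g z)
    (b := fun N => b (N + N₀)) (fun N => ?_) (fun N => ?_) ?_ (fun N => hN₀ _ (by omega))
    ((tendsto_add_atTop_iff_nat N₀).2 hA)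
  · exact integrable_mul_L1 (measurable_velCut hχ _).aestronglyMeasurable
      (abs_velCut_le_of_kin hp hp0 h _) g
  · filter_upwards [ae_nonneg hg] with z hz
    exact mul_nonneg (indicator_nonneg (fun z _ => hχ0 z) _) hz
  · exact Eventually.of_forall fun z =>
      ((tendsto_add_atTop_iff_nat N₀).2 (tendsto_velCut χ z)).mul_const _

/-- The energy restricted to velocities below `N` is conserved exactly as soon as `N ≥ n`.
Finiteness at time `t` then follows from Fatou's lemma as `N → ∞`. -/
theorem IsMild.integrable_kin (hW : IsCutoff n W) (h : IsMild W id T f₀ f)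
    (h0 : Integrable (fun z => kin z * f₀ z)) {t : ℝ} (ht : t ∈ Icc 0 T) (hf : 0 ≤ f t) :
    Integrable (fun z => kin z * f t z) := by
  refine (integrable_of_velCut_le (p := fun y => max y 0) continuous_kin.measurable
    (fun z => (kin_pos z).le) (fun _ _ h => max_le_max_right _ h) (fun _ => le_max_right _ _)
    (fun z => by rw [abs_of_pos (kin_pos z)]; exact le_max_left _ _) hf ?_
    (tendsto_integral_velCut continuous_kin.measurable h0
      (integrable_L1 _).aestronglyMeasurable)).1
  filter_upwards [eventually_ge_atTop ⌈n⌉₊] with N hN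
  exact (h.integral_velCut_eq hW continuous_kin.measurable kin_shift collGrad_kin
    (fun z => (abs_of_pos (kin_pos z)).le) ((Nat.le_ceil _).trans (by exact_mod_cast hN)) ht).le

theorem integrable_of_abs_le_kin {χ : Phase d → ℝ} (hχ : Measurable χ) (hk : ∀ z, |χ z| ≤ kin z)
    {g : Phase d → ℝ} (hg : AEStronglyMeasurable g volume) (h : Integrable (fun z => kin z * g z)) :
    Integrable (fun z => χ z * g z) := by
  refine h.mono (hχ.aestronglyMeasurable.mul hg) (Eventually.of_forall fun z => ?_)
  rw [norm_mul, norm_mul, Real.norm_of_nonneg (kin_pos z).le]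
  exact mul_le_mul_of_nonneg_right (hk z) (norm_nonneg _)

theorem IsMild.integral_collInvariant (hW : IsCutoff n W) (h : IsMild W id T f₀ f)
    (h0 : Integrable (fun z => kin z * f₀ z)) {χ : Phase d → ℝ}
    (hχ : Measurable χ) (hs : ∀ t z, χ (shift t z) = χ z) (hg : ∀ c, collGrad χ c = 0)
    (hk : ∀ z, |χ z| ≤ kin z) {t : ℝ} (ht : t ∈ Icc 0 T) (hf : 0 ≤ f t) :
    ∫ z, χ z * f t z = ∫ z, χ z * f₀ z := by
  have hm := fun g : L1 d => (integrable_L1 g).aestronglyMeasurable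
  refine tendsto_nhds_unique (tendsto_integral_velCut hχ (integrable_of_abs_le_kin hχ hk (hm _)
    (h.integrable_kin hW h0 ht hf)) (hm _)) ((tendsto_integral_velCut hχ
    (integrable_of_abs_le_kin hχ hk (hm _) h0) (hm _)).congr' ?_)
  filter_upwards [eventually_ge_atTop ⌈n⌉₊] with N hN
  exact (h.integral_velCut_eq hW hχ hs hg hk
    ((Nat.le_ceil _).trans (by exact_mod_cast hN)) ht).symm

/-- With `s = b / a ≤ 1` one has `(1 + s)^q ≤ (1 + s)² ≤ 1 + 3 s`. The leading term `a ^ q` will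
cancel against the loss, which leaves a mixed product. -/
theorem add_rpow_le {a b q : ℝ} (ha : 0 < a) (hb : 0 ≤ b) (hab : b ≤ a) (hq : q ≤ 2) :
    (a + b) ^ q ≤ a ^ q + 3 * (a ^ (q - 1) * b) := by
  have h1 : a + b = a * (1 + b / a) := by field_simp
  have h2 : b / a ≤ 1 := (div_le_one ha).2 hab
  have h3 : 0 ≤ b / a := div_nonneg hb ha.le
  have h4 : (1 + b / a) ^ q ≤ 1 + 3 * (b / a) := by
    calc (1 + b / a) ^ q ≤ (1 + b / a) ^ (2 : ℝ) :=
          Real.rpow_le_rpow_of_exponent_le (by linarith) hq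
      _ = (1 + b / a) ^ 2 := by norm_cast
      _ ≤ _ := by nlinarith
  rw [h1, Real.mul_rpow ha.le (by linarith), Real.rpow_sub_one ha.ne']
  calc a ^ q * (1 + b / a) ^ q ≤ a ^ q * (1 + 3 * (b / a)) := by gcongr
    _ = _ := by field_simp

/-- Moment production in a collision. -/
theorem collGrad_kin_rpow_mul_le {q ν : ℝ} (hq : 1 ≤ q) (hq2 : q ≤ 2) (hν1 : ν ≤ 1)
    (c : Coll d) :
    collGrad (fun z => kin z ^ q) c * (kin c.1 + kin c.2.1) ^ ν
      ≤ 6 * (kin c.1 ^ q * kin c.2.1 + kin c.1 * kin c.2.1 ^ q) := by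
  -- The excess is at most `3 a^(q-1) b`, and `(a + b)^ν ≤ 2 a` because `ν ≤ 1` and `a + b ≥ 1`. So
  -- the growth of the weight is absorbed, and the result has one factor of order `q` and one of the
  -- order of the energy.
  have key : ∀ a b : ℝ, 1 ≤ b → b ≤ a →
      ((a + b) ^ q - a ^ q - b ^ q) * (a + b) ^ ν ≤ 6 * (a ^ q * b) := by
    intro a b hb hab
    have ha : 0 < a := by linarith
    have h1 := add_rpow_le ha (by linarith : (0 : ℝ) ≤ b) hab hq2
    have h2 : 0 ≤ b ^ q := by positivity
    have h3 : (a + b) ^ ν ≤ 2 * a := by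
      calc (a + b) ^ ν ≤ (a + b) ^ (1 : ℝ) :=
            Real.rpow_le_rpow_of_exponent_le (by linarith) hν1
        _ ≤ 2 * a := by rw [Real.rpow_one]; linarith
    have h4 : a ^ (q - 1) * a = a ^ q := by
      rw [Real.rpow_sub_one ha.ne']; field_simp
    calc ((a + b) ^ q - a ^ q - b ^ q) * (a + b) ^ ν
        ≤ (3 * (a ^ (q - 1) * b)) * (2 * a) := by
          refine mul_le_mul (by linarith) h3 (by positivity) (by positivity)
      _ = 6 * (a ^ (q - 1) * a * b) := by ring
      _ = _ := by rw [h4]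
  -- Energy is conserved and `y ^ q` is superadditive for `q ≥ 1`, so the post-collisional pair is
  -- bounded whatever the direction `ω`.
  have h1 : kin (post c) ^ q + kin (postS c) ^ q ≤ (kin c.1 + kin c.2.1) ^ q := by
    rw [← kin_post c]
    exact Real.add_rpow_le_rpow_add (kin_pos _).le (kin_pos _).le hq
  have h5 : 0 ≤ (kin c.1 + kin c.2.1) ^ ν :=
    Real.rpow_nonneg (add_pos (kin_pos _) (kin_pos _)).le _
  have h6 : 0 ≤ kin c.1 ^ q := Real.rpow_nonneg (kin_pos _).le _
  have h7 : 0 ≤ kin c.2.1 ^ q := Real.rpow_nonneg (kin_pos _).le _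
  have h2 : collGrad (fun z => kin z ^ q) c * (kin c.1 + kin c.2.1) ^ ν
      ≤ ((kin c.1 + kin c.2.1) ^ q - kin c.1 ^ q - kin c.2.1 ^ q)
        * (kin c.1 + kin c.2.1) ^ ν := by
    refine mul_le_mul_of_nonneg_right ?_ h5
    rw [collGrad]; linarith
  refine h2.trans ?_
  rcases le_total (kin c.2.1) (kin c.1) with h | h
  · have := key _ _ (one_le_kin c.2.1) h
    nlinarith [mul_nonneg (kin_pos c.1).le h7]
  · have := key _ _ (one_le_kin c.1) h
    rw [add_comm (kin c.2.1), sub_right_comm] at this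
    nlinarith [mul_nonneg (kin_pos c.2.1).le h6]

/-- Propagation of moments in velocity for the truncated problem. -/
theorem IsMild.integral_kin_rpow_le (hW : IsCutoff n W) {Λ ν : ℝ} (hΛ : 0 ≤ Λ)
    (hν1 : ν ≤ 1) (hWE : ∀ c, W c ≤ Λ * (kin c.1 + kin c.2.1) ^ ν)
    (h : IsMild W id T f₀ f) (hf0 : 0 ≤ f₀)
    (hf : ∀ t ∈ Icc 0 T, 0 ≤ f t) (h0 : Integrable (fun z => kin z * f₀ z))
    {q : ℝ} (hq : 1 ≤ q) (hq2 : q ≤ 2) (hm : Integrable (fun z => kin z ^ q * f₀ z))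
    {t : ℝ} (ht : t ∈ Icc 0 T) :
    Integrable (fun z => kin z ^ q * f t z) ∧
      ∫ z, kin z ^ q * f t z ≤ (∫ z, kin z ^ q * f₀ z)
        * Real.exp (6 * Λ * sphArea d * (∫ z, kin z * f₀ z) * T) := by
  set M := ∫ z, kin z * f₀ z with hM
  have hM0 : 0 ≤ M := integral_nonneg_of_ae (by
    filter_upwards [ae_nonneg hf0] with z hz using mul_nonneg (kin_pos z).le hz)
  have hΛS : 0 ≤ 6 * Λ * sphArea d := by have := sphArea_nonneg (d := d); positivity
  have hmeas : Measurable fun z : Phase d => kin z ^ q := continuous_kin.measurable.pow_const q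
  have hp : Monotone fun y : ℝ => (max y 0) ^ q := fun _ _ hab =>
    Real.rpow_le_rpow (le_max_right _ _) (max_le_max_right _ hab) (by linarith)
  have hp0 : ∀ y : ℝ, 0 ≤ (max y 0) ^ q := fun y => Real.rpow_nonneg (le_max_right _ _) _
  have hpk : ∀ z : Phase d, |kin z ^ q| ≤ (max (kin z) 0) ^ q := fun z => by
    rw [max_eq_left (kin_pos z).le, abs_of_nonneg (Real.rpow_nonneg (kin_pos z).le _)]
  have hcut0 : ∀ N (z : Phase d), 0 ≤ velCut N (fun z => kin z ^ q) z := fun N z =>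
    indicator_nonneg (fun z _ => Real.rpow_nonneg (kin_pos z).le _) _
  have hle : ∀ N (z : Phase d), velCut N (fun z => kin z ^ q) z ≤ kin z ^ q := fun N z =>
    indicator_le_self' (fun z _ => Real.rpow_nonneg (kin_pos z).le _) _
  have main : ∀ N, n ≤ N → ∫ z, velCut N (fun z => kin z ^ q) z * f t z
      ≤ (∫ z, kin z ^ q * f₀ z) * Real.exp (6 * Λ * sphArea d * M * T) := by
    intro N hN
    have hb := abs_velCut_le_of_kin hp hp0 hpk N
    have hvm := measurable_velCut hmeas N
    obtain ⟨h1, h2, h3⟩ := h.integral_mul_eq hvm hb (velCut_shift (fun _ _ => rfl) N)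
    have hI : ∀ g : L1 d, Integrable fun z => velCut N (fun z => kin z ^ q) z * g z := fun g =>
      integrable_mul_L1 hvm.aestronglyMeasurable hb g
    -- One factor of the moment production is the energy, equal to its initial value `M`. The
    -- production is therefore linear in the moment itself, with a constant independent of `N`, `n`
    -- and the size of the cutoff weight.
    have step : ∀ s ∈ Icc 0 T,
        ∫ z, velCut N (fun z => kin z ^ q) z * collQ W (fun z => id (f s z)) z
        ≤ 6 * Λ * sphArea d * M * ∫ z, velCut N (fun z => kin z ^ q) z * f s z := by
      intro s hs
      obtain ⟨i1, e1⟩ := integral_mul_collQ hW.toIsCollWeight (h.integrable_rate s hs) hvm hb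
      have hk := h.integrable_kin hW h0 hs (hf s hs)
      have hMs : ∫ z, kin z * f s z = M :=
        h.integral_collInvariant hW h0 continuous_kin.measurable kin_shift collGrad_kin
          (fun z => (abs_of_pos (kin_pos z)).le) hs (hf s hs)
      have i2 : Integrable (fun c : Coll d => 6 * Λ *
          (velCut N (fun z => kin z ^ q) c.1 * f s c.1 * (kin c.2.1 * f s c.2.1)
            + kin c.1 * f s c.1 * (velCut N (fun z => kin z ^ q) c.2.1 * f s c.2.1)))
          (collMeasure d) := ((integrable_tensor (hI (f s)) hk).add
        (integrable_tensor hk (hI (f s)))).const_mul (6 * Λ)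
      have hpt : ∀ᵐ c ∂collMeasure d,
          collGrad (velCut N (fun z => kin z ^ q)) c * rate W (fun z => id (f s z)) c
          ≤ 6 * Λ * (velCut N (fun z => kin z ^ q) c.1 * f s c.1 * (kin c.2.1 * f s c.2.1)
            + kin c.1 * f s c.1 * (velCut N (fun z => kin z ^ q) c.2.1 * f s c.2.1)) := by
        filter_upwards [quasi_fst.ae (ae_nonneg (hf s hs)),
          quasi_snd.ae (ae_nonneg (hf s hs))] with c hc1 hc2
        by_cases hc : W c = 0
        · rw [rate, hc, zero_mul, mul_zero]
          have := hcut0 N c.1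
          have := hcut0 N c.2.1
          have := kin_pos c.1
          have := kin_pos c.2.1
          positivity
        · obtain ⟨⟨-, g1⟩, -, g2⟩ := hW.supp c hc
          obtain ⟨⟨-, g1'⟩, -, g2'⟩ := hW.supp_post hc
          have hcg : collGrad (velCut N fun z : Phase d => kin z ^ q) c
              = collGrad (fun z => kin z ^ q) c := by
            simp only [collGrad]
            rw [velCut_of_le (g1.trans hN), velCut_of_le (g2.trans hN), velCut_of_le (g1'.trans hN),
              velCut_of_le (g2'.trans hN)]
          rw [hcg, velCut_of_le (g1.trans hN), velCut_of_le (g2.trans hN)]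
          have k1 := collGrad_kin_rpow_mul_le hq hq2 hν1 c
          have hff : 0 ≤ f s c.1 * f s c.2.1 := mul_nonneg hc1 hc2
          have k0 : 0 ≤ kin c.1 ^ q * kin c.2.1 + kin c.1 * kin c.2.1 ^ q :=
            add_nonneg (mul_nonneg (Real.rpow_nonneg (kin_pos _).le _) (kin_pos _).le)
              (mul_nonneg (kin_pos _).le (Real.rpow_nonneg (kin_pos _).le _))
          have k2 : collGrad (fun z => kin z ^ q) c * W c
              ≤ Λ * (6 * (kin c.1 ^ q * kin c.2.1 + kin c.1 * kin c.2.1 ^ q)) := by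
            -- The upper bound for `W` is useful only where the gradient is nonnegative; elsewhere
            -- `0 ≤ W` suffices.
            rcases le_total 0 (collGrad (fun z : Phase d => kin z ^ q) c) with hs' | hs'
            · calc _ ≤ collGrad (fun z => kin z ^ q) c * (Λ * (kin c.1 + kin c.2.1) ^ ν) := by
                    gcongr; exact hWE c
                _ = Λ * (collGrad (fun z => kin z ^ q) c * (kin c.1 + kin c.2.1) ^ ν) := by ring
                _ ≤ _ := by gcongr
            · exact (mul_nonpos_of_nonpos_of_nonneg hs' (hW.nonneg c)).trans (by positivity)
          simp only [rate, preProd, id]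
          calc _ = collGrad (fun z => kin z ^ q) c * W c * (f s c.1 * f s c.2.1) := by ring
            _ ≤ Λ * (6 * (kin c.1 ^ q * kin c.2.1 + kin c.1 * kin c.2.1 ^ q))
                * (f s c.1 * f s c.2.1) := by gcongr
            _ = _ := by ring
      rw [e1]
      have := integral_mono_ae i1 i2 hpt
      rw [integral_const_mul, integral_add (integrable_tensor (hI (f s)) hk)
        (integrable_tensor hk (hI (f s))),
        integral_tensor (fun z => velCut N (fun z => kin z ^ q) z * f s z)
          (fun z => kin z * f s z), integral_tensor (fun z => kin z * f s z)
          (fun z => velCut N (fun z => kin z ^ q) z * f s z), hMs] at this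
      linarith
    have hg := gronwall_integral (A := ∫ z, kin z ^ q * f₀ z) (C := 6 * Λ * sphArea d * M)
      (by positivity) h1 (fun t ht => ?_) t ht
    · refine hg.trans ?_
      have hA : 0 ≤ ∫ z, kin z ^ q * f₀ z := integral_nonneg_of_ae (by
        filter_upwards [ae_nonneg hf0] with z hz
          using mul_nonneg (Real.rpow_nonneg (kin_pos z).le _) hz)
      have := ht.2
      gcongr
    · rw [h3 t ht]
      refine add_le_add ?_ ?_
      · refine integral_mono_ae (hI _) hm ?_
        filter_upwards [ae_nonneg hf0] with z hz using mul_le_mul_of_nonneg_right (hle N z) hz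
      · rw [← intervalIntegral.integral_const_mul]
        have hsub : Icc 0 t ⊆ Icc 0 T := Icc_subset_Icc_right ht.2
        refine intervalIntegral.integral_mono_on ht.1 ?_ ?_ fun s hs => step s (hsub hs)
        · exact ContinuousOn.intervalIntegrable (by rw [uIcc_of_le ht.1]; exact h2.mono hsub)
        · exact (ContinuousOn.intervalIntegrable
            (by rw [uIcc_of_le ht.1]; exact h1.mono hsub)).const_mul _
  refine integrable_of_velCut_le hmeas (fun z => Real.rpow_nonneg (kin_pos z).le _) hp hp0 hpk
    (hf t ht) ?_ tendsto_const_nhds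
  filter_upwards [eventually_ge_atTop ⌈n⌉₊] with N hN
  exact main N ((Nat.le_ceil _).trans (by exact_mod_cast hN))

end Cutoff

end FuzzyBoltzmann

/-! ### The second moment in the position. -/

namespace FuzzyBoltzmann

open Filter Topology

variable {d : ℕ}

/-- A bounded increasing approximation of the identity. -/
noncomputable def satur (N s : ℝ) : ℝ := N * s / (N + s)

theorem satur_nonneg {N s : ℝ} (hN : 0 ≤ N) (hs : 0 ≤ s) : 0 ≤ satur N s := by
  unfold satur; positivity

theorem satur_le_left {N s : ℝ} (hN : 0 < N) (hs : 0 ≤ s) : satur N s ≤ N := by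
  rw [satur, div_le_iff₀ (by linarith)]; nlinarith

theorem satur_le_right {N s : ℝ} (hN : 0 < N) (hs : 0 ≤ s) : satur N s ≤ s := by
  rw [satur, div_le_iff₀ (by linarith)]; nlinarith

theorem hasDerivAt_satur {N s : ℝ} (hN : 0 < N) (hs : 0 ≤ s) :
    HasDerivAt (satur N) (N ^ 2 / (N + s) ^ 2) s := by
  have h : HasDerivAt (fun s => N * s / (N + s)) ((N * 1 * (N + s) - N * s * 1) / (N + s) ^ 2) s :=
    ((hasDerivAt_id s).const_mul N).div ((hasDerivAt_id s).const_add N) (by simp; linarith)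
  convert! h using 1
  ring

theorem tendsto_satur (s : ℝ) : Tendsto (fun N : ℕ => satur N s) atTop (𝓝 s) := by
  have h : Tendsto (fun N : ℕ => s / (1 + s / N)) atTop (𝓝 (s / (1 + 0))) :=
    tendsto_const_nhds.div (tendsto_const_nhds.add (tendsto_const_div_atTop_nhds_zero_nat s))
      (by norm_num)
  rw [add_zero, div_one] at h
  refine h.congr' ?_
  filter_upwards [eventually_gt_atTop 0] with N hN
  have : (N : ℝ) ≠ 0 := by exact_mod_cast hN.ne'
  rw [satur]
  by_cases hs : (N : ℝ) + s = 0
  · have : 1 + s / N = 0 := by field_simp; linarith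
    rw [this, hs, div_zero, div_zero]
  · have : 1 + s / (N : ℝ) ≠ 0 := by
      intro h; apply hs; field_simp at h; linarith
    field_simp

/-- A continuous cutoff in velocity. -/
noncomputable def velTent (N : ℝ) (v : Vec d) : ℝ := max 0 (min 1 (N + 1 - ‖v‖))

theorem continuous_velTent (N : ℝ) : Continuous (velTent N : Vec d → ℝ) := by
  unfold velTent; fun_prop

theorem velTent_nonneg (N : ℝ) (v : Vec d) : 0 ≤ velTent N v := le_max_left _ _

theorem velTent_le_one (N : ℝ) (v : Vec d) : velTent N v ≤ 1 := max_le zero_le_one (min_le_left _ _)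

theorem velTent_eq_one {N : ℝ} {v : Vec d} (h : ‖v‖ ≤ N) : velTent N v = 1 := by
  rw [velTent, min_eq_left (by linarith), max_eq_right zero_le_one]

theorem velTent_mul_sq_le {N : ℝ} (v : Vec d) : velTent N v * ‖v‖ ^ 2 ≤ (N + 1) ^ 2 := by
  by_cases h : ‖v‖ ≤ N + 1
  · calc velTent N v * ‖v‖ ^ 2 ≤ 1 * (N + 1) ^ 2 := by
          gcongr
          exact velTent_le_one N v
      _ = _ := one_mul _
  · have : velTent N v = 0 := max_eq_left ((min_le_right _ _).trans (by linarith))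
    rw [this, zero_mul]; positivity

/-- A bounded version of the second moment in the position. -/
noncomputable def posCut (N : ℝ) (z : Phase d) : ℝ := velTent N z.2 * satur N (pos z)

theorem pos_pos (z : Phase d) : 0 < pos z := one_pos.trans_le (one_le_pos z)

theorem posCut_nonneg {N : ℝ} (hN : 0 < N) (z : Phase d) : 0 ≤ posCut N z :=
  mul_nonneg (velTent_nonneg _ _) (satur_nonneg hN.le (pos_pos z).le)

theorem posCut_le {N : ℝ} (hN : 0 < N) (z : Phase d) : posCut N z ≤ pos z :=
  (mul_le_of_le_one_left (satur_nonneg hN.le (pos_pos z).le) (velTent_le_one _ _)).trans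
    (satur_le_right hN (pos_pos z).le)

theorem posCut_le_left {N : ℝ} (hN : 0 < N) (z : Phase d) : posCut N z ≤ N :=
  (mul_le_of_le_one_left (satur_nonneg hN.le (pos_pos z).le) (velTent_le_one _ _)).trans
    (satur_le_left hN (pos_pos z).le)

theorem continuous_posCut {N : ℝ} (hN : 0 < N) : Continuous (posCut N : Phase d → ℝ) := by
  unfold posCut satur
  have := continuous_velTent (d := d) N
  have := continuous_pos (d := d)
  exact (by fun_prop : Continuous fun z : Phase d => velTent N z.2).mul
    ((by fun_prop : Continuous fun z : Phase d => N * pos z).div (by fun_prop)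
      fun z => by have := pos_pos z; positivity)

theorem tendsto_posCut (z : Phase d) : Tendsto (fun N : ℕ => posCut N z) atTop (𝓝 (pos z)) := by
  refine (tendsto_satur (pos z)).congr' ?_
  filter_upwards [eventually_ge_atTop ⌈‖z.2‖⌉₊] with N hN
  rw [posCut, velTent_eq_one ((Nat.le_ceil _).trans (by exact_mod_cast hN)), one_mul]

/-- The derivative of `posCut N` along free transport. -/
noncomputable def posCutDeriv (N : ℝ) (z : Phase d) : ℝ :=
  velTent N z.2 * (N ^ 2 / (N + pos z) ^ 2 * (2 * inner ℝ z.1 z.2))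

theorem continuous_posCutDeriv {N : ℝ} (hN : 0 < N) :
    Continuous (posCutDeriv N : Phase d → ℝ) := by
  have := continuous_velTent (d := d) N
  have := continuous_pos (d := d)
  exact (by fun_prop : Continuous fun z : Phase d => velTent N z.2).mul
    ((continuous_const.div (by fun_prop) fun z => by have := pos_pos z; positivity).mul
      (by fun_prop))

theorem hasDerivAt_posCut {N : ℝ} (hN : 0 < N) (t : ℝ) (z : Phase d) :
    HasDerivAt (fun s => posCut N (shift s z)) (posCutDeriv N (shift t z)) t := by
  have h1 : HasDerivAt (fun s : ℝ => z.1 + s • z.2) z.2 t := by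
    simpa using ((hasDerivAt_id t).smul_const z.2).const_add z.1
  have h2 : HasDerivAt (fun s : ℝ => pos (shift s z)) (2 * inner ℝ (shift t z).1 z.2) t := by
    simpa [pos, shift] using h1.norm_sq.const_add 1
  have h3 : HasDerivAt (fun s : ℝ => satur N (pos (shift s z)))
      (N ^ 2 / (N + pos (shift t z)) ^ 2 * (2 * inner ℝ (shift t z).1 z.2)) t :=
    HasDerivAt.comp (h₂ := satur N) t (hasDerivAt_satur hN (pos_pos (shift t z)).le) h2
  exact h3.const_mul (velTent N z.2)

/-- Combines `2 ⟨x, v⟩ ≤ |x|² + |v|²` with the concavity of the saturation, in the form `s φ'(s) ≤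
φ(s)`. The cut moment thus controls its own growth up to the kinetic energy, uniformly in `N`. -/
theorem abs_posCutDeriv_le {N : ℝ} (hN : 0 < N) (z : Phase d) :
    |posCutDeriv N z| ≤ posCut N z + velTent N z.2 * ‖z.2‖ ^ 2 := by
  have hp := pos_pos z
  have h1 : |2 * inner ℝ z.1 z.2| ≤ pos z + ‖z.2‖ ^ 2 := by
    have := abs_real_inner_le_norm z.1 z.2
    rw [abs_mul, abs_two]
    unfold pos
    nlinarith [sq_nonneg (‖z.1‖ - ‖z.2‖)]
  have h2 : N ^ 2 / (N + pos z) ^ 2 ≤ 1 := by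
    rw [div_le_one (by positivity)]; gcongr; linarith
  have h3 : N ^ 2 / (N + pos z) ^ 2 * pos z ≤ satur N (pos z) := by
    have : satur N (pos z) - N ^ 2 / (N + pos z) ^ 2 * pos z
        = N * pos z ^ 2 / (N + pos z) ^ 2 := by
      unfold satur; field_simp; ring
    have h4 : 0 ≤ N * pos z ^ 2 / (N + pos z) ^ 2 := by positivity
    linarith
  rw [posCutDeriv, posCut, ← mul_add, abs_mul, abs_of_nonneg (velTent_nonneg _ _), abs_mul,
    abs_of_nonneg (by positivity : 0 ≤ N ^ 2 / (N + pos z) ^ 2)]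
  refine mul_le_mul_of_nonneg_left ?_ (velTent_nonneg _ _)
  calc N ^ 2 / (N + pos z) ^ 2 * |2 * inner ℝ z.1 z.2|
      ≤ N ^ 2 / (N + pos z) ^ 2 * (pos z + ‖z.2‖ ^ 2) := by gcongr
    _ = N ^ 2 / (N + pos z) ^ 2 * pos z + N ^ 2 / (N + pos z) ^ 2 * ‖z.2‖ ^ 2 := by ring
    _ ≤ satur N (pos z) + 1 * ‖z.2‖ ^ 2 := by gcongr
    _ = _ := by ring

variable {n T : ℝ} {W : Coll d → ℝ} {f₀ : L1 d} {f : ℝ → L1 d}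

/-- Collisions leave positions unchanged, and for `n ≤ N` the velocity cutoff equals `1` at every
state involved, so the collision term does not contribute. Transport contributes at rate one plus
the conserved energy, and Gronwall's inequality applies. -/
theorem IsMild.integral_posCut_le (hW : IsCutoff n W) (hT : 0 ≤ T) (h : IsMild W id T f₀ f)
    (hf : ∀ t ∈ Icc 0 T, 0 ≤ f t) (h0 : Integrable (fun z => kin z * f₀ z))
    {N : ℝ} (hN : 0 < N) (hn : n ≤ N) {t : ℝ} (ht : t ∈ Icc 0 T) :
    ∫ z, posCut N z * f t z
      ≤ ((∫ z, posCut N z * f₀ z) + (∫ z, kin z * f₀ z) * T) * Real.exp (1 * t) := by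
  obtain ⟨F, G, h1, h2, h3, h4⟩ := h.exists_extension hT
  have hFc : Continuous F := continuous_iff_continuousAt.2 fun t => (h1 t).continuousAt
  have hC : ∀ z : Phase d, |posCut N z| ≤ N := fun z => by
    rw [abs_of_nonneg (posCut_nonneg hN z)]; exact posCut_le_left hN z
  have hC' : ∀ z : Phase d, |posCutDeriv N z| ≤ N + (N + 1) ^ 2 := fun z =>
    (abs_posCutDeriv_le hN z).trans (add_le_add (posCut_le_left hN z) (velTent_mul_sq_le _))
  have c1 : Continuous fun p : ℝ × Phase d => posCut N (shift p.1 p.2) :=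
    (continuous_posCut hN).comp continuous_shift_uncurry
  have c2 : Continuous fun p : ℝ × Phase d => posCutDeriv N (shift p.1 p.2) :=
    (continuous_posCutDeriv hN).comp continuous_shift_uncurry
  have hd := fun t => hasDerivAt_integral_pairing c1 c2 (fun t z => hasDerivAt_posCut hN t z)
    (fun p => hC _) (fun p => hC' _) (h1 t)
  have k1 := continuous_integral_pairing c1 (fun p => hC _) hFc
  have k2 : Continuous fun t => (∫ z, posCutDeriv N (shift t z) * F t z)
      + ∫ z, posCut N (shift t z) * G t z := (continuous_integral_pairing c2 (fun p => hC' _) hFc).add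
    (continuous_integral_pairing c1 (fun p => hC _) h2)
  have e1 : ∀ s ∈ Icc 0 T, ∫ z, posCut N (shift s z) * F s z = ∫ z, posCut N z * f s z := by
    intro s hs
    rw [(h4 s hs).1, integral_mul_alongChar s (fun z => posCut N (shift s z))]
    simp only [shift_shift_neg]
  have e2 : ∀ s ∈ Icc 0 T, ∫ z, posCut N (shift s z) * G s z = 0 := by
    intro s hs
    rw [(h4 s hs).2, integral_mul_alongChar s (fun z => posCut N (shift s z))]
    simp only [shift_shift_neg]
    rw [(integral_mul_collQ hW.toIsCollWeight (h.integrable_rate s hs)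
      (continuous_posCut hN).measurable hC).2]
    have e : ∀ c, collGrad (posCut N) c * rate W (fun z => id (f s z)) c = 0 := fun c => by
      by_cases hc : W c = 0
      · rw [rate, hc]; ring
      · obtain ⟨⟨-, g1⟩, -, g2⟩ := hW.supp c hc
        obtain ⟨⟨-, g1'⟩, -, g2'⟩ := hW.supp_post hc
        have : collGrad (posCut N) c = 0 := by
          rw [collGrad, posCut, posCut, posCut, posCut, velTent_eq_one (g1.trans hn),
            velTent_eq_one (g2.trans hn), velTent_eq_one (g1'.trans hn),
            velTent_eq_one (g2'.trans hn)]
          simp only [post, postS, pos]; ring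
        rw [this, zero_mul]
    rw [integral_congr_ae (Eventually.of_forall e)]
    simp
  have e3 : ∀ s ∈ Icc 0 T, ∫ z, posCutDeriv N (shift s z) * F s z
      ≤ (∫ z, posCut N z * f s z) + ∫ z, kin z * f₀ z := by
    intro s hs
    have hk := h.integrable_kin hW h0 hs (hf s hs)
    have hMs : ∫ z, kin z * f s z = ∫ z, kin z * f₀ z :=
      h.integral_collInvariant hW h0 continuous_kin.measurable kin_shift collGrad_kin
        (fun z => (abs_of_pos (kin_pos z)).le) hs (hf s hs)
    have i1 := integrable_mul_L1 (continuous_posCut hN).aestronglyMeasurable hC (f s)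
    rw [(h4 s hs).1, integral_mul_alongChar s (fun z => posCutDeriv N (shift s z)), ← hMs,
      ← integral_add i1 hk]
    simp only [shift_shift_neg]
    refine integral_mono_ae
      (integrable_mul_L1 (continuous_posCutDeriv hN).aestronglyMeasurable hC' (f s))
      (i1.add hk) ?_
    filter_upwards [ae_nonneg (hf s hs)] with z hz
    rw [← add_mul]
    refine mul_le_mul_of_nonneg_right ((le_abs_self _).trans ((abs_posCutDeriv_le hN z).trans ?_)) hz
    have : velTent N z.2 * ‖z.2‖ ^ 2 ≤ ‖z.2‖ ^ 2 :=
      mul_le_of_le_one_left (by positivity) (velTent_le_one _ _)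
    unfold kin
    linarith
  have hM0 : 0 ≤ ∫ z, kin z * f₀ z := by
    rw [← h.zero_eq hT]
    exact integral_nonneg_of_ae (by
      filter_upwards [ae_nonneg (hf 0 ⟨le_rfl, hT⟩)] with z hz using mul_nonneg (kin_pos z).le hz)
  have hcont : ContinuousOn (fun s => ∫ z, posCut N z * f s z) (Icc 0 T) :=
    k1.continuousOn.congr fun s hs => (e1 s hs).symm
  refine gronwall_integral zero_le_one hcont (fun t ht => ?_) t ht
  have hsub : Icc 0 t ⊆ Icc 0 T := Icc_subset_Icc_right ht.2
  have hft := intervalIntegral.integral_eq_sub_of_hasDerivAt (a := 0) (b := t) (fun s _ => hd s)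
    (k2.intervalIntegrable _ _)
  have hmono := intervalIntegral.integral_mono_on ht.1 (k2.intervalIntegrable (μ := volume) 0 t)
    (g := fun s => (∫ z, posCut N z * f s z) + ∫ z, kin z * f₀ z)
    ((ContinuousOn.intervalIntegrable
      (by rw [uIcc_of_le ht.1]; exact hcont.mono hsub)).add intervalIntegrable_const)
    (fun s hs => by
      have := e3 s (hsub hs)
      have := e2 s (hsub hs)
      linarith)
  rw [intervalIntegral.integral_add (ContinuousOn.intervalIntegrable
      (by rw [uIcc_of_le ht.1]; exact hcont.mono hsub)) intervalIntegrable_const,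
    intervalIntegral.integral_const, sub_zero, smul_eq_mul] at hmono
  have e4 := e1 t ht
  have e5 := e1 0 ⟨le_rfl, hT⟩
  rw [h.zero_eq hT] at e5
  rw [e4, e5] at hft
  have : t * ∫ z, kin z * f₀ z ≤ (∫ z, kin z * f₀ z) * T := by
    rw [mul_comm]; gcongr; exact ht.2
  linarith

/-- Growth of the second moment in the position for the truncated problem. -/
theorem IsMild.integral_pos_le (hW : IsCutoff n W) (hT : 0 ≤ T) (h : IsMild W id T f₀ f)
    (hf0 : 0 ≤ f₀) (hf : ∀ t ∈ Icc 0 T, 0 ≤ f t) (h0 : Integrable (fun z => kin z * f₀ z))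
    (hx : Integrable (fun z => pos z * f₀ z)) {t : ℝ} (ht : t ∈ Icc 0 T) :
    Integrable (fun z => pos z * f t z) ∧
      ∫ z, pos z * f t z
        ≤ ((∫ z, pos z * f₀ z) + (∫ z, kin z * f₀ z) * T) * Real.exp T := by
  have hC : ∀ N : ℝ, 0 < N → ∀ z : Phase d, |posCut N z| ≤ N := fun N hN z => by
    rw [abs_of_nonneg (posCut_nonneg hN z)]; exact posCut_le_left hN z
  -- The shifted index is positive and at least `n`, as required by the bound for the cut moment.
  have hNp : ∀ N : ℕ, (0 : ℝ) < ((N + ⌈n⌉₊ + 1 : ℕ) : ℝ) := fun N => by positivity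
  refine integrable_of_tendsto_of_integral_le
    (u := fun N z => posCut (N + ⌈n⌉₊ + 1 : ℕ) z * f t z) (fun N => ?_) (fun N => ?_) ?_
    (fun N => ?_) tendsto_const_nhds
  · exact integrable_mul_L1 (continuous_posCut (hNp N)).aestronglyMeasurable (hC _ (hNp N)) _
  · filter_upwards [ae_nonneg (hf t ht)] with z hz using mul_nonneg (posCut_nonneg (hNp N) z) hz
  · exact Eventually.of_forall fun z =>
      ((tendsto_add_atTop_iff_nat (⌈n⌉₊ + 1)).2 (tendsto_posCut z)).mul_const _
  · refine (h.integral_posCut_le hW hT hf h0 (hNp N) ?_ ht).trans ?_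
    · have := Nat.le_ceil n
      push_cast; linarith
    · have h1 : ∫ z, posCut (N + ⌈n⌉₊ + 1 : ℕ) z * f₀ z ≤ ∫ z, pos z * f₀ z := by
        refine integral_mono_ae (integrable_mul_L1 (continuous_posCut (hNp N)).aestronglyMeasurable
          (hC _ (hNp N)) _) hx ?_
        filter_upwards [ae_nonneg hf0] with z hz
          using mul_le_mul_of_nonneg_right (posCut_le (hNp N) z) hz
      have h2 : 0 ≤ ∫ z, kin z * f₀ z := integral_nonneg_of_ae (by
        filter_upwards [ae_nonneg hf0] with z hz using mul_nonneg (kin_pos z).le hz)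
      have h3 : 0 ≤ ∫ z, pos z * f₀ z := integral_nonneg_of_ae (by
        filter_upwards [ae_nonneg hf0] with z hz using mul_nonneg (pos_pos z).le hz)
      rw [one_mul]
      have := ht.2
      gcongr

end FuzzyBoltzmann

/-! ### Growing weights and their truncation. -/

namespace FuzzyBoltzmann

open Filter Topology

variable {d : ℕ}

/-- Collision weights of growth `(⟨v⟩² + ⟨v_*⟩²)^ν`. -/
structure HasGrowth (Λ ν : ℝ) (W : Coll d → ℝ) : Prop extends IsCollWeight W where
  const_nonneg : 0 ≤ Λ
  exp_nonneg : 0 ≤ ν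
  exp_le : ν ≤ 1
  le : ∀ c, W c ≤ Λ * (kin c.1 + kin c.2.1) ^ ν

section Weight

theorem one_le_jb (y : Vec d) : 1 ≤ jb y := by
  rw [jb, Real.one_le_sqrt]; nlinarith [sq_nonneg ‖y‖]

theorem jb_sq (y : Vec d) : jb y ^ 2 = 1 + ‖y‖ ^ 2 := Real.sq_sqrt (by positivity)

theorem jb_rpow_two_mul (y : Vec d) (p : ℝ) : jb y ^ (2 * p) = (1 + ‖y‖ ^ 2) ^ p := by
  rw [Real.rpow_mul (by linarith [one_le_jb y]), Real.rpow_two, jb_sq]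

theorem jb_neg (y : Vec d) : jb (-y) = jb y := by rw [jb, jb, norm_neg]

theorem continuous_jb : Continuous (jb : Vec d → ℝ) := by unfold jb; fun_prop

/-- The spatial kernel is bounded, and `⟨v - v_*⟩² ≤ 2 (⟨v⟩² + ⟨v_*⟩²)`. Exponents are halved
because `kin` is the square of the bracket. For `μ ≤ 0` the growth exponent is `0`. -/
theorem weight_hasGrowth {μ : ℝ} (hμ : μ ≤ 1) {B : Vec d → Sph d → ℝ} (hB : IsCollisionKernel μ B)
    {k : Vec d → ℝ} (hk : IsSpatialKernel k) :
    ∃ Λ, HasGrowth Λ (max μ 0 / 2) (weight B k) := by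
  obtain ⟨CB, hCB, hb⟩ := hB.bounds
  obtain ⟨Ck, γ, hCk, hγ, hk⟩ := hk
  have hk0 : ∀ y, 0 ≤ k y := fun y => by rw [hk]; positivity
  have hk1 : ∀ y, k y ≤ Ck := fun y => by
    rw [hk]
    refine mul_le_of_le_one_right hCk.le (Real.exp_le_one_iff.2 ?_)
    have := one_le_jb y
    nlinarith
  have hkn : ∀ y, k (-y) = k y := fun y => by rw [hk, hk, jb_neg]
  have hkc : Continuous k := by
    have := continuous_jb (d := d)
    rw [show k = fun y => Ck * Real.exp (-γ * jb y) from funext hk]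
    fun_prop
  have hB0 : ∀ v ω, 0 ≤ B v ω := fun v ω => le_trans (by
    have := one_le_jb v
    positivity) (hb v ω).1
  have hm : 0 ≤ max μ 0 := le_max_right _ _
  refine ⟨CB * Ck * 2, ⟨?_, ?_, ?_, ?_⟩, by positivity, by positivity, ?_, ?_⟩
  · exact (hB.measurable.comp (g := fun p : Vec d × Sph d => B p.1 p.2)
      (f := fun c : Coll d => (c.1.2 - c.2.1.2, c.2.2)) (by fun_prop)).mul
      (hkc.measurable.comp (by fun_prop))
  · exact fun c => mul_nonneg (hB0 _ _) (hk0 _)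
  · intro c
    simp only [weight, collMap, post, postS]
    rw [hB.symm, ← hB.collision_invariant]
  · intro c
    simp only [weight, swapColl]
    rw [hB.symm, ← hkn, neg_sub]
  · have : max μ 0 ≤ 1 := max_le hμ zero_le_one
    linarith
  · intro c
    set y := c.1.2 - c.2.1.2
    have hE : 0 < kin c.1 + kin c.2.1 := add_pos (kin_pos _) (kin_pos _)
    have h1 : jb y ^ μ ≤ 2 * (kin c.1 + kin c.2.1) ^ (max μ 0 / 2) := by
      calc jb y ^ μ ≤ jb y ^ (max μ 0) :=
            Real.rpow_le_rpow_of_exponent_le (one_le_jb y) (le_max_left _ _)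
        _ = (1 + ‖y‖ ^ 2) ^ (max μ 0 / 2) := by rw [← jb_rpow_two_mul]; congr 1; ring
        _ ≤ (2 * (kin c.1 + kin c.2.1)) ^ (max μ 0 / 2) := by
            refine Real.rpow_le_rpow (by positivity) ?_ (by positivity)
            have := norm_sub_le c.1.2 c.2.1.2
            have h2 : ‖y‖ ^ 2 ≤ (‖c.1.2‖ + ‖c.2.1.2‖) ^ 2 := by gcongr
            unfold kin
            nlinarith [sq_nonneg (‖c.1.2‖ - ‖c.2.1.2‖)]
        _ = 2 ^ (max μ 0 / 2) * (kin c.1 + kin c.2.1) ^ (max μ 0 / 2) :=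
            Real.mul_rpow zero_le_two hE.le
        _ ≤ 2 ^ (1 : ℝ) * (kin c.1 + kin c.2.1) ^ (max μ 0 / 2) := by
            refine mul_le_mul_of_nonneg_right (Real.rpow_le_rpow_of_exponent_le one_le_two ?_)
              (Real.rpow_nonneg hE.le _)
            have : max μ 0 ≤ 1 := max_le hμ zero_le_one
            linarith
        _ = _ := by rw [Real.rpow_one]
    calc weight B k c ≤ (CB * jb y ^ μ) * Ck :=
          mul_le_mul (hb _ _).2 (hk1 _) (hk0 _) (by have := one_le_jb y; positivity)
      _ ≤ (CB * (2 * (kin c.1 + kin c.2.1) ^ (max μ 0 / 2))) * Ck := by gcongr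
      _ = _ := by ring

end Weight

section Cut

/-- The collisions seen by the truncated weights. -/
def region (d : ℕ) (n : ℝ) : Set (Coll d) :=
  {c | ‖c.1.1‖ ≤ n ∧ ‖c.2.1.1‖ ≤ n ∧ ‖c.1.2‖ ^ 2 + ‖c.2.1.2‖ ^ 2 ≤ n ^ 2}

theorem measurableSet_region (n : ℝ) : MeasurableSet (region d n) :=
  (measurableSet_le (f := fun c : Coll d => ‖c.1.1‖) (by fun_prop) measurable_const).inter
    ((measurableSet_le (f := fun c : Coll d => ‖c.2.1.1‖) (by fun_prop) measurable_const).inter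
      (measurableSet_le (f := fun c : Coll d => ‖c.1.2‖ ^ 2 + ‖c.2.1.2‖ ^ 2) (by fun_prop)
        measurable_const))

/-- The truncation of a collision weight to a bounded region. -/
noncomputable def cutWeight (n : ℝ) (W : Coll d → ℝ) : Coll d → ℝ := (region d n).indicator W

variable {Λ ν : ℝ} {W : Coll d → ℝ}

theorem cutWeight_of_mem {n : ℝ} {c : Coll d} (h : c ∈ region d n) (W : Coll d → ℝ) :
    cutWeight n W c = W c := indicator_of_mem h W

theorem cutWeight_of_notMem {n : ℝ} {c : Coll d} (h : c ∉ region d n) (W : Coll d → ℝ) :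
    cutWeight n W c = 0 := indicator_of_notMem h W

/-- The region limits the sum of the squared speeds because this sum is conserved, while the
individual speeds are not. The truncated weight therefore keeps the symmetry under collisions. -/
theorem collMap_mem_region {n : ℝ} {c : Coll d} : collMap c ∈ region d n ↔ c ∈ region d n := by
  have := norm_sq_post c.1.2 c.2.1.2 c.2.2
  simp only [region, collMap, post, postS, mem_ofPred_eq, this]

theorem swapColl_mem_region {n : ℝ} {c : Coll d} : swapColl c ∈ region d n ↔ c ∈ region d n := by
  simp only [region, swapColl, mem_ofPred_eq, add_comm (‖c.2.1.2‖ ^ 2)]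
  tauto

theorem IsCollWeight.truncate (h : IsCollWeight W) (n : ℝ) : IsCollWeight (cutWeight n W) where
  measurable := h.measurable.indicator (measurableSet_region n)
  nonneg := fun c => indicator_nonneg (fun c _ => h.nonneg c) c
  collMap := fun c => by
    by_cases hc : c ∈ region d n
    · rw [cutWeight_of_mem hc, cutWeight_of_mem (collMap_mem_region.2 hc), h.collMap]
    · rw [cutWeight_of_notMem hc, cutWeight_of_notMem (mt collMap_mem_region.1 hc)]
  swap := fun c => by
    by_cases hc : c ∈ region d n
    · rw [cutWeight_of_mem hc, cutWeight_of_mem (swapColl_mem_region.2 hc), h.swap]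
    · rw [cutWeight_of_notMem hc, cutWeight_of_notMem (mt swapColl_mem_region.1 hc)]

theorem cutWeight_le (h : IsCollWeight W) (n : ℝ) (c : Coll d) : cutWeight n W c ≤ W c :=
  indicator_le_self' (fun c _ => h.nonneg c) c

theorem HasGrowth.truncate (h : HasGrowth Λ ν W) (n : ℝ) : HasGrowth Λ ν (cutWeight n W) where
  toIsCollWeight := h.toIsCollWeight.truncate n
  const_nonneg := h.const_nonneg
  exp_nonneg := h.exp_nonneg
  exp_le := h.exp_le
  le := fun c => (cutWeight_le h.toIsCollWeight n c).trans (h.le c)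

theorem HasGrowth.isCutoff (h : HasGrowth Λ ν W) {n : ℝ} (hn : 0 ≤ n) :
    IsCutoff n (cutWeight n W) where
  toIsCollWeight := h.toIsCollWeight.truncate n
  bounded := by
    have h0 := h.const_nonneg
    refine ⟨Λ * (2 + n ^ 2) ^ ν, by positivity, fun c => ?_⟩
    by_cases hc : c ∈ region d n
    · rw [cutWeight_of_mem hc]
      refine (h.le c).trans (mul_le_mul_of_nonneg_left (Real.rpow_le_rpow
        (add_pos (kin_pos _) (kin_pos _)).le ?_ h.exp_nonneg) h0)
      have := hc.2.2
      unfold kin; linarith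
    · rw [cutWeight_of_notMem hc]; positivity
  supp := fun c hc => by
    have hc : c ∈ region d n := by
      by_contra hn; exact hc (cutWeight_of_notMem hn W)
    obtain ⟨h1, h2, h3⟩ := hc
    refine ⟨⟨h1, ?_⟩, h2, ?_⟩
    · exact (sq_le_sq₀ (norm_nonneg _) hn).1 (by nlinarith [sq_nonneg ‖c.2.1.2‖])
    · exact (sq_le_sq₀ (norm_nonneg _) hn).1 (by nlinarith [sq_nonneg ‖c.1.2‖])

theorem region_mono {m n : ℝ} (hm : 0 ≤ m) (h : m ≤ n) : region d m ⊆ region d n :=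
  fun _ hc => ⟨hc.1.trans h, hc.2.1.trans h, hc.2.2.trans (by gcongr)⟩

theorem exists_mem_region (c : Coll d) : ∃ n : ℝ, 0 ≤ n ∧ c ∈ region d n := by
  refine ⟨‖c.1.1‖ + ‖c.2.1.1‖ + ‖c.1.2‖ + ‖c.2.1.2‖, by positivity, ?_⟩
  have h1 := norm_nonneg c.1.1
  have h2 := norm_nonneg c.2.1.1
  have h3 := norm_nonneg c.1.2
  have h4 := norm_nonneg c.2.1.2
  refine ⟨by linarith, by linarith, ?_⟩
  nlinarith [mul_nonneg h3 h4, mul_nonneg (add_nonneg h1 h2) (add_nonneg h3 h4),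
    sq_nonneg (‖c.1.1‖ + ‖c.2.1.1‖)]

theorem eventually_cutWeight_eq {ι : Type*} {l : Filter ι} {n : ι → ℝ} (hn : Tendsto n l atTop)
    (W : Coll d → ℝ) (c : Coll d) : ∀ᶠ i in l, cutWeight (n i) W c = W c := by
  obtain ⟨m, hm, hc⟩ := exists_mem_region c
  filter_upwards [hn.eventually_ge_atTop m] with i hi
  exact cutWeight_of_mem (region_mono hm hi hc) W

end Cut

/-! ### Bilinear estimates and the stability estimate for growing weights. -/

section Growth

variable {Λ ν : ℝ} {W V : Coll d → ℝ} {f g : Phase d → ℝ}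

/-- For numbers `a, b ≥ 1` one has `a + b ≤ 2 a b`. The product form lets integrals over pairs of
particles factor into moments. -/
theorem kin_add_rpow_le (hν : 0 ≤ ν) (hν1 : ν ≤ 1) (z w : Phase d) :
    (kin z + kin w) ^ ν ≤ 2 * (kin z ^ ν * kin w ^ ν) := by
  have h1 := one_le_kin z
  have h2 := one_le_kin w
  calc (kin z + kin w) ^ ν ≤ (2 * (kin z * kin w)) ^ ν :=
        Real.rpow_le_rpow (by linarith) (by nlinarith) hν
    _ = 2 ^ ν * (kin z ^ ν * kin w ^ ν) := by
        rw [Real.mul_rpow zero_le_two (by positivity), Real.mul_rpow (by linarith) (by linarith)]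
    _ ≤ 2 ^ (1 : ℝ) * (kin z ^ ν * kin w ^ ν) := by
        refine mul_le_mul_of_nonneg_right
          (Real.rpow_le_rpow_of_exponent_le one_le_two hν1) ?_
        have := Real.rpow_nonneg (kin_pos z).le ν
        have := Real.rpow_nonneg (kin_pos w).le ν
        positivity
    _ = _ := by rw [Real.rpow_one]

theorem HasGrowth.le_mul (h : HasGrowth Λ ν W) (c : Coll d) :
    W c ≤ 2 * Λ * (kin c.1 ^ ν * kin c.2.1 ^ ν) := by
  refine (h.le c).trans ?_
  have := mul_le_mul_of_nonneg_left (kin_add_rpow_le h.exp_nonneg h.exp_le c.1 c.2.1)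
    h.const_nonneg
  linarith

theorem kin_rpow_nonneg (p : ℝ) (z : Phase d) : 0 ≤ kin z ^ p := Real.rpow_nonneg (kin_pos z).le p

theorem measurable_kin_rpow (p : ℝ) : Measurable fun z : Phase d => kin z ^ p :=
  continuous_kin.measurable.pow_const p

theorem kin_rpow_le_rpow {p q : ℝ} (h : p ≤ q) (z : Phase d) : kin z ^ p ≤ kin z ^ q :=
  Real.rpow_le_rpow_of_exponent_le (one_le_kin z) h

theorem integrable_kin_rpow_of_le {p q : ℝ} (h : p ≤ q) (hf : AEStronglyMeasurable f volume)
    (hi : Integrable fun z => kin z ^ q * f z) : Integrable fun z => kin z ^ p * f z := by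
  refine hi.mono ((measurable_kin_rpow p).aestronglyMeasurable.mul hf)
    (Eventually.of_forall fun z => ?_)
  rw [norm_mul, norm_mul, Real.norm_of_nonneg (kin_rpow_nonneg _ _),
    Real.norm_of_nonneg (kin_rpow_nonneg _ _)]
  exact mul_le_mul_of_nonneg_right (kin_rpow_le_rpow h z) (norm_nonneg _)

theorem integrable_weight_abs {w : Phase d → ℝ} (hw : ∀ z, 0 ≤ w z)
    (h : Integrable fun z => w z * f z) : Integrable fun z => w z * |f z| := by
  refine h.norm.congr (Eventually.of_forall fun z => ?_)
  simp only [norm_mul, Real.norm_eq_abs, abs_of_nonneg (hw z)]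

theorem integrable_weight_abs_sub {w : Phase d → ℝ} (hw : ∀ z, 0 ≤ w z)
    (hf : Integrable fun z => w z * f z) (hg : Integrable fun z => w z * g z) :
    Integrable fun z => w z * |f z - g z| := by
  refine integrable_weight_abs (f := fun z => f z - g z) hw ?_
  refine (hf.sub hg).congr (Eventually.of_forall fun z => ?_)
  simp only [Pi.sub_apply]; ring

theorem integrable_weight_of_abs {w : Phase d → ℝ} (hm : Measurable w)
    (hf : AEStronglyMeasurable f volume)
    (h : Integrable fun z => w z * |f z|) : Integrable fun z => w z * f z := by
  refine h.mono (hm.aestronglyMeasurable.mul hf) (Eventually.of_forall fun z => ?_)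
  rw [norm_mul, norm_mul, Real.norm_eq_abs |f z|, abs_abs, Real.norm_eq_abs (f z)]

theorem aestronglyMeasurable_rate (hW : IsCollWeight W) (hf : AEStronglyMeasurable f volume) :
    AEStronglyMeasurable (rate W f) (collMeasure d) :=
  hW.measurable.aestronglyMeasurable.mul
    ((hf.comp_quasiMeasurePreserving quasi_fst).mul (hf.comp_quasiMeasurePreserving quasi_snd))

theorem HasGrowth.integrable_rate (h : HasGrowth Λ ν W) (hf : AEStronglyMeasurable f volume)
    (hi : Integrable fun z => kin z ^ ν * f z) : Integrable (rate W f) (collMeasure d) := by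
  refine ((integrable_tensor hi hi).const_mul (2 * Λ)).mono
    (aestronglyMeasurable_rate h.toIsCollWeight hf) (Eventually.of_forall fun c => ?_)
  have h0 := h.const_nonneg
  have h1 := h.le_mul c
  have e : 2 * Λ * (kin c.1 ^ ν * f c.1 * (kin c.2.1 ^ ν * f c.2.1))
      = (2 * Λ * (kin c.1 ^ ν * kin c.2.1 ^ ν)) * (f c.1 * f c.2.1) := by ring
  rw [e, rate, preProd, norm_mul, norm_mul _ (f c.1 * f c.2.1), Real.norm_of_nonneg (h.nonneg c),
    Real.norm_of_nonneg ((h.nonneg c).trans h1)]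
  gcongr

theorem HasGrowth.integral_abs_rate_sub_le (h : HasGrowth Λ ν W)
    (hf : AEStronglyMeasurable f volume) (hg : AEStronglyMeasurable g volume)
    (hfi : Integrable fun z => kin z ^ ν * f z) (hgi : Integrable fun z => kin z ^ ν * g z) :
    ∫ c, |rate W f c - rate W g c| ∂collMeasure d
      ≤ 2 * Λ * sphArea d * ((∫ z, kin z ^ ν * |f z - g z|)
        * ((∫ z, kin z ^ ν * |f z|) + ∫ z, kin z ^ ν * |g z|)) := by
  have hd : Integrable fun z => kin z ^ ν * |f z - g z| :=
    integrable_weight_abs_sub (kin_rpow_nonneg ν) hfi hgi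
  have hfa := integrable_weight_abs (kin_rpow_nonneg ν) hfi
  have hga := integrable_weight_abs (kin_rpow_nonneg ν) hgi
  have i1 := integrable_tensor hfa hd
  have i2 := integrable_tensor hd hga
  have i3 : Integrable (fun c : Coll d => 2 * Λ *
      (kin c.1 ^ ν * |f c.1| * (kin c.2.1 ^ ν * |f c.2.1 - g c.2.1|)
        + kin c.1 ^ ν * |f c.1 - g c.1| * (kin c.2.1 ^ ν * |g c.2.1|))) (collMeasure d) :=
    (i1.add i2).const_mul (2 * Λ)
  have hm := integral_mono ((h.integrable_rate hf hfi).sub (h.integrable_rate hg hgi)).abs i3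
    (fun c => ?_)
  · rw [integral_const_mul, integral_add i1 i2,
      integral_tensor (fun z => kin z ^ ν * |f z|) (fun z => kin z ^ ν * |f z - g z|),
      integral_tensor (fun z => kin z ^ ν * |f z - g z|) (fun z => kin z ^ ν * |g z|)] at hm
    refine hm.trans (le_of_eq ?_)
    ring
  · have h1 := h.le_mul c
    have e : rate W f c - rate W g c
        = W c * (f c.1 * (f c.2.1 - g c.2.1) + (f c.1 - g c.1) * g c.2.1) := by
      simp only [rate, preProd]; ring
    simp only [Pi.sub_apply, e]
    rw [abs_mul, abs_of_nonneg (h.nonneg c)]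
    calc W c * |f c.1 * (f c.2.1 - g c.2.1) + (f c.1 - g c.1) * g c.2.1|
        ≤ (2 * Λ * (kin c.1 ^ ν * kin c.2.1 ^ ν))
          * (|f c.1| * |f c.2.1 - g c.2.1| + |f c.1 - g c.1| * |g c.2.1|) := by
          refine mul_le_mul h1 ?_ (abs_nonneg _) ((h.nonneg c).trans h1)
          rw [← abs_mul, ← abs_mul]; exact abs_add_le _ _
      _ = _ := by ring

theorem kin_rpow_mul_self (z : Phase d) : kin z ^ ν * kin z = kin z ^ (1 + ν) := by
  rw [Real.rpow_add (kin_pos z), Real.rpow_one]; ring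

/-- The collision energy times the rate is integrable if `1 + ν` moments are finite. -/
theorem HasGrowth.integrable_energy_mul_rate (h : HasGrowth Λ ν W)
    (hf : AEStronglyMeasurable f volume) (hi : Integrable fun z => kin z ^ (1 + ν) * f z) :
    Integrable (fun c => (kin c.1 + kin c.2.1) * rate W f c) (collMeasure d) := by
  have hi' := integrable_kin_rpow_of_le (p := ν) (by linarith) hf hi
  have i1 : Integrable (fun c : Coll d => 2 * Λ *
      (kin c.1 ^ (1 + ν) * f c.1 * (kin c.2.1 ^ ν * f c.2.1)
        + kin c.1 ^ ν * f c.1 * (kin c.2.1 ^ (1 + ν) * f c.2.1))) (collMeasure d) :=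
    ((integrable_tensor hi hi').add (integrable_tensor hi' hi)).const_mul (2 * Λ)
  have hmE : Measurable fun c : Coll d => kin c.1 + kin c.2.1 :=
    ((continuous_kin.comp continuous_fst).add
      (continuous_kin.comp (continuous_fst.comp continuous_snd))).measurable
  refine i1.mono (hmE.aestronglyMeasurable.mul (aestronglyMeasurable_rate h.toIsCollWeight hf))
    (Eventually.of_forall fun c => ?_)
  have h1 := h.le_mul c
  have hE : 0 ≤ kin c.1 + kin c.2.1 := (add_pos (kin_pos _) (kin_pos _)).le
  have e : 2 * Λ * (kin c.1 ^ (1 + ν) * f c.1 * (kin c.2.1 ^ ν * f c.2.1)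
        + kin c.1 ^ ν * f c.1 * (kin c.2.1 ^ (1 + ν) * f c.2.1))
      = (kin c.1 + kin c.2.1) * ((2 * Λ * (kin c.1 ^ ν * kin c.2.1 ^ ν)) * (f c.1 * f c.2.1)) := by
    rw [← kin_rpow_mul_self, ← kin_rpow_mul_self]; ring
  rw [e, rate, preProd, norm_mul, norm_mul _ (_ * (f c.1 * f c.2.1)), norm_mul,
    norm_mul _ (f c.1 * f c.2.1), Real.norm_of_nonneg (h.nonneg c),
    Real.norm_of_nonneg ((h.nonneg c).trans h1)]
  gcongr

/-- Weighted bound for the collision operator. -/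
theorem integrable_kin_mul_collOp {K : Coll d → ℝ} (hK : Integrable K (collMeasure d))
    (hE : Integrable (fun c => (kin c.1 + kin c.2.1) * K c) (collMeasure d)) :
    Integrable (fun z => kin z * |collOp K z|) ∧
      ∫ z, kin z * |collOp K z| ≤ 2 * ∫ c, (kin c.1 + kin c.2.1) * |K c| ∂collMeasure d := by
  have hE0 : ∀ c : Coll d, 0 ≤ kin c.1 + kin c.2.1 := fun c =>
    (add_pos (kin_pos _) (kin_pos _)).le
  have hEa : Integrable (fun c => (kin c.1 + kin c.2.1) * |K c|) (collMeasure d) := by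
    refine hE.norm.congr (Eventually.of_forall fun c => ?_)
    simp only [norm_mul, Real.norm_eq_abs, abs_of_nonneg (hE0 c)]
  have h1 := lintegral_collOp_le hK (w := fun z => ENNReal.ofReal (kin z))
    continuous_kin.measurable.ennreal_ofReal
  have h2 : ∫⁻ c, (ENNReal.ofReal (kin c.1) + ENNReal.ofReal (kin (post c))) * ‖K c‖ₑ
      ∂collMeasure d ≤ ENNReal.ofReal (2 * ∫ c, (kin c.1 + kin c.2.1) * |K c| ∂collMeasure d) := by
    rw [← integral_const_mul, ofReal_integral_eq_lintegral_ofReal (hEa.const_mul 2)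
      (Eventually.of_forall fun c => mul_nonneg zero_le_two (mul_nonneg (hE0 c) (abs_nonneg _)))]
    refine lintegral_mono fun c => ?_
    rw [← ENNReal.ofReal_add (kin_pos _).le (kin_pos _).le, Real.enorm_eq_ofReal_abs,
      ← ENNReal.ofReal_mul (add_pos (kin_pos _) (kin_pos _)).le]
    refine ENNReal.ofReal_le_ofReal ?_
    rw [← mul_assoc]
    refine mul_le_mul_of_nonneg_right ?_ (abs_nonneg _)
    -- By conservation of energy both `kin c.1` and `kin (post c)` are at most the collision energy,
    -- whence the factor `2`.
    have := kin_post c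
    have := kin_pos (postS c)
    have := kin_pos c.2.1
    have := kin_pos c.1
    linarith
  have h3 : ∫⁻ z, ENNReal.ofReal (kin z * |collOp K z|)
      = ∫⁻ z, ENNReal.ofReal (kin z) * ‖collOp K z‖ₑ :=
    lintegral_congr fun z => by
      rw [ENNReal.ofReal_mul (kin_pos z).le, Real.enorm_eq_ofReal_abs]
  have hm : AEStronglyMeasurable (fun z => kin z * |collOp K z|) volume :=
    continuous_kin.aestronglyMeasurable.mul (integrable_L1 _).abs.aestronglyMeasurable
  have h0 : 0 ≤ᵐ[volume] fun z => kin z * |collOp K z| :=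
    Eventually.of_forall fun z => mul_nonneg (kin_pos z).le (abs_nonneg _)
  have h4 : ∫⁻ z, ENNReal.ofReal (kin z * |collOp K z|) ≤
      ENNReal.ofReal (2 * ∫ c, (kin c.1 + kin c.2.1) * |K c| ∂collMeasure d) :=
    h3.trans_le (h1.trans h2)
  have hi : Integrable (fun z => kin z * |collOp K z|) :=
    ⟨hm, (hasFiniteIntegral_iff_ofReal h0).2 (h4.trans_lt ENNReal.ofReal_lt_top)⟩
  refine ⟨hi, ?_⟩
  rw [integral_eq_lintegral_of_nonneg_ae h0 hm]
  exact ENNReal.toReal_le_of_le_ofReal (mul_nonneg zero_le_two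
    (integral_nonneg fun c => mul_nonneg (hE0 c) (abs_nonneg _))) h4

theorem sign_mul_eq_abs (x : ℝ) : Real.sign x * x = |x| := by
  rcases lt_trichotomy x 0 with h | h | h
  · rw [Real.sign_of_neg h, abs_of_neg h]; ring
  · simp [h]
  · rw [Real.sign_of_pos h, abs_of_pos h, one_mul]

/-- The stability estimate in `L¹(⟨v⟩²)`. -/
theorem HasGrowth.integral_sign_mul_le (h : HasGrowth Λ ν W)
    {f g : L1 d} (hf0 : 0 ≤ f) (hf : Integrable fun z => kin z ^ (1 + ν) * f z)
    (hg : Integrable fun z => kin z ^ (1 + ν) * g z) {s : Phase d → ℝ}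
    (hs : ∀ᵐ z, s z = Real.sign (f z - g z)) (hsm : AEStronglyMeasurable s volume) :
    ∫ z, kin z * (s z * (collQ W f - collQ W g) z)
      ≤ 8 * Λ * sphArea d * ((∫ z, kin z ^ (1 + ν) * f z) + ∫ z, kin z ^ (1 + ν) * |g z|)
        * ∫ z, kin z * |f z - g z| := by
  have hfm := (integrable_L1 f).aestronglyMeasurable
  have hgm := (integrable_L1 g).aestronglyMeasurable
  have hν := h.exp_nonneg
  have hf' := integrable_kin_rpow_of_le (p := ν) (by linarith) hfm hf
  have hg' := integrable_kin_rpow_of_le (p := ν) (by linarith) hgm hg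
  have rf := h.integrable_rate hfm hf'
  have rg := h.integrable_rate hgm hg'
  set K : Coll d → ℝ := fun c => rate W f c - rate W g c with hKdef
  have hK : Integrable K (collMeasure d) := rf.sub rg
  have hEK : Integrable (fun c => (kin c.1 + kin c.2.1) * K c) (collMeasure d) := by
    simp only [hKdef, mul_sub]
    exact (h.integrable_energy_mul_rate hfm hf).sub (h.integrable_energy_mul_rate hgm hg)
  have hE : ∀ c : Coll d, 0 ≤ kin c.1 + kin c.2.1 := fun c =>
    (add_pos (kin_pos _) (kin_pos _)).le
  have hs1 : ∀ᵐ z, |s z| ≤ 1 := by filter_upwards [hs] with z hz; rw [hz]; exact abs_sign_le_one _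
  let ψ : Phase d → ℝ := fun z => kin z * s z
  have hψm : AEStronglyMeasurable ψ volume := continuous_kin.aestronglyMeasurable.mul hsm
  have hψ : ∀ᵐ z, |ψ z| ≤ kin z := by
    filter_upwards [hs1] with z hz
    rw [abs_mul, abs_of_pos (kin_pos z)]
    exact mul_le_of_le_one_right (kin_pos z).le hz
  have h1 : Integrable (fun c => ψ c.1 * K c) (collMeasure d) := by
    refine hEK.mono ((hψm.comp_quasiMeasurePreserving quasi_fst).mul hK.1) ?_
    filter_upwards [quasi_fst.ae hψ] with c hc
    rw [norm_mul (ψ c.1) (K c), norm_mul (_ + _) (K c), Real.norm_of_nonneg (hE c),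
      Real.norm_eq_abs (ψ _)]
    have := kin_pos c.2.1
    exact mul_le_mul_of_nonneg_right (hc.trans (by linarith)) (norm_nonneg _)
  have h2 : Integrable (fun c => ψ (post c) * K c) (collMeasure d) := by
    refine hEK.mono ((hψm.comp_quasiMeasurePreserving quasi_post).mul hK.1) ?_
    filter_upwards [quasi_post.ae hψ] with c hc
    rw [norm_mul (ψ (post c)) (K c), norm_mul (_ + _) (K c), Real.norm_of_nonneg (hE c),
      Real.norm_eq_abs (ψ _)]
    have := kin_pos (postS c)
    have := kin_post c
    exact mul_le_mul_of_nonneg_right (hc.trans (by linarith)) (norm_nonneg _)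
  obtain ⟨-, i2, e⟩ := integral_mul_collOp_symm hK (Eventually.of_forall fun c => by
    simp only [hKdef, rate_swapColl h.toIsCollWeight]) h1 h2
  have hfa : Integrable fun z => kin z ^ (1 + ν) * |g z| :=
    integrable_weight_abs (kin_rpow_nonneg _) hg
  have hd1 : Integrable fun z => kin z ^ (1 + ν) * |f z - g z| :=
    integrable_weight_abs_sub (kin_rpow_nonneg _) hf hg
  have hd2 : Integrable fun z => kin z * |f z - g z| := by
    have := integrable_kin_rpow_of_le (p := 1) (by linarith)
      (f := fun z => |f z - g z|) (hfm.sub hgm).norm hd1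
    simpa only [Real.rpow_one] using this
  have hcoll : collQ W f - collQ W g = collOp K := collOp_sub rf rg
  rw [hcoll]
  have e1 : ∫ z, kin z * (s z * collOp K z) = ∫ z, ψ z * collOp K z :=
    integral_congr_ae (Eventually.of_forall fun z => by simp only [ψ]; ring)
  rw [e1, e]
  have j1 := integrable_tensor hf hd2
  have j2 := integrable_tensor hd2 hf
  have j3 := integrable_tensor hd1 hd2
  have j4 := integrable_tensor hd2 hd1
  have j6 : Integrable (fun c : Coll d => kin c.1 ^ (1 + ν) * f c.1 * (kin c.2.1 * |f c.2.1 - g c.2.1|)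
      + kin c.1 * |f c.1 - g c.1| * (kin c.2.1 ^ (1 + ν) * f c.2.1)) (collMeasure d) := j1.add j2
  have j7 : Integrable (fun c : Coll d =>
      kin c.1 ^ (1 + ν) * |f c.1 - g c.1| * (kin c.2.1 * |f c.2.1 - g c.2.1|)
      + kin c.1 * |f c.1 - g c.1| * (kin c.2.1 ^ (1 + ν) * |f c.2.1 - g c.2.1|))
      (collMeasure d) := j3.add j4
  have j5 : Integrable (fun c : Coll d => 4 * Λ *
      ((kin c.1 ^ (1 + ν) * f c.1 * (kin c.2.1 * |f c.2.1 - g c.2.1|)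
        + kin c.1 * |f c.1 - g c.1| * (kin c.2.1 ^ (1 + ν) * f c.2.1))
      + (kin c.1 ^ (1 + ν) * |f c.1 - g c.1| * (kin c.2.1 * |f c.2.1 - g c.2.1|)
        + kin c.1 * |f c.1 - g c.1| * (kin c.2.1 ^ (1 + ν) * |f c.2.1 - g c.2.1|))))
      (collMeasure d) := (j6.add j7).const_mul (4 * Λ)
  have hmono := integral_mono_ae i2 j5 (by
    filter_upwards [quasi_fst.ae (ae_nonneg hf0), quasi_snd.ae (ae_nonneg hf0), quasi_fst.ae hs,
      quasi_snd.ae hs, quasi_fst.ae hψ, quasi_snd.ae hψ, quasi_post.ae hψ, quasi_postS.ae hψ]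
      with c f1 f2 s1 s2 p1 p2 p3 p4
    set a := kin c.1 with ha
    set b := kin c.2.1 with hb
    have a1 : 1 ≤ a := one_le_kin _
    have b1 : 1 ≤ b := one_le_kin _
    set h₁ := f c.1 - g c.1 with hh1
    set h₂ := f c.2.1 - g c.2.1 with hh2
    have hab := kin_post c
    have q1 : ψ c.1 * h₁ = a * |h₁| := by
      simp only [ψ, s1]
      rw [mul_assoc, sign_mul_eq_abs]
    have q2 : ψ c.2.1 * h₂ = b * |h₂| := by
      simp only [ψ, s2]
      rw [mul_assoc, sign_mul_eq_abs]
    set G := collGrad ψ c with hG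
    have G1 : G = ψ (post c) + ψ (postS c) - ψ c.1 - ψ c.2.1 := rfl
    have u1 := abs_le.1 p1
    have u2 := abs_le.1 p2
    have u3 := abs_le.1 p3
    have u4 := abs_le.1 p4
    -- The decisive cancellation. The part `-ψ h₁` of the gradient equals `-a |h₁|` by the choice of
    -- sign. The other three terms are at most `a + 2 b` by conservation of energy, so the weight
    -- `a` at the particle itself drops out and only the weight of its partner remains.
    have r1 : G * h₁ ≤ 2 * b * |h₁| := by
      have k1 : |ψ (post c) + ψ (postS c) - ψ c.2.1| ≤ a + 2 * b := by
        rw [abs_le]; constructor <;> linarith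
      have k2 : (ψ (post c) + ψ (postS c) - ψ c.2.1) * h₁ ≤ (a + 2 * b) * |h₁| :=
        (le_abs_self _).trans (by rw [abs_mul]; gcongr)
      have : G * h₁ = (ψ (post c) + ψ (postS c) - ψ c.2.1) * h₁ - a * |h₁| := by
        rw [G1, ← q1]; ring
      linarith
    have r2 : G * h₂ ≤ 2 * a * |h₂| := by
      have k1 : |ψ (post c) + ψ (postS c) - ψ c.1| ≤ 2 * a + b := by
        rw [abs_le]; constructor <;> linarith
      have k2 : (ψ (post c) + ψ (postS c) - ψ c.1) * h₂ ≤ (2 * a + b) * |h₂| :=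
        (le_abs_self _).trans (by rw [abs_mul]; gcongr)
      have : G * h₂ = (ψ (post c) + ψ (postS c) - ψ c.1) * h₂ - b * |h₂| := by
        rw [G1, ← q2]; ring
      linarith
    have r3 : -(G * (h₁ * h₂)) ≤ 2 * (a + b) * (|h₁| * |h₂|) := by
      have k1 : |G| ≤ 2 * (a + b) := by
        rw [G1, abs_le]; constructor <;> linarith
      refine (neg_le_abs _).trans ?_
      rw [abs_mul, abs_mul]; gcongr
    -- The expansion is arranged so that the linear terms carry `f`, which is nonnegative; no sign
    -- of `g` is needed. The price is the quadratic term, handled by `r3`.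
    have eK : K c = W c * (f c.1 * h₂ + f c.2.1 * h₁ - h₁ * h₂) := by
      simp only [hKdef, rate, preProd, hh1, hh2]; ring
    have n1 : 0 ≤ |h₁| := abs_nonneg _
    have n2 : 0 ≤ |h₂| := abs_nonneg _
    set X := a * f c.1 * |h₂| + b * f c.2.1 * |h₁| + (a + b) * (|h₁| * |h₂|) with hX
    have hX0 : 0 ≤ X := by
      have : 0 ≤ a := by linarith
      have : 0 ≤ b := by linarith
      positivity
    have r4 : G * (f c.1 * h₂ + f c.2.1 * h₁ - h₁ * h₂) ≤ 2 * X := by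
      have t1 := mul_le_mul_of_nonneg_left r2 f1
      have t2 := mul_le_mul_of_nonneg_left r1 f2
      rw [hX]
      linarith
    have r5 : G * K c ≤ (2 * Λ * (a ^ ν * b ^ ν)) * (2 * X) := by
      rw [eK]
      calc G * (W c * (f c.1 * h₂ + f c.2.1 * h₁ - h₁ * h₂))
          = W c * (G * (f c.1 * h₂ + f c.2.1 * h₁ - h₁ * h₂)) := by ring
        _ ≤ W c * (2 * X) := mul_le_mul_of_nonneg_left r4 (h.nonneg c)
        _ ≤ _ := mul_le_mul_of_nonneg_right (h.le_mul c) (by linarith)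
    refine r5.trans ?_
    have v1 : a ^ ν * a = a ^ (1 + ν) := kin_rpow_mul_self c.1
    have v2 : b ^ ν * b = b ^ (1 + ν) := kin_rpow_mul_self c.2.1
    have w1 : a ^ ν ≤ a := by simpa using kin_rpow_le_rpow h.exp_le c.1
    have w2 : b ^ ν ≤ b := by simpa using kin_rpow_le_rpow h.exp_le c.2.1
    have z1 : 0 ≤ a ^ (1 + ν) := kin_rpow_nonneg _ _
    have z2 : 0 ≤ b ^ (1 + ν) := kin_rpow_nonneg _ _
    have e2 : 2 * Λ * (a ^ ν * b ^ ν) * (2 * X)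
        = 4 * Λ * ((a ^ (1 + ν) * f c.1 * (b ^ ν * |h₂|) + a ^ ν * |h₁| * (b ^ (1 + ν) * f c.2.1))
          + (a ^ (1 + ν) * |h₁| * (b ^ ν * |h₂|) + a ^ ν * |h₁| * (b ^ (1 + ν) * |h₂|))) := by
      rw [hX, ← v1, ← v2]; ring
    rw [e2]
    have := h.const_nonneg
    gcongr)
  rw [integral_const_mul, integral_add j6 j7, integral_add j1 j2,
    integral_add j3 j4, integral_tensor (fun z => kin z ^ (1 + ν) * f z)
      (fun z => kin z * |f z - g z|), integral_tensor (fun z => kin z * |f z - g z|)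
      (fun z => kin z ^ (1 + ν) * f z), integral_tensor (fun z => kin z ^ (1 + ν) * |f z - g z|)
      (fun z => kin z * |f z - g z|), integral_tensor (fun z => kin z * |f z - g z|)
      (fun z => kin z ^ (1 + ν) * |f z - g z|)] at hmono
  -- From `|f - g| ≤ f + |g|`: one factor of the quadratic term is bounded by moments, so the
  -- estimate is linear in the difference.
  have hfin : ∫ z, kin z ^ (1 + ν) * |f z - g z|
      ≤ (∫ z, kin z ^ (1 + ν) * f z) + ∫ z, kin z ^ (1 + ν) * |g z| := by
    rw [← integral_add hf hfa]
    refine integral_mono_ae hd1 (hf.add hfa) ?_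
    filter_upwards [ae_nonneg hf0] with z hz
    have := abs_sub (f z) (g z)
    rw [abs_of_nonneg hz] at this
    simp only [← mul_add]
    exact mul_le_mul_of_nonneg_left this (kin_rpow_nonneg _ _)
  have hga0 : 0 ≤ ∫ z, kin z ^ (1 + ν) * |g z| :=
    integral_nonneg fun z => mul_nonneg (kin_rpow_nonneg _ _) (abs_nonneg _)
  have hh0 : 0 ≤ ∫ z, kin z * |f z - g z| :=
    integral_nonneg fun z => mul_nonneg (kin_pos z).le (abs_nonneg _)
  have hc0 : 0 ≤ 4 * Λ * sphArea d :=
    mul_nonneg (mul_nonneg (by norm_num) h.const_nonneg) sphArea_nonneg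
  have := mul_le_mul_of_nonneg_left (mul_le_mul_of_nonneg_right hfin hh0) hc0
  have := mul_nonneg hc0 (mul_nonneg hga0 hh0)
  linarith

end Growth

end FuzzyBoltzmann

/-! ### Lower semicontinuity of the dissipation, and continuous dependence for bounded weights. -/

namespace FuzzyBoltzmann

open Filter Topology

variable {d : ℕ}

/-- The entropy dissipation with a general collision weight. -/
noncomputable def dissW (W : Coll d → ℝ) (f : Phase d → ℝ) : ℝ≥0∞ :=
  ENNReal.ofReal (1 / 4) *
    ∫⁻ c, dissDensity (postProd f c) (preProd f c) * ENNReal.ofReal (W c) ∂(collMeasure d)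

theorem dissDensity_of_pos {a b : ℝ} (ha : 0 < a) (hb : 0 < b) :
    dissDensity a b = ENNReal.ofReal ((a - b) * (Real.log a - Real.log b)) :=
  if_pos ⟨ha, hb⟩

theorem dissDensity_comm (a b : ℝ) : dissDensity a b = dissDensity b a := by
  unfold dissDensity
  have : (a - b) * (Real.log a - Real.log b) = (b - a) * (Real.log b - Real.log a) := by ring
  simp only [and_comm (a := 0 < a), and_comm (a := a = 0), this]

theorem dissDensity_eq_top {a b : ℝ} (ha : a ≤ 0) (h : ¬ (a = 0 ∧ b = 0)) :
    dissDensity a b = ⊤ := by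
  rw [dissDensity, if_neg (fun h => absurd h.1 (not_lt.2 ha)), if_neg h]

/-- The value at such a point is `+∞`, so nearby values must exceed any given bound. For `a < 0`
they are infinite as well. For `a = 0 < b` the difference of the logarithms diverges while `b - a`
stays away from zero. -/
theorem lowerSemicontinuousAt_dissDensity_of_nonpos {a b : ℝ} (ha : a ≤ 0)
    (h : ¬ (a = 0 ∧ b = 0)) (hb : 0 ≤ b) :
    LowerSemicontinuousAt (fun p : ℝ × ℝ => dissDensity p.1 p.2) (a, b) := by
  intro y hy
  simp only [dissDensity_eq_top ha h] at hy
  rcases ha.lt_or_eq with ha' | rfl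
  · have : ∀ᶠ p : ℝ × ℝ in 𝓝 (a, b), p.1 < 0 := continuous_fst.continuousAt.eventually_lt_const ha'
    filter_upwards [this] with p hp
    rw [dissDensity_eq_top hp.le (fun h => absurd h.1 hp.ne)]
    exact hy
  · have hb' : 0 < b := lt_of_le_of_ne hb fun h' => h ⟨rfl, h'.symm⟩
    set r := y.toReal with hr
    have hr0 : 0 ≤ r := ENNReal.toReal_nonneg
    -- The first bound keeps the difference of the arguments above `b / 4`. The second makes the
    -- difference of the logarithms at least `4 / b * (r + 1)`, so their product exceeds `r`.
    set δ := min (b / 4) (b / 2 * Real.exp (-(4 / b * (r + 1)))) with hδ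
    have hδ0 : 0 < δ := lt_min (by positivity) (by positivity)
    have e1 : ∀ᶠ p : ℝ × ℝ in 𝓝 (0, b), p.1 < δ :=
      continuous_fst.continuousAt.eventually_lt_const hδ0
    have e2 : ∀ᶠ p : ℝ × ℝ in 𝓝 (0, b), b / 2 < p.2 :=
      continuous_snd.continuousAt.eventually_const_lt (by simp; linarith)
    filter_upwards [e1, e2] with p h1 h2
    have p2 : 0 < p.2 := by linarith
    rcases le_or_gt p.1 0 with h3 | h3
    · rw [dissDensity_eq_top h3 (fun h => absurd h.2 p2.ne')]; exact hy
    · rw [dissDensity_of_pos h3 p2, ← ENNReal.ofReal_toReal hy.ne, ← hr]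
      refine (ENNReal.ofReal_lt_ofReal_iff_of_nonneg hr0).2 ?_
      have l1 : Real.log p.1 ≤ Real.log (b / 2) - 4 / b * (r + 1) := by
        rw [← Real.log_exp (-(4 / b * (r + 1))), sub_eq_add_neg] at *
        rw [← Real.log_exp (-(4 / b * (r + 1))), ← Real.log_mul (by positivity)
          (Real.exp_pos _).ne']
        exact Real.log_le_log h3 (h1.le.trans (min_le_right _ _))
      have l2 : Real.log (b / 2) ≤ Real.log p.2 := Real.log_le_log (by positivity) h2.le
      have l3 : b / 4 ≤ p.2 - p.1 := by have := h1.trans_le (min_le_left _ _); linarith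
      have l4 : 4 / b * (r + 1) ≤ Real.log p.2 - Real.log p.1 := by linarith
      calc r < b / 4 * (4 / b * (r + 1)) := by field_simp; linarith
        _ ≤ (p.2 - p.1) * (Real.log p.2 - Real.log p.1) :=
            mul_le_mul l3 l4 (by positivity) (by linarith)
        _ = _ := by ring

/-- At the origin the value is the minimum `0`, in the open quadrant the density is continuous, and
at all other points it is `+∞`. -/
theorem lowerSemicontinuous_dissDensity :
    LowerSemicontinuous fun p : ℝ × ℝ => dissDensity p.1 p.2 := by
  rintro ⟨a, b⟩
  by_cases h0 : a = 0 ∧ b = 0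
  · intro y hy
    simp [dissDensity, h0.1, h0.2] at hy
  have swap : LowerSemicontinuousAt (fun p : ℝ × ℝ => dissDensity p.1 p.2) (b, a) →
      LowerSemicontinuousAt (fun p : ℝ × ℝ => dissDensity p.1 p.2) (a, b) := by
    intro h y hy
    have := h y (by simpa only [dissDensity_comm b a] using hy)
    have hs := (continuous_swap (X := ℝ) (Y := ℝ)).tendsto (a, b)
    filter_upwards [hs.eventually this] with p hp
    simpa only [Prod.swap, dissDensity_comm p.2] using hp
  have h0' : ¬ (b = 0 ∧ a = 0) := fun h => h0 h.symm
  rcases le_or_gt a 0 with ha | ha <;> rcases le_or_gt b 0 with hb | hb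
  · by_cases hb0 : b = 0
    · subst hb0
      exact lowerSemicontinuousAt_dissDensity_of_nonpos ha h0 le_rfl
    · intro y hy
      simp only [dissDensity_eq_top ha h0] at hy
      have : ∀ᶠ p : ℝ × ℝ in 𝓝 (a, b), p.2 < 0 :=
        continuous_snd.continuousAt.eventually_lt_const (lt_of_le_of_ne hb hb0)
      filter_upwards [this] with p hp
      rw [dissDensity_comm, dissDensity_eq_top hp.le (fun h => absurd h.1 hp.ne)]
      exact hy
  · exact lowerSemicontinuousAt_dissDensity_of_nonpos ha h0 hb.le
  · exact swap (lowerSemicontinuousAt_dissDensity_of_nonpos hb h0' ha.le)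
  · have e1 : ∀ᶠ p : ℝ × ℝ in 𝓝 (a, b), 0 < p.1 :=
      continuous_fst.continuousAt.eventually_const_lt ha
    have e2 : ∀ᶠ p : ℝ × ℝ in 𝓝 (a, b), 0 < p.2 :=
      continuous_snd.continuousAt.eventually_const_lt hb
    refine ContinuousAt.lowerSemicontinuousAt ?_
    have hc : ContinuousAt (fun p : ℝ × ℝ =>
        ENNReal.ofReal ((p.1 - p.2) * (Real.log p.1 - Real.log p.2))) (a, b) := by
      refine ENNReal.continuous_ofReal.continuousAt.comp ?_
      refine (continuousAt_fst.sub continuousAt_snd).mul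
        ((ContinuousAt.log continuousAt_fst ha.ne').sub (ContinuousAt.log continuousAt_snd hb.ne'))
    refine hc.congr ?_
    filter_upwards [e1, e2] with p h1 h2
    rw [dissDensity_of_pos h1 h2]

theorem measurable_dissDensity : Measurable fun p : ℝ × ℝ => dissDensity p.1 p.2 :=
  lowerSemicontinuous_dissDensity.measurable

/-- Lower semicontinuity of the dissipation under convergence in `L¹`, with varying weights and
truncations. -/
theorem dissW_le_liminf {W : Coll d → ℝ} {V : ℕ → Coll d → ℝ} (hV : ∀ n, Measurable (V n))
    (hVW : ∀ c, ∀ᶠ n in atTop, V n c = W c) {τ : ℕ → ℝ → ℝ} (hτ : ∀ n, LipschitzWith 1 (τ n))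
    {σ : ℝ → ℝ} (hτσ : ∀ y, Tendsto (fun n => τ n y) atTop (𝓝 (σ y))) {F : ℕ → L1 d} {f : L1 d}
    (hF : Tendsto F atTop (𝓝 f)) :
    dissW W (fun z => σ (f z)) ≤ liminf (fun n => dissW (V n) fun z => τ n (F n z)) atTop := by
  by_contra! hlt
  -- Convergence in `L¹` is pointwise only along subsequences. Hence a contradiction is sought:
  -- along a subsequence the dissipation stays below `y`, a further one converges almost everywhere,
  -- and Fatou's lemma bounds the limit by `y`.
  obtain ⟨y, hy1, hy2⟩ := exists_between hlt
  obtain ⟨φ, hφ, hφy⟩ := extraction_of_frequently_atTop (frequently_lt_of_liminf_lt (by isBoundedDefault) hy1)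
  obtain ⟨ψ, hψ, hae⟩ := (tendstoInMeasure_of_tendsto_Lp
    (hF.comp hφ.tendsto_atTop)).exists_seq_tendsto_ae
  have hθ : Tendsto (fun n => φ (ψ n)) atTop atTop := hφ.tendsto_atTop.comp hψ.tendsto_atTop
  have hae' : ∀ᵐ z, Tendsto (fun n => τ (φ (ψ n)) (F (φ (ψ n)) z)) atTop (𝓝 (σ (f z))) := by
    filter_upwards [hae] with z hz
    have h1 := (hτσ (f z)).comp hθ
    have h2 : Tendsto (fun n => τ (φ (ψ n)) (F (φ (ψ n)) z) - τ (φ (ψ n)) (f z)) atTop (𝓝 0) := by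
      refine squeeze_zero_norm (fun n => ?_) (tendsto_iff_norm_sub_tendsto_zero.1 hz)
      simpa using (hτ (φ (ψ n))).norm_sub_le (F (φ (ψ n)) z) (f z)
    simpa [Function.comp_def] using h2.add h1
  have hm : ∀ n, AEMeasurable (fun c => dissDensity (postProd (fun z => τ n (F n z)) c)
      (preProd (fun z => τ n (F n z)) c) * ENNReal.ofReal (V n c)) (collMeasure d) := by
    intro n
    have h0 : AEStronglyMeasurable (fun z => τ n (F n z)) volume :=
      (hτ n).continuous.comp_aestronglyMeasurable (integrable_L1 _).aestronglyMeasurable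
    have h1 := (h0.comp_quasiMeasurePreserving quasi_post).mul
      (h0.comp_quasiMeasurePreserving quasi_postS)
    have h2 := (h0.comp_quasiMeasurePreserving quasi_fst).mul
      (h0.comp_quasiMeasurePreserving quasi_snd)
    exact (measurable_dissDensity.comp_aemeasurable (h1.aemeasurable.prodMk h2.aemeasurable)).mul
      (hV n).ennreal_ofReal.aemeasurable
  have hle : dissW W (fun z => σ (f z)) ≤ y := by
    have hf := lintegral_liminf_le' (u := atTop) (fun n => hm (φ (ψ n)))
    have h1 : ∫⁻ c, dissDensity (postProd (fun z => σ (f z)) c) (preProd (fun z => σ (f z)) c)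
        * ENNReal.ofReal (W c) ∂(collMeasure d)
        ≤ liminf (fun n => ∫⁻ c, dissDensity (postProd (fun z => τ (φ (ψ n)) (F (φ (ψ n)) z)) c)
      (preProd (fun z => τ (φ (ψ n)) (F (φ (ψ n)) z)) c) * ENNReal.ofReal (V (φ (ψ n)) c)
      ∂(collMeasure d)) atTop := by
      refine (lintegral_mono_ae ?_).trans hf
      filter_upwards [quasi_fst.ae hae', quasi_snd.ae hae', quasi_post.ae hae',
        quasi_postS.ae hae'] with c c1 c2 c3 c4
      refine le_trans ?_ ENNReal.le_liminf_mul
      refine mul_le_mul' ?_ ?_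
      · have ht := (c3.mul c4).prodMk_nhds (c1.mul c2)
        have hl := LowerSemicontinuousAt.le_liminf (lowerSemicontinuous_dissDensity
          (postProd (fun z => σ (f z)) c, preProd (fun z => σ (f z)) c))
        exact hl.trans (liminf_le_liminf_of_le ht)
      · have : Tendsto (fun n => ENNReal.ofReal (V (φ (ψ n)) c)) atTop
            (𝓝 (ENNReal.ofReal (W c))) := by
          refine tendsto_const_nhds.congr' ?_
          filter_upwards [hθ.eventually (hVW c)] with n hn
          rw [hn]
        rw [this.liminf_eq]
    calc dissW W (fun z => σ (f z))
        ≤ ENNReal.ofReal (1 / 4) * liminf (fun n => ∫⁻ c,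
            dissDensity (postProd (fun z => τ (φ (ψ n)) (F (φ (ψ n)) z)) c)
            (preProd (fun z => τ (φ (ψ n)) (F (φ (ψ n)) z)) c) * ENNReal.ofReal (V (φ (ψ n)) c)
            ∂(collMeasure d)) atTop := mul_le_mul_right h1 _
      _ = liminf (fun _ : ℕ => ENNReal.ofReal (1 / 4)) atTop * _ := by rw [liminf_const]
      _ ≤ liminf (fun n => dissW (V (φ (ψ n))) fun z => τ (φ (ψ n)) (F (φ (ψ n)) z)) atTop :=
          ENNReal.le_liminf_mul
      _ ≤ y := liminf_le_of_frequently_le' (Frequently.of_forall fun n => (hφy (ψ n)).le)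
  exact absurd hle (not_le.2 hy2)

/-- Along continuous curves in `L¹` the dissipation is a measurable function of time. -/
theorem measurable_dissW {W : Coll d → ℝ} (hW : Measurable W) {τ : ℝ → ℝ}
    (hτ : LipschitzWith 1 τ) {F : ℝ → L1 d} (hF : Continuous F) :
    Measurable fun s => dissW W fun z => τ (F s z) := by
  -- As a function of time the dissipation is lower semicontinuous, by `dissW_le_liminf` along
  -- sequences of times.
  refine LowerSemicontinuous.measurable fun x y hy => ?_
  by_contra hn
  rw [not_eventually] at hn
  obtain ⟨u, hu, huy⟩ := exists_seq_forall_of_frequently hn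
  have := dissW_le_liminf (V := fun _ => W) (fun _ => hW) (fun c => Eventually.of_forall fun _ => rfl)
    (τ := fun _ => τ) (fun _ => hτ) (fun y => tendsto_const_nhds) ((hF.tendsto x).comp hu)
  refine absurd (hy.trans_le this) (not_lt.2 ?_)
  refine liminf_le_of_frequently_le' (Frequently.of_forall fun n => not_lt.1 (huy n))

/-- Mild solutions depend continuously on the data, the weight and the truncation, for bounded
weights. -/
theorem tendsto_of_isMild {Λ : ℝ} (hΛ0 : 0 ≤ Λ) {W : Coll d → ℝ} (hW : IsCollWeight W)
    (hΛ : ∀ c, W c ≤ Λ) {V : ℕ → Coll d → ℝ} (hV : ∀ n, IsCollWeight (V n))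
    (hVΛ : ∀ n c, V n c ≤ Λ) (hVW : ∀ c, Tendsto (fun n => V n c) atTop (𝓝 (W c)))
    {τ : ℕ → ℝ → ℝ} (hτ : ∀ n, IsTruncation (τ n))
    (hτσ : ∀ y, Tendsto (fun n => τ n y) atTop (𝓝 y)) {T : ℝ} {f₀ : L1 d} {f : ℝ → L1 d}
    (h : IsMild W id T f₀ f) {g₀ : ℕ → L1 d} {g : ℕ → ℝ → L1 d}
    (hg : ∀ n, IsMild (V n) (τ n) T (g₀ n) (g n)) (h0 : Tendsto g₀ atTop (𝓝 f₀)) {ρ : ℝ}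
    (hfρ : ∀ t ∈ Icc 0 T, ‖f t‖ ≤ ρ) (hgρ : ∀ n, ∀ t ∈ Icc 0 T, ‖g n t‖ ≤ ρ) :
    ∀ t ∈ Icc 0 T, Tendsto (fun n => g n t) atTop (𝓝 (f t)) := by
  intro t ht
  have hT : 0 ≤ T := ht.1.trans ht.2
  have hρ : 0 ≤ ρ := (norm_nonneg _).trans (hfρ t ht)
  have hS := sphArea_nonneg (d := d)
  -- The consistency error: both operators act on the same limit curve, so it tends to zero by
  -- dominated convergence. The rest of the difference is controlled by the Lipschitz bound of the
  -- approximating operator, and Gronwall's inequality closes the estimate.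
  let e : ℕ → ℝ → ℝ := fun n s => ‖collQ (V n) (fun z => τ n (f s z)) - collQ W fun z => id (f s z)‖
  have hec : ∀ n, ContinuousOn (e n) (Icc 0 T) := fun n =>
    (((continuous_collQ_truncation (hV n) hΛ0 (hVΛ n) (hτ n)).comp_continuousOn h.continuousOn).sub
      h.continuousOn_collQ).norm
  have hfi : ∀ n s, Integrable (rate (V n) fun z => τ n (f s z)) (collMeasure d) := fun n s =>
    FuzzyBoltzmann.integrable_rate (hV n) (hVΛ n) ((hτ n).integrable (f s))
  have hdom : ∀ n s c, |rate (V n) (fun z => τ n (f s z)) c - rate W (fun z => id (f s z)) c|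
      ≤ 2 * Λ * (|f s c.1| * |f s c.2.1|) := by
    intro n s c
    have h1 : |rate (V n) (fun z => τ n (f s z)) c| ≤ Λ * (|f s c.1| * |f s c.2.1|) := by
      rw [rate, preProd, abs_mul, abs_mul, abs_of_nonneg ((hV n).nonneg c)]
      exact mul_le_mul (hVΛ n c) (mul_le_mul ((hτ n).abs_le _) ((hτ n).abs_le _) (abs_nonneg _)
        (abs_nonneg _)) (by positivity) hΛ0
    have h2 : |rate W (fun z => id (f s z)) c| ≤ Λ * (|f s c.1| * |f s c.2.1|) := by
      rw [rate, preProd, abs_mul, abs_mul, abs_of_nonneg (hW.nonneg c)]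
      exact mul_le_mul_of_nonneg_right (hΛ c) (by positivity)
    refine (abs_sub _ _).trans ?_
    linarith
  have hdi : ∀ s, Integrable (fun c : Coll d => 2 * Λ * (|f s c.1| * |f s c.2.1|))
      (collMeasure d) := fun s =>
    (integrable_tensor (integrable_L1 (f s)).abs (integrable_L1 (f s)).abs).const_mul _
  have heb : ∀ n, ∀ s ∈ Icc 0 T, e n s ≤ 2 * ∫ c, |rate (V n) (fun z => τ n (f s z)) c
      - rate W (fun z => id (f s z)) c| ∂collMeasure d := fun n s hs =>
    norm_collQ_sub_le (hfi n s) (h.integrable_rate s hs)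
  have he0 : Tendsto (fun n => ∫ s in (0 : ℝ)..T, e n s) atTop (𝓝 0) := by
    have : Tendsto (fun n => ∫ s in (0 : ℝ)..T, e n s) atTop (𝓝 (∫ _ in (0 : ℝ)..T, (0 : ℝ))) := by
      refine intervalIntegral.tendsto_integral_filter_of_dominated_convergence
        (fun _ => 2 * (2 * Λ * (sphArea d * (ρ * ρ)))) (Eventually.of_forall fun n => ?_)
        (Eventually.of_forall fun n => Eventually.of_forall fun s hs => ?_)
        intervalIntegrable_const (Eventually.of_forall fun s hs => ?_)
      · rw [uIoc_of_le hT]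
        exact ((hec n).mono Ioc_subset_Icc_self).aestronglyMeasurable measurableSet_Ioc
      · rw [uIoc_of_le hT] at hs
        have hs' : s ∈ Icc 0 T := Ioc_subset_Icc_self hs
        rw [norm_norm]
        refine (heb n s hs').trans ?_
        have := integral_mono ((hfi n s).sub (h.integrable_rate s hs')).abs (hdi s)
          (fun c => hdom n s c)
        rw [integral_const_mul, integral_tensor (fun z => |f s z|) (fun z => |f s z|),
          ← norm_L1] at this
        refine mul_le_mul_of_nonneg_left (this.trans ?_) zero_le_two
        have := hfρ s hs'
        gcongr
      · rw [uIoc_of_le hT] at hs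
        have hs' : s ∈ Icc 0 T := Ioc_subset_Icc_self hs
        have hlim : Tendsto (fun n => ∫ c, |rate (V n) (fun z => τ n (f s z)) c
            - rate W (fun z => id (f s z)) c| ∂collMeasure d) atTop
            (𝓝 (∫ _ : Coll d, (0 : ℝ) ∂collMeasure d)) := by
          refine tendsto_integral_of_dominated_convergence _
            (fun n => ((hfi n s).sub (h.integrable_rate s hs')).abs.aestronglyMeasurable) (hdi s)
            (fun n => Eventually.of_forall fun c => ?_) (Eventually.of_forall fun c => ?_)
          · rw [Real.norm_eq_abs, abs_abs]; exact hdom n s c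
          · have := ((hVW c).mul ((hτσ (f s c.1)).mul (hτσ (f s c.2.1)))).sub_const
              (rate W (fun z => id (f s z)) c)
            rw [show W c * (f s c.1 * f s c.2.1) = rate W (fun z => id (f s z)) c from rfl,
              sub_self] at this
            simp only [rate, preProd] at this ⊢
            simpa using this.abs
        rw [integral_zero] at hlim
        refine squeeze_zero (fun n => norm_nonneg _) (fun n => heb n s hs') ?_
        simpa using hlim.const_mul 2
    rwa [intervalIntegral.integral_zero] at this
  have main : ∀ n, ‖g n t - f t‖
      ≤ (‖g₀ n - f₀‖ + ∫ s in (0 : ℝ)..T, e n s) * Real.exp (2 * (Λ * sphArea d * (2 * ρ)) * t) := by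
    intro n
    refine gronwall_integral (y := fun t => ‖g n t - f t‖) (T := T) (by positivity)
      ((hg n).continuousOn.sub h.continuousOn).norm (fun t ht => ?_) t ht
    have hsub : Icc 0 t ⊆ Icc 0 T := Icc_subset_Icc_right ht.2
    have ii : ∀ {X : Type} [NormedAddCommGroup X] {H : ℝ → X}, ContinuousOn H (Icc 0 T) →
        IntervalIntegrable H volume 0 t := fun hH =>
      ContinuousOn.intervalIntegrable (by rw [uIcc_of_le ht.1]; exact hH.mono hsub)
    have c1 := continuousOn_alongChar continuousOn_id (hg n).continuousOn_collQ
    have c2 := continuousOn_alongChar continuousOn_id h.continuousOn_collQ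
    have e1 : alongChar t (g n t - f t) = (g₀ n - f₀) + ∫ s in (0 : ℝ)..t,
        alongChar s (collQ (V n) (fun z => τ n (g n s z)) - collQ W fun z => id (f s z)) := by
      rw [alongChar_sub, (hg n).eq t ht, h.eq t ht]
      simp only [alongChar_sub]
      rw [intervalIntegral.integral_sub (ContinuousOn.intervalIntegrable
        (by rw [uIcc_of_le ht.1]; exact c1.mono hsub)) (ContinuousOn.intervalIntegrable
        (by rw [uIcc_of_le ht.1]; exact c2.mono hsub))]
      abel
    rw [← norm_alongChar t, e1]
    have hy : ContinuousOn (fun s => ‖g n s - f s‖) (Icc 0 T) :=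
      ((hg n).continuousOn.sub h.continuousOn).norm
    have hb : ∀ s ∈ Icc 0 T,
        ‖alongChar s (collQ (V n) (fun z => τ n (g n s z)) - collQ W fun z => id (f s z))‖
        ≤ 2 * (Λ * sphArea d * (2 * ρ)) * ‖g n s - f s‖ + e n s := by
      intro s hs
      rw [norm_alongChar]
      refine (norm_sub_le_norm_sub_add_norm_sub _ (collQ (V n) (fun z => τ n (f s z))) _).trans ?_
      refine add_le_add ?_ le_rfl
      refine (norm_collQ_truncation_sub_le (hV n) hΛ0 (hVΛ n) (hτ n) _ _).trans ?_
      have := hgρ n s hs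
      have := hfρ s hs
      calc 2 * (Λ * sphArea d * (‖g n s - f s‖ * (‖g n s‖ + ‖f s‖)))
          ≤ 2 * (Λ * sphArea d * (‖g n s - f s‖ * (ρ + ρ))) := by gcongr
        _ = _ := by ring
    have hcb : ContinuousOn (fun s => 2 * (Λ * sphArea d * (2 * ρ)) * ‖g n s - f s‖ + e n s)
        (Icc 0 T) := (continuousOn_const.mul hy).add (hec n)
    have k1 := intervalIntegral.norm_integral_le_of_norm_le ht.1 (Eventually.of_forall
      fun s hs => hb s (hsub (Ioc_subset_Icc_self hs))) (ii hcb)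
    rw [intervalIntegral.integral_add ((ii hy).const_mul _) (ii (hec n)),
      intervalIntegral.integral_const_mul] at k1
    have k2 : ∫ s in (0 : ℝ)..t, e n s ≤ ∫ s in (0 : ℝ)..T, e n s :=
      intervalIntegral.integral_mono_interval le_rfl ht.1 ht.2
        (Eventually.of_forall fun s => norm_nonneg _)
        (ContinuousOn.intervalIntegrable (by rw [uIcc_of_le hT]; exact hec n))
    have k3 := norm_add_le (g₀ n - f₀) (∫ s in (0 : ℝ)..t,
        alongChar s (collQ (V n) (fun z => τ n (g n s z)) - collQ W fun z => id (f s z)))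
    linarith
  rw [tendsto_iff_norm_sub_tendsto_zero]
  refine squeeze_zero (fun n => norm_nonneg _) main ?_
  have := ((tendsto_iff_norm_sub_tendsto_zero.1 h0).add he0).mul_const
    (Real.exp (2 * (Λ * sphArea d * (2 * ρ)) * t))
  simpa using this

/-- Continuous dependence for a constant sequence: the sequence with value `g` converges to `f`. -/
theorem IsMild.unique_of_bounded {Λ : ℝ} (hΛ0 : 0 ≤ Λ) {W : Coll d → ℝ} (hW : IsCollWeight W)
    (hΛ : ∀ c, W c ≤ Λ) {T : ℝ} {f₀ : L1 d} {f g : ℝ → L1 d}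
    (h : IsMild W id T f₀ f) (hg : IsMild W id T f₀ g) : EqOn g f (Icc 0 T) := by
  obtain ⟨ρ, hρ⟩ := isCompact_Icc.exists_bound_of_continuousOn h.continuousOn
  obtain ⟨ρ', hρ'⟩ := isCompact_Icc.exists_bound_of_continuousOn hg.continuousOn
  intro t ht
  exact tendsto_nhds_unique tendsto_const_nhds (tendsto_of_isMild hΛ0 hW hΛ (fun _ : ℕ => hW)
    (fun _ => hΛ) (fun c => tendsto_const_nhds) (τ := fun _ => id) (fun _ => isTruncation_id)
    (fun y => tendsto_const_nhds) h (fun _ => hg) tendsto_const_nhds (ρ := max ρ ρ')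
    (fun t ht => (hρ t ht).trans (le_max_left _ _))
    (fun _ t ht => (hρ' t ht).trans (le_max_right _ _)) t ht)

end FuzzyBoltzmann

/-! ### The entropy identity for the problem truncated at height `R`. -/

namespace FuzzyBoltzmann

open Filter Topology

variable {d : ℕ}

section Profile

/-- The derivative `1 + log y` of `y log y`, with `y` clamped to `[c, R]`. -/
noncomputable def logClamp (c R y : ℝ) : ℝ := 1 + Real.log (max c (min y R))

/-- An approximation of `y log y` with Lipschitz derivative `logClamp`. -/
noncomputable def entProfile (c R y : ℝ) : ℝ := ∫ s in (0 : ℝ)..y, logClamp c R s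

variable {c R : ℝ}

theorem logClamp_of_mem {y : ℝ} (h1 : c ≤ y) (h2 : y ≤ R) : logClamp c R y = 1 + Real.log y := by
  rw [logClamp, min_eq_left h2, max_eq_right h1]

theorem abs_log_sub_log_le {a b : ℝ} (hc : 0 < c) (ha : c ≤ a) (hb : c ≤ b) :
    |Real.log a - Real.log b| ≤ 1 / c * |a - b| := by
  have key : ∀ a b : ℝ, c ≤ a → c ≤ b → Real.log a - Real.log b ≤ 1 / c * |a - b| := by
    intro a b ha hb
    have ha0 : 0 < a := hc.trans_le ha
    have hb0 : 0 < b := hc.trans_le hb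
    rw [← Real.log_div ha0.ne' hb0.ne']
    calc Real.log (a / b) ≤ a / b - 1 := Real.log_le_sub_one_of_pos (by positivity)
      _ = (a - b) / b := by field_simp
      _ ≤ |a - b| / b := by gcongr; exact le_abs_self _
      _ ≤ |a - b| / c := by gcongr
      _ = _ := by ring
  rw [abs_le]
  have h1 := key a b ha hb
  have h2 := key b a hb ha
  rw [abs_sub_comm] at h2
  constructor <;> linarith

theorem lipschitz_logClamp (hc : 0 < c) (x y : ℝ) :
    |logClamp c R x - logClamp c R y| ≤ 1 / c * |x - y| := by
  have h1 : |max c (min x R) - max c (min y R)| ≤ |x - y| := by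
    rw [max_comm c, max_comm c]
    refine (abs_max_sub_max_le_abs _ _ _).trans ?_
    rw [min_comm x, min_comm y]
    have := abs_min_sub_min_le_max R x R y
    simpa using this
  have := abs_log_sub_log_le hc (le_max_left c (min x R)) (le_max_left c (min y R))
  rw [logClamp, logClamp, add_sub_add_left_eq_sub]
  refine this.trans ?_
  gcongr

theorem continuous_logClamp (hc : 0 < c) : Continuous (logClamp c R) := by
  unfold logClamp
  refine continuous_const.add (Continuous.log (by fun_prop) fun y => ?_)
  exact (hc.trans_le (le_max_left _ _)).ne'

theorem logClamp_ge (hc : 0 < c) (y : ℝ) : -(|Real.log c|) ≤ logClamp c R y := by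
  have := Real.log_le_log hc (le_max_left c (min y R))
  have := neg_abs_le (Real.log c)
  rw [logClamp]; linarith

theorem isProfile_entProfile (hc : 0 < c) (hcR : c ≤ R) :
    IsProfile (entProfile c R) (logClamp c R) (1 / c) (1 + |Real.log c| + |Real.log R|) where
  zero := intervalIntegral.integral_same
  hasDerivAt y := intervalIntegral.integral_hasDerivAt_right
    ((continuous_logClamp hc).intervalIntegrable _ _)
    ((continuous_logClamp hc).stronglyMeasurableAtFilter _ _) (continuous_logClamp hc).continuousAt
  lip_nonneg := by positivity
  lipschitz := lipschitz_logClamp hc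
  bounded y := by
    have h1 := logClamp_ge (R := R) hc y
    have h2 : Real.log (max c (min y R)) ≤ Real.log R :=
      Real.log_le_log (hc.trans_le (le_max_left _ _)) (max_le hcR (min_le_right _ _))
    have h3 := le_abs_self (Real.log R)
    have h4 := abs_nonneg (Real.log R)
    have h5 := abs_nonneg (Real.log c)
    rw [abs_le]
    constructor
    · linarith
    · rw [logClamp]; linarith

theorem entProfile_ge (hc : 0 < c) {y : ℝ} (hy : 0 ≤ y) :
    -(|Real.log c|) * y ≤ entProfile c R y := by
  have := intervalIntegral.integral_mono_on hy intervalIntegrable_const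
    ((continuous_logClamp (R := R) hc).intervalIntegrable (μ := volume) 0 y)
    (fun s _ => logClamp_ge (R := R) hc s)
  rw [intervalIntegral.integral_const, smul_eq_mul, sub_zero] at this
  rw [entProfile]; linarith

theorem entProfile_const (hc : 0 < c) : entProfile c R c = c + c * Real.log c := by
  have : entProfile c R c = ∫ _ in (0 : ℝ)..c, (1 + Real.log c) := by
    refine intervalIntegral.integral_congr fun s hs => ?_
    rw [uIcc_of_le hc.le] at hs
    simp only [logClamp]
    rw [max_eq_left ((min_le_left _ _).trans hs.2)]
  rw [this, intervalIntegral.integral_const, smul_eq_mul]; ring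

theorem integral_one_add_log (y : ℝ) :
    ∫ s in c..y, (1 + Real.log s) = y * Real.log y - c * Real.log c := by
  rw [intervalIntegral.integral_add intervalIntegrable_const
    intervalIntegral.intervalIntegrable_log', integral_log, intervalIntegral.integral_const,
    smul_eq_mul]
  ring

theorem entProfile_eq_add (hc : 0 < c) (y : ℝ) :
    entProfile c R y = c + c * Real.log c + ∫ s in c..y, logClamp c R s := by
  have hi : ∀ a b, IntervalIntegrable (logClamp c R) volume a b := fun a b =>
    (continuous_logClamp hc).intervalIntegrable a b
  rw [← entProfile_const (R := R) hc, entProfile, entProfile,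
    intervalIntegral.integral_add_adjacent_intervals (hi _ _) (hi _ _)]

/-- The additive constant `c` comes from the interval `[0, c]`: there the clamped derivative
integrates to `c + c log c`, whereas the exact derivative of `y log y` integrates to `c log c`. -/
theorem entProfile_eq (hc : 0 < c) {y : ℝ} (h1 : c ≤ y) (h2 : y ≤ R) :
    entProfile c R y = y * Real.log y + c := by
  have : ∫ s in c..y, logClamp c R s = ∫ s in c..y, (1 + Real.log s) := by
    refine intervalIntegral.integral_congr fun s hs => ?_
    rw [uIcc_of_le h1] at hs
    exact logClamp_of_mem hs.1 (hs.2.trans h2)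
  rw [entProfile_eq_add hc, this, integral_one_add_log]; ring

/-- For `y ≥ c` clamping at `R` can only lower the derivative. -/
theorem entProfile_le (hc : 0 < c) {y : ℝ} (h1 : c ≤ y) :
    entProfile c R y ≤ y * Real.log y + c := by
  have := intervalIntegral.integral_mono_on h1
    ((continuous_logClamp (R := R) hc).intervalIntegrable (μ := volume) c y)
    (intervalIntegrable_const.add intervalIntegral.intervalIntegrable_log')
    (g := fun s => 1 + Real.log s) (fun s hs => by
      rw [logClamp]
      have : max c (min s R) ≤ s := max_le hs.1 (min_le_left _ _)
      have := Real.log_le_log (hc.trans_le (le_max_left _ _)) this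
      linarith)
  rw [integral_one_add_log] at this
  rw [entProfile_eq_add hc]; linarith

end Profile

section Truncated

variable {n T c R : ℝ} {W : Coll d → ℝ} {f₀ : L1 d} {f : ℝ → L1 d}

/-- The initial states that can be affected by collisions in the ball of radius `n` up to
time `T`. -/
def active (d : ℕ) (n T : ℝ) : Set (Phase d) := {z | ‖z.1‖ ≤ n * (1 + T) ∧ ‖z.2‖ ≤ n}

theorem measurableSet_active (n T : ℝ) : MeasurableSet (active d n T) :=
  (measurableSet_le (f := fun z : Phase d => ‖z.1‖) (by fun_prop) measurable_const).inter
    (measurableSet_le (f := fun z : Phase d => ‖z.2‖) (by fun_prop) measurable_const)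

theorem measure_active_lt_top (n T : ℝ) : volume (active d n T) < ⊤ := by
  have : active d n T ⊆ Metric.closedBall 0 (max (n * (1 + T)) n) := fun z hz => by
    rw [mem_closedBall_zero_iff, Prod.norm_def]
    exact max_le_max hz.1 hz.2
  exact (measure_mono this).trans_lt measure_closedBall_lt_top

/-- A particle found in the ball of radius `n` at time `s` has travelled at most `T n` since time
zero, which explains the radius `n (1 + T)` of the active set. -/
theorem shift_neg_mem_active {s : ℝ} (hs : s ∈ Icc 0 T) {z : Phase d} (h1 : ‖z.1‖ ≤ n)
    (h2 : ‖z.2‖ ≤ n) : shift (-s) z ∈ active d n T := by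
  refine ⟨?_, h2⟩
  have h3 : ‖s • z.2‖ ≤ T * n := by
    rw [norm_smul, Real.norm_of_nonneg hs.1]
    exact mul_le_mul hs.2 h2 (norm_nonneg _) (hs.1.trans hs.2)
  calc ‖(shift (-s) z).1‖ = ‖z.1 - s • z.2‖ := by simp only [shift]; congr 1; rw [neg_smul]; abel
    _ ≤ ‖z.1‖ + ‖s • z.2‖ := norm_sub_le _ _
    _ ≤ n + T * n := add_le_add h1 h3
    _ = _ := by ring

/-- The weight of the active set. -/
noncomputable def actInd (d : ℕ) (n T : ℝ) : Phase d → ℝ := (active d n T).indicator 1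

theorem measurable_actInd : Measurable (actInd d n T) :=
  measurable_one.indicator (measurableSet_active n T)

theorem actInd_of_mem {z : Phase d} (h : z ∈ active d n T) : actInd d n T z = 1 :=
  indicator_of_mem h _

theorem actInd_of_notMem {z : Phase d} (h : z ∉ active d n T) : actInd d n T z = 0 :=
  indicator_of_notMem h _

theorem abs_actInd_le (z : Phase d) : |actInd d n T z| ≤ 1 := by
  by_cases h : z ∈ active d n T
  · rw [actInd_of_mem h, abs_one]
  · rw [actInd_of_notMem h, abs_zero]; exact zero_le_one

/-- Entropy production of the truncated collision operator. -/
theorem dissW_truncation_eq (hW : IsCutoff n W) (hc : 0 < c) (hcR : c ≤ R) {g : L1 d}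
    (hi : Integrable (rate W fun z => min (g z) R) (collMeasure d)) {s : ℝ} (hs : s ∈ Icc 0 T)
    (hlow : ∀ᵐ z, z ∈ active d n T → c ≤ alongChar s g z) :
    (∫ z, actInd d n T z * (logClamp c R (alongChar s g z)
        * alongChar s (collQ W fun z => min (g z) R) z)) ≤ 0 ∧
      dissW W (fun z => min (g z) R) = ENNReal.ofReal (- ∫ z, actInd d n T z *
        (logClamp c R (alongChar s g z) * alongChar s (collQ W fun z => min (g z) R) z)) := by
  set q : Phase d → ℝ := fun z => min (g z) R with hq
  -- A bounded test function that equals `1 + log (min (g z) R)` at every state in the ball of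
  -- radius `n`. The height of the clamp is the height at which the collision operator truncates, so
  -- entropy production and dissipation match exactly.
  let ψ : Phase d → ℝ := fun z => actInd d n T (shift (-s) z) * logClamp c R (g z)
  have hgm : Measurable g := (Lp.stronglyMeasurable g).measurable
  have hψm : Measurable ψ := (measurable_actInd.comp (continuous_shift (-s)).measurable).mul
    ((continuous_logClamp hc).measurable.comp hgm)
  have hψC : ∀ z, |ψ z| ≤ 1 + |Real.log c| + |Real.log R| := fun z => by
    rw [abs_mul]
    refine (mul_le_of_le_one_left (abs_nonneg _) (abs_actInd_le _)).trans ?_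
    exact (isProfile_entProfile hc hcR).bounded _
  have e1 : ∫ z, actInd d n T z * (logClamp c R (alongChar s g z) * alongChar s (collQ W q) z)
      = ∫ z, ψ z * collQ W q z := by
    rw [← integral_comp_shift s (fun z => ψ z * collQ W q z)]
    refine integral_congr_ae ?_
    filter_upwards [coeFn_alongChar s g, coeFn_alongChar s (collQ W q)] with z h1 h2
    simp only [ψ]
    rw [h1, h2, shift_neg_shift, mul_assoc]
  obtain ⟨i2, e2⟩ := integral_collIntegrand hW.toIsCollWeight hi (ψ := ψ)
    (hi.bdd_mul (c := 1 + |Real.log c| + |Real.log R|)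
      (hψm.comp measurable_fst).aestronglyMeasurable (Eventually.of_forall fun c => hψC _))
    (hi.bdd_mul (c := 1 + |Real.log c| + |Real.log R|)
      (hψm.comp continuous_post.measurable).aestronglyMeasurable
      (Eventually.of_forall fun c => hψC _))
  have hlow' : ∀ᵐ z, ‖z.1‖ ≤ n ∧ ‖z.2‖ ≤ n → c ≤ q z ∧ ψ z = 1 + Real.log (q z) := by
    have h1 : ∀ᵐ z, z ∈ active d n T → c ≤ g (shift s z) := by
      filter_upwards [hlow, coeFn_alongChar s g] with z h1 h2 hz
      rw [← h2]; exact h1 hz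
    filter_upwards [ae_comp_shift (-s) h1] with z hz hn
    have hm := shift_neg_mem_active hs hn.1 hn.2
    have h3 := hz hm
    rw [shift_shift_neg] at h3
    have h4 : c ≤ min (g z) R := le_min h3 hcR
    refine ⟨h4, ?_⟩
    simp only [ψ]
    rw [actInd_of_mem hm, one_mul, logClamp, max_eq_right h4]
  have hpt : ∀ᵐ p ∂collMeasure d,
      0 ≤ collGrad ψ p * (postProd q p - preProd q p) * W p ∧
      dissDensity (postProd q p) (preProd q p) * ENNReal.ofReal (W p)
        = ENNReal.ofReal (collGrad ψ p * (postProd q p - preProd q p) * W p) := by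
    filter_upwards [quasi_fst.ae hlow', quasi_snd.ae hlow', quasi_post.ae hlow',
      quasi_postS.ae hlow'] with p h1 h2 h3 h4
    by_cases hp : W p = 0
    · rw [hp]; simp
    · obtain ⟨g1, g2⟩ := hW.supp p hp
      obtain ⟨g3, g4⟩ := hW.supp_post hp
      obtain ⟨a1, b1⟩ := h1 g1
      obtain ⟨a2, b2⟩ := h2 g2
      obtain ⟨a3, b3⟩ := h3 g3
      obtain ⟨a4, b4⟩ := h4 g4
      have p1 := hc.trans_le a1
      have p2 := hc.trans_le a2
      have p3 := hc.trans_le a3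
      have p4 := hc.trans_le a4
      -- The constants `1` cancel in the gradient, and the four logarithms combine into those of the
      -- two products.
      have hG : collGrad ψ p = Real.log (postProd q p) - Real.log (preProd q p) := by
        rw [collGrad, b1, b2, b3, b4, postProd, preProd, Real.log_mul p3.ne' p4.ne',
          Real.log_mul p1.ne' p2.ne']
        ring
      have hpp : 0 < postProd q p := mul_pos p3 p4
      have hpr : 0 < preProd q p := mul_pos p1 p2
      have hnn : 0 ≤ (postProd q p - preProd q p)
          * (Real.log (postProd q p) - Real.log (preProd q p)) := by
        rcases le_total (preProd q p) (postProd q p) with h | h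
        · exact mul_nonneg (sub_nonneg.2 h) (sub_nonneg.2 (Real.log_le_log hpr h))
        · exact mul_nonneg_of_nonpos_of_nonpos (sub_nonpos.2 h)
            (sub_nonpos.2 (Real.log_le_log hpp h))
      rw [hG, mul_comm (Real.log _ - _)]
      refine ⟨mul_nonneg hnn (hW.nonneg p), ?_⟩
      rw [dissDensity_of_pos hpp hpr, ENNReal.ofReal_mul hnn]
  have h0 : 0 ≤ᵐ[collMeasure d] fun p => collGrad ψ p * (postProd q p - preProd q p) * W p :=
    hpt.mono fun p h => h.1
  rw [e1, e2]
  have hI := integral_nonneg_of_ae h0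
  refine ⟨by linarith, ?_⟩
  rw [dissW, lintegral_congr_ae (hpt.mono fun p h => h.2),
    ← ofReal_integral_eq_lintegral_ofReal i2 h0, ← ENNReal.ofReal_mul (by norm_num)]
  congr 1; ring

/-- The entropy identity for the problem truncated at height `R`. -/
theorem IsMild.truncated_entropy (hW : IsCutoff n W) (hc : 0 < c) (hcR : c ≤ R)
    (h : IsMild W (fun y => min y R) T f₀ f)
    (hlow : ∀ s ∈ Icc 0 T, ∀ᵐ z, z ∈ active d n T → c ≤ alongChar s (f s) z)
    {t : ℝ} (ht : t ∈ Icc 0 T) :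
    ∫⁻ s in Icc 0 t, dissW W (fun z => min (f s z) R) = ENNReal.ofReal
      ((∫ z, actInd d n T z * entProfile c R (f₀ z))
        - ∫ z, actInd d n T z * entProfile c R (alongChar t (f t) z)) ∧
    (∫ z, actInd d n T z * entProfile c R (alongChar t (f t) z))
      ≤ ∫ z, actInd d n T z * entProfile c R (f₀ z) := by
  have hT : 0 ≤ T := ht.1.trans ht.2
  obtain ⟨F, G, h1, h2, h3, h4⟩ := h.exists_extension hT
  have hFc : Continuous F := continuous_iff_continuousAt.2 fun t => (h1 t).continuousAt
  have hp := isProfile_entProfile hc hcR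
  have hm := (measurable_actInd (d := d) (n := n) (T := T)).aestronglyMeasurable (μ := volume)
  have e := hp.integral_sub_eq hm abs_actInd_le h1 h2 0 t
  have hIc := hp.continuous_integral_deriv hm abs_actInd_le hFc h2
  set I : ℝ → ℝ := fun s => ∫ z, actInd d n T z * (logClamp c R (F s z) * G s z) with hI
  have key : ∀ s ∈ Icc 0 T, I s ≤ 0 ∧ dissW W (fun z => min (f s z) R) = ENNReal.ofReal (-I s) := by
    intro s hs
    have := dissW_truncation_eq hW hc hcR (h.integrable_rate s hs) hs (hlow s hs)
    simp only [hI, (h4 s hs).1, (h4 s hs).2]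
    exact this
  have hsub : Icc 0 t ⊆ Icc 0 T := Icc_subset_Icc_right ht.2
  have e2 : ∫⁻ s in Icc 0 t, dissW W (fun z => min (f s z) R)
      = ENNReal.ofReal (∫ s in (0 : ℝ)..t, -I s) := by
    rw [intervalIntegral.integral_of_le ht.1, ← integral_Icc_eq_integral_Ioc,
      ofReal_integral_eq_lintegral_ofReal]
    · exact setLIntegral_congr_fun measurableSet_Icc fun s hs => (key s (hsub hs)).2
    · exact hIc.neg.integrableOn_Icc
    · exact (ae_restrict_iff' measurableSet_Icc).2 (Eventually.of_forall fun s hs =>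
        neg_nonneg.2 (key s (hsub hs)).1)
  have e3 : ∫ s in (0 : ℝ)..t, I s ≤ 0 := by
    have := intervalIntegral.integral_nonneg (f := fun s => -I s) (μ := volume) ht.1
      (fun s hs => neg_nonneg.2 (key s (hsub hs)).1)
    rw [intervalIntegral.integral_neg] at this
    linarith
  rw [h3, (h4 t ht).1] at e
  refine ⟨?_, by linarith⟩
  rw [e2, intervalIntegral.integral_neg, ← e]
  congr 1; ring

/-- Away from the active set nothing happens along characteristics. -/
theorem IsMild.ae_eq_of_notMem_active {τ : ℝ → ℝ} (hW : IsCutoff n W) (h : IsMild W τ T f₀ f)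
    {t : ℝ} (ht : t ∈ Icc 0 T) :
    ∀ᵐ z, z ∉ active d n T → alongChar t (f t) z = f₀ z := by
  set D : L1 d := alongChar t (f t) - f₀ with hD
  have hDm : Measurable D := (Lp.stronglyMeasurable D).measurable
  -- Pairing with the sign of the displacement `D`, restricted to the complement of the active set,
  -- turns vanishing of an integral into vanishing almost everywhere. The pairing with each
  -- collision term is zero because that term lives on the ball.
  let ψ : Phase d → ℝ := fun z => (1 - actInd d n T z) * Real.sign (D z)
  have hsm : Measurable Real.sign := by
    unfold Real.sign
    exact Measurable.ite measurableSet_Iio measurable_const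
      (Measurable.ite measurableSet_Ioi measurable_const measurable_const)
  have hψm : Measurable ψ := (measurable_const.sub measurable_actInd).mul (hsm.comp hDm)
  have hψC : ∀ z, |ψ z| ≤ 1 := fun z => by
    simp only [ψ]
    rw [abs_mul]
    by_cases hz : z ∈ active d n T
    · rw [actInd_of_mem hz]; simp
    · rw [actInd_of_notMem hz]; simpa using abs_sign_le_one _
  obtain ⟨ℓ, hℓ⟩ := exists_pairing (d := d) hψm.aestronglyMeasurable hψC
  have e1 : ℓ D = 0 := by
    rw [hD, h.eq t ht, add_sub_cancel_left, ← ContinuousLinearMap.intervalIntegral_comp_comm]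
    · refine intervalIntegral.integral_zero_ae (Eventually.of_forall fun s hs => ?_)
      rw [uIoc_of_le ht.1] at hs
      have hs' : s ∈ Icc 0 T := ⟨hs.1.le, hs.2.trans ht.2⟩
      rw [hℓ, integral_mul_alongChar]
      refine integral_eq_zero_of_ae ?_
      filter_upwards [hW.collQ_eq_zero (fun z => τ (f s z))] with z hz
      by_cases hn : ‖z.1‖ ≤ n ∧ ‖z.2‖ ≤ n
      · simp only [ψ]
        rw [actInd_of_mem (shift_neg_mem_active hs' hn.1 hn.2)]; simp
      · rw [hz hn]; simp
    · refine ContinuousOn.intervalIntegrable ?_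
      rw [uIcc_of_le ht.1]
      exact (continuousOn_alongChar continuousOn_id h.continuousOn_collQ).mono
        (Icc_subset_Icc_right ht.2)
  rw [hℓ] at e1
  have h0 : ∀ z, 0 ≤ ψ z * D z := fun z => by
    simp only [ψ]
    rw [mul_assoc, sign_mul_eq_abs]
    refine mul_nonneg ?_ (abs_nonneg _)
    have := (abs_le.1 (abs_actInd_le (n := n) (T := T) z)).2
    linarith
  have h1 := (integral_eq_zero_iff_of_nonneg h0
    (integrable_mul_L1 hψm.aestronglyMeasurable hψC D)).1 e1
  filter_upwards [h1, Lp.coeFn_sub (alongChar t (f t)) f₀] with z hz hz2 hn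
  simp only [ψ, Pi.zero_apply] at hz
  rw [actInd_of_notMem hn, sub_zero, one_mul, sign_mul_eq_abs, abs_eq_zero, hD, hz2,
    Pi.sub_apply, sub_eq_zero] at hz
  exact hz

end Truncated

end FuzzyBoltzmann

/-! ### The entropy inequality for weights of bounded support. -/

namespace FuzzyBoltzmann

open Filter Topology

variable {d : ℕ}

/-- The dissipation of a limit is known only through a limit inferior. It is then enough to prove
the inequality with each finite `r` below it in its place, and finiteness comes for free. -/
theorem ne_top_and_add_toReal_le {b : ℝ≥0∞} {X h : ℝ} (h0 : X ≤ h)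
    (hr : ∀ r : NNReal, (r : ℝ≥0∞) < b → X + r ≤ h) : b ≠ ⊤ ∧ X + b.toReal ≤ h := by
  have hb : b ≤ ENNReal.ofReal (h - X) := by
    refine ENNReal.le_of_forall_nnreal_lt fun r hrb => ?_
    have := hr r hrb
    rw [← ENNReal.ofReal_coe_nnreal]
    exact ENNReal.ofReal_le_ofReal (by linarith)
  refine ⟨ne_top_of_le_ne_top ENNReal.ofReal_ne_top hb, ?_⟩
  have := ENNReal.toReal_le_of_le_ofReal (by linarith) hb
  linarith

/-- A version of Fatou's lemma for integrands bounded below. -/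
theorem integrable_of_tendsto_of_frequently_le {α : Type*} [MeasurableSpace α] {μ : Measure α}
    {u v : ℕ → α → ℝ} {g k : α → ℝ} (hu : ∀ n, Integrable (u n) μ) (hv : ∀ n, Integrable (v n) μ)
    (hk : Integrable k μ) (h0 : ∀ n, ∀ᵐ z ∂μ, 0 ≤ u n z + v n z)
    (hg : ∀ᵐ z ∂μ, Tendsto (fun n => u n z) atTop (𝓝 (g z)))
    (hvk : ∀ᵐ z ∂μ, Tendsto (fun n => v n z) atTop (𝓝 (k z)))
    (hvi : Tendsto (fun n => ∫ z, v n z ∂μ) atTop (𝓝 (∫ z, k z ∂μ)))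
    {b : ℕ → ℝ} {B : ℝ} (hb : ∀ n, ∫ z, u n z ∂μ ≤ b n) (hB : Tendsto b atTop (𝓝 B)) :
    Integrable g μ ∧ ∫ z, g z ∂μ ≤ B := by
  have := integrable_of_tendsto_of_integral_le (u := fun n z => u n z + v n z)
    (g := fun z => g z + k z) (b := fun n => b n + ∫ z, v n z ∂μ) (B := B + ∫ z, k z ∂μ)
    (fun n => (hu n).add (hv n)) h0
    (by filter_upwards [hg, hvk] with z h1 h2 using h1.add h2)
    (fun n => by rw [integral_add (hu n) (hv n)]; have := hb n; linarith) (hB.add hvi)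
  have hgi : Integrable g μ := by
    refine (this.1.sub hk).congr (Eventually.of_forall fun z => ?_)
    simp
  refine ⟨hgi, ?_⟩
  have h2 := this.2
  rw [integral_add hgi hk] at h2
  linarith

section

variable {n T : ℝ} {W : Coll d → ℝ} {f₀ : L1 d} {f : ℝ → L1 d}

theorem tendsto_alongChar {ι : Type*} {l : Filter ι} (t : ℝ) {G : ι → L1 d} {g : L1 d}
    (h : Tendsto G l (𝓝 g)) : Tendsto (fun i => alongChar t (G i)) l (𝓝 (alongChar t g)) := by
  rw [tendsto_iff_norm_sub_tendsto_zero] at h ⊢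
  refine h.congr fun i => ?_
  rw [← alongChar_sub, norm_alongChar]

/-- Limit of the truncated entropies. -/
theorem integrable_entropy_of_truncated {c X : ℝ} (hc : 0 < c) {R : ℕ → ℝ}
    (hR : Tendsto R atTop atTop) (hcR : ∀ N, c ≤ R N) {G : ℕ → L1 d} {F : L1 d}
    (hG : Tendsto G atTop (𝓝 F)) (hG0 : ∀ N, 0 ≤ G N)
    (hlow : ∀ N, ∀ᵐ z, z ∈ active d n T → c ≤ G N z)
    (hX : ∀ᶠ N in atTop, ∫ z, actInd d n T z * entProfile c (R N) (G N z) ≤ X) :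
    Integrable (fun z => actInd d n T z * (F z * Real.log (F z) + c)) ∧
      ∫ z, actInd d n T z * (F z * Real.log (F z) + c) ≤ X := by
  have hK0 : ∀ z, 0 ≤ actInd d n T z := fun z => indicator_nonneg (fun _ _ => zero_le_one) z
  have hKm := measurable_actInd (d := d) (n := n) (T := T)
  obtain ⟨N₀, hN₀⟩ := eventually_atTop.1 hX
  have hG' := (tendsto_add_atTop_iff_nat N₀).2 hG
  obtain ⟨φ, hφ, hae⟩ := (tendstoInMeasure_of_tendsto_Lp hG').exists_seq_tendsto_ae
  obtain ⟨θ, hθ, hθN, hae⟩ : ∃ θ : ℕ → ℕ, Tendsto θ atTop atTop ∧ (∀ N, N₀ ≤ θ N) ∧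
      ∀ᵐ z, Tendsto (fun N => G (θ N) z) atTop (𝓝 (F z)) :=
    ⟨fun N => φ N + N₀, (tendsto_add_atTop_nat N₀).comp hφ.tendsto_atTop,
      fun N => Nat.le_add_left _ _, hae⟩
  obtain ⟨C, hC⟩ : ∃ C, C = |Real.log c| := ⟨_, rfl⟩
  have hC0 : 0 ≤ C := hC ▸ abs_nonneg _
  have hψm : Measurable fun z => C * actInd d n T z := hKm.const_mul _
  have hψC : ∀ z, |C * actInd d n T z| ≤ C * 1 := fun z => by
    rw [abs_mul, abs_of_nonneg hC0]
    exact mul_le_mul_of_nonneg_left (abs_actInd_le z) hC0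
  obtain ⟨ℓ, hℓ⟩ := exists_pairing (d := d) hψm.aestronglyMeasurable hψC
  have hvi : ∀ G : L1 d, Integrable fun z => C * actInd d n T z * G z := fun G =>
    integrable_mul_L1 hψm.aestronglyMeasurable hψC G
  have hint : ∀ N (F : L1 d), Integrable fun z => actInd d n T z * entProfile c (R N) (F z) :=
    fun N F => integrable_weight_mul hKm.aestronglyMeasurable abs_actInd_le
      ((isProfile_entProfile hc (hcR N)).integrable F)
  have hall : ∀ᵐ z, ∀ N, 0 ≤ G N z ∧ (z ∈ active d n T → c ≤ G N z) :=
    ae_all_iff.2 fun N => by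
      filter_upwards [ae_nonneg (hG0 N), hlow N] with z h1 h2 using ⟨h1, h2⟩
  have hvk : ∀ᵐ z, Tendsto (fun N => C * actInd d n T z * G (θ N) z) atTop
      (𝓝 (C * actInd d n T z * F z)) := by
    filter_upwards [hae] with z hz using hz.const_mul _
  have hvl : Tendsto (fun N => ∫ z, C * actInd d n T z * G (θ N) z) atTop
      (𝓝 (∫ z, C * actInd d n T z * F z)) := by
    simp only [← hℓ]
    exact (ℓ.continuous.tendsto F).comp (hG.comp hθ)
  -- The profile is at least `-C y`, so adding `C y` on the active set makes the integrand
  -- nonnegative. The added integral converges because it is linear in `G`.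
  have h0 : ∀ N, ∀ᵐ z, 0 ≤ actInd d n T z * entProfile c (R (θ N)) (G (θ N) z)
      + C * actInd d n T z * G (θ N) z := fun N => by
    filter_upwards [hall] with z hz
    have := entProfile_ge (R := R (θ N)) hc (hz (θ N)).1
    rw [← hC] at this
    have := mul_le_mul_of_nonneg_left this (hK0 z)
    linarith
  have hg : ∀ᵐ z, Tendsto (fun N => actInd d n T z * entProfile c (R (θ N)) (G (θ N) z)) atTop
      (𝓝 (actInd d n T z * (F z * Real.log (F z) + c))) := by
    filter_upwards [hae, hall] with z hz hzl
    by_cases hzK : z ∈ active d n T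
    · have h1 : Tendsto (fun N => G (θ N) z * Real.log (G (θ N) z) + c) atTop
          (𝓝 (F z * Real.log (F z) + c)) :=
        ((Real.continuous_mul_log.tendsto (F z)).comp hz).add_const c
      refine (h1.const_mul (actInd d n T z)).congr' ?_
      -- Once the values are below `F z + 1` and `R` has passed that level, the profile is exactly
      -- `y log y + c`.
      have h2 : ∀ᶠ N in atTop, G (θ N) z < F z + 1 := hz.eventually_lt_const (by linarith)
      have h3 : ∀ᶠ N in atTop, F z + 1 ≤ R (θ N) := (hR.comp hθ).eventually_ge_atTop _
      filter_upwards [h2, h3] with N h2 h3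
      rw [entProfile_eq hc ((hzl _).2 hzK) (by linarith)]
    · rw [actInd_of_notMem hzK]; simp
  exact integrable_of_tendsto_of_frequently_le (fun N => hint (θ N) (G (θ N)))
    (fun N => hvi (G (θ N))) (hvi F) h0 hg hvk hvl (fun N => hN₀ (θ N) (hθN N)) tendsto_const_nhds

/-- The entropy inequality for the problem with a truncated collision weight. -/
theorem entropy_of_isCutoff (hW : IsCutoff n W) (hf₀ : 0 ≤ f₀)
    (hlow : ∃ c > 0, ∀ᵐ z, z ∈ active d n T → c ≤ f₀ z)
    (hent : Integrable fun z => f₀ z * Real.log (f₀ z))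
    (h : IsMild W id T f₀ f) {t : ℝ} (ht : t ∈ Icc 0 T) :
    Integrable (fun z => f t z * Real.log (f t z)) ∧
      ∫⁻ s in Icc 0 t, dissW W (f s) ≠ ⊤ ∧
      (∫ z, f t z * Real.log (f t z)) + (∫⁻ s in Icc 0 t, dissW W (f s)).toReal
        ≤ ∫ z, f₀ z * Real.log (f₀ z) := by
  have hT : 0 ≤ T := ht.1.trans ht.2
  obtain ⟨Λ, hΛ0, hΛ⟩ := hW.bounded
  obtain ⟨c₀, hc₀, hlow⟩ := hlow
  let R : ℕ → ℝ := fun N => N + 1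
  have hR0 : ∀ N, 0 ≤ R N := fun N => by positivity
  have hR1 : ∀ N, 1 ≤ R N := fun N => by simp [R]
  have hex := fun N => exists_mild hW.toIsCollWeight hΛ0 hΛ (isTruncation_min (hR0 N)) hf₀
  choose g hgm hg using hex
  set lam := Λ * sphArea d * ‖f₀‖ with hlam
  have hlam0 : 0 ≤ lam := mul_nonneg (mul_nonneg hΛ0 sphArea_nonneg) (norm_nonneg _)
  -- The data are at least `c₀` on the active set, and the solution loses at most the factor
  -- `exp(-λT)` up to time `T`. The minimum with `1` puts `c` below every height `R N`.
  set c := min 1 (c₀ * Real.exp (-lam * T)) with hcdef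
  have hc : 0 < c := lt_min one_pos (by positivity)
  have hc1 : c ≤ 1 := min_le_left _ _
  have hcR : ∀ N, c ≤ R N := fun N => hc1.trans (hR1 N)
  have hglow : ∀ N, ∀ s ∈ Icc 0 T, ∀ᵐ z, z ∈ active d n T → c ≤ alongChar s (g N s) z := by
    intro N s hs
    have h1 := (hg N s hs.1).2.2
    filter_upwards [hlow, (Lp.coeFn_le _ _).2 h1,
      Lp.coeFn_smul (Real.exp (-lam * s)) f₀] with z h2 h3 h4 hz
    rw [h4, Pi.smul_apply, smul_eq_mul] at h3
    refine (min_le_right _ _).trans (le_trans ?_ h3)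
    rw [mul_comm]
    have := hs.2
    have h5 : Real.exp (-lam * T) ≤ Real.exp (-lam * s) := Real.exp_le_exp.2 (by nlinarith)
    exact mul_le_mul h5 (h2 hz) hc₀.le (Real.exp_pos _).le
  have hmild0 := h.zero_eq hT
  have hconv : ∀ s ∈ Icc 0 T, Tendsto (fun N => g N s) atTop (𝓝 (f s)) := by
    obtain ⟨ρ, hρ⟩ := isCompact_Icc.exists_bound_of_continuousOn h.continuousOn
    refine tendsto_of_isMild hΛ0 hW.toIsCollWeight hΛ (fun _ => hW.toIsCollWeight) (fun _ => hΛ)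
      (fun c => tendsto_const_nhds) (fun N => isTruncation_min (hR0 N)) (fun y => ?_) h
      (fun N => hgm N T) tendsto_const_nhds (ρ := max ρ ‖f₀‖)
      (fun s hs => (hρ s hs).trans (le_max_left _ _))
      (fun N s hs => (hg N s hs.1).2.1.le.trans (le_max_right _ _))
    refine tendsto_const_nhds.congr' ?_
    filter_upwards [eventually_ge_atTop ⌈y⌉₊] with N hN
    have : y ≤ N := (Nat.le_ceil y).trans (by exact_mod_cast hN)
    rw [min_eq_left]
    simp only [R]; linarith
  -- the bound for the truncated problems
  set K := actInd d n T with hK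
  have hKm : Measurable K := measurable_actInd
  have hK0 : ∀ z, 0 ≤ K z := fun z => indicator_nonneg (fun _ _ => zero_le_one) z
  have hKi : Integrable K :=
    (integrable_indicator_iff (measurableSet_active n T)).2
      (integrableOn_const (measure_active_lt_top n T).ne)
  have hKφ : ∀ u : Phase d → ℝ, Integrable u → Integrable fun z => K z * u z := fun u hu =>
    integrable_weight_mul hKm.aestronglyMeasurable abs_actInd_le hu
  set A := (∫ z, K z * (f₀ z * Real.log (f₀ z))) + c * ∫ z, K z with hA
  have hprof := fun N => isProfile_entProfile hc (hcR N)
  have hint : ∀ N (F : L1 d), Integrable fun z => K z * entProfile c (R N) (F z) := fun N F =>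
    hKφ _ ((hprof N).integrable F)
  have hAN : ∀ N, ∫ z, K z * entProfile c (R N) (f₀ z) ≤ A := by
    intro N
    rw [hA, ← integral_const_mul, ← integral_add (hKφ _ hent) (hKi.const_mul c)]
    refine integral_mono_ae (hint N f₀) ((hKφ _ hent).add (hKi.const_mul c)) ?_
    filter_upwards [hglow 0 0 ⟨le_rfl, hT⟩] with z hz
    rw [(hgm 0 T).zero_eq hT, alongChar_zero] at hz
    by_cases hzK : z ∈ active d n T
    · have := entProfile_le (R := R N) hc (hz hzK)
      simp only [hK]
      rw [actInd_of_mem hzK]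
      linarith
    · simp only [hK]
      rw [actInd_of_notMem hzK]; simp
  set b := ∫⁻ s in Icc 0 t, dissW W (f s) with hb
  let bN : ℕ → ℝ≥0∞ := fun N => ∫⁻ s in Icc 0 t, dissW W fun z => min (g N s z) (R N)
  have hbN : ∀ N, (∫ z, K z * entProfile c (R N) (alongChar t (g N t) z)) + (bN N).toReal ≤ A := by
    intro N
    obtain ⟨h1, h2⟩ := (hgm N T).truncated_entropy hW hc (hcR N) (hglow N) ht
    have : (bN N).toReal = (∫ z, K z * entProfile c (R N) (f₀ z))
        - ∫ z, K z * entProfile c (R N) (alongChar t (g N t) z) := by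
      simp only [bN]
      rw [h1, ENNReal.toReal_ofReal (by linarith)]
    rw [this]
    have := hAN N
    linarith
  have hbt : ∀ N, bN N ≠ ⊤ := fun N => by
    obtain ⟨h1, -⟩ := (hgm N T).truncated_entropy hW hc (hcR N) (hglow N) ht
    simp only [bN]
    rw [h1]; exact ENNReal.ofReal_ne_top
  have hsub : Icc 0 t ⊆ Icc 0 T := Icc_subset_Icc_right ht.2
  -- Fatou's lemma in time, combined with the lower semicontinuity of the dissipation at each fixed
  -- time.
  have hblim : b ≤ liminf bN atTop := by
    have hm : ∀ N, AEMeasurable (fun s => dissW W fun z => min (g N s z) (R N))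
        (volume.restrict (Icc 0 t)) := by
      intro N
      obtain ⟨F, G, h1, -, -, h4⟩ := (hgm N T).exists_extension hT
      have hFc : Continuous F := continuous_iff_continuousAt.2 fun t => (h1 t).continuousAt
      have hFc' : Continuous fun s => alongChar (-s) (F s) :=
        continuous_alongChar.comp (continuous_neg.prodMk hFc)
      refine (measurable_dissW hW.measurable (isTruncation_min (hR0 N)).lipschitz
        hFc').aemeasurable.congr ?_
      refine (ae_restrict_iff' measurableSet_Icc).2 (Eventually.of_forall fun s hs => ?_)
      simp only [(h4 s (hsub hs)).1, alongChar_neg_self]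
    refine le_trans ?_ (lintegral_liminf_le' hm)
    refine lintegral_mono_ae ((ae_restrict_iff' measurableSet_Icc).2
      (Eventually.of_forall fun s hs => ?_))
    refine dissW_le_liminf (V := fun _ => W) (fun _ => hW.measurable)
      (fun c => Eventually.of_forall fun _ => rfl) (τ := fun N y => min y (R N)) (σ := id)
      (fun N => (isTruncation_min (hR0 N)).lipschitz) (fun y => ?_) (hconv s (hsub hs))
    refine tendsto_const_nhds.congr' ?_
    filter_upwards [eventually_ge_atTop ⌈y⌉₊] with N hN
    have : y ≤ N := (Nat.le_ceil y).trans (by exact_mod_cast hN)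
    rw [min_eq_left, id]
    simp only [R]; linarith
  -- passage to the limit in the entropy
  obtain ⟨F, hF⟩ : ∃ F, F = alongChar t (f t) := ⟨_, rfl⟩
  have hFlim : Tendsto (fun N => alongChar t (g N t)) atTop (𝓝 F) :=
    hF ▸ tendsto_alongChar t (hconv t ht)
  have hRt : Tendsto R atTop atTop :=
    tendsto_atTop_add_const_right _ _ tendsto_natCast_atTop_atTop
  have hlimit := fun X => integrable_entropy_of_truncated (n := n) (T := T) (X := X) hc hRt hcR hFlim
    (fun N => alongChar_nonneg t (hg N t ht.1).1) (fun N => hglow N t ht)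
  obtain ⟨hi1, hX0⟩ := hlimit A (Eventually.of_forall fun N => by
    have := hbN N
    have : 0 ≤ (bN N).toReal := ENNReal.toReal_nonneg
    linarith)
  -- If `r < b`, then eventually the dissipation of the truncated problems exceeds `r`, so their
  -- entropies are below `A - r`, and so is the limit.
  have hbr := ne_top_and_add_toReal_le (b := b) hX0 (fun r hr => by
    have := eventually_lt_of_lt_liminf (hr.trans_le hblim)
    have := (hlimit (A - r) (by
      filter_upwards [this] with N hN
      have h1 := hbN N
      have h2 : (r : ℝ) ≤ (bN N).toReal := by
        have := ENNReal.toReal_mono (hbt N) hN.le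
        simpa using this
      linarith)).2
    linarith)
  -- conclusion
  have hi2 : Integrable fun z => K z * (F z * Real.log (F z)) := by
    refine (hi1.sub (hKi.const_mul c)).congr (Eventually.of_forall fun z => ?_)
    simp only [Pi.sub_apply]; ring
  have hi3 : Integrable fun z => f₀ z * Real.log (f₀ z) - K z * (f₀ z * Real.log (f₀ z)) :=
    hent.sub (hKφ _ hent)
  -- Outside the active set the solution read along characteristics equals the data. The entropy
  -- there is unchanged and cancels, so no lower bound on the data is needed there.
  have hdecomp : (fun z => F z * Real.log (F z)) =ᵐ[volume] fun z => K z * (F z * Real.log (F z))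
      + (f₀ z * Real.log (f₀ z) - K z * (f₀ z * Real.log (f₀ z))) := by
    filter_upwards [h.ae_eq_of_notMem_active hW ht] with z hz
    by_cases hzK : z ∈ active d n T
    · simp only [hK]
      rw [actInd_of_mem hzK]; ring
    · simp only [hK]
      rw [actInd_of_notMem hzK, hF, hz hzK]; ring
  have hiF : Integrable fun z => F z * Real.log (F z) := (hi2.add hi3).congr hdecomp.symm
  have hFf : (fun z => F z * Real.log (F z)) =ᵐ[volume]
      fun z => f t (shift t z) * Real.log (f t (shift t z)) := by
    filter_upwards [coeFn_alongChar t (f t)] with z hz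
    rw [hF, hz]
  have hif : Integrable fun z => f t z * Real.log (f t z) :=
    ((mp_shift t).integrable_comp_emb (shiftEquiv t).measurableEmbedding).1 (hiF.congr hFf)
  refine ⟨hif, hbr.1, ?_⟩
  have e1 : ∫ z, f t z * Real.log (f t z) = ∫ z, F z * Real.log (F z) := by
    rw [integral_congr_ae hFf, integral_comp_shift t fun z => f t z * Real.log (f t z)]
  have e2 : ∫ z, K z * (F z * Real.log (F z) + c)
      = (∫ z, K z * (F z * Real.log (F z))) + c * ∫ z, K z := by
    rw [← integral_const_mul, ← integral_add hi2 (hKi.const_mul c)]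
    refine integral_congr_ae (Eventually.of_forall fun z => ?_)
    simp only; ring
  have h2 := hbr.2
  rw [e1, integral_congr_ae hdecomp, integral_add hi2 hi3, integral_sub hent (hKφ _ hent)]
  rw [e2] at h2
  linarith

end

end FuzzyBoltzmann

/-! ### A reference density, limits of moments, and lower semicontinuity of the entropy. -/

namespace FuzzyBoltzmann

open Filter Topology

variable {d : ℕ}

section Reference

/-- A positive reference density with finite moments. -/
noncomputable def refDens (z : Phase d) : ℝ := Real.exp (-‖z‖)

theorem continuous_refDens : Continuous (refDens : Phase d → ℝ) := by unfold refDens; fun_prop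

theorem refDens_pos (z : Phase d) : 0 < refDens z := Real.exp_pos _

/-- From `s^m / m! ≤ exp s` with `s = 1 + ‖z‖` and `m = k + D`: the product decays like `(1 +
‖z‖)^(-D)`, and `D` exceeds the dimension. -/
theorem integrable_mul_refDens {w : Phase d → ℝ} (hw : Measurable w) {k : ℕ}
    (hk : ∀ z, |w z| ≤ (1 + ‖z‖) ^ k) : Integrable fun z => w z * refDens z := by
  set D := Module.finrank ℝ (Phase d) + 1
  have h1 : Integrable fun z : Phase d => (1 + ‖z‖) ^ (-(D : ℝ)) :=
    integrable_one_add_norm (by simp [D])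
  refine (h1.const_mul ((k + D).factorial * Real.exp 1)).mono'
    (hw.mul continuous_refDens.measurable).aestronglyMeasurable (Eventually.of_forall fun z => ?_)
  have hs : 0 < 1 + ‖z‖ := by positivity
  have h2 := Real.pow_div_factorial_le_exp (1 + ‖z‖) hs.le (k + D)
  rw [div_le_iff₀ (by positivity), Real.exp_add] at h2
  rw [norm_mul, Real.norm_eq_abs, Real.norm_of_nonneg (refDens_pos z).le, Real.rpow_neg hs.le,
    Real.rpow_natCast, refDens, Real.exp_neg, ← div_eq_mul_inv, ← div_eq_mul_inv,
    div_le_div_iff₀ (Real.exp_pos _) (by positivity)]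
  calc |w z| * (1 + ‖z‖) ^ D ≤ (1 + ‖z‖) ^ k * (1 + ‖z‖) ^ D := by gcongr; exact hk z
    _ = (1 + ‖z‖) ^ (k + D) := (pow_add _ _ _).symm
    _ ≤ _ := by linarith

theorem integrable_refDens : Integrable (refDens : Phase d → ℝ) := by
  have := integrable_mul_refDens (d := d) (w := fun _ => 1) measurable_const (k := 0) (by simp)
  simpa using this

theorem norm_sq_le_kin_add_pos (z : Phase d) : ‖z‖ ^ 2 ≤ kin z + pos z := by
  unfold kin pos
  rw [Prod.norm_def]
  rcases max_cases ‖z.1‖ ‖z.2‖ with h | h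
  · rw [h.1]; nlinarith [sq_nonneg ‖z.2‖]
  · rw [h.1]; nlinarith [sq_nonneg ‖z.1‖]

theorem kin_le (z : Phase d) : kin z ≤ (1 + ‖z‖) ^ 2 := by
  have := norm_snd_le z
  have := norm_nonneg z.2
  unfold kin; nlinarith

theorem pos_le (z : Phase d) : pos z ≤ (1 + ‖z‖) ^ 2 := by
  have := norm_fst_le z
  have := norm_nonneg z.1
  unfold pos; nlinarith

theorem integrable_kin_rpow_mul_refDens {q : ℝ} (hq : q ≤ 2) :
    Integrable fun z : Phase d => kin z ^ q * refDens z := by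
  refine integrable_mul_refDens (continuous_kin.measurable.pow_const q) (k := 4) fun z => ?_
  rw [abs_of_nonneg (kin_rpow_nonneg _ _)]
  calc kin z ^ q ≤ kin z ^ (2 : ℝ) := kin_rpow_le_rpow hq z
    _ = kin z ^ 2 := by norm_cast
    _ ≤ ((1 + ‖z‖) ^ 2) ^ 2 := by have := kin_pos z; gcongr; exact kin_le z
    _ = _ := by ring

theorem integrable_pos_mul_refDens : Integrable fun z : Phase d => pos z * refDens z :=
  integrable_mul_refDens continuous_pos.measurable (k := 2) fun z => by
    rw [abs_of_pos (pos_pos z)]; exact pos_le z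

theorem integrable_norm_mul_refDens : Integrable fun z : Phase d => ‖z‖ * refDens z :=
  integrable_mul_refDens (by fun_prop) (k := 1) fun z => by
    rw [abs_of_nonneg (norm_nonneg z)]; linarith

theorem refDens_mul_log (z : Phase d) :
    refDens z * Real.log (refDens z) = -(‖z‖ * refDens z) := by
  rw [refDens, Real.log_exp]; ring

/-- Nonnegativity of the relative entropy density with respect to `exp(-‖z‖)`, that is, `log s ≤ s -
1` with `s = refDens z / y`. It bounds the negative part of `y log y` by the first moment. -/
theorem mul_log_ge {y : ℝ} (hy : 0 ≤ y) (z : Phase d) :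
    -(‖z‖ * y) + y - refDens z ≤ y * Real.log y := by
  rcases hy.eq_or_lt with rfl | hy
  · have := refDens_pos z; simp; exact this.le
  · have h := Real.log_le_sub_one_of_pos (div_pos (refDens_pos z) hy)
    rw [Real.log_div (refDens_pos z).ne' hy.ne'] at h
    have h2 := mul_le_mul_of_nonneg_left h hy.le
    have e : y * (refDens z / y - 1) = refDens z - y := by field_simp
    have e2 : Real.log (refDens z) = -‖z‖ := by rw [refDens, Real.log_exp]
    rw [e, e2] at h2
    linarith

end Reference

section Moments

variable {w u : Phase d → ℝ}

theorem integrable_abs_of_nonneg {g : L1 d} (hg : 0 ≤ g) (h : Integrable fun z => w z * g z) :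
    Integrable (fun z => w z * |g z|) ∧ ∫ z, w z * |g z| = ∫ z, w z * g z := by
  have e : (fun z => w z * g z) =ᵐ[volume] fun z => w z * |g z| := by
    filter_upwards [ae_nonneg hg] with z hz
    rw [abs_of_nonneg hz]
  exact ⟨h.congr e, (integral_congr_ae e).symm⟩

/-- Fatou's lemma for moments along sequences converging in `L¹`. -/
theorem integrable_moment_of_tendsto (hw0 : ∀ z, 0 ≤ w z) {G : ℕ → L1 d} {g : L1 d}
    (hG : Tendsto G atTop (𝓝 g)) (hi : ∀ n, Integrable fun z => w z * |G n z|) {b : ℕ → ℝ} {B : ℝ}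
    (hb : ∀ n, ∫ z, w z * |G n z| ≤ b n) (hB : Tendsto b atTop (𝓝 B)) :
    Integrable (fun z => w z * |g z|) ∧ ∫ z, w z * |g z| ≤ B := by
  obtain ⟨φ, hφ, hae⟩ := (tendstoInMeasure_of_tendsto_Lp hG).exists_seq_tendsto_ae
  refine integrable_of_tendsto_of_integral_le (fun n => hi (φ n))
    (fun n => Eventually.of_forall fun z => mul_nonneg (hw0 z) (abs_nonneg _)) ?_
    (fun n => hb (φ n)) (hB.comp hφ.tendsto_atTop)
  filter_upwards [hae] with z hz using hz.abs.const_mul _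

/-- Convergence of lower moments from bounds for higher moments. -/
theorem tendsto_integral_of_moment {ι : Type*} {l : Filter ι}
    (hu0 : ∀ z, 0 ≤ u z) (hw0 : ∀ z, 0 ≤ w z) (huw : ∀ R, 1 ≤ R → ∀ z, u z ≤ R + w z / R)
    {G : ι → L1 d} {g : L1 d} (hG : Tendsto G l (𝓝 g)) {M : ℝ}
    (hi : ∀ᶠ i in l, Integrable (fun z => w z * |G i z|) ∧ ∫ z, w z * |G i z| ≤ M)
    (hg : Integrable (fun z => w z * |g z|) ∧ ∫ z, w z * |g z| ≤ M) :
    Tendsto (fun i => ∫ z, u z * |G i z - g z|) l (𝓝 0) := by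
  have hM : 0 ≤ M := (integral_nonneg fun z => mul_nonneg (hw0 z) (abs_nonneg _)).trans hg.2
  -- Interpolation: `u ≤ R + w / R` gives a multiple of the `L¹` distance plus an error `2 M / R`
  -- that is uniform in the index. First `R` is taken large, then the index.
  have key : ∀ R, 1 ≤ R → ∀ᶠ i in l, ∫ z, u z * |G i z - g z| ≤ R * ‖G i - g‖ + 2 * M / R := by
    intro R hR
    filter_upwards [hi] with i hi
    have hR0 : 0 < R := by linarith
    have hd : ‖G i - g‖ = ∫ z, |G i z - g z| := by
      rw [norm_L1]
      refine integral_congr_ae ?_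
      filter_upwards [Lp.coeFn_sub (G i) g] with z hz
      rw [hz, Pi.sub_apply]
    have i1 : Integrable fun z => |G i z - g z| := ((integrable_L1 _).sub (integrable_L1 _)).abs
    have i2 : Integrable fun z => w z * |G i z| + w z * |g z| := hi.1.add hg.1
    have i3 : Integrable fun z => R * |G i z - g z| + (w z * |G i z| + w z * |g z|) / R :=
      (i1.const_mul R).add (i2.div_const R)
    have hpt : ∀ z, u z * |G i z - g z|
        ≤ R * |G i z - g z| + (w z * |G i z| + w z * |g z|) / R := fun z => by
      calc u z * |G i z - g z| ≤ (R + w z / R) * |G i z - g z| :=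
            mul_le_mul_of_nonneg_right (huw R hR z) (abs_nonneg _)
        _ = R * |G i z - g z| + w z * |G i z - g z| / R := by ring
        _ ≤ R * |G i z - g z| + w z * (|G i z| + |g z|) / R := by
            have := abs_sub (G i z) (g z)
            have := hw0 z
            gcongr
        _ = _ := by ring
    have hmono := integral_mono_of_nonneg (Eventually.of_forall fun z =>
      mul_nonneg (hu0 z) (abs_nonneg _)) i3 (Eventually.of_forall hpt)
    rw [integral_add (i1.const_mul R) (i2.div_const R), integral_const_mul, integral_div,
      integral_add hi.1 hg.1, ← hd] at hmono
    refine hmono.trans (add_le_add le_rfl ?_)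
    have := hi.2
    have := hg.2
    gcongr
    linarith
  rw [tendsto_order]
  refine ⟨fun a ha => Eventually.of_forall fun i => ha.trans_le (integral_nonneg fun z =>
    mul_nonneg (hu0 z) (abs_nonneg _)), fun ε hε => ?_⟩
  obtain ⟨R, hR, hRε⟩ : ∃ R, 1 ≤ R ∧ 2 * M / R < ε / 2 := by
    refine ⟨4 * M / ε + 1, by have : 0 ≤ 4 * M / ε := by positivity
                              linarith, ?_⟩
    have : 0 < 4 * M / ε + 1 := by positivity
    rw [div_lt_iff₀ this]
    have : ε / 2 * (4 * M / ε + 1) = 2 * M + ε / 2 := by field_simp; ring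
    linarith
  have hn := (tendsto_iff_norm_sub_tendsto_zero.1 hG).eventually_lt_const
    (show (0 : ℝ) < ε / (2 * R) by positivity)
  filter_upwards [key R hR, hn] with i h1 h2
  have h3 : R * ‖G i - g‖ < R * (ε / (2 * R)) := by gcongr
  have h4 : R * (ε / (2 * R)) = ε / 2 := by field_simp
  linarith

theorem kin_rpow_le_add {ν R : ℝ} (hν1 : ν ≤ 1) (hR : 1 ≤ R) (z : Phase d) :
    kin z ^ ν ≤ R + kin z ^ (1 + ν) / R := by
  have h0 := kin_pos z
  have h1 := kin_rpow_nonneg (1 + ν) z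
  rcases le_total (kin z) R with h | h
  · have : kin z ^ ν ≤ kin z := by simpa using kin_rpow_le_rpow hν1 z
    have : 0 ≤ kin z ^ (1 + ν) / R := by positivity
    linarith
  · have : kin z ^ ν ≤ kin z ^ (1 + ν) / R := by
      rw [le_div_iff₀ (by linarith), ← kin_rpow_mul_self]
      have := kin_rpow_nonneg ν z
      gcongr
    linarith

theorem norm_le_add {R : ℝ} (hR : 1 ≤ R) (z : Phase d) : ‖z‖ ≤ R + (kin z + pos z) / R := by
  have h0 := norm_sq_le_kin_add_pos z
  have h1 : ‖z‖ ≤ R + ‖z‖ ^ 2 / R := by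
    rcases le_total ‖z‖ R with h | h
    · have : 0 ≤ ‖z‖ ^ 2 / R := by positivity
      linarith
    · have : ‖z‖ ≤ ‖z‖ ^ 2 / R := by
        rw [le_div_iff₀ (by linarith)]
        have := norm_nonneg z
        nlinarith
      linarith
  have : ‖z‖ ^ 2 / R ≤ (kin z + pos z) / R := by gcongr
  linarith

end Moments

section Entropy

theorem integrable_norm_mul {g : L1 d} (hk : Integrable fun z => kin z * g z)
    (hp : Integrable fun z => pos z * g z) : Integrable fun z => ‖z‖ * g z := by
  have h : Integrable fun z => (kin z + pos z) * g z := by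
    exact (hk.add hp).congr (Eventually.of_forall fun z => (add_mul _ _ _).symm)
  refine h.mono ((by fun_prop : Measurable fun z : Phase d => ‖z‖).aestronglyMeasurable.mul
    (integrable_L1 g).1) (Eventually.of_forall fun z => ?_)
  rw [norm_mul, norm_mul, norm_norm,
    Real.norm_of_nonneg (add_pos (kin_pos z) (pos_pos z)).le]
  refine mul_le_mul_of_nonneg_right ?_ (norm_nonneg _)
  have := norm_sq_le_kin_add_pos z
  have := one_le_kin z
  have := one_le_pos z
  by_contra! hlt
  nlinarith

theorem aestronglyMeasurable_mul_log (g : L1 d) :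
    AEStronglyMeasurable (fun z => g z * Real.log (g z)) volume :=
  Real.continuous_mul_log.comp_aestronglyMeasurable (integrable_L1 g).1

theorem integrable_mul_log_of_le {g : L1 d} (hg : 0 ≤ g) (hn : Integrable fun z => ‖z‖ * g z)
    {k : Phase d → ℝ} (hk : Integrable k) (h : ∀ᵐ z, g z * Real.log (g z) ≤ k z) :
    Integrable fun z => g z * Real.log (g z) := by
  have hl : Integrable fun z => -(‖z‖ * g z) + g z - refDens z :=
    (hn.neg.add (integrable_L1 g)).sub integrable_refDens
  refine (hl.abs.add hk.abs).mono' (aestronglyMeasurable_mul_log g) ?_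
  filter_upwards [h, ae_nonneg hg] with z h1 h2
  have h3 := mul_log_ge h2 z
  rw [Real.norm_eq_abs, abs_le, Pi.add_apply]
  have h4 := neg_abs_le (-(‖z‖ * g z) + g z - refDens z)
  have h5 := le_abs_self (k z)
  have h6 := abs_nonneg (k z)
  have h7 := abs_nonneg (-(‖z‖ * g z) + g z - refDens z)
  constructor <;> linarith

/-- A finite entropy says only that the positive part is integrable; the negative part is integrable
because of the first moment. -/
theorem integrable_mul_log_of_entropy {g : L1 d} (hg : 0 ≤ g) (hn : Integrable fun z => ‖z‖ * g z)
    (h : entropy g < ⊤) : Integrable fun z => g z * Real.log (g z) := by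
  have hp : ∫⁻ z, ENNReal.ofReal (g z * Real.log (g z)) ≠ ⊤ := by
    intro htop
    rw [entropy, if_pos htop] at h
    exact lt_irrefl _ h
  have hk : Integrable fun z => max (g z * Real.log (g z)) 0 := by
    refine ⟨(aestronglyMeasurable_mul_log g).sup aestronglyMeasurable_const, ?_⟩
    refine (hasFiniteIntegral_iff_ofReal (f := fun z => max (g z * Real.log (g z)) 0)
      (Eventually.of_forall fun z => le_max_right _ _)).2 ?_
    refine lt_of_eq_of_lt (lintegral_congr fun z => ?_) (lt_top_iff_ne_top.2 hp)
    rw [ENNReal.ofReal_max, ENNReal.ofReal_zero, max_eq_left zero_le]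
  exact integrable_mul_log_of_le hg hn hk (Eventually.of_forall fun z => le_max_left _ _)

theorem entropy_eq {g : L1 d} (h : Integrable fun z => g z * Real.log (g z)) :
    entropy g = ((∫ z, g z * Real.log (g z) : ℝ) : EReal) := by
  have h1 : ∫⁻ z, ENNReal.ofReal (g z * Real.log (g z)) ≠ ⊤ := h.lintegral_lt_top.ne
  have h2 : ∫⁻ z, ENNReal.ofReal (-(g z * Real.log (g z))) ≠ ⊤ := h.neg.lintegral_lt_top.ne
  rw [entropy, if_neg h1, integral_eq_lintegral_pos_part_sub_lintegral_neg_part h, EReal.coe_sub,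
    EReal.coe_ennreal_toReal h1, EReal.coe_ennreal_toReal h2]

/-- Lower semicontinuity of the entropy. -/
theorem integral_mul_log_le_of_tendsto {G : ℕ → L1 d} {g : L1 d} (hG : Tendsto G atTop (𝓝 g))
    (hG0 : ∀ n, 0 ≤ G n) {M : ℝ} (hk : ∀ n, Integrable fun z => kin z * G n z)
    (hp : ∀ n, Integrable fun z => pos z * G n z)
    (hM : ∀ n, (∫ z, kin z * G n z) + ∫ z, pos z * G n z ≤ M)
    (hi : ∀ n, Integrable fun z => G n z * Real.log (G n z)) {h : ℕ → ℝ} {B : ℝ}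
    (hh : ∀ᶠ n in atTop, ∫ z, G n z * Real.log (G n z) ≤ h n) (hB : Tendsto h atTop (𝓝 B)) :
    Integrable (fun z => g z * Real.log (g z)) ∧ ∫ z, g z * Real.log (g z) ≤ B := by
  have hw0 : ∀ z : Phase d, 0 ≤ kin z + pos z := fun z => (add_pos (kin_pos z) (pos_pos z)).le
  have hwi : ∀ n, Integrable (fun z => (kin z + pos z) * |G n z|) ∧
      ∫ z, (kin z + pos z) * |G n z| ≤ M := fun n => by
    have h1 : Integrable fun z => (kin z + pos z) * G n z := by
      exact ((hk n).add (hp n)).congr (Eventually.of_forall fun z => (add_mul _ _ _).symm)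
    obtain ⟨h2, h3⟩ := integrable_abs_of_nonneg (hG0 n) h1
    refine ⟨h2, ?_⟩
    rw [h3]
    simp only [add_mul]
    rw [integral_add (hk n) (hp n)]
    exact hM n
  have hgi := integrable_moment_of_tendsto hw0 hG (fun n => (hwi n).1) (fun n => (hwi n).2)
    tendsto_const_nhds
  have hlim := tendsto_integral_of_moment (u := fun z => ‖z‖)
    (fun z => norm_nonneg z) hw0 (fun R hR z => norm_le_add hR z) hG (Eventually.of_forall hwi) hgi
  have hn : ∀ n, Integrable fun z => ‖z‖ * G n z := fun n => integrable_norm_mul (hk n) (hp n)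
  have hng : Integrable fun z => ‖z‖ * g z := by
    have h1 : Integrable fun z => (kin z + pos z) * g z :=
      integrable_weight_of_abs (continuous_kin.add continuous_pos).measurable
        (integrable_L1 g).1 hgi.1
    have hkg : Integrable fun z => kin z * g z := by
      refine h1.mono (continuous_kin.aestronglyMeasurable.mul (integrable_L1 g).1)
        (Eventually.of_forall fun z => ?_)
      rw [norm_mul, norm_mul, Real.norm_of_nonneg (hw0 z), Real.norm_of_nonneg (kin_pos z).le]
      have := pos_pos z
      gcongr
      linarith
    have hpg : Integrable fun z => pos z * g z := by
      refine h1.mono (continuous_pos.aestronglyMeasurable.mul (integrable_L1 g).1)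
        (Eventually.of_forall fun z => ?_)
      rw [norm_mul, norm_mul, Real.norm_of_nonneg (hw0 z), Real.norm_of_nonneg (pos_pos z).le]
      have := kin_pos z
      gcongr
      linarith
    exact integrable_norm_mul hkg hpg
  have hlim' : Tendsto (fun n => ∫ z, ‖z‖ * G n z) atTop (𝓝 (∫ z, ‖z‖ * g z)) := by
    rw [tendsto_iff_norm_sub_tendsto_zero]
    refine squeeze_zero (fun n => norm_nonneg _) (fun n => ?_) hlim
    rw [← integral_sub (hn n) hng]
    refine (norm_integral_le_integral_norm _).trans (le_of_eq ?_)
    refine integral_congr_ae (Eventually.of_forall fun z => ?_)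
    simp only
    rw [← mul_sub, norm_mul, norm_norm, Real.norm_eq_abs]
  have hlim1 : Tendsto (fun n => ∫ z, G n z) atTop (𝓝 (∫ z, g z)) := by
    obtain ⟨ℓ, hℓ⟩ := exists_integralCLM (d := d)
    simp only [← hℓ]
    exact (ℓ.continuous.tendsto g).comp hG
  obtain ⟨φ, hφ, hae⟩ := (tendstoInMeasure_of_tendsto_Lp hG).exists_seq_tendsto_ae
  obtain ⟨N₀, hN₀⟩ := eventually_atTop.1 hh
  have hφN : Tendsto (fun n => φ (n + N₀)) atTop atTop :=
    hφ.tendsto_atTop.comp (tendsto_add_atTop_nat N₀)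
  -- By `mul_log_ge` this correction makes the entropy integrand nonnegative. Its integral
  -- converges, since bounded second moments together with `L¹` convergence imply convergence of
  -- first moments. Fatou's lemma then applies to the sum.
  have hv : ∀ n, Integrable fun z => ‖z‖ * G n z - G n z + refDens z := fun n =>
    ((hn n).sub (integrable_L1 _)).add integrable_refDens
  have hvg : Integrable fun z => ‖z‖ * g z - g z + refDens z :=
    (hng.sub (integrable_L1 _)).add integrable_refDens
  have ev : ∀ n, ∫ z, (‖z‖ * G n z - G n z + refDens z)
      = (∫ z, ‖z‖ * G n z) - (∫ z, G n z) + ∫ z : Phase d, refDens z := fun n => by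
    have h1 : Integrable fun z => ‖z‖ * G n z - G n z := (hn n).sub (integrable_L1 _)
    rw [integral_add h1 integrable_refDens, integral_sub (hn n) (integrable_L1 _)]
  have evg : ∫ z, (‖z‖ * g z - g z + refDens z)
      = (∫ z, ‖z‖ * g z) - (∫ z, g z) + ∫ z : Phase d, refDens z := by
    have h1 : Integrable fun z => ‖z‖ * g z - g z := hng.sub (integrable_L1 _)
    rw [integral_add h1 integrable_refDens, integral_sub hng (integrable_L1 _)]
  have hae' : ∀ᵐ z, Tendsto (fun n => G (φ (n + N₀)) z) atTop (𝓝 (g z)) := by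
    filter_upwards [hae] with z hz
    exact hz.comp (tendsto_add_atTop_nat N₀)
  refine integrable_of_tendsto_of_frequently_le (u := fun n z => G (φ (n + N₀)) z
    * Real.log (G (φ (n + N₀)) z)) (v := fun n z => ‖z‖ * G (φ (n + N₀)) z - G (φ (n + N₀)) z
    + refDens z) (fun n => hi _) (fun n => hv _) hvg (fun n => ?_) ?_ ?_ ?_
    (b := fun n => h (φ (n + N₀))) (fun n => hN₀ _ ((Nat.le_add_left _ _).trans (hφ.id_le _)))
    (hB.comp hφN)
  · filter_upwards [ae_nonneg (hG0 (φ (n + N₀)))] with z hz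
    have := mul_log_ge hz z
    linarith
  · filter_upwards [hae'] with z hz
    exact (Real.continuous_mul_log.tendsto (g z)).comp hz
  · filter_upwards [hae'] with z hz
    exact ((hz.const_mul _).sub hz).add_const _
  · rw [evg]
    simp only [ev]
    exact ((hlim'.comp hφN).sub (hlim1.comp hφN)).add_const _

/-- The entropy inequality passes to the limit. -/
theorem entropy_inequality_of_tendsto {T : ℝ} {W : Coll d → ℝ} {V : ℕ → Coll d → ℝ}
    (hV : ∀ n, Measurable (V n)) (hVW : ∀ c, ∀ᶠ n in atTop, V n c = W c) {f : ℝ → L1 d}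
    {g : ℕ → ℝ → L1 d} (hgc : ∀ n, ContinuousOn (g n) (Icc 0 T))
    (hgf : ∀ t ∈ Icc 0 T, Tendsto (fun n => g n t) atTop (𝓝 (f t)))
    (hg0 : ∀ n, ∀ t ∈ Icc 0 T, 0 ≤ g n t) {M : ℝ}
    (hk : ∀ n, ∀ t ∈ Icc 0 T, Integrable fun z => kin z * g n t z)
    (hp : ∀ n, ∀ t ∈ Icc 0 T, Integrable fun z => pos z * g n t z)
    (hM : ∀ n, ∀ t ∈ Icc 0 T, (∫ z, kin z * g n t z) + ∫ z, pos z * g n t z ≤ M)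
    {h : ℕ → ℝ} {B : ℝ} (hB : Tendsto h atTop (𝓝 B))
    (hent : ∀ n, ∀ t ∈ Icc 0 T, Integrable (fun z => g n t z * Real.log (g n t z)) ∧
      ∫⁻ s in Icc 0 t, dissW (V n) (g n s) ≠ ⊤ ∧
      (∫ z, g n t z * Real.log (g n t z)) + (∫⁻ s in Icc 0 t, dissW (V n) (g n s)).toReal ≤ h n)
    {t : ℝ} (ht : t ∈ Icc 0 T) :
    Integrable (fun z => f t z * Real.log (f t z)) ∧
      ∫⁻ s in Icc 0 t, dissW W (f s) ≠ ⊤ ∧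
      (∫ z, f t z * Real.log (f t z)) + (∫⁻ s in Icc 0 t, dissW W (f s)).toReal ≤ B := by
  have hT : 0 ≤ T := ht.1.trans ht.2
  have hsub : Icc 0 t ⊆ Icc 0 T := Icc_subset_Icc_right ht.2
  let b : ℕ → ℝ≥0∞ := fun n => ∫⁻ s in Icc 0 t, dissW (V n) (g n s)
  have hblim : ∫⁻ s in Icc 0 t, dissW W (f s) ≤ liminf b atTop := by
    have hm : ∀ n, AEMeasurable (fun s => dissW (V n) (g n s)) (volume.restrict (Icc 0 t)) := by
      intro n
      have hF := (continuousOn_iff_continuous_domRestrict.1 (hgc n)).Icc_extend' (h := hT)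
      refine (measurable_dissW (hV n) (τ := id) LipschitzWith.id hF).aemeasurable.congr ?_
      refine (ae_restrict_iff' measurableSet_Icc).2 (Eventually.of_forall fun s hs => ?_)
      simp only [IccExtend_of_mem hT _ (hsub hs)]
      rfl
    refine le_trans ?_ (lintegral_liminf_le' hm)
    refine lintegral_mono_ae ((ae_restrict_iff' measurableSet_Icc).2
      (Eventually.of_forall fun s hs => ?_))
    exact dissW_le_liminf hV hVW (τ := fun _ => id) (σ := id) (fun _ => LipschitzWith.id)
      (fun y => tendsto_const_nhds) (hgf s (hsub hs))
  -- Lower semicontinuity is prepared with `h n - r` for arbitrary `r`, so that any amount `r` of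
  -- dissipation can be carried to the limit by `ne_top_and_add_toReal_le`.
  have hlsc := fun (r : ℝ) hr => integral_mul_log_le_of_tendsto (hgf t ht) (fun n => hg0 n t ht)
    (fun n => hk n t ht) (fun n => hp n t ht) (fun n => hM n t ht) (fun n => (hent n t ht).1)
    (h := fun n => h n - r) hr (hB.sub_const r)
  obtain ⟨hi, h0⟩ := hlsc 0 (Eventually.of_forall fun n => by
    have h1 := (hent n t ht).2.2
    have h2 : 0 ≤ (∫⁻ s in Icc 0 t, dissW (V n) (g n s)).toReal := ENNReal.toReal_nonneg
    linarith)
  rw [sub_zero] at h0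
  refine ⟨hi, ne_top_and_add_toReal_le h0 fun r hr => ?_⟩
  have h1 := eventually_lt_of_lt_liminf (hr.trans_le hblim)
  have h2 := (hlsc r (by
    filter_upwards [h1] with n hn
    have h3 := (hent n t ht).2
    have h4 : (r : ℝ) ≤ (b n).toReal := by
      have := ENNReal.toReal_mono h3.1 hn.le
      simpa using this
    have h5 := h3.2
    simp only [b] at h4
    linarith)).2
  linarith

end Entropy

end FuzzyBoltzmann

/-! ### Approximating data: bounded core plus a small positive density. -/

namespace FuzzyBoltzmann

open Filter Topology

variable {d : ℕ}

/-- The bounded part of phase space seen by the approximating data. -/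
def core (d n : ℕ) : Set (Phase d) := {z | kin z ≤ n + 1 ∧ pos z ≤ n + 1}

theorem measurableSet_core (n : ℕ) : MeasurableSet (core d n) :=
  (measurableSet_le continuous_kin.measurable measurable_const).inter
    (measurableSet_le continuous_pos.measurable measurable_const)

theorem eventually_mem_core (z : Phase d) : ∀ᶠ n in atTop, z ∈ core d n := by
  have h : Tendsto (fun n : ℕ => (n : ℝ) + 1) atTop atTop :=
    tendsto_atTop_add_const_right _ _ tendsto_natCast_atTop_atTop
  exact (h.eventually_ge_atTop (kin z)).and (h.eventually_ge_atTop (pos z))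

/-- The proportion of the reference density in the approximating data. -/
noncomputable def mixing (n : ℕ) : ℝ := 1 / ((n : ℝ) + 1)

theorem mixing_pos (n : ℕ) : 0 < mixing n := by unfold mixing; positivity

theorem mixing_le_one (n : ℕ) : mixing n ≤ 1 := by
  unfold mixing
  rw [div_le_one (by positivity)]
  linarith [(Nat.cast_nonneg n : (0 : ℝ) ≤ n)]

theorem tendsto_mixing : Tendsto mixing atTop (𝓝 0) := tendsto_one_div_add_atTop_nhds_zero_nat

/-- Truncation to a bounded set, mixed with the reference density. -/
noncomputable def approxFun (n : ℕ) (f : Phase d → ℝ) (z : Phase d) : ℝ :=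
  (1 - mixing n) * (core d n).indicator f z + mixing n * refDens z

theorem integrable_approxFun (n : ℕ) (f : L1 d) : Integrable (approxFun n f) :=
  (((integrable_L1 f).indicator (measurableSet_core n)).const_mul _).add
    (integrable_refDens.const_mul _)

/-- The approximating data. -/
noncomputable def approxData (n : ℕ) (f : L1 d) : L1 d := (integrable_approxFun n f).toL1 _

theorem coeFn_approxData (n : ℕ) (f : L1 d) : approxData n f =ᵐ[volume] approxFun n f :=
  Integrable.coeFn_toL1 _

section Data

variable {f : L1 d} {w w' : Phase d → ℝ}

theorem approxData_nonneg (hf : 0 ≤ f) (n : ℕ) : 0 ≤ approxData n f := by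
  rw [← Lp.coeFn_nonneg]
  filter_upwards [coeFn_approxData n f, ae_nonneg hf] with z hz h0
  rw [hz, Pi.zero_apply, approxFun]
  have := mixing_le_one n
  exact add_nonneg (mul_nonneg (by linarith) (indicator_apply_nonneg fun _ => h0))
    (mul_nonneg (mixing_pos n).le (refDens_pos z).le)

/-- Moments of the approximating data. -/
theorem integral_mul_approxData_le (hf : 0 ≤ f) (hw : Measurable w) (hw0 : ∀ z, 0 ≤ w z)
    (hw0' : ∀ z, 0 ≤ w' z) {n : ℕ} (h : ∀ z ∈ core d n, w z ≤ w' z)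
    (hi : Integrable fun z => w' z * f z) (hr : Integrable fun z => w z * refDens z) :
    Integrable (fun z => w z * approxData n f z) ∧
      ∫ z, w z * approxData n f z ≤ (∫ z, w' z * f z) + ∫ z, w z * refDens z := by
  have hk : Integrable fun z => w' z * f z + w z * refDens z := hi.add hr
  have hm : AEStronglyMeasurable (fun z => w z * approxData n f z) volume :=
    hw.aestronglyMeasurable.mul (integrable_L1 _).1
  have h1 : ∀ᵐ z, 0 ≤ w z * approxData n f z ∧
      w z * approxData n f z ≤ w' z * f z + w z * refDens z := by
    filter_upwards [coeFn_approxData n f, ae_nonneg hf, ae_nonneg (approxData_nonneg hf n)]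
      with z hz h0 h2
    refine ⟨mul_nonneg (hw0 z) h2, ?_⟩
    rw [hz, approxFun, mul_add]
    have e1 := mixing_le_one n
    have e2 := mixing_pos n
    have e3 := hw0 z
    have e4 := (refDens_pos z).le
    refine add_le_add ?_ (mul_le_mul_of_nonneg_left (mul_le_of_le_one_left e4 e1) e3)
    -- Off the core the truncated part vanishes, so `w ≤ w'` is needed only on the core. With `w` of
    -- the order `kin²` and `w' = (n + 1) kin`, a missing moment is traded for a factor `n + 1`.
    by_cases hc : z ∈ core d n
    · rw [indicator_of_mem hc]
      calc w z * ((1 - mixing n) * f z) ≤ w z * f z :=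
            mul_le_mul_of_nonneg_left (mul_le_of_le_one_left h0 (by linarith)) e3
        _ ≤ w' z * f z := mul_le_mul_of_nonneg_right (h z hc) h0
    · rw [indicator_of_notMem hc, mul_zero, mul_zero]
      exact mul_nonneg (hw0' z) h0
  have hint : Integrable fun z => w z * approxData n f z := by
    refine hk.mono' hm ?_
    filter_upwards [h1] with z hz
    rw [Real.norm_of_nonneg hz.1]; exact hz.2
  refine ⟨hint, ?_⟩
  rw [← integral_add hi hr]
  exact integral_mono_ae hint hk (h1.mono fun z hz => hz.2)

theorem tendsto_integral_mul_approxData_sub (hf : 0 ≤ f) (hw : Measurable w) (hw0 : ∀ z, 0 ≤ w z)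
    (hi : Integrable fun z => w z * f z) (hr : Integrable fun z => w z * refDens z) :
    Tendsto (fun n => ∫ z, w z * |approxData n f z - f z|) atTop (𝓝 0) := by
  have h0 : (0 : ℝ) = ∫ z : Phase d, (0 : ℝ) := by simp
  rw [h0]
  have hae : ∀ᵐ z, ∀ n, approxData n f z = approxFun n f z :=
    ae_all_iff.2 fun n => coeFn_approxData n f
  refine tendsto_integral_of_dominated_convergence (fun z => 2 * (w z * f z) + w z * refDens z)
    (fun n => hw.aestronglyMeasurable.mul ((integrable_L1 _).sub (integrable_L1 _)).abs.1)
    ((hi.const_mul 2).add hr) (fun n => ?_) ?_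
  · filter_upwards [hae, ae_nonneg hf] with z hz h0
    rw [Real.norm_of_nonneg (mul_nonneg (hw0 z) (abs_nonneg _)), hz n, approxFun]
    have e1 := mixing_le_one n
    have e2 := mixing_pos n
    have e4 := (refDens_pos z).le
    have e5 : 0 ≤ (core d n).indicator f z := indicator_apply_nonneg fun _ => h0
    have e6 : (core d n).indicator f z ≤ f z := indicator_le_self' (fun _ _ => h0) z
    have e7 : mixing n * refDens z ≤ refDens z := mul_le_of_le_one_left e4 e1
    have e8 : (1 - mixing n) * (core d n).indicator f z ≤ f z :=
      (mul_le_of_le_one_left e5 (by linarith)).trans e6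
    have e9 : 0 ≤ (1 - mixing n) * (core d n).indicator f z := mul_nonneg (by linarith) e5
    have e10 : 0 ≤ mixing n * refDens z := mul_nonneg e2.le e4
    calc w z * |_| ≤ w z * (2 * f z + refDens z) := by
          refine mul_le_mul_of_nonneg_left ?_ (hw0 z)
          rw [abs_le]; constructor <;> linarith
      _ = _ := by ring
  · filter_upwards [hae] with z hz
    have h1 : Tendsto (fun n => approxFun n f z) atTop (𝓝 (f z)) := by
      have h2 : Tendsto (fun n => (1 - mixing n) * f z + mixing n * refDens z) atTop
          (𝓝 ((1 - 0) * f z + 0 * refDens z)) :=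
        ((tendsto_const_nhds.sub tendsto_mixing).mul_const _).add (tendsto_mixing.mul_const _)
      rw [sub_zero, one_mul, zero_mul, add_zero] at h2
      refine h2.congr' ?_
      filter_upwards [eventually_mem_core z] with n hn
      rw [approxFun, indicator_of_mem hn]
    simp only [hz]
    have h3 := ((h1.sub_const (f z)).abs.const_mul (w z))
    simpa using h3

theorem tendsto_approxData (hf : 0 ≤ f) : Tendsto (fun n => approxData n f) atTop (𝓝 f) := by
  rw [tendsto_iff_norm_sub_tendsto_zero]
  have h := tendsto_integral_mul_approxData_sub (w := fun _ => 1) hf measurable_const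
    (fun _ => zero_le_one) (by simpa using integrable_L1 f) (by simpa using integrable_refDens)
  refine h.congr fun n => ?_
  rw [norm_L1]
  refine integral_congr_ae ?_
  filter_upwards [Lp.coeFn_sub (approxData n f) f] with z hz
  rw [hz, one_mul, Pi.sub_apply]

/-- The active set is bounded, so the reference density has a positive lower bound on it. This
supplies the positivity needed for the entropy inequality with a truncated weight. -/
theorem exists_le_approxData (hf : 0 ≤ f) (n : ℕ) (R T : ℝ) :
    ∃ c > 0, ∀ᵐ z, z ∈ active d R T → c ≤ approxData n f z := by
  refine ⟨mixing n * Real.exp (-(max (R * (1 + T)) R)),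
    mul_pos (mixing_pos n) (Real.exp_pos _), ?_⟩
  filter_upwards [coeFn_approxData n f, ae_nonneg hf] with z hz h0 hm
  rw [hz, approxFun]
  have e1 := mixing_le_one n
  have e5 : 0 ≤ (core d n).indicator f z := indicator_apply_nonneg fun _ => h0
  have e9 : 0 ≤ (1 - mixing n) * (core d n).indicator f z := mul_nonneg (by linarith) e5
  have : mixing n * Real.exp (-(max (R * (1 + T)) R)) ≤ mixing n * refDens z := by
    refine mul_le_mul_of_nonneg_left ?_ (mixing_pos n).le
    rw [refDens, Real.exp_le_exp, Prod.norm_def]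
    exact neg_le_neg (max_le_max hm.1 hm.2)
  linarith

/-- The entropy of the approximating data. -/
theorem entropy_approxData (hf : 0 ≤ f) (hk : Integrable fun z => kin z * f z)
    (hp : Integrable fun z => pos z * f z) (he : Integrable fun z => f z * Real.log (f z)) :
    (∀ n, Integrable fun z => approxData n f z * Real.log (approxData n f z)) ∧
      ∃ h : ℕ → ℝ, Tendsto h atTop (𝓝 (∫ z, f z * Real.log (f z))) ∧
        ∀ n, ∫ z, approxData n f z * Real.log (approxData n f z) ≤ h n := by
  let b : ℕ → Phase d → ℝ := fun n z => (1 - mixing n) *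
    (core d n).indicator (fun z => f z * Real.log (f z)) z - mixing n * (‖z‖ * refDens z)
  have hb : ∀ n, Integrable (b n) := fun n =>
    ((he.indicator (measurableSet_core n)).const_mul _).sub (integrable_norm_mul_refDens.const_mul _)
  have hle : ∀ n, ∀ᵐ z, approxData n f z * Real.log (approxData n f z) ≤ b n z := fun n => by
    filter_upwards [coeFn_approxData n f, ae_nonneg hf] with z hz h0
    rw [hz]
    -- Mixing by a convex combination pays off here: convexity of `y log y` bounds the entropy of
    -- the mixture by that of its two components.
    have hc := Real.convexOn_mul_log.2
      (show (core d n).indicator f z ∈ Ici (0 : ℝ) from indicator_apply_nonneg fun _ => h0)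
      (show refDens z ∈ Ici (0 : ℝ) from (refDens_pos z).le)
      (sub_nonneg.2 (mixing_le_one n)) (mixing_pos n).le (sub_add_cancel 1 (mixing n))
    simp only [smul_eq_mul] at hc
    refine hc.trans (le_of_eq ?_)
    simp only [b]
    rw [refDens_mul_log]
    by_cases hcore : z ∈ core d n
    · rw [indicator_of_mem hcore, indicator_of_mem hcore]; ring
    · rw [indicator_of_notMem hcore, indicator_of_notMem hcore]; simp
  have hn : ∀ n, Integrable fun z => ‖z‖ * approxData n f z := fun n => by
    refine integrable_norm_mul ?_ ?_
    · exact (integral_mul_approxData_le hf continuous_kin.measurable (fun z => (kin_pos z).le)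
        (fun z => (kin_pos z).le) (fun z _ => le_rfl) hk
        (by simpa using integrable_kin_rpow_mul_refDens (d := d) one_le_two)).1
    · exact (integral_mul_approxData_le hf continuous_pos.measurable (fun z => (pos_pos z).le)
        (fun z => (pos_pos z).le) (fun z _ => le_rfl) hp integrable_pos_mul_refDens).1
  have hint := fun n => integrable_mul_log_of_le (approxData_nonneg hf n) (hn n) (hb n) (hle n)
  refine ⟨hint, fun n => ∫ z, b n z, ?_, fun n => integral_mono_ae (hint n) (hb n) (hle n)⟩
  refine tendsto_integral_of_dominated_convergence
    (fun z => |f z * Real.log (f z)| + ‖z‖ * refDens z) (fun n => (hb n).1)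
    (he.abs.add integrable_norm_mul_refDens) (fun n => Eventually.of_forall fun z => ?_)
    (Eventually.of_forall fun z => ?_)
  · have e1 := mixing_le_one n
    have e2 := (mixing_pos n).le
    have e3 : 0 ≤ ‖z‖ * refDens z := mul_nonneg (norm_nonneg _) (refDens_pos z).le
    refine (norm_sub_le _ _).trans (add_le_add ?_ ?_)
    · rw [norm_mul, Real.norm_of_nonneg (by linarith)]
      refine (mul_le_of_le_one_left (norm_nonneg _) (by linarith)).trans ?_
      exact norm_indicator_le_norm_self (fun z => f z * Real.log (f z)) z
    · rw [norm_mul, Real.norm_of_nonneg e2, Real.norm_of_nonneg e3]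
      exact mul_le_of_le_one_left e3 e1
  · have h2 : Tendsto (fun n => (1 - mixing n) * (f z * Real.log (f z))
        - mixing n * (‖z‖ * refDens z)) atTop
        (𝓝 ((1 - 0) * (f z * Real.log (f z)) - 0 * (‖z‖ * refDens z))) :=
      ((tendsto_const_nhds.sub tendsto_mixing).mul_const _).sub (tendsto_mixing.mul_const _)
    rw [sub_zero, one_mul, zero_mul, sub_zero] at h2
    refine h2.congr' ?_
    filter_upwards [eventually_mem_core z] with n hn
    simp only [b]
    rw [indicator_of_mem hn]

end Data

end FuzzyBoltzmann

/-! ### Stability and uniqueness of mild solutions in `L¹(⟨v⟩²)`. -/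

namespace FuzzyBoltzmann

open Filter Topology

variable {d : ℕ}

section Transport

theorem integrable_kin_alongChar {D : L1 d} (s : ℝ) :
    (Integrable fun z => kin z * |alongChar s D z|) ↔ Integrable fun z => kin z * |D z| := by
  rw [← (mp_shift s).integrable_comp_emb (shiftEquiv s).measurableEmbedding
    (g := fun z => kin z * |D z|)]
  refine integrable_congr ?_
  filter_upwards [coeFn_alongChar s D] with z hz
  simp only [Function.comp_apply, kin_shift, hz]

theorem integral_kin_alongChar {D : L1 d} (s : ℝ) :
    ∫ z, kin z * |alongChar s D z| = ∫ z, kin z * |D z| := by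
  rw [← integral_comp_shift s fun z => kin z * |D z|]
  refine integral_congr_ae ?_
  filter_upwards [coeFn_alongChar s D] with z hz
  simp only [kin_shift, hz]

theorem integral_kin_sign_alongChar {D Q : L1 d} (s : ℝ) :
    ∫ z, kin z * (Real.sign (alongChar s D z) * alongChar s Q z)
      = ∫ z, kin z * (Real.sign (D z) * Q z) := by
  rw [← integral_comp_shift s fun z => kin z * (Real.sign (D z) * Q z)]
  refine integral_congr_ae ?_
  filter_upwards [coeFn_alongChar s D, coeFn_alongChar s Q] with z h1 h2
  simp only [kin_shift, h1, h2]

end Transport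

section Stability

variable {Λ ν : ℝ} {W U V : Coll d → ℝ}

theorem HasGrowth.integral_energy_mul_rate_le (h : HasGrowth Λ ν W) {f : L1 d}
    (hf : Integrable fun z => kin z ^ (1 + ν) * f z) {M : ℝ}
    (hM : ∫ z, kin z ^ (1 + ν) * |f z| ≤ M) :
    ∫ c, (kin c.1 + kin c.2.1) * |rate W f c| ∂collMeasure d ≤ 4 * Λ * sphArea d * M ^ 2 := by
  have hfm := (integrable_L1 f).aestronglyMeasurable
  have ha := integrable_weight_abs (kin_rpow_nonneg _) hf
  have hb := integrable_kin_rpow_of_le (p := ν) (by linarith) hfm.norm ha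
  have i1 := integrable_tensor ha hb
  have i2 := integrable_tensor hb ha
  have hm := integral_mono_of_nonneg (μ := collMeasure d)
    (f := fun c => (kin c.1 + kin c.2.1) * |rate W f c|) (Eventually.of_forall fun c =>
      mul_nonneg (add_pos (kin_pos _) (kin_pos _)).le (abs_nonneg _))
    ((i1.add i2).const_mul (2 * Λ)) (Eventually.of_forall fun c => by
      have h1 := h.le_mul c
      simp only [rate, preProd, Pi.add_apply]
      rw [abs_mul, abs_mul, abs_of_nonneg (h.nonneg c)]
      have hE : 0 ≤ kin c.1 + kin c.2.1 := (add_pos (kin_pos _) (kin_pos _)).le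
      calc (kin c.1 + kin c.2.1) * (W c * (|f c.1| * |f c.2.1|))
          ≤ (kin c.1 + kin c.2.1) * (2 * Λ * (kin c.1 ^ ν * kin c.2.1 ^ ν)
            * (|f c.1| * |f c.2.1|)) := by gcongr
        _ = _ := by
          rw [← kin_rpow_mul_self, ← kin_rpow_mul_self, Real.norm_eq_abs, Real.norm_eq_abs]; ring)
  simp only [Pi.add_apply] at hm
  rw [integral_const_mul, integral_add i1 i2,
    integral_tensor (fun z => kin z ^ (1 + ν) * |f z|) (fun z => kin z ^ ν * ‖f z‖),
    integral_tensor (fun z => kin z ^ ν * ‖f z‖) (fun z => kin z ^ (1 + ν) * |f z|)] at hm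
  have hle : ∫ z, kin z ^ ν * ‖f z‖ ≤ M := by
    refine (integral_mono hb ha fun z => ?_).trans hM
    exact mul_le_mul_of_nonneg_right (kin_rpow_le_rpow (by linarith) z) (abs_nonneg _)
  have h0 : 0 ≤ ∫ z, kin z ^ ν * ‖f z‖ :=
    integral_nonneg fun z => mul_nonneg (kin_rpow_nonneg _ _) (norm_nonneg _)
  have h00 : 0 ≤ ∫ z, kin z ^ (1 + ν) * |f z| :=
    integral_nonneg fun z => mul_nonneg (kin_rpow_nonneg _ _) (abs_nonneg _)
  have hc := h.const_nonneg
  have hS := sphArea_nonneg (d := d)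
  refine hm.trans ?_
  calc 2 * Λ * (sphArea d * ((∫ z, kin z ^ (1 + ν) * |f z|) * ∫ z, kin z ^ ν * ‖f z‖)
        + sphArea d * ((∫ z, kin z ^ ν * ‖f z‖) * ∫ z, kin z ^ (1 + ν) * |f z|))
      = 4 * Λ * sphArea d * ((∫ z, kin z ^ (1 + ν) * |f z|) * ∫ z, kin z ^ ν * ‖f z‖) := by ring
    _ ≤ 4 * Λ * sphArea d * (M * M) := by gcongr; exact h00.trans hM
    _ = _ := by ring

theorem HasGrowth.integrable_rate_L1 (h : HasGrowth Λ ν W) {f : L1 d}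
    (hf : Integrable fun z => kin z ^ (1 + ν) * f z) : Integrable (rate W f) (collMeasure d) :=
  h.integrable_rate (integrable_L1 f).1
    (integrable_kin_rpow_of_le (by linarith) (integrable_L1 f).1 hf)

theorem HasGrowth.integral_kin_mul_collQ_le (h : HasGrowth Λ ν W) {f : L1 d}
    (hf : Integrable fun z => kin z ^ (1 + ν) * f z) {M : ℝ}
    (hM : ∫ z, kin z ^ (1 + ν) * |f z| ≤ M) :
    Integrable (fun z => kin z * |collQ W f z|) ∧
      ∫ z, kin z * |collQ W f z| ≤ 8 * Λ * sphArea d * M ^ 2 := by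
  obtain ⟨h1, h2⟩ := integrable_kin_mul_collOp (h.integrable_rate_L1 hf)
    (h.integrable_energy_mul_rate (integrable_L1 f).1 hf)
  refine ⟨h1, h2.trans ?_⟩
  have := h.integral_energy_mul_rate_le hf hM
  linarith

theorem measurable_sign : Measurable Real.sign := by
  unfold Real.sign
  exact Measurable.ite measurableSet_Iio measurable_const
    (Measurable.ite measurableSet_Ioi measurable_const measurable_const)

theorem integrable_kin_of_rpow (hν : 0 ≤ ν) {f : Phase d → ℝ}
    (hm : AEStronglyMeasurable f volume) (hf : Integrable fun z => kin z ^ (1 + ν) * f z) :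
    Integrable fun z => kin z * f z := by
  simpa only [Real.rpow_one] using integrable_kin_rpow_of_le (p := 1) (by linarith) hm hf

/-- The difference is split as `(Q_V f - Q_V g) + (Q_U f - Q_U g)` with the second bracket replaced
by `Q_U f - Q_V f`. The first bracket is the stability estimate for one weight. The second compares
two weights on `f` alone, so tail bounds are required of only one of the solutions. -/
theorem HasGrowth.integral_kin_sign_mul_le (hV : HasGrowth Λ ν V) (hU : HasGrowth Λ ν U)
    {f g : L1 d} (hf0 : 0 ≤ f) (hf : Integrable fun z => kin z ^ (1 + ν) * f z)
    (hg : Integrable fun z => kin z ^ (1 + ν) * g z) {M e : ℝ}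
    (hfM : ∫ z, kin z ^ (1 + ν) * |f z| ≤ M) (hgM : ∫ z, kin z ^ (1 + ν) * |g z| ≤ M)
    (hE : 2 * ∫ c, (kin c.1 + kin c.2.1) * |rate U f c - rate V f c| ∂collMeasure d ≤ e) :
    ∫ z, kin z * (Real.sign ((f - g) z) * (collQ U f - collQ V g) z)
      ≤ 16 * Λ * sphArea d * M * (∫ z, kin z * |(f - g) z|) + e := by
  have hsub := Lp.coeFn_sub f g
  have hs : ∀ᵐ z, Real.sign ((f - g) z) = Real.sign (f z - g z) := by
    filter_upwards [hsub] with z hz; rw [hz, Pi.sub_apply]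
  have hsm : AEStronglyMeasurable (fun z => Real.sign ((f - g) z)) volume :=
    (measurable_sign.comp_aemeasurable (integrable_L1 _).1.aemeasurable).aestronglyMeasurable
  have h1 := hV.integral_sign_mul_le hf0 hf hg hs hsm
  have rU := hU.integrable_rate_L1 hf
  have rV := hV.integrable_rate_L1 hf
  have hEK : Integrable (fun c => (kin c.1 + kin c.2.1) * (rate U f c - rate V f c))
      (collMeasure d) := by
    simp only [mul_sub]
    exact (hU.integrable_energy_mul_rate (integrable_L1 f).1 hf).sub
      (hV.integrable_energy_mul_rate (integrable_L1 f).1 hf)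
  obtain ⟨h2, h3⟩ := integrable_kin_mul_collOp (rU.sub rV) hEK
  have ec : collOp (rate U f - rate V f) = collQ U f - collQ V f := (collOp_sub rU rV).symm
  rw [ec] at h2 h3
  have hQf := (hV.integral_kin_mul_collQ_le hf hfM).1
  have hQg := (hV.integral_kin_mul_collQ_le hg hgM).1
  have hs1 : ∀ z, |Real.sign ((f - g) z)| ≤ 1 := fun z => abs_sign_le_one _
  have key : ∀ {D : L1 d}, Integrable (fun z => kin z * |D z|) →
      Integrable fun z => kin z * (Real.sign ((f - g) z) * D z) := fun {D} hD => by
    refine hD.mono (continuous_kin.aestronglyMeasurable.mul (hsm.mul (integrable_L1 D).1))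
      (Eventually.of_forall fun z => ?_)
    rw [norm_mul, norm_mul, norm_mul, Real.norm_eq_abs |D z|, abs_abs]
    refine mul_le_mul_of_nonneg_left ?_ (norm_nonneg _)
    exact mul_le_of_le_one_left (norm_nonneg _) (hs1 z)
  have hV' : Integrable (fun z => kin z * |(collQ V f - collQ V g) z|) := by
    refine (hQf.add hQg).mono (continuous_kin.aestronglyMeasurable.mul (integrable_L1 _).1.norm) ?_
    filter_upwards [Lp.coeFn_sub (collQ V f) (collQ V g)] with z hz
    have := kin_pos z
    rw [hz, Pi.sub_apply, Pi.add_apply, Real.norm_of_nonneg (by positivity),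
      Real.norm_of_nonneg (by positivity), ← mul_add]
    exact mul_le_mul_of_nonneg_left (abs_sub _ _) this.le
  have hsplit : collQ U f - collQ V g = (collQ V f - collQ V g) + (collQ U f - collQ V f) := by abel
  have e1 : ∫ z, kin z * (Real.sign ((f - g) z) * (collQ U f - collQ V g) z)
      = (∫ z, kin z * (Real.sign ((f - g) z) * (collQ V f - collQ V g) z))
        + ∫ z, kin z * (Real.sign ((f - g) z) * (collQ U f - collQ V f) z) := by
    rw [← integral_add (key hV') (key h2)]
    refine integral_congr_ae ?_
    rw [hsplit]
    filter_upwards [Lp.coeFn_add (collQ V f - collQ V g) (collQ U f - collQ V f)] with z hz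
    rw [hz, Pi.add_apply]; ring
  have h4 : ∫ z, kin z * (Real.sign ((f - g) z) * (collQ U f - collQ V f) z)
      ≤ ∫ z, kin z * |(collQ U f - collQ V f) z| := by
    refine integral_mono (key h2) h2 fun z => mul_le_mul_of_nonneg_left ?_ (kin_pos z).le
    refine (le_abs_self _).trans ?_
    rw [abs_mul]
    exact mul_le_of_le_one_left (abs_nonneg _) (hs1 z)
  have e2 : ∫ z, kin z * |(f - g) z| = ∫ z, kin z * |f z - g z| := by
    refine integral_congr_ae ?_
    filter_upwards [hsub] with z hz
    rw [hz, Pi.sub_apply]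
  rw [e1, e2]
  have h5 : (∫ z, kin z ^ (1 + ν) * f z) ≤ M := by
    rw [← (integrable_abs_of_nonneg hf0 hf).2]; exact hfM
  have h6 : 0 ≤ ∫ z, kin z * |f z - g z| :=
    integral_nonneg fun z => mul_nonneg (kin_pos z).le (abs_nonneg _)
  have h7 : 0 ≤ 8 * Λ * sphArea d :=
    mul_nonneg (mul_nonneg (by norm_num) hV.const_nonneg) sphArea_nonneg
  have h8 := mul_le_mul_of_nonneg_right (mul_le_mul_of_nonneg_left (add_le_add h5 hgM) h7) h6
  have h9 := h3.trans hE
  calc _ ≤ 8 * Λ * sphArea d * (M + M) * (∫ z, kin z * |f z - g z|) + e :=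
        add_le_add (h1.trans h8) (h4.trans h9)
    _ = _ := by ring

/-- Stability of mild solutions in `L¹(⟨v⟩²)`. -/
theorem IsMild.integral_kin_sub_le (hV : HasGrowth Λ ν V) (hU : HasGrowth Λ ν U) {T : ℝ}
    {f₀ g₀ : L1 d} {f g : ℝ → L1 d} (hf : IsMild U id T f₀ f) (hg : IsMild V id T g₀ g)
    (hf0 : ∀ t ∈ Icc 0 T, 0 ≤ f t) {M e : ℝ}
    (hfM : ∀ t ∈ Icc 0 T, Integrable (fun z => kin z ^ (1 + ν) * f t z) ∧
      ∫ z, kin z ^ (1 + ν) * |f t z| ≤ M)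
    (hgM : ∀ t ∈ Icc 0 T, Integrable (fun z => kin z ^ (1 + ν) * g t z) ∧
      ∫ z, kin z ^ (1 + ν) * |g t z| ≤ M) (he : 0 ≤ e)
    (hE : ∀ t ∈ Icc 0 T, 2 * ∫ c, (kin c.1 + kin c.2.1) * |rate U (f t) c - rate V (f t) c|
      ∂collMeasure d ≤ e) {t : ℝ} (ht : t ∈ Icc 0 T) :
    ∫ z, kin z * |(f t - g t) z|
      ≤ ((∫ z, kin z * |(f₀ - g₀) z|) + e * T) * Real.exp (16 * Λ * sphArea d * M * t) := by
  have hT : 0 ≤ T := ht.1.trans ht.2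
  obtain ⟨F₁, G₁, hF₁, hG₁, h01, h1⟩ := hf.exists_extension hT
  obtain ⟨F₂, G₂, hF₂, hG₂, h02, h2⟩ := hg.exists_extension hT
  have hF : ∀ s, HasDerivAt (fun s => F₁ s - F₂ s) (G₁ s - G₂ s) s := fun s =>
    (hF₁ s).sub (hF₂ s)
  have eF : ∀ s ∈ Icc 0 T, F₁ s - F₂ s = alongChar s (f s - g s) := fun s hs => by
    rw [(h1 s hs).1, (h2 s hs).1, alongChar_sub]
  have eG : ∀ s ∈ Icc 0 T, G₁ s - G₂ s = alongChar s (collQ U (f s) - collQ V (g s)) :=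
    fun s hs => by rw [(h1 s hs).2, (h2 s hs).2, alongChar_sub]; rfl
  have hν := hV.exp_nonneg
  have hM0 : 0 ≤ M := (integral_nonneg fun z => mul_nonneg (kin_rpow_nonneg _ _)
    (abs_nonneg _)).trans (hfM t ht).2
  have hC : 0 ≤ 16 * Λ * sphArea d * M := mul_nonneg (mul_nonneg (mul_nonneg (by norm_num)
    hV.const_nonneg) sphArea_nonneg) hM0
  have hbd : ∀ s ∈ Icc 0 T, Integrable (fun z => kin z * |(G₁ s - G₂ s) z|) ∧
      ∫ z, kin z * |(G₁ s - G₂ s) z| ≤ 8 * Λ * sphArea d * M ^ 2 + 8 * Λ * sphArea d * M ^ 2 := by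
    intro s hs
    obtain ⟨a1, a2⟩ := hU.integral_kin_mul_collQ_le (hfM s hs).1 (hfM s hs).2
    obtain ⟨b1, b2⟩ := hV.integral_kin_mul_collQ_le (hgM s hs).1 (hgM s hs).2
    have hi : Integrable fun z => kin z * |collQ U (f s) z| + kin z * |collQ V (g s) z| := a1.add b1
    have hle : ∀ᵐ z, kin z * |(collQ U (f s) - collQ V (g s)) z|
        ≤ kin z * |collQ U (f s) z| + kin z * |collQ V (g s) z| := by
      filter_upwards [Lp.coeFn_sub (collQ U (f s)) (collQ V (g s))] with z hz
      rw [hz, Pi.sub_apply, ← mul_add]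
      exact mul_le_mul_of_nonneg_left (abs_sub _ _) (kin_pos z).le
    have hI : Integrable fun z => kin z * |(collQ U (f s) - collQ V (g s)) z| := by
      refine hi.mono' (continuous_kin.aestronglyMeasurable.mul (integrable_L1 _).1.norm) ?_
      filter_upwards [hle] with z hz
      rwa [Real.norm_of_nonneg (mul_nonneg (kin_pos z).le (abs_nonneg _))]
    rw [eG s hs, integral_kin_alongChar, integrable_kin_alongChar]
    refine ⟨hI, (integral_mono_ae hI hi hle).trans ?_⟩
    rw [integral_add a1 b1]
    exact add_le_add a2 b2
  have h0 : Integrable fun z => kin z * |(F₁ 0 - F₂ 0) z| := by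
    have hs : (0 : ℝ) ∈ Icc 0 T := ⟨le_rfl, hT⟩
    rw [eF 0 hs, integrable_kin_alongChar]
    have := integrable_weight_abs_sub (fun z => (kin_pos z).le)
      (integrable_kin_of_rpow hν (integrable_L1 _).1 (hfM 0 hs).1)
      (integrable_kin_of_rpow hν (integrable_L1 _).1 (hgM 0 hs).1)
    refine this.congr ?_
    filter_upwards [Lp.coeFn_sub (f 0) (g 0)] with z hz
    rw [hz, Pi.sub_apply]
  have := (weighted_gronwall hF (hG₁.sub hG₂) continuous_kin.measurable (fun z => (kin_pos z).le)
    hbd h0 hC he (fun s hs _ => ?_) ht).2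
  · simp only [h01, h02] at this
    rwa [eF t ht, integral_kin_alongChar] at this
  · rw [eF s hs, eG s hs, integral_kin_alongChar, integral_kin_sign_alongChar]
    exact hV.integral_kin_sign_mul_le hU (hf0 s hs) (hfM s hs).1 (hgM s hs).1 (hfM s hs).2
      (hgM s hs).2 (hE s hs)

/-- Uniqueness of mild solutions with bounded moments. -/
theorem IsMild.unique_of_moments (hW : HasGrowth Λ ν W) {T : ℝ} {f₀ : L1 d} {f g : ℝ → L1 d}
    (hf : IsMild W id T f₀ f) (hg : IsMild W id T f₀ g) (hf0 : ∀ t ∈ Icc 0 T, 0 ≤ f t) {M : ℝ}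
    (hfM : ∀ t ∈ Icc 0 T, Integrable (fun z => kin z ^ (1 + ν) * f t z) ∧
      ∫ z, kin z ^ (1 + ν) * |f t z| ≤ M)
    (hgM : ∀ t ∈ Icc 0 T, Integrable (fun z => kin z ^ (1 + ν) * g t z) ∧
      ∫ z, kin z ^ (1 + ν) * |g t z| ≤ M) : EqOn g f (Icc 0 T) := by
  intro t ht
  have h := hf.integral_kin_sub_le hW hW hg hf0 hfM hgM le_rfl (fun s _ => by simp) ht
  have h0 : ∫ z, kin z * |(f₀ - f₀) z| = 0 := by
    rw [sub_self]
    refine integral_eq_zero_of_ae ?_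
    filter_upwards [Lp.coeFn_zero ℝ 1 (volume : Measure (Phase d))] with z hz
    rw [hz]; simp
  rw [h0, zero_mul, add_zero, zero_mul] at h
  have hi := integrable_kin_of_rpow hW.exp_nonneg (integrable_L1 _).1 (hfM t ht).1
  have hi' := integrable_kin_of_rpow hW.exp_nonneg (integrable_L1 _).1 (hgM t ht).1
  have hI : Integrable fun z => kin z * |(f t - g t) z| := by
    refine (integrable_weight_abs_sub (fun z => (kin_pos z).le) hi hi').congr ?_
    filter_upwards [Lp.coeFn_sub (f t) (g t)] with z hz
    rw [hz, Pi.sub_apply]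
  have hle : ‖f t - g t‖ ≤ 0 := by
    rw [norm_L1]
    refine (integral_mono (integrable_L1 _).abs hI fun z => ?_).trans h
    exact le_mul_of_one_le_left (abs_nonneg _) (one_le_kin z)
  exact (sub_eq_zero.1 (norm_le_zero_iff.1 hle)).symm

end Stability

end FuzzyBoltzmann

/-! ### The truncation error and the Cauchy property of the approximations. -/

namespace FuzzyBoltzmann

open Filter Topology

variable {d : ℕ} {Λ ν : ℝ} {W : Coll d → ℝ}

section Tail

theorem sq_le_of_notMem_region {R : ℝ} (hR : 0 ≤ R) {c : Coll d} (h : c ∉ region d R) :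
    R ^ 2 ≤ pos c.1 + pos c.2.1 + (kin c.1 + kin c.2.1) := by
  have h1 := norm_nonneg c.1.1
  have h2 := norm_nonneg c.2.1.1
  by_contra! hlt
  unfold pos kin at hlt
  refine h ⟨?_, ?_, ?_⟩
  · by_contra! h3
    nlinarith [sq_nonneg ‖c.2.1.1‖, sq_nonneg ‖c.1.2‖, sq_nonneg ‖c.2.1.2‖]
  · by_contra! h3
    nlinarith [sq_nonneg ‖c.1.1‖, sq_nonneg ‖c.1.2‖, sq_nonneg ‖c.2.1.2‖]
  · nlinarith [sq_nonneg ‖c.1.1‖, sq_nonneg ‖c.2.1.1‖]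

/-- For `ν ≤ 1/2` the left side is at most `Λ E^(3/2)`, and off the region `P ≥ N⁸`. If `√E ≥ N²`,
then `N² E^(3/2) ≤ E²`. Otherwise `N² E^(3/2) ≤ N⁸ ≤ P`. The fourth power in the radius is chosen
for this second case. -/
theorem HasGrowth.energy_mul_le (h : HasGrowth Λ ν W) (hν : ν ≤ 1 / 2) {N : ℝ} (hN : 1 ≤ N)
    {c : Coll d} (hc : c ∉ region d (N ^ 4)) :
    (kin c.1 + kin c.2.1) * W c ≤ Λ / N ^ 2 *
      (2 * (kin c.1 ^ (2 : ℝ) + kin c.2.1 ^ (2 : ℝ))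
        + (pos c.1 + pos c.2.1 + (kin c.1 + kin c.2.1))) := by
  set E := kin c.1 + kin c.2.1 with hE
  set P := pos c.1 + pos c.2.1 + E with hP
  have h1 := one_le_kin c.1
  have h2 := one_le_kin c.2.1
  have hE1 : 1 ≤ E := by linarith
  have hN0 : 0 < N := by linarith
  have hR : (N ^ 4) ^ 2 ≤ P := sq_le_of_notMem_region (by positivity) hc
  have h0 := h.const_nonneg
  have hW : W c ≤ Λ * Real.sqrt E := by
    refine (h.le c).trans (mul_le_mul_of_nonneg_left ?_ h0)
    rw [Real.sqrt_eq_rpow]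
    exact Real.rpow_le_rpow_of_exponent_le hE1 hν
  have hsq : Real.sqrt E ^ 2 = E := Real.sq_sqrt (by linarith)
  have hs0 := Real.sqrt_nonneg E
  have hP0 : 0 ≤ P := (sq_nonneg _).trans hR
  have key : N ^ 2 * (E * Real.sqrt E) ≤ E ^ 2 + P := by
    rcases le_total (N ^ 2) (Real.sqrt E) with hle | hle
    · have : N ^ 2 * (E * Real.sqrt E) ≤ Real.sqrt E * (E * Real.sqrt E) := by gcongr
      have e : Real.sqrt E * (E * Real.sqrt E) = E ^ 2 := by
        calc _ = E * Real.sqrt E ^ 2 := by ring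
          _ = _ := by rw [hsq]; ring
      linarith
    · have h3 : E ≤ N ^ 4 := by
        rw [← hsq]
        calc Real.sqrt E ^ 2 ≤ (N ^ 2) ^ 2 := by gcongr
          _ = _ := by ring
      have : N ^ 2 * (E * Real.sqrt E) ≤ N ^ 2 * (N ^ 4 * N ^ 2) := by gcongr
      have e : N ^ 2 * (N ^ 4 * N ^ 2) = (N ^ 4) ^ 2 := by ring
      have : 0 ≤ E ^ 2 := sq_nonneg _
      linarith
  have hE2 : E ^ 2 ≤ 2 * (kin c.1 ^ (2 : ℝ) + kin c.2.1 ^ (2 : ℝ)) := by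
    rw [Real.rpow_two, Real.rpow_two, hE]
    nlinarith [sq_nonneg (kin c.1 - kin c.2.1)]
  calc E * W c ≤ E * (Λ * Real.sqrt E) := by gcongr
    _ = Λ / N ^ 2 * (N ^ 2 * (E * Real.sqrt E)) := by field_simp
    _ ≤ Λ / N ^ 2 * (E ^ 2 + P) := by gcongr
    _ ≤ _ := by gcongr

/-- The error of truncating the collision weight. -/
theorem HasGrowth.integral_energy_tail_le (h : HasGrowth Λ ν W) (hν : ν ≤ 1 / 2) {N R A : ℝ}
    (hN : 1 ≤ N) (hR : N ^ 4 ≤ R) {f : L1 d} (hf : 0 ≤ f) (h2 : Integrable fun z => kin z ^ (2 : ℝ) * f z)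
    (hp : Integrable fun z => pos z * f z) (hA0 : ∫ z, f z ≤ A)
    (hA2 : ∫ z, kin z ^ (2 : ℝ) * f z ≤ A * N) (hAp : ∫ z, pos z * f z ≤ A * N) :
    2 * ∫ c, (kin c.1 + kin c.2.1) *
      |rate (cutWeight (N ^ 4) W) f c - rate (cutWeight R W) f c| ∂collMeasure d
      ≤ 16 * Λ * sphArea d * A ^ 2 / N := by
  have hN0 : 0 < N := by linarith
  have h0 := h.const_nonneg
  have hk : Integrable fun z => kin z * f z := by
    simpa only [Real.rpow_one] using
      integrable_kin_rpow_of_le (p := 1) one_le_two (integrable_L1 f).1 h2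
  have hf1 := integrable_L1 f
  have i1 := integrable_tensor h2 hf1
  have i2 := integrable_tensor hf1 h2
  have i3 := integrable_tensor hp hf1
  have i4 := integrable_tensor hf1 hp
  have i5 := integrable_tensor hk hf1
  have i6 := integrable_tensor hf1 hk
  have i12 : Integrable (fun c : Coll d => kin c.1 ^ (2 : ℝ) * f c.1 * f c.2.1
      + f c.1 * (kin c.2.1 ^ (2 : ℝ) * f c.2.1)) (collMeasure d) := i1.add i2
  have i34 : Integrable (fun c : Coll d => pos c.1 * f c.1 * f c.2.1
      + f c.1 * (pos c.2.1 * f c.2.1)) (collMeasure d) := i3.add i4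
  have i56 : Integrable (fun c : Coll d => kin c.1 * f c.1 * f c.2.1
      + f c.1 * (kin c.2.1 * f c.2.1)) (collMeasure d) := i5.add i6
  have i3456 : Integrable (fun c : Coll d => (pos c.1 * f c.1 * f c.2.1
      + f c.1 * (pos c.2.1 * f c.2.1)) + (kin c.1 * f c.1 * f c.2.1
      + f c.1 * (kin c.2.1 * f c.2.1))) (collMeasure d) := i34.add i56
  have iall : Integrable (fun c : Coll d => Λ / N ^ 2 * (2 * (kin c.1 ^ (2 : ℝ) * f c.1 * f c.2.1
      + f c.1 * (kin c.2.1 ^ (2 : ℝ) * f c.2.1)) + ((pos c.1 * f c.1 * f c.2.1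
      + f c.1 * (pos c.2.1 * f c.2.1)) + (kin c.1 * f c.1 * f c.2.1
      + f c.1 * (kin c.2.1 * f c.2.1))))) (collMeasure d) :=
    ((i12.const_mul 2).add i3456).const_mul _
  have hm := integral_mono_of_nonneg (μ := collMeasure d)
    (f := fun c => (kin c.1 + kin c.2.1) *
      |rate (cutWeight (N ^ 4) W) f c - rate (cutWeight R W) f c|)
    (Eventually.of_forall fun c => mul_nonneg (add_pos (kin_pos _) (kin_pos _)).le (abs_nonneg _))
    iall (by
      filter_upwards [quasi_fst.ae (ae_nonneg hf), quasi_snd.ae (ae_nonneg hf)] with c f1 f2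
      have hE : 0 ≤ kin c.1 + kin c.2.1 := (add_pos (kin_pos _) (kin_pos _)).le
      have hff : 0 ≤ f c.1 * f c.2.1 := mul_nonneg f1 f2
      by_cases hc : c ∈ region d (N ^ 4)
      · rw [rate, rate, cutWeight_of_mem hc,
          cutWeight_of_mem (region_mono (by positivity) hR hc), sub_self, abs_zero, mul_zero]
        have := kin_pos c.1
        have := kin_pos c.2.1
        have := pos_pos c.1
        have := pos_pos c.2.1
        positivity
      · rw [rate, rate, cutWeight_of_notMem hc, zero_mul, zero_sub, abs_neg, preProd, abs_mul,
          abs_of_nonneg hff, abs_of_nonneg ((h.toIsCollWeight.truncate R).nonneg c)]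
        calc (kin c.1 + kin c.2.1) * (cutWeight R W c * (f c.1 * f c.2.1))
            ≤ (kin c.1 + kin c.2.1) * (W c * (f c.1 * f c.2.1)) := by
              have := cutWeight_le h.toIsCollWeight R c
              gcongr
          _ = ((kin c.1 + kin c.2.1) * W c) * (f c.1 * f c.2.1) := by ring
          _ ≤ _ := mul_le_mul_of_nonneg_right (h.energy_mul_le hν hN hc) hff
          _ = _ := by ring)
  rw [integral_const_mul, integral_add (i12.const_mul 2) i3456, integral_const_mul,
    integral_add i1 i2, integral_add i34 i56, integral_add i3 i4, integral_add i5 i6,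
    integral_tensor (fun z => kin z ^ (2 : ℝ) * f z) (fun z => f z),
    integral_tensor (fun z => f z) (fun z => kin z ^ (2 : ℝ) * f z),
    integral_tensor (fun z => pos z * f z) (fun z => f z),
    integral_tensor (fun z => f z) (fun z => pos z * f z),
    integral_tensor (fun z => kin z * f z) (fun z => f z),
    integral_tensor (fun z => f z) (fun z => kin z * f z)] at hm
  have hAk : ∫ z, kin z * f z ≤ A * N := by
    refine (integral_mono_ae hk h2 ?_).trans hA2
    filter_upwards [ae_nonneg hf] with z hz
    refine mul_le_mul_of_nonneg_right ?_ hz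
    simpa only [Real.rpow_one] using kin_rpow_le_rpow one_le_two z
  have hf00 : 0 ≤ ∫ z, f z := integral_nonneg_of_ae (ae_nonneg hf)
  have hS := sphArea_nonneg (d := d)
  have hA : 0 ≤ A := hf00.trans hA0
  -- The higher moments are allowed to grow like `A N`: against the gain `N⁻²` of the tail, the
  -- error is still of order `A² / N`.
  have hprod : ∀ x, x ≤ A * N → x * (∫ z, f z) ≤ A * N * A := fun x hx =>
    (mul_le_mul_of_nonneg_right hx hf00).trans (mul_le_mul_of_nonneg_left hA0 (by positivity))
  have p1 := hprod _ hA2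
  have p2 := hprod _ hAp
  have p3 := hprod _ hAk
  calc 2 * ∫ c, (kin c.1 + kin c.2.1) *
      |rate (cutWeight (N ^ 4) W) f c - rate (cutWeight R W) f c| ∂collMeasure d
      ≤ 2 * (Λ / N ^ 2 * (sphArea d * (4 * ((∫ z, kin z ^ (2 : ℝ) * f z) * ∫ z, f z)
        + 2 * ((∫ z, pos z * f z) * ∫ z, f z) + 2 * ((∫ z, kin z * f z) * ∫ z, f z)))) := by
        refine mul_le_mul_of_nonneg_left (hm.trans (le_of_eq ?_)) zero_le_two
        ring
    _ ≤ 2 * (Λ / N ^ 2 * (sphArea d * (4 * (A * N * A) + 2 * (A * N * A) + 2 * (A * N * A)))) := by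
        gcongr
    _ = _ := by field_simp; ring

end Tail

section Approximation

/-- Solutions of the truncated equations with the approximating data. -/
structure IsApprox (W : Coll d → ℝ) (f₀ : L1 d) (g : ℕ → ℝ → L1 d) : Prop where
  mild : ∀ (n : ℕ) T, IsMild (cutWeight (((n : ℝ) + 1) ^ 4) W) id T (approxData n f₀) (g n)
  nonneg : ∀ (n : ℕ) t, 0 ≤ t → 0 ≤ g n t

theorem HasGrowth.isCutoff_nat (h : HasGrowth Λ ν W) (n : ℕ) :
    IsCutoff (((n : ℝ) + 1) ^ 4) (cutWeight (((n : ℝ) + 1) ^ 4) W) := h.isCutoff (by positivity)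

theorem HasGrowth.exists_isApprox (h : HasGrowth Λ ν W) {f₀ : L1 d} (hf₀ : 0 ≤ f₀) :
    ∃ g, IsApprox W f₀ g := by
  have hex : ∀ n : ℕ, ∃ f : ℝ → L1 d,
      (∀ T, IsMild (cutWeight (((n : ℝ) + 1) ^ 4) W) id T (approxData n f₀) f) ∧
        ∀ t, 0 ≤ t → 0 ≤ f t := fun n => by
    obtain ⟨L, hL0, hL⟩ := (h.isCutoff_nat n).bounded
    obtain ⟨f, hf, hf0⟩ := exists_mild (h.isCutoff_nat n).toIsCollWeight hL0 hL isTruncation_id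
      (approxData_nonneg hf₀ n)
    exact ⟨f, hf, fun t ht => (hf0 t ht).1⟩
  choose g hg hg0 using hex
  exact ⟨g, hg, hg0⟩

variable {f₀ : L1 d} {g : ℕ → ℝ → L1 d} {T t : ℝ}

theorem integrable_kin_mul_refDens : Integrable fun z : Phase d => kin z * refDens z := by
  simpa only [Real.rpow_one] using integrable_kin_rpow_mul_refDens (d := d) one_le_two

theorem integral_kin_mul_approxData_le (hf₀ : 0 ≤ f₀) (hk : Integrable fun z => kin z * f₀ z)
    (n : ℕ) : Integrable (fun z => kin z * approxData n f₀ z) ∧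
      ∫ z, kin z * approxData n f₀ z ≤ (∫ z, kin z * f₀ z) + ∫ z : Phase d, kin z * refDens z :=
  integral_mul_approxData_le hf₀ continuous_kin.measurable (fun z => (kin_pos z).le)
    (fun z => (kin_pos z).le) (fun _ _ => le_rfl) hk integrable_kin_mul_refDens

theorem integral_pos_mul_approxData_le (hf₀ : 0 ≤ f₀) (hk : Integrable fun z => pos z * f₀ z)
    (n : ℕ) : Integrable (fun z => pos z * approxData n f₀ z) ∧
      ∫ z, pos z * approxData n f₀ z ≤ (∫ z, pos z * f₀ z) + ∫ z : Phase d, pos z * refDens z :=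
  integral_mul_approxData_le hf₀ continuous_pos.measurable (fun z => (pos_pos z).le)
    (fun z => (pos_pos z).le) (fun _ _ => le_rfl) hk integrable_pos_mul_refDens

theorem integral_kin_rpow_mul_approxData_le (hf₀ : 0 ≤ f₀) {q : ℝ} (hq : q ≤ 2)
    (hk : Integrable fun z => kin z ^ q * f₀ z) (n : ℕ) :
    Integrable (fun z => kin z ^ q * approxData n f₀ z) ∧ ∫ z, kin z ^ q * approxData n f₀ z
      ≤ (∫ z, kin z ^ q * f₀ z) + ∫ z : Phase d, kin z ^ q * refDens z :=
  integral_mul_approxData_le hf₀ (measurable_kin_rpow q) (kin_rpow_nonneg q)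
    (kin_rpow_nonneg q) (fun _ _ => le_rfl) hk (integrable_kin_rpow_mul_refDens hq)

theorem IsApprox.integral_kin_rpow_le (hg : IsApprox W f₀ g) (h : HasGrowth Λ ν W) (hf₀ : 0 ≤ f₀)
    (hk : Integrable fun z => kin z * f₀ z) {q : ℝ} (hq : 1 ≤ q) (hq2 : q ≤ 2) {n : ℕ}
    (hm : Integrable fun z => kin z ^ q * approxData n f₀ z) (ht : t ∈ Icc 0 T) :
    Integrable (fun z => kin z ^ q * g n t z) ∧
      ∫ z, kin z ^ q * g n t z ≤ (∫ z, kin z ^ q * approxData n f₀ z)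
        * Real.exp (6 * Λ * sphArea d * (∫ z, kin z * approxData n f₀ z) * T) :=
  (hg.mild n T).integral_kin_rpow_le (h.isCutoff_nat n) h.const_nonneg h.exp_le (h.truncate _).le
    (approxData_nonneg hf₀ n) (fun s hs => hg.nonneg n s hs.1)
    (integral_kin_mul_approxData_le hf₀ hk n).1 hq hq2 hm ht

theorem IsApprox.integral_collInvariant (hg : IsApprox W f₀ g) (h : HasGrowth Λ ν W) (hf₀ : 0 ≤ f₀)
    (hk : Integrable fun z => kin z * f₀ z) {χ : Phase d → ℝ}
    (hχ : Measurable χ) (hs : ∀ t z, χ (shift t z) = χ z) (hc : ∀ c, collGrad χ c = 0)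
    (hχk : ∀ z, |χ z| ≤ kin z) (n : ℕ) (ht : 0 ≤ t) :
    ∫ z, χ z * g n t z = ∫ z, χ z * approxData n f₀ z :=
  (hg.mild n t).integral_collInvariant (h.isCutoff_nat n)
    (integral_kin_mul_approxData_le hf₀ hk n).1 hχ hs hc hχk ⟨ht, le_rfl⟩ (hg.nonneg n t ht)

theorem IsApprox.integral_kin_le (hg : IsApprox W f₀ g) (h : HasGrowth Λ ν W) (hf₀ : 0 ≤ f₀)
    (hk : Integrable fun z => kin z * f₀ z) (n : ℕ) (ht : 0 ≤ t) :
    Integrable (fun z => kin z * g n t z) ∧ ∫ z, kin z * g n t z ≤ (∫ z, kin z * f₀ z)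
      + ∫ z : Phase d, kin z * refDens z := by
  have h0 := integral_kin_mul_approxData_le hf₀ hk n
  refine ⟨(hg.mild n t).integrable_kin (h.isCutoff_nat n) h0.1 ⟨ht, le_rfl⟩ (hg.nonneg n t ht), ?_⟩
  rw [hg.integral_collInvariant h hf₀ hk continuous_kin.measurable kin_shift collGrad_kin
    (fun z => (abs_of_pos (kin_pos z)).le) n ht]
  exact h0.2

theorem IsApprox.integral_pos_le (hg : IsApprox W f₀ g) (h : HasGrowth Λ ν W) (hf₀ : 0 ≤ f₀)
    (hk : Integrable fun z => kin z * f₀ z) {n : ℕ}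
    (hx : Integrable fun z => pos z * approxData n f₀ z) (ht : t ∈ Icc 0 T) :
    Integrable (fun z => pos z * g n t z) ∧ ∫ z, pos z * g n t z
      ≤ ((∫ z, pos z * approxData n f₀ z) + (∫ z, kin z * approxData n f₀ z) * T) * Real.exp T :=
  (hg.mild n T).integral_pos_le (h.isCutoff_nat n) (ht.1.trans ht.2) (approxData_nonneg hf₀ n)
    (fun s hs => hg.nonneg n s hs.1) (integral_kin_mul_approxData_le hf₀ hk n).1 hx ht

/-- The bound is uniform in `n`, because the moments of the approximating data are dominated by
those of `f₀` and of the reference density, and propagation does not depend on the truncation. -/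
theorem IsApprox.exists_moment_bound (hg : IsApprox W f₀ g) (h : HasGrowth Λ ν W) (hf₀ : 0 ≤ f₀)
    {q : ℝ} (hq : 1 ≤ q) (hq2 : q ≤ 2) (hm : Integrable fun z => kin z ^ q * f₀ z) (T : ℝ) :
    ∃ M, ∀ n, ∀ t ∈ Icc 0 T, Integrable (fun z => kin z ^ q * g n t z) ∧
      ∫ z, kin z ^ q * |g n t z| ≤ M := by
  have hk : Integrable fun z => kin z * f₀ z := by
    simpa only [Real.rpow_one] using integrable_kin_rpow_of_le hq (integrable_L1 f₀).1 hm
  refine ⟨((∫ z, kin z ^ q * f₀ z) + ∫ z : Phase d, kin z ^ q * refDens z) * Real.exp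
    (6 * Λ * sphArea d * ((∫ z, kin z * f₀ z) + ∫ z : Phase d, kin z * refDens z) * T),
    fun n t ht => ?_⟩
  have hT : 0 ≤ T := ht.1.trans ht.2
  have h1 := integral_kin_rpow_mul_approxData_le hf₀ hq2 hm n
  have h2 := integral_kin_mul_approxData_le hf₀ hk n
  obtain ⟨h3, h4⟩ := hg.integral_kin_rpow_le h hf₀ hk hq hq2 h1.1 ht
  refine ⟨h3, ?_⟩
  rw [(integrable_abs_of_nonneg (hg.nonneg n t ht.1) h3).2]
  have hS : 0 ≤ 6 * Λ * sphArea d :=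
    mul_nonneg (mul_nonneg (by norm_num) h.const_nonneg) sphArea_nonneg
  have h5 : 0 ≤ ∫ z, kin z ^ q * approxData n f₀ z := integral_nonneg_of_ae (by
    filter_upwards [ae_nonneg (approxData_nonneg hf₀ n)] with z hz
    exact mul_nonneg (kin_rpow_nonneg _ _) hz)
  refine h4.trans (mul_le_mul h1.2 (Real.exp_le_exp.2 ?_) (Real.exp_pos _).le (h5.trans h1.2))
  exact mul_le_mul_of_nonneg_right (mul_le_mul_of_nonneg_left h2.2 hS) hT

/-- The data need not have moments of order `kin²` or `pos`. For the approximating data these grow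
at most linearly in `n`, since on the core `kin² ≤ (n + 1) kin` and `pos ≤ n + 1`. This is what the
tail estimate tolerates, so a finite velocity moment of `f₀` suffices for convergence. -/
theorem IsApprox.exists_growth_bound (hg : IsApprox W f₀ g) (h : HasGrowth Λ ν W) (hf₀ : 0 ≤ f₀)
    (hk : Integrable fun z => kin z * f₀ z) (T : ℝ) :
    ∃ A, ∀ n : ℕ, ∀ t ∈ Icc 0 T, Integrable (fun z => kin z ^ (2 : ℝ) * g n t z) ∧
      Integrable (fun z => pos z * g n t z) ∧ ∫ z, g n t z ≤ A ∧
      ∫ z, kin z ^ (2 : ℝ) * g n t z ≤ A * ((n : ℝ) + 1) ∧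
      ∫ z, pos z * g n t z ≤ A * ((n : ℝ) + 1) := by
  set m1 := ∫ z, kin z * f₀ z with hm1
  set r1 := ∫ z : Phase d, kin z * refDens z with hr1
  set r2 := ∫ z : Phase d, kin z ^ (2 : ℝ) * refDens z with hr2
  set r3 := ∫ z : Phase d, pos z * refDens z with hr3
  set ex := Real.exp (6 * Λ * sphArea d * (m1 + r1) * T) with hex
  have hm1' : 0 ≤ m1 := integral_nonneg_of_ae (by
    filter_upwards [ae_nonneg hf₀] with z hz using mul_nonneg (kin_pos z).le hz)
  have hr1' : 0 ≤ r1 := integral_nonneg fun z => mul_nonneg (kin_pos z).le (refDens_pos z).le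
  have hr2' : 0 ≤ r2 :=
    integral_nonneg fun z => mul_nonneg (kin_rpow_nonneg _ z) (refDens_pos z).le
  have hr3' : 0 ≤ r3 := integral_nonneg fun z => mul_nonneg (pos_pos z).le (refDens_pos z).le
  have hS : 0 ≤ 6 * Λ * sphArea d :=
    mul_nonneg (mul_nonneg (by norm_num) h.const_nonneg) sphArea_nonneg
  refine ⟨(m1 + r1) + (m1 + r2) * ex + ((m1 + r3) + (m1 + r1) * |T|) * Real.exp T,
    fun n t ht => ?_⟩
  have hT : 0 ≤ T := ht.1.trans ht.2
  have hn1 : (1 : ℝ) ≤ (n : ℝ) + 1 := by linarith [(Nat.cast_nonneg n : (0 : ℝ) ≤ n)]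
  have hn0 : (0 : ℝ) ≤ (n : ℝ) + 1 := by linarith
  have a1 := integral_kin_mul_approxData_le hf₀ hk n
  have hnk : Integrable fun z => (((n : ℝ) + 1) * kin z) * f₀ z := by
    simpa only [mul_assoc] using hk.const_mul ((n : ℝ) + 1)
  have hw' : ∀ z : Phase d, 0 ≤ ((n : ℝ) + 1) * kin z := fun z => mul_nonneg hn0 (kin_pos z).le
  have e : ∫ z, (((n : ℝ) + 1) * kin z) * f₀ z = ((n : ℝ) + 1) * m1 := by
    simp only [mul_assoc]; rw [integral_const_mul]
  have a2 := integral_mul_approxData_le hf₀ (measurable_kin_rpow 2) (kin_rpow_nonneg 2)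
    hw' (n := n) (fun z hz => by
      rw [Real.rpow_two, sq]
      exact mul_le_mul_of_nonneg_right hz.1 (kin_pos z).le) hnk
    (integrable_kin_rpow_mul_refDens le_rfl)
  have a3 := integral_mul_approxData_le hf₀ continuous_pos.measurable (fun z => (pos_pos z).le)
    hw' (n := n) (fun z hz => hz.2.trans (le_mul_of_one_le_right hn0 (one_le_kin z))) hnk
    integrable_pos_mul_refDens
  rw [e] at a2 a3
  obtain ⟨b1, b2⟩ := hg.integral_kin_rpow_le h hf₀ hk one_le_two le_rfl a2.1 ht
  obtain ⟨c1, c2⟩ := hg.integral_pos_le h hf₀ hk a3.1 ht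
  obtain ⟨k1, k2⟩ := hg.integral_kin_le h hf₀ hk n ht.1
  have hint : ∫ z, g n t z ≤ m1 + r1 := by
    refine (integral_mono_ae (integrable_L1 _) k1 ?_).trans k2
    filter_upwards [ae_nonneg (hg.nonneg n t ht.1)] with z hz
    exact le_mul_of_one_le_left hz (one_le_kin z)
  have hex0 : 0 < ex := Real.exp_pos _
  have hexT : 0 < Real.exp T := Real.exp_pos _
  have t2 : 0 ≤ (m1 + r2) * ex := by positivity
  have t3 : 0 ≤ ((m1 + r3) + (m1 + r1) * |T|) * Real.exp T := by positivity
  have t1 : 0 ≤ m1 + r1 := by positivity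
  rw [abs_of_nonneg hT] at t3 ⊢
  refine ⟨b1, c1, by linarith, ?_, ?_⟩
  · have u1 : (∫ z, kin z ^ (2 : ℝ) * approxData n f₀ z) ≤ (m1 + r2) * ((n : ℝ) + 1) :=
      a2.2.trans (by have := le_mul_of_one_le_right hr2' hn1; linarith)
    have u0 : 0 ≤ (m1 + r2) * ((n : ℝ) + 1) := by positivity
    have u2 : Real.exp (6 * Λ * sphArea d * (∫ z, kin z * approxData n f₀ z) * T) ≤ ex :=
      Real.exp_le_exp.2 (mul_le_mul_of_nonneg_right (mul_le_mul_of_nonneg_left a1.2 hS) hT)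
    have u3 := b2.trans (mul_le_mul u1 u2 (Real.exp_pos _).le u0)
    refine u3.trans ((le_of_eq (by ring)).trans (mul_le_mul_of_nonneg_right
      (show (m1 + r2) * ex ≤ _ by linarith) hn0))
  · have u1 : (∫ z, pos z * approxData n f₀ z) ≤ (m1 + r3) * ((n : ℝ) + 1) :=
      a3.2.trans (by have := le_mul_of_one_le_right hr3' hn1; linarith)
    have u2 : (∫ z, kin z * approxData n f₀ z) * T ≤ (m1 + r1) * T * ((n : ℝ) + 1) := by
      have := mul_le_mul_of_nonneg_right a1.2 hT
      have : (m1 + r1) * T ≤ (m1 + r1) * T * ((n : ℝ) + 1) :=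
        le_mul_of_one_le_right (by positivity) hn1
      linarith
    have u3 := c2.trans (mul_le_mul_of_nonneg_right (add_le_add u1 u2) hexT.le)
    refine u3.trans ((le_of_eq (by ring)).trans (mul_le_mul_of_nonneg_right
      (show ((m1 + r3) + (m1 + r1) * T) * Real.exp T ≤ _ by linarith) hn0))

/-- Stability with two truncated weights. The weights are compared on the solution of smaller index
`n`, where the tail estimate with `N = n + 1` gives an error of order `1 / (n + 1) = mixing n`. -/
theorem IsApprox.exists_cauchy_bound (hg : IsApprox W f₀ g) (h : HasGrowth Λ ν W) (hν : ν ≤ 1 / 2)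
    (hf₀ : 0 ≤ f₀) (hm : Integrable fun z => kin z ^ (1 + ν) * f₀ z) (T : ℝ) :
    ∃ C K : ℝ, ∀ n m : ℕ, n ≤ m → ∀ t ∈ Icc 0 T,
      ∫ z, kin z * |(g n t - g m t) z|
        ≤ ((∫ z, kin z * |(approxData n f₀ - approxData m f₀) z|) + C * mixing n) * K := by
  have hν0 := h.exp_nonneg
  have hk := integrable_kin_of_rpow hν0 (integrable_L1 f₀).1 hm
  obtain ⟨M, hM⟩ := hg.exists_moment_bound h hf₀ (q := 1 + ν) (by linarith) (by linarith) hm T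
  obtain ⟨A, hA⟩ := hg.exists_growth_bound h hf₀ hk T
  have h0 := h.const_nonneg
  have hS := sphArea_nonneg (d := d)
  refine ⟨16 * Λ * sphArea d * A ^ 2 * T, Real.exp (16 * Λ * sphArea d * M * T),
    fun n m hnm t ht => ?_⟩
  have hT : 0 ≤ T := ht.1.trans ht.2
  have hn1 : (1 : ℝ) ≤ (n : ℝ) + 1 := by linarith [(Nat.cast_nonneg n : (0 : ℝ) ≤ n)]
  have hnm' : ((n : ℝ) + 1) ^ 4 ≤ ((m : ℝ) + 1) ^ 4 := by gcongr
  have he : 0 ≤ 16 * Λ * sphArea d * A ^ 2 / ((n : ℝ) + 1) := by positivity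
  have key := (hg.mild n T).integral_kin_sub_le (h.truncate (((m : ℝ) + 1) ^ 4))
    (h.truncate (((n : ℝ) + 1) ^ 4)) (hg.mild m T) (fun s hs => hg.nonneg n s hs.1) (hM n) (hM m)
    he (fun s hs => by
      obtain ⟨a1, a2, a3, a4, a5⟩ := hA n s hs
      exact h.integral_energy_tail_le hν hn1 hnm' (hg.nonneg n s hs.1) a1 a2 a3 a4 a5) ht
  have hM0 : 0 ≤ M := (integral_nonneg fun z => mul_nonneg (kin_rpow_nonneg _ _)
    (abs_nonneg _)).trans (hM n t ht).2
  have hi0 : 0 ≤ ∫ z, kin z * |(approxData n f₀ - approxData m f₀) z| :=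
    integral_nonneg fun z => mul_nonneg (kin_pos z).le (abs_nonneg _)
  refine key.trans (mul_le_mul (le_of_eq ?_) (Real.exp_le_exp.2 ?_) (Real.exp_pos _).le ?_)
  · unfold mixing; ring
  · exact mul_le_mul_of_nonneg_left ht.2 (by positivity)
  · exact add_nonneg hi0 (mul_nonneg (by positivity) (mixing_pos n).le)

end Approximation

end FuzzyBoltzmann

/-! ### Passage to the limit in the truncated equations. -/

namespace FuzzyBoltzmann

open Filter Topology

variable {d : ℕ} {Λ ν : ℝ} {W : Coll d → ℝ}

section Continuity

/-- The collision operator is locally Lipschitz in the moment of order `ν` of `kin`. Convergence in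
that norm follows by interpolation between `L¹` convergence and the bound for the moment of order `1
+ ν`. -/
theorem HasGrowth.tendsto_norm_collQ_sub {ι : Type*} {l : Filter ι} {V : ι → Coll d → ℝ}
    (h : ∀ i, HasGrowth Λ ν (V i)) {G : ι → L1 d} {g : L1 d} (hG : Tendsto G l (𝓝 g)) {M : ℝ}
    (hi : ∀ᶠ i in l, Integrable (fun z => kin z ^ (1 + ν) * |G i z|) ∧
      ∫ z, kin z ^ (1 + ν) * |G i z| ≤ M)
    (hg : Integrable (fun z => kin z ^ (1 + ν) * |g z|) ∧ ∫ z, kin z ^ (1 + ν) * |g z| ≤ M) :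
    Tendsto (fun i => ‖collQ (V i) (G i) - collQ (V i) g‖) l (𝓝 0) := by
  -- The condition `ν ≤ 1` is read off one of the weights, which requires an index.
  rcases isEmpty_or_nonempty ι with hι | ⟨⟨i₀⟩⟩
  · rw [filter_eq_bot_of_isEmpty l]; exact tendsto_bot
  have hd := tendsto_integral_of_moment (u := fun z => kin z ^ ν) (kin_rpow_nonneg ν)
    (kin_rpow_nonneg (1 + ν)) (fun R hR z => kin_rpow_le_add (h i₀).exp_le hR z) hG hi hg
  have hd2 := hd.const_mul (2 * (2 * Λ * sphArea d * (M + M)))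
  rw [mul_zero] at hd2
  refine squeeze_zero' (Eventually.of_forall fun _ => norm_nonneg _) ?_ hd2
  have hm := fun f : L1 d => (integrable_L1 f).1
  have hint : ∀ {f : L1 d}, Integrable (fun z => kin z ^ (1 + ν) * |f z|) →
      Integrable fun z => kin z ^ (1 + ν) * f z := fun {f} hf =>
    integrable_weight_of_abs (measurable_kin_rpow _) (hm f) hf
  have hlow : ∀ {f : L1 d}, Integrable (fun z => kin z ^ (1 + ν) * |f z|) ∧
      ∫ z, kin z ^ (1 + ν) * |f z| ≤ M → ∫ z, kin z ^ ν * |f z| ≤ M := fun {f} hf =>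
    (integral_mono (integrable_kin_rpow_of_le (by linarith) (hm f).norm hf.1) hf.1 fun z =>
      mul_le_mul_of_nonneg_right (kin_rpow_le_rpow (by linarith) z) (abs_nonneg _)).trans hf.2
  filter_upwards [hi] with i hi
  refine (norm_collQ_sub_le ((h i).integrable_rate_L1 (hint hi.1))
    ((h i).integrable_rate_L1 (hint hg.1))).trans ?_
  have h1 := (h i).integral_abs_rate_sub_le (hm (G i)) (hm g)
    (integrable_kin_rpow_of_le (by linarith) (hm _) (hint hi.1))
    (integrable_kin_rpow_of_le (by linarith) (hm _) (hint hg.1))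
  have h2 := hlow hi
  have h3 := hlow hg
  have h0 := (h i).const_nonneg
  have hS := sphArea_nonneg (d := d)
  have h4 : 0 ≤ ∫ z, kin z ^ ν * |G i z - g z| :=
    integral_nonneg fun z => mul_nonneg (kin_rpow_nonneg _ _) (abs_nonneg _)
  calc _ ≤ 2 * (2 * Λ * sphArea d * ((∫ z, kin z ^ ν * |G i z - g z|)
        * ((∫ z, kin z ^ ν * |G i z|) + ∫ z, kin z ^ ν * |g z|))) :=
        mul_le_mul_of_nonneg_left h1 zero_le_two
    _ ≤ 2 * (2 * Λ * sphArea d * ((∫ z, kin z ^ ν * |G i z - g z|) * (M + M))) := by gcongr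
    _ = _ := by ring

theorem HasGrowth.tendsto_collQ_cutWeight (h : HasGrowth Λ ν W) {R : ℕ → ℝ}
    (hR : Tendsto R atTop atTop) {g : L1 d} (hg : Integrable fun z => kin z ^ (1 + ν) * g z) :
    Tendsto (fun n => collQ (cutWeight (R n) W) g) atTop (𝓝 (collQ W g)) := by
  have hr := h.integrable_rate_L1 hg
  have hrn := fun n => (h.truncate (R n)).integrable_rate_L1 hg
  rw [tendsto_iff_norm_sub_tendsto_zero]
  have hlim : Tendsto (fun n => ∫ c, |rate (cutWeight (R n) W) g c - rate W g c| ∂collMeasure d)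
      atTop (𝓝 (∫ _ : Coll d, (0 : ℝ) ∂collMeasure d)) := by
    refine tendsto_integral_of_dominated_convergence (fun c => ‖rate W g c‖)
      (fun n => ((hrn n).sub hr).abs.1) hr.norm (fun n => Eventually.of_forall fun c => ?_)
      (Eventually.of_forall fun c => ?_)
    · rw [Real.norm_eq_abs, abs_abs]
      by_cases hc : c ∈ region d (R n)
      · rw [rate, rate, cutWeight_of_mem hc, sub_self, abs_zero]; exact norm_nonneg _
      · rw [rate, cutWeight_of_notMem hc, zero_mul, zero_sub, abs_neg]; exact le_rfl
    · refine tendsto_const_nhds.congr' ?_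
      filter_upwards [eventually_cutWeight_eq hR W c] with n hn
      rw [rate, rate, hn, sub_self, abs_zero]
  rw [integral_zero] at hlim
  refine squeeze_zero (fun _ => norm_nonneg _) (fun n => norm_collQ_sub_le (hrn n) hr) ?_
  simpa using hlim.const_mul 2

theorem HasGrowth.tendsto_collQ_of_tendsto (h : HasGrowth Λ ν W) {R : ℕ → ℝ}
    (hR : Tendsto R atTop atTop) {G : ℕ → L1 d} {g : L1 d} (hG : Tendsto G atTop (𝓝 g)) {M : ℝ}
    (hi : ∀ n, Integrable (fun z => kin z ^ (1 + ν) * |G n z|) ∧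
      ∫ z, kin z ^ (1 + ν) * |G n z| ≤ M)
    (hg : Integrable (fun z => kin z ^ (1 + ν) * |g z|) ∧ ∫ z, kin z ^ (1 + ν) * |g z| ≤ M) :
    Tendsto (fun n => collQ (cutWeight (R n) W) (G n)) atTop (𝓝 (collQ W g)) := by
  have h1 := HasGrowth.tendsto_norm_collQ_sub (fun n => h.truncate (R n)) hG
    (Eventually.of_forall hi) hg
  have h2 := h.tendsto_collQ_cutWeight hR
    (integrable_weight_of_abs (measurable_kin_rpow _) (integrable_L1 g).1 hg.1)
  have h3 := (tendsto_zero_iff_norm_tendsto_zero.2 h1).add h2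
  simpa using h3

/-- The collision operator is continuous along `L¹`-continuous curves with bounded moments. -/
theorem HasGrowth.continuousOn_collQ (h : HasGrowth Λ ν W) {s : Set ℝ} {f : ℝ → L1 d}
    (hf : ContinuousOn f s) {M : ℝ} (hi : ∀ t ∈ s, Integrable (fun z => kin z ^ (1 + ν) * |f t z|) ∧
      ∫ z, kin z ^ (1 + ν) * |f t z| ≤ M) : ContinuousOn (fun t => collQ W (f t)) s := by
  intro t ht
  rw [ContinuousWithinAt, tendsto_iff_norm_sub_tendsto_zero]
  exact HasGrowth.tendsto_norm_collQ_sub (fun _ => h) (hf t ht)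
    (eventually_nhdsWithin_of_forall hi) (hi t ht)

end Continuity

section Limit

theorem integrable_kin_abs_sub {f g : L1 d} (hf : Integrable fun z => kin z * f z)
    (hg : Integrable fun z => kin z * g z) : Integrable fun z => kin z * |(f - g) z| := by
  refine (integrable_weight_abs_sub (fun z => (kin_pos z).le) hf hg).congr ?_
  filter_upwards [Lp.coeFn_sub f g] with z hz
  rw [hz, Pi.sub_apply]

theorem norm_le_integral_kin {f : L1 d} (hf : Integrable fun z => kin z * |f z|) :
    ‖f‖ ≤ ∫ z, kin z * |f z| := by
  rw [norm_L1]
  exact integral_mono (integrable_L1 _).abs hf fun z =>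
    le_mul_of_one_le_left (abs_nonneg _) (one_le_kin z)

theorem integral_kin_sub_comm (f g : L1 d) :
    ∫ z, kin z * |(f - g) z| = ∫ z, kin z * |(g - f) z| := by
  refine integral_congr_ae ?_
  filter_upwards [Lp.coeFn_sub f g, Lp.coeFn_sub g f] with z h1 h2
  rw [h1, h2, Pi.sub_apply, Pi.sub_apply, abs_sub_comm]

/-- Convergence in `L¹(⟨v⟩²)`, locally uniformly in time. -/
def KinLimit (g : ℕ → ℝ → L1 d) (f : ℝ → L1 d) : Prop :=
  ∀ T ε : ℝ, 0 < ε → ∀ᶠ n in atTop, ∀ t ∈ Icc 0 T,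
    Integrable (fun z => kin z * |(g n t - f t) z|) ∧ ∫ z, kin z * |(g n t - f t) z| ≤ ε

variable {f₀ : L1 d} {g : ℕ → ℝ → L1 d} {f : ℝ → L1 d} {T t : ℝ}

theorem IsApprox.exists_forall_le (hg : IsApprox W f₀ g) (h : HasGrowth Λ ν W) (hν : ν ≤ 1 / 2)
    (hf₀ : 0 ≤ f₀) (hm : Integrable fun z => kin z ^ (1 + ν) * f₀ z) (T : ℝ) {ε : ℝ} (hε : 0 < ε) :
    ∃ N, ∀ n ≥ N, ∀ m ≥ N, ∀ t ∈ Icc 0 T, ∫ z, kin z * |(g n t - g m t) z| ≤ ε := by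
  obtain ⟨C, K, hCK⟩ := hg.exists_cauchy_bound h hν hf₀ hm T
  have hk := integrable_kin_of_rpow h.exp_nonneg (integrable_L1 f₀).1 hm
  have ha := tendsto_integral_mul_approxData_sub hf₀ continuous_kin.measurable
    (fun z => (kin_pos z).le) hk integrable_kin_mul_refDens
  have hkn := fun n => (integral_kin_mul_approxData_le hf₀ hk n).1
  have hmix := tendsto_mixing.const_mul |C|
  rw [mul_zero] at hmix
  -- Three errors of size `δ`, two from the data and one from the tail, are multiplied by at most
  -- `|K| + 1`.
  set δ := ε / (3 * (|K| + 1)) with hδ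
  have hK : 0 < |K| + 1 := by positivity
  have hδ0 : 0 < δ := by positivity
  obtain ⟨N, hN⟩ := eventually_atTop.1 ((ha.eventually_lt_const hδ0).and
    (hmix.eventually_lt_const hδ0))
  have main : ∀ n ≥ N, ∀ m ≥ N, n ≤ m → ∀ t ∈ Icc 0 T,
      ∫ z, kin z * |(g n t - g m t) z| ≤ ε := by
    intro n hn m hm' hnm t ht
    have i1 : Integrable fun z => kin z * |approxData n f₀ z - f₀ z| :=
      integrable_weight_abs_sub (fun z => (kin_pos z).le) (hkn n) hk
    have i2 : Integrable fun z => kin z * |approxData m f₀ z - f₀ z| :=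
      integrable_weight_abs_sub (fun z => (kin_pos z).le) (hkn m) hk
    have h1 : ∫ z, kin z * |(approxData n f₀ - approxData m f₀) z| ≤ δ + δ := by
      refine le_trans ?_ (add_le_add (hN n hn).1.le (hN m hm').1.le)
      rw [← integral_add i1 i2]
      refine integral_mono_ae (integrable_kin_abs_sub (hkn n) (hkn m)) (i1.add i2) ?_
      filter_upwards [Lp.coeFn_sub (approxData n f₀) (approxData m f₀)] with z hz
      rw [hz, Pi.sub_apply]
      have : |approxData n f₀ z - approxData m f₀ z|
          ≤ |approxData n f₀ z - f₀ z| + |approxData m f₀ z - f₀ z| := by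
        rw [abs_sub_comm (approxData m f₀ z)]
        exact abs_sub_le _ _ _
      simp only [← mul_add]
      exact mul_le_mul_of_nonneg_left this (kin_pos z).le
    have h0 : 0 ≤ ∫ z, kin z * |(approxData n f₀ - approxData m f₀) z| :=
      integral_nonneg fun z => mul_nonneg (kin_pos z).le (abs_nonneg _)
    have h2 : C * mixing n ≤ δ :=
      (mul_le_mul_of_nonneg_right (le_abs_self C) (mixing_pos n).le).trans (hN n hn).2.le
    have h3 := (hCK n m hnm t ht).trans (le_abs_self _)
    rw [abs_mul] at h3
    have h4 : |(∫ z, kin z * |(approxData n f₀ - approxData m f₀) z|) + C * mixing n|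
        ≤ 3 * δ := by
      refine (abs_add_le _ _).trans ?_
      rw [abs_of_nonneg h0, abs_mul, abs_of_pos (mixing_pos n)]
      linarith [(hN n hn).2]
    calc _ ≤ _ := h3
      _ ≤ 3 * δ * (|K| + 1) := mul_le_mul h4 (by linarith) (abs_nonneg _) (by positivity)
      _ = ε := by rw [hδ]; field_simp
  refine ⟨N, fun n hn m hm' t ht => ?_⟩
  rcases le_total n m with hnm | hnm
  · exact main n hn m hm' hnm t ht
  · rw [integral_kin_sub_comm]; exact main m hm' n hn hnm t ht

/-- The limit is taken in `L¹` at each time. Letting the second index tend to infinity in the Cauchy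
estimate, Fatou's lemma restores the weight `kin` and the uniformity in time. At negative times the
value is irrelevant and set to `0`. -/
theorem IsApprox.exists_kinLimit (hg : IsApprox W f₀ g) (h : HasGrowth Λ ν W) (hν : ν ≤ 1 / 2)
    (hf₀ : 0 ≤ f₀) (hm : Integrable fun z => kin z ^ (1 + ν) * f₀ z) : ∃ f, KinLimit g f := by
  have hk := integrable_kin_of_rpow h.exp_nonneg (integrable_L1 f₀).1 hm
  have hgk : ∀ n t, 0 ≤ t → Integrable fun z => kin z * g n t z := fun n t ht =>
    (hg.integral_kin_le h hf₀ hk n ht).1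
  have hex : ∀ t, ∃ F, 0 ≤ t → Tendsto (fun n => g n t) atTop (𝓝 F) := by
    intro t
    by_cases ht : 0 ≤ t
    · have hc : CauchySeq fun n => g n t := by
        refine Metric.cauchySeq_iff.2 fun ε hε => ?_
        obtain ⟨N, hN⟩ := hg.exists_forall_le h hν hf₀ hm t (half_pos hε)
        refine ⟨N, fun m hm' n hn => ?_⟩
        rw [dist_eq_norm]
        refine (norm_le_integral_kin (integrable_kin_abs_sub (hgk m t ht) (hgk n t ht))).trans_lt ?_
        exact (hN m hm' n hn t ⟨ht, le_rfl⟩).trans_lt (half_lt_self hε)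
      obtain ⟨F, hF⟩ := cauchySeq_tendsto_of_complete hc
      exact ⟨F, fun _ => hF⟩
    · exact ⟨0, fun h => absurd h ht⟩
  choose f hf using hex
  refine ⟨f, fun T ε hε => ?_⟩
  obtain ⟨N, hN⟩ := hg.exists_forall_le h hν hf₀ hm T hε
  filter_upwards [eventually_ge_atTop N] with n hn t ht
  have hlim : Tendsto (fun m => g n t - g (m + N) t) atTop (𝓝 (g n t - f t)) :=
    tendsto_const_nhds.sub ((hf t ht.1).comp (tendsto_add_atTop_nat N))
  exact integrable_moment_of_tendsto (fun z => (kin_pos z).le) hlim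
    (fun m => integrable_kin_abs_sub (hgk n t ht.1) (hgk _ t ht.1))
    (fun m => hN n hn (m + N) (Nat.le_add_left _ _) t ht) tendsto_const_nhds

theorem KinLimit.tendsto (hl : KinLimit g f) (ht : 0 ≤ t) :
    Tendsto (fun n => g n t) atTop (𝓝 (f t)) := by
  refine Metric.tendsto_nhds.2 fun ε hε => ?_
  filter_upwards [hl t (ε / 2) (half_pos hε)] with n hn
  obtain ⟨h1, h2⟩ := hn t ⟨ht, le_rfl⟩
  rw [dist_eq_norm]
  exact ((norm_le_integral_kin h1).trans h2).trans_lt (half_lt_self hε)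

theorem KinLimit.continuousOn (hl : KinLimit g f) (hc : ∀ n, ContinuousOn (g n) (Icc 0 T)) :
    ContinuousOn f (Icc 0 T) := by
  have hu : TendstoUniformlyOn g f atTop (Icc 0 T) := by
    refine Metric.tendstoUniformlyOn_iff.2 fun ε hε => ?_
    filter_upwards [hl T (ε / 2) (half_pos hε)] with n hn t ht
    obtain ⟨h1, h2⟩ := hn t ht
    rw [dist_comm, dist_eq_norm]
    exact ((norm_le_integral_kin h1).trans h2).trans_lt (half_lt_self hε)
  exact hu.continuousOn (Frequently.of_forall hc)

theorem KinLimit.nonneg (hl : KinLimit g f) (hg : IsApprox W f₀ g) (ht : 0 ≤ t) : 0 ≤ f t :=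
  ge_of_tendsto' (hl.tendsto ht) fun n => hg.nonneg n t ht

/-- Moments in the limit. -/
theorem KinLimit.integral_mul_le (hl : KinLimit g f) (hg : IsApprox W f₀ g) (ht : 0 ≤ t)
    {w : Phase d → ℝ} (hw : Measurable w) (hw0 : ∀ z, 0 ≤ w z)
    (hi : ∀ n, Integrable fun z => w z * g n t z) {b : ℕ → ℝ} {B : ℝ}
    (hb : ∀ n, ∫ z, w z * g n t z ≤ b n) (hB : Tendsto b atTop (𝓝 B)) :
    Integrable (fun z => w z * f t z) ∧ ∫ z, w z * f t z ≤ B := by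
  have ha := fun n => integrable_abs_of_nonneg (hg.nonneg n t ht) (hi n)
  obtain ⟨h1, h2⟩ := integrable_moment_of_tendsto hw0 (hl.tendsto ht) (fun n => (ha n).1)
    (fun n => (ha n).2.trans_le (hb n)) hB
  have h3 := integrable_weight_of_abs hw (integrable_L1 (f t)).1 h1
  refine ⟨h3, ?_⟩
  rwa [← (integrable_abs_of_nonneg (hl.nonneg hg ht) h3).2]

theorem KinLimit.tendsto_integral (hl : KinLimit g f) {χ : Phase d → ℝ} (hχ : Measurable χ)
    (hχk : ∀ z, |χ z| ≤ kin z) (ht : 0 ≤ t) (hg : ∀ n, Integrable fun z => kin z * g n t z)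
    (hf : Integrable fun z => kin z * f t z) :
    Tendsto (fun n => ∫ z, χ z * g n t z) atTop (𝓝 (∫ z, χ z * f t z)) := by
  refine Metric.tendsto_nhds.2 fun ε hε => ?_
  filter_upwards [hl t (ε / 2) (half_pos hε)] with n hn
  obtain ⟨h1, h2⟩ := hn t ⟨ht, le_rfl⟩
  have i1 := integrable_of_abs_le_kin hχ hχk (integrable_L1 (g n t)).1 (hg n)
  have i2 := integrable_of_abs_le_kin hχ hχk (integrable_L1 (f t)).1 hf
  rw [Real.dist_eq, ← integral_sub i1 i2]
  refine lt_of_le_of_lt ((abs_integral_le_integral_abs).trans ?_) (half_lt_self hε)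
  refine le_trans (integral_mono_ae (i1.sub i2).abs h1 ?_) h2
  filter_upwards [Lp.coeFn_sub (g n t) (f t)] with z hz
  rw [hz, Pi.sub_apply]
  rw [← mul_sub, abs_mul]
  exact mul_le_mul_of_nonneg_right (hχk z) (abs_nonneg _)

theorem tendsto_cutRadius : Tendsto (fun n : ℕ => ((n : ℝ) + 1) ^ 4) atTop atTop :=
  (tendsto_pow_atTop (by norm_num)).comp
    (tendsto_atTop_add_const_right _ _ tendsto_natCast_atTop_atTop)

/-- The limit solves the equation. -/
theorem KinLimit.isMild (hl : KinLimit g f) (hg : IsApprox W f₀ g) (h : HasGrowth Λ ν W)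
    (hν : ν ≤ 1) (hf₀ : 0 ≤ f₀) (hm : Integrable fun z => kin z ^ (1 + ν) * f₀ z) (T : ℝ) :
    IsMild W id T f₀ f := by
  have hν0 := h.exp_nonneg
  obtain ⟨M, hM⟩ := hg.exists_moment_bound h hf₀ (q := 1 + ν) (by linarith) (by linarith) hm T
  have hMa : ∀ n, ∀ t ∈ Icc 0 T, Integrable (fun z => kin z ^ (1 + ν) * |g n t z|) ∧
      ∫ z, kin z ^ (1 + ν) * |g n t z| ≤ M := fun n t ht =>
    ⟨integrable_weight_abs (kin_rpow_nonneg _) (hM n t ht).1, (hM n t ht).2⟩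
  have hMf : ∀ t ∈ Icc 0 T, Integrable (fun z => kin z ^ (1 + ν) * |f t z|) ∧
      ∫ z, kin z ^ (1 + ν) * |f t z| ≤ M := fun t ht =>
    integrable_moment_of_tendsto (kin_rpow_nonneg _) (hl.tendsto ht.1) (fun n => (hMa n t ht).1)
      (fun n => (hMa n t ht).2) tendsto_const_nhds
  have hc : ContinuousOn f (Icc 0 T) := hl.continuousOn fun n => (hg.mild n T).continuousOn
  refine ⟨hc, fun t ht => h.integrable_rate_L1 (integrable_weight_of_abs (measurable_kin_rpow _)
    (integrable_L1 _).1 (hMf t ht).1), h.continuousOn_collQ hc hMf, fun t ht => ?_⟩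
  have hT : 0 ≤ T := ht.1.trans ht.2
  have hsub : Icc 0 t ⊆ Icc 0 T := Icc_subset_Icc_right ht.2
  have h1 : Tendsto (fun n => alongChar t (g n t)) atTop (𝓝 (alongChar t (f t))) :=
    tendsto_alongChar t (hl.tendsto ht.1)
  have h2 : Tendsto (fun n => approxData n f₀ + ∫ s in (0 : ℝ)..t, alongChar s
      (collQ (cutWeight (((n : ℝ) + 1) ^ 4) W) fun z => id (g n s z))) atTop
      (𝓝 (f₀ + ∫ s in (0 : ℝ)..t, alongChar s (collQ W fun z => id (f s z)))) := by
    refine (tendsto_approxData hf₀).add ?_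
    -- The collision terms converge in `L¹` at each time and are bounded uniformly by the moments,
    -- so dominated convergence in time applies.
    refine intervalIntegral.tendsto_integral_filter_of_dominated_convergence
      (fun _ => 8 * Λ * sphArea d * M ^ 2) (Eventually.of_forall fun n => ?_)
      (Eventually.of_forall fun n => Eventually.of_forall fun s hs => ?_)
      intervalIntegrable_const (Eventually.of_forall fun s hs => ?_)
    · rw [uIoc_of_le ht.1]
      exact ((continuousOn_alongChar continuousOn_id (hg.mild n T).continuousOn_collQ).mono
        (Ioc_subset_Icc_self.trans hsub)).aestronglyMeasurable measurableSet_Ioc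
    · rw [uIoc_of_le ht.1] at hs
      have hs' : s ∈ Icc 0 T := hsub (Ioc_subset_Icc_self hs)
      rw [norm_alongChar]
      obtain ⟨a1, a2⟩ := (h.truncate (((n : ℝ) + 1) ^ 4)).integral_kin_mul_collQ_le
        (hM n s hs').1 (hM n s hs').2
      exact (norm_le_integral_kin a1).trans a2
    · rw [uIoc_of_le ht.1] at hs
      have hs' : s ∈ Icc 0 T := hsub (Ioc_subset_Icc_self hs)
      exact tendsto_alongChar s (h.tendsto_collQ_of_tendsto tendsto_cutRadius (hl.tendsto hs'.1)
        (fun n => hMa n s hs') (hMf s hs'))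
  refine tendsto_nhds_unique h1 (h2.congr fun n => ?_)
  exact ((hg.mild n T).eq t ht).symm

end Limit

end FuzzyBoltzmann

/-! ### Regular solutions: the a priori bounds in the limit. -/

namespace FuzzyBoltzmann

open Filter Topology

variable {d : ℕ} {Λ ν : ℝ} {W : Coll d → ℝ} {f₀ : L1 d} {g : ℕ → ℝ → L1 d} {f : ℝ → L1 d} {T t : ℝ}

theorem tendsto_integral_mul_approxData (hf₀ : 0 ≤ f₀) {χ w : Phase d → ℝ} (hχ : Measurable χ)
    (hw : Measurable w) (hχw : ∀ z, |χ z| ≤ w z) (hi : Integrable fun z => w z * f₀ z)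
    (hr : Integrable fun z => w z * refDens z) :
    Tendsto (fun n => ∫ z, χ z * approxData n f₀ z) atTop (𝓝 (∫ z, χ z * f₀ z)) := by
  have hw0 : ∀ z, 0 ≤ w z := fun z => (abs_nonneg _).trans (hχw z)
  have hlow : ∀ {F : L1 d}, Integrable (fun z => w z * F z) → Integrable fun z => χ z * F z :=
    fun {F} hF => by
      refine hF.mono (hχ.aestronglyMeasurable.mul (integrable_L1 F).1)
        (Eventually.of_forall fun z => ?_)
      rw [norm_mul, norm_mul, Real.norm_of_nonneg (hw0 z)]
      exact mul_le_mul_of_nonneg_right (hχw z) (norm_nonneg _)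
  have hn := fun n => (integral_mul_approxData_le hf₀ hw hw0 hw0 (n := n) (fun _ _ => le_rfl)
    hi hr).1
  rw [tendsto_iff_norm_sub_tendsto_zero]
  refine squeeze_zero (fun _ => norm_nonneg _) (fun n => ?_)
    (tendsto_integral_mul_approxData_sub hf₀ hw hw0 hi hr)
  rw [← integral_sub (hlow (hn n)) (hlow hi)]
  refine (norm_integral_le_integral_norm _).trans (integral_mono
    ((hlow (hn n)).sub (hlow hi)).norm (integrable_weight_abs_sub hw0 (hn n) hi) fun z => ?_)
  simp only
  rw [← mul_sub, norm_mul]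
  exact mul_le_mul_of_nonneg_right (hχw z) (norm_nonneg _)

/-- Nonnegative solutions with the expected a priori bounds. -/
structure IsRegular (W : Coll d → ℝ) (Λ ν : ℝ) (f₀ : L1 d) (f : ℝ → L1 d) : Prop where
  mild : ∀ T, IsMild W id T f₀ f
  nonneg : ∀ t, 0 ≤ t → 0 ≤ f t
  energy : ∀ t, 0 ≤ t → Integrable fun z => kin z * f t z
  invariant : ∀ χ : Phase d → ℝ, Measurable χ → (∀ t z, χ (shift t z) = χ z) →
    (∀ c, collGrad χ c = 0) → (∀ z, |χ z| ≤ kin z) → ∀ t, 0 ≤ t →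
    ∫ z, χ z * f t z = ∫ z, χ z * f₀ z
  moment : ∀ T, ∀ t ∈ Icc 0 T, Integrable (fun z => kin z ^ (1 + ν) * f t z) ∧
    ∫ z, kin z ^ (1 + ν) * f t z ≤ (∫ z, kin z ^ (1 + ν) * f₀ z)
      * Real.exp (6 * Λ * sphArea d * (∫ z, kin z * f₀ z) * T)
  position : Integrable (fun z => pos z * f₀ z) → ∀ T, ∀ t ∈ Icc 0 T,
    Integrable (fun z => pos z * f t z) ∧ ∫ z, pos z * f t z
      ≤ ((∫ z, pos z * f₀ z) + (∫ z, kin z * f₀ z) * T) * Real.exp T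
  entropy_le : Integrable (fun z => pos z * f₀ z) → Integrable (fun z => f₀ z * Real.log (f₀ z)) →
    ∀ t, 0 ≤ t → Integrable (fun z => f t z * Real.log (f t z)) ∧
      ∫⁻ s in Icc 0 t, dissW W (f s) ≠ ⊤ ∧
      (∫ z, f t z * Real.log (f t z)) + (∫⁻ s in Icc 0 t, dissW W (f s)).toReal
        ≤ ∫ z, f₀ z * Real.log (f₀ z)

theorem KinLimit.entropy_inequality (hl : KinLimit g f) (hg : IsApprox W f₀ g)
    (h : HasGrowth Λ ν W) (hf₀ : 0 ≤ f₀) (hk : Integrable fun z => kin z * f₀ z)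
    (hp : Integrable fun z => pos z * f₀ z) (he : Integrable fun z => f₀ z * Real.log (f₀ z))
    (ht : 0 ≤ t) : Integrable (fun z => f t z * Real.log (f t z)) ∧
      ∫⁻ s in Icc 0 t, dissW W (f s) ≠ ⊤ ∧
      (∫ z, f t z * Real.log (f t z)) + (∫⁻ s in Icc 0 t, dissW W (f s)).toReal
        ≤ ∫ z, f₀ z * Real.log (f₀ z) := by
  obtain ⟨e1, b, hb, e2⟩ := entropy_approxData hf₀ hk hp he
  set m := (∫ z, kin z * f₀ z) + ∫ z : Phase d, kin z * refDens z with hm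
  set p := (∫ z, pos z * f₀ z) + ∫ z : Phase d, pos z * refDens z with hpdef
  have hpa := fun n => integral_pos_mul_approxData_le hf₀ hp n
  have hka := fun n => integral_kin_mul_approxData_le hf₀ hk n
  have hgk := fun n s (hs : s ∈ Icc 0 t) => hg.integral_kin_le h hf₀ hk n hs.1
  have hgp := fun n s (hs : s ∈ Icc 0 t) => hg.integral_pos_le h hf₀ hk (hpa n).1 hs
  refine entropy_inequality_of_tendsto (V := fun n : ℕ => cutWeight (((n : ℝ) + 1) ^ 4) W)
    (fun n => (h.isCutoff_nat n).measurable) (fun c => eventually_cutWeight_eq tendsto_cutRadius W c)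
    (fun n => (hg.mild n t).continuousOn) (fun s hs => hl.tendsto hs.1)
    (fun n s hs => hg.nonneg n s hs.1) (M := m + (p + m * t) * Real.exp t)
    (fun n s hs => (hgk n s hs).1) (fun n s hs => (hgp n s hs).1)
    (fun n s hs => ?_) hb (fun n s hs => ?_) (t := t) ⟨ht, le_rfl⟩
  · refine add_le_add (hgk n s hs).2 ((hgp n s hs).2.trans ?_)
    have h1 := (hpa n).2
    have h2 := mul_le_mul_of_nonneg_right (hka n).2 ht
    exact mul_le_mul_of_nonneg_right (add_le_add h1 h2) (Real.exp_pos _).le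
  · obtain ⟨a1, a2, a3⟩ := entropy_of_isCutoff (h.isCutoff_nat n) (approxData_nonneg hf₀ n)
      (exists_le_approxData hf₀ n _ t) (e1 n) (hg.mild n t) hs
    exact ⟨a1, a2, a3.trans (e2 n)⟩

/-- Existence of regular solutions. -/
theorem HasGrowth.exists_isRegular (h : HasGrowth Λ ν W) (hν : ν ≤ 1 / 2) (hf₀ : 0 ≤ f₀)
    (hm : Integrable fun z => kin z ^ (1 + ν) * f₀ z) : ∃ f, IsRegular W Λ ν f₀ f := by
  obtain ⟨g, hg⟩ := h.exists_isApprox hf₀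
  obtain ⟨f, hl⟩ := hg.exists_kinLimit h hν hf₀ hm
  have hν0 := h.exp_nonneg
  have hk := integrable_kin_of_rpow hν0 (integrable_L1 f₀).1 hm
  have hgk := fun n t (ht : 0 ≤ t) => hg.integral_kin_le h hf₀ hk n ht
  have hfk : ∀ t, 0 ≤ t → Integrable fun z => kin z * f t z := fun t ht =>
    (hl.integral_mul_le hg ht continuous_kin.measurable (fun z => (kin_pos z).le)
      (fun n => (hgk n t ht).1) (fun n => (hgk n t ht).2) tendsto_const_nhds).1
  have hkin := tendsto_integral_mul_approxData hf₀ continuous_kin.measurable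
    continuous_kin.measurable (fun z => (abs_of_pos (kin_pos z)).le) hk integrable_kin_mul_refDens
  refine ⟨f, fun T => hl.isMild hg h h.exp_le hf₀ hm T, fun t ht => hl.nonneg hg ht, hfk, ?_, ?_,
    ?_, fun hp he t ht => hl.entropy_inequality hg h hf₀ hk hp he ht⟩
  · intro χ hχ hs hc hχk t ht
    refine tendsto_nhds_unique (hl.tendsto_integral hχ hχk ht (fun n => (hgk n t ht).1)
      (hfk t ht)) ?_
    simp only [hg.integral_collInvariant h hf₀ hk hχ hs hc hχk _ ht]
    exact tendsto_integral_mul_approxData hf₀ hχ continuous_kin.measurable hχk hk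
      integrable_kin_mul_refDens
  · intro T t ht
    have hma := fun n => (integral_kin_rpow_mul_approxData_le hf₀ (q := 1 + ν) (by linarith) hm n).1
    have hb := fun n => hg.integral_kin_rpow_le h hf₀ hk (q := 1 + ν) (by linarith) (by linarith)
      (hma n) ht
    -- The moments of the approximating data converge to those of `f₀`, so the limiting bound
    -- contains no contribution of the reference density and has leading constant `1`.
    have hlim := tendsto_integral_mul_approxData hf₀ (measurable_kin_rpow (1 + ν))
      (measurable_kin_rpow (1 + ν)) (fun z => (abs_of_nonneg (kin_rpow_nonneg _ z)).le) hm
      (integrable_kin_rpow_mul_refDens (by linarith))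
    refine hl.integral_mul_le hg ht.1 (measurable_kin_rpow _) (kin_rpow_nonneg _)
      (fun n => (hb n).1) (fun n => (hb n).2) (hlim.mul ?_)
    exact (Real.continuous_exp.tendsto _).comp ((hkin.const_mul _).mul_const _)
  · intro hp T t ht
    have hpa := fun n => (integral_pos_mul_approxData_le hf₀ hp n).1
    have hb := fun n => hg.integral_pos_le h hf₀ hk (hpa n) ht
    have hlim := tendsto_integral_mul_approxData hf₀ continuous_pos.measurable
      continuous_pos.measurable (fun z => (abs_of_pos (pos_pos z)).le) hp integrable_pos_mul_refDens
    exact hl.integral_mul_le hg ht.1 continuous_pos.measurable (fun z => (pos_pos z).le)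
      (fun n => (hb n).1) (fun n => (hb n).2) ((hlim.add (hkin.mul_const T)).mul_const _)

end FuzzyBoltzmann

/-! ### Translation between moments and norms; conservation laws; almost everywhere bounds in time.
-/

namespace FuzzyBoltzmann

open Filter Topology

variable {d : ℕ} {Λ ν : ℝ} {W : Coll d → ℝ} {f₀ g : L1 d} {f : ℝ → L1 d} {T t : ℝ}

section Norms

theorem lintegral_ofReal_weight {w : Phase d → ℝ} (hw0 : ∀ z, 0 ≤ w z)
    (h : Integrable fun z => w z * |g z|) :
    ∫⁻ z, ENNReal.ofReal (w z * |g z|) = ENNReal.ofReal (∫ z, w z * |g z|) :=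
  (ofReal_integral_eq_lintegral_ofReal h
    (Eventually.of_forall fun z => mul_nonneg (hw0 z) (abs_nonneg _))).symm

theorem integrable_weight_of_lintegral {w : Phase d → ℝ} (hw : Measurable w) (hw0 : ∀ z, 0 ≤ w z)
    (h : ∫⁻ z, ENNReal.ofReal (w z * |g z|) < ⊤) : Integrable fun z => w z * |g z| :=
  ⟨hw.aestronglyMeasurable.mul (integrable_L1 g).1.norm,
    (hasFiniteIntegral_iff_ofReal (Eventually.of_forall fun z =>
      mul_nonneg (hw0 z) (abs_nonneg _))).2 h⟩

theorem normX_two (g : Phase d → ℝ) : normX 2 g = ∫⁻ z, ENNReal.ofReal (pos z * |g z|) := by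
  refine lintegral_congr fun z => ?_
  rw [Real.rpow_two, jb_sq]; rfl

theorem normV_two (g : Phase d → ℝ) : normV 2 g = ∫⁻ z, ENNReal.ofReal (kin z * |g z|) := by
  refine lintegral_congr fun z => ?_
  rw [Real.rpow_two, jb_sq]; rfl

theorem normV_two_add (μ : ℝ) (g : Phase d → ℝ) :
    normV (2 + μ) g = ∫⁻ z, ENNReal.ofReal (kin z ^ (1 + μ / 2) * |g z|) := by
  refine lintegral_congr fun z => ?_
  rw [show 2 + μ = 2 * (1 + μ / 2) by ring, jb_rpow_two_mul]; rfl

theorem integrable_pos_of_normX (h : normX 2 g < ⊤) : Integrable fun z => pos z * g z :=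
  integrable_weight_of_abs continuous_pos.measurable (integrable_L1 g).1
    (integrable_weight_of_lintegral continuous_pos.measurable (fun z => (pos_pos z).le)
      (by rwa [← normX_two]))

theorem integrable_kin_of_normV (h : normV 2 g < ⊤) : Integrable fun z => kin z * g z :=
  integrable_weight_of_abs continuous_kin.measurable (integrable_L1 g).1
    (integrable_weight_of_lintegral continuous_kin.measurable (fun z => (kin_pos z).le)
      (by rwa [← normV_two]))

theorem integrable_kin_rpow_of_normV {μ : ℝ} (h : normV (2 + μ) g < ⊤) :
    Integrable fun z => kin z ^ (1 + μ / 2) * g z :=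
  integrable_weight_of_abs (measurable_kin_rpow _) (integrable_L1 g).1
    (integrable_weight_of_lintegral (measurable_kin_rpow _) (kin_rpow_nonneg _)
      (by rwa [← normV_two_add]))

theorem lintegral_ofReal_weight_of_nonneg {w : Phase d → ℝ} (hw0 : ∀ z, 0 ≤ w z) (hg : 0 ≤ g)
    (h : Integrable fun z => w z * g z) :
    ∫⁻ z, ENNReal.ofReal (w z * |g z|) = ENNReal.ofReal (∫ z, w z * g z) := by
  obtain ⟨h1, h2⟩ := integrable_abs_of_nonneg hg h
  rw [lintegral_ofReal_weight hw0 h1, h2]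

theorem normX_two_eq (hg : 0 ≤ g) (h : Integrable fun z => pos z * g z) :
    normX 2 g = ENNReal.ofReal (∫ z, pos z * g z) := by
  rw [normX_two, lintegral_ofReal_weight_of_nonneg (fun z => (pos_pos z).le) hg h]

theorem normV_two_eq (hg : 0 ≤ g) (h : Integrable fun z => kin z * g z) :
    normV 2 g = ENNReal.ofReal (∫ z, kin z * g z) := by
  rw [normV_two, lintegral_ofReal_weight_of_nonneg (fun z => (kin_pos z).le) hg h]

theorem normV_two_add_eq {μ : ℝ} (hg : 0 ≤ g)
    (h : Integrable fun z => kin z ^ (1 + μ / 2) * g z) :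
    normV (2 + μ) g = ENNReal.ofReal (∫ z, kin z ^ (1 + μ / 2) * g z) := by
  rw [normV_two_add, lintegral_ofReal_weight_of_nonneg (kin_rpow_nonneg _) hg h]

theorem integral_weight_nonneg {w : Phase d → ℝ} (hw0 : ∀ z, 0 ≤ w z) (hg : 0 ≤ g) :
    0 ≤ ∫ z, w z * g z :=
  integral_nonneg_of_ae (by
    filter_upwards [ae_nonneg hg] with z hz using mul_nonneg (hw0 z) hz)

end Norms

section Conservation

theorem abs_coord_le_kin (i : Fin d) (z : Phase d) : |z.2 i| ≤ kin z := by
  have h1 : |z.2 i| ≤ ‖z.2‖ := by simpa using PiLp.norm_apply_le z.2 i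
  unfold kin
  nlinarith [sq_nonneg (‖z.2‖ - 1)]

theorem norm_smul_velocity_le (a : ℝ) (z : Phase d) : ‖a • z.2‖ ≤ ‖kin z * a‖ := by
  rw [norm_smul, norm_mul, mul_comm, Real.norm_of_nonneg (kin_pos z).le]
  refine mul_le_mul_of_nonneg_right ?_ (norm_nonneg _)
  unfold kin
  nlinarith [sq_nonneg (‖z.2‖ - 1)]

theorem integral_smul_velocity_apply (h : Integrable fun z => kin z * g z) (i : Fin d) :
    (∫ z, g z • z.2) i = ∫ z, z.2 i * g z := by
  have hi : Integrable fun z => g z • z.2 := by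
    refine h.mono ((integrable_L1 g).1.smul
      (by fun_prop : Continuous fun z : Phase d => z.2).aestronglyMeasurable)
      (Eventually.of_forall fun z => norm_smul_velocity_le _ _)
  have := ((EuclideanSpace.proj i : Vec d →L[ℝ] ℝ).integral_comp_comm hi).symm
  refine this.trans (integral_congr_ae (Eventually.of_forall fun z => ?_))
  simp [mul_comm]

theorem IsRegular.sameMomentumEnergy (h : IsRegular W Λ ν f₀ f)
    (h0 : Integrable fun z => kin z * f₀ z) (ht : 0 ≤ t) : SameMomentumEnergy f₀ (f t) := by
  have hk := h.energy t ht
  refine ⟨?_, ?_, ?_⟩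
  · rw [normV_two_eq (h.nonneg t ht) hk]; exact ENNReal.ofReal_lt_top
  · ext i
    rw [integral_smul_velocity_apply hk, integral_smul_velocity_apply h0]
    refine h.invariant (fun z => z.2 i) (by fun_prop) (fun _ _ => rfl) (fun c => ?_)
      (abs_coord_le_kin i) t ht
    have := congrArg (fun v : Vec d => v i) (postV_add_postVs c.1.2 c.2.1.2 c.2.2)
    simp only [PiLp.add_apply] at this
    simp only [collGrad, post, postS]
    linarith
  · refine h.invariant (fun z => ‖z.2‖ ^ 2) (by fun_prop) (fun _ _ => rfl) (fun c => ?_)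
      (fun z => ?_) t ht
    · have := norm_sq_post c.1.2 c.2.1.2 c.2.2
      simp only [collGrad, post, postS]
      linarith
    · rw [abs_of_nonneg (sq_nonneg _)]
      unfold kin; linarith

theorem IsRegular.integral_eq (h : IsRegular W Λ ν f₀ f) (ht : 0 ≤ t) :
    ∫ z, f t z = ∫ z, f₀ z := by
  have := h.invariant (fun _ => 1) measurable_const (fun _ _ => rfl) (fun c => by simp [collGrad])
    (fun z => by rw [abs_one]; exact one_le_kin z) t ht
  simpa using this

end Conservation

section Entropy

theorem IsRegular.entropyInequality {B : Vec d → Sph d → ℝ} {k : Vec d → ℝ}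
    (h : IsRegular (weight B k) Λ ν f₀ f) (hf₀ : 0 ≤ f₀) (hk : Integrable fun z => kin z * f₀ z)
    (hp : Integrable fun z => pos z * f₀ z) (he : entropy f₀ < ⊤) (hT : 0 ≤ T) :
    EntropyInequality B k T f₀ f := by
  have hi := integrable_mul_log_of_entropy hf₀ (integrable_norm_mul hk hp) he
  refine ⟨fun t ht => ?_, (h.entropy_le hp hi T hT).2.1.lt_top⟩
  obtain ⟨h1, h2, h3⟩ := h.entropy_le hp hi t ht.1
  rw [entropy_eq h1, entropy_eq hi]
  refine ⟨EReal.bot_lt_coe _, EReal.coe_lt_top _, ?_⟩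
  have e : ∫⁻ s in Icc 0 t, dissipation B k (f s) = ∫⁻ s in Icc 0 t, dissW (weight B k) (f s) := rfl
  rw [e, ← EReal.coe_ennreal_toReal h2]
  norm_cast
  linarith

end Entropy

section Uniqueness

/-- A moment bound at almost all times holds at all times. -/
theorem integral_moment_le_of_ae {w : Phase d → ℝ} (hw0 : ∀ z, 0 ≤ w z) (hT : 0 < T)
    (hf : ContinuousOn f (Icc 0 T)) {M : ℝ}
    (h : ∀ᵐ t ∂(volume.restrict (Icc 0 T)), Integrable (fun z => w z * |f t z|) ∧
      ∫ z, w z * |f t z| ≤ M) (ht : t ∈ Icc 0 T) :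
    Integrable (fun z => w z * |f t z|) ∧ ∫ z, w z * |f t z| ≤ M := by
  -- A set of full measure is dense, so every time is a limit of times at which the bound holds.
  -- Continuity in `L¹` and Fatou's lemma carry the bound over, at the end points as well.
  have hd := Measure.dense_of_ae ((ae_restrict_iff' measurableSet_Icc).1 h)
  have hcl : t ∈ closure (Ioo 0 T ∩ {s | s ∈ Icc 0 T → Integrable (fun z => w z * |f s z|) ∧
      ∫ z, w z * |f s z| ≤ M}) := by
    have := closure_mono (hd.open_subset_closure_inter (isOpen_Ioo (a := (0 : ℝ)) (b := T)))
    rw [closure_closure, closure_Ioo hT.ne] at this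
    exact this ht
  obtain ⟨s, hs, hlim⟩ := mem_closure_iff_seq_limit.1 hcl
  have hsI : ∀ n, s n ∈ Icc 0 T := fun n => Ioo_subset_Icc_self (hs n).1
  have hF : Tendsto (fun n => f (s n)) atTop (𝓝 (f t)) :=
    (hf t ht).tendsto.comp (tendsto_nhdsWithin_iff.2 ⟨hlim, Eventually.of_forall hsI⟩)
  exact integrable_moment_of_tendsto hw0 hF (fun n => ((hs n).2 (hsI n)).1)
    (fun n => ((hs n).2 (hsI n)).2) tendsto_const_nhds

theorem IsEssBounded.exists_moment_bound {μ p : ℝ} {f : ℝ → L1 d}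
    (h : IsEssBounded p (2 + μ) T f) (hT : 0 < T) (hf : ContinuousOn f (Icc 0 T)) :
    ∃ M, ∀ t ∈ Icc 0 T, Integrable (fun z => kin z ^ (1 + μ / 2) * |f t z|) ∧
      ∫ z, kin z ^ (1 + μ / 2) * |f t z| ≤ M := by
  obtain ⟨M, hM⟩ := h
  refine ⟨max M 0, fun t ht => integral_moment_le_of_ae (kin_rpow_nonneg _) hT hf ?_ ht⟩
  filter_upwards [hM] with t ht
  have h1 : normV (2 + μ) (f t) ≤ ENNReal.ofReal M := le_add_self.trans ht
  rw [normV_two_add] at h1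
  have h2 := integrable_weight_of_lintegral (g := f t) (measurable_kin_rpow _) (kin_rpow_nonneg _)
    (h1.trans_lt ENNReal.ofReal_lt_top)
  refine ⟨h2, ?_⟩
  rw [lintegral_ofReal_weight (kin_rpow_nonneg _) h2] at h1
  exact (ENNReal.ofReal_le_ofReal_iff (le_max_right _ _)).1
    (h1.trans (ENNReal.ofReal_le_ofReal (le_max_left _ _)))

end Uniqueness

end FuzzyBoltzmann

/-! ### Bounds in the norms of the theorem, uniqueness of weak solutions, and conclusion. -/

namespace FuzzyBoltzmann

open Filter Topology

variable {d : ℕ} {Λ ν : ℝ} {f₀ : L1 d} {f : ℝ → L1 d} {T t : ℝ}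

/-- With `p` and `k` the initial moments in position and velocity, `p + k T ≤ (1 + T) (p + k)`. This
gives the constant `(1 + T) exp T`. -/
theorem IsRegular.normX_le {W : Coll d → ℝ} (h : IsRegular W Λ ν f₀ f) (hf₀ : 0 ≤ f₀)
    (hfin : normXV 2 2 f₀ < ⊤) (ht : t ∈ Icc 0 T) :
    normX 2 (f t) ≤ ENNReal.ofReal ((1 + T) * Real.exp T) * normXV 2 2 f₀ := by
  have hT : 0 ≤ T := ht.1.trans ht.2
  have hp := integrable_pos_of_normX (le_self_add.trans_lt hfin)
  have hk := integrable_kin_of_normV (le_add_self.trans_lt hfin)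
  obtain ⟨h1, h2⟩ := h.position hp T t ht
  have p0 := integral_weight_nonneg (fun z => (pos_pos z).le) hf₀
  have k0 := integral_weight_nonneg (fun z => (kin_pos z).le) hf₀
  rw [normXV, normX_two_eq hf₀ hp, normV_two_eq hf₀ hk, normX_two_eq (h.nonneg t ht.1) h1,
    ← ENNReal.ofReal_add p0 k0, ← ENNReal.ofReal_mul (by positivity)]
  refine ENNReal.ofReal_le_ofReal (h2.trans ?_)
  rw [mul_right_comm]
  refine mul_le_mul_of_nonneg_right ?_ (Real.exp_pos T).le
  nlinarith [mul_nonneg hT p0]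

theorem IsRegular.normV_le {W : Coll d → ℝ} {μ : ℝ} (h : IsRegular W Λ (μ / 2) f₀ f)
    (hf₀ : 0 ≤ f₀) (hk : normV 2 f₀ < ⊤) (hm : normV (2 + μ) f₀ < ⊤) (ht : t ∈ Icc 0 T) :
    normV (2 + μ) (f t) ≤ ENNReal.ofReal
      (1 * Real.exp (6 * Λ * sphArea d * T * (normV 2 f₀).toReal)) * normV (2 + μ) f₀ := by
  obtain ⟨h1, h2⟩ := h.moment T t ht
  have k0 := integral_weight_nonneg (fun z => (kin_pos z).le) hf₀
  rw [normV_two_eq hf₀ (integrable_kin_of_normV hk), ENNReal.toReal_ofReal k0,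
    normV_two_add_eq hf₀ (integrable_kin_rpow_of_normV hm), normV_two_add_eq (h.nonneg t ht.1) h1,
    ← ENNReal.ofReal_mul (by positivity)]
  refine ENNReal.ofReal_le_ofReal (h2.trans (le_of_eq ?_))
  rw [one_mul, mul_comm (∫ z, _), mul_right_comm _ T]

theorem normV_mono {p q : ℝ} (h : p ≤ q) (g : Phase d → ℝ) : normV p g ≤ normV q g :=
  lintegral_mono fun z => ENNReal.ofReal_le_ofReal (mul_le_mul_of_nonneg_right
    (Real.rpow_le_rpow_of_exponent_le (one_le_jb z.2) h) (abs_nonneg _))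

theorem IsRegular.isEssBounded {W : Coll d → ℝ} {μ : ℝ} (h : IsRegular W Λ (μ / 2) f₀ f)
    (hf₀ : 0 ≤ f₀) (hμ : 0 ≤ μ) (hfin : normXV 2 (2 + μ) f₀ < ⊤) (T : ℝ) :
    IsEssBounded 2 (2 + μ) T f := by
  have hx : normX 2 f₀ < ⊤ := le_self_add.trans_lt hfin
  have hm : normV (2 + μ) f₀ < ⊤ := le_add_self.trans_lt hfin
  have hk : normV 2 f₀ < ⊤ := (normV_mono (by linarith) _).trans_lt hm
  have hxv : normXV 2 2 f₀ < ⊤ := ENNReal.add_lt_top.2 ⟨hx, hk⟩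
  set A := ENNReal.ofReal ((1 + T) * Real.exp T) * normXV 2 2 f₀ + ENNReal.ofReal
    (1 * Real.exp (6 * Λ * sphArea d * T * (normV 2 f₀).toReal)) * normV (2 + μ) f₀ with hA
  have hAfin : A ≠ ⊤ := (ENNReal.add_lt_top.2 ⟨ENNReal.mul_lt_top ENNReal.ofReal_lt_top hxv,
    ENNReal.mul_lt_top ENNReal.ofReal_lt_top hm⟩).ne
  refine ⟨A.toReal, (ae_restrict_iff' measurableSet_Icc).2 (Eventually.of_forall fun t ht => ?_)⟩
  rw [ENNReal.ofReal_toReal hAfin]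
  exact add_le_add (h.normX_le hf₀ hxv ht) (h.normV_le hf₀ hk hm ht)

/-- Weak solutions with bounded moments are mild. -/
theorem HasGrowth.isMild_of_isWeakSolution {B : Vec d → Sph d → ℝ} {k : Vec d → ℝ}
    (hW : HasGrowth Λ ν (weight B k)) (hT : 0 < T) (h : IsWeakSolution B k T f₀ f) {M : ℝ}
    (hM : ∀ t ∈ Icc 0 T, Integrable (fun z => kin z ^ (1 + ν) * |f t z|) ∧
      ∫ z, kin z ^ (1 + ν) * |f t z| ≤ M) : IsMild (weight B k) id T f₀ f :=
  FuzzyBoltzmann.isMild_of_isWeakSolution hW.toIsCollWeight hT h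
    (fun t ht => hW.integrable_rate_L1 (integrable_weight_of_abs (measurable_kin_rpow _)
      (integrable_L1 _).1 (hM t ht).1)) (hW.continuousOn_collQ h.1 hM)

/-- Uniqueness of weak solutions with bounded moments. -/
theorem IsRegular.eqOn_of_isWeakSolution {B : Vec d → Sph d → ℝ} {k : Vec d → ℝ} {μ : ℝ}
    (hW : HasGrowth Λ (μ / 2) (weight B k)) (hf : IsRegular (weight B k) Λ (μ / 2) f₀ f)
    (hT : 0 < T) {g : ℝ → L1 d} (hg : IsWeakSolution B k T f₀ g)
    (hb : IsEssBounded 2 (2 + μ) T g) : EqOn g f (Icc 0 T) := by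
  obtain ⟨M, hM⟩ := hb.exists_moment_bound hT hg.1
  set M' := (∫ z, kin z ^ (1 + μ / 2) * f₀ z)
      * Real.exp (6 * Λ * sphArea d * (∫ z, kin z * f₀ z) * T)
  refine (hf.mild T).unique_of_moments hW (M := max M M')
    (hW.isMild_of_isWeakSolution hT hg hM) (fun t ht => hf.nonneg t ht.1) (fun t ht => ?_)
    (fun t ht => ?_)
  · obtain ⟨h1, h2⟩ := hf.moment T t ht
    refine ⟨h1, ?_⟩
    rw [(integrable_abs_of_nonneg (hf.nonneg t ht.1) h1).2]
    exact h2.trans (le_max_right _ _)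
  · exact ⟨integrable_weight_of_abs (measurable_kin_rpow _) (integrable_L1 _).1 (hM t ht).1,
      (hM t ht).2.trans (le_max_left _ _)⟩

/-- For bounded weights there are solutions for all data, regular if the data has finite energy. -/
theorem HasGrowth.exists_isMild {W : Coll d → ℝ} (hW : HasGrowth Λ 0 W) (hf₀ : 0 ≤ f₀) :
    ∃ f : ℝ → L1 d, (∀ T, IsMild W id T f₀ f) ∧ (∀ t, 0 ≤ t → 0 ≤ f t ∧ ‖f t‖ = ‖f₀‖) ∧
      (normV 2 f₀ < ⊤ → IsRegular W Λ 0 f₀ f) := by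
  -- With finite energy the solution is taken from the approximation scheme, which provides the
  -- extra bounds. Otherwise the Picard solution is enough, and the last claim is vacuous.
  by_cases hk : normV 2 f₀ < ⊤
  · obtain ⟨f, hf⟩ := hW.exists_isRegular (by norm_num) hf₀
      (by simpa only [add_zero, Real.rpow_one] using integrable_kin_of_normV hk)
    refine ⟨f, hf.mild, fun t ht => ⟨hf.nonneg t ht, ?_⟩, fun _ => hf⟩
    rw [norm_eq_integral_of_nonneg (hf.nonneg t ht), norm_eq_integral_of_nonneg hf₀,
      hf.integral_eq ht]
  · obtain ⟨f, hf, h⟩ := exists_mild hW.toIsCollWeight hW.const_nonneg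
      (fun c => by simpa using hW.le c) isTruncation_id hf₀
    exact ⟨f, hf, fun t ht => ⟨(h t ht).1, (h t ht).2.1⟩, fun h' => absurd h' hk⟩

/-- Uniqueness of weak solutions for bounded weights. -/
theorem IsMild.eqOn_of_isWeakSolution {B : Vec d → Sph d → ℝ} {k : Vec d → ℝ}
    (hW : HasGrowth Λ 0 (weight B k)) (hf : IsMild (weight B k) id T f₀ f) (hT : 0 < T)
    {g : ℝ → L1 d} (hg : IsWeakSolution B k T f₀ g) : EqOn g f (Icc 0 T) := by
  have hb : ∀ c, weight B k c ≤ Λ := fun c => by simpa using hW.le c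
  refine IsMild.unique_of_bounded hW.const_nonneg hW.toIsCollWeight hb hf
    (FuzzyBoltzmann.isMild_of_isWeakSolution hW.toIsCollWeight hT hg
      (fun t _ => FuzzyBoltzmann.integrable_rate hW.toIsCollWeight hb (integrable_L1 _)) ?_)
  exact (continuous_collQ_truncation hW.toIsCollWeight hW.const_nonneg hb
    isTruncation_id).comp_continuousOn hg.1

end FuzzyBoltzmann

theorem theorem3p2 (d : ℕ) (hd : 3 ≤ d) (μ : ℝ) (hμ : μ ≤ 1)
    (B : Vec d → Sph d → ℝ) (hB : IsCollisionKernel μ B)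
    (k : Vec d → ℝ) (hk : IsSpatialKernel k) :
    (μ ≤ 0 →
      ∃ C : ℝ → ℝ, ∀ f₀ : L1 d, 0 ≤ f₀ →
        ∃ f : ℝ → L1 d, ∀ T : ℝ, 0 < T →
          IsWeakSolution B k T f₀ f ∧
          ContDiffOn ℝ 1 (fun t => alongChar t (f t)) (Icc 0 T) ∧
          (∀ t ∈ Icc 0 T, 0 ≤ f t ∧ ‖f t‖ = ‖f₀‖) ∧
          (∀ g : ℝ → L1 d, IsWeakSolution B k T f₀ g → EqOn g f (Icc 0 T)) ∧
          (normV 2 f₀ < ⊤ → ∀ t ∈ Icc 0 T, SameMomentumEnergy f₀ (f t)) ∧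
          (normXV 2 2 f₀ < ⊤ → ∀ t ∈ Icc 0 T,
            normX 2 (f t) ≤ ENNReal.ofReal (C T) * normXV 2 2 f₀) ∧
          (normXV 2 2 f₀ < ⊤ → entropy f₀ < ⊤ → EntropyInequality B k T f₀ f)) ∧
    (0 < μ →
      ∃ (C C' : ℝ → ℝ) (K : ℝ), ∀ f₀ : L1 d, 0 ≤ f₀ → normXV 2 (2 + μ) f₀ < ⊤ → entropy f₀ < ⊤ →
        ∃ f : ℝ → L1 d, ∀ T : ℝ, 0 < T →
          IsWeakSolution B k T f₀ f ∧
          ContDiffOn ℝ 1 (fun t => alongChar t (f t)) (Icc 0 T) ∧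
          IsEssBounded 2 (2 + μ) T f ∧
          (∀ g : ℝ → L1 d, IsWeakSolution B k T f₀ g → IsEssBounded 2 (2 + μ) T g →
            EqOn g f (Icc 0 T)) ∧
          (∀ t ∈ Icc 0 T, 0 ≤ f t ∧ ∫ z, f t z = ∫ z, f₀ z) ∧
          (∀ t ∈ Icc 0 T, SameMomentumEnergy f₀ (f t)) ∧
          (∀ t ∈ Icc 0 T, normX 2 (f t) ≤ ENNReal.ofReal (C T) * normXV 2 2 f₀) ∧
          (∀ t ∈ Icc 0 T, normV (2 + μ) (f t) ≤
            ENNReal.ofReal (K * Real.exp (C' T * (normV 2 f₀).toReal)) * normV (2 + μ) f₀) ∧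
          EntropyInequality B k T f₀ f) := by
  obtain ⟨Λ, hW⟩ := weight_hasGrowth hμ hB hk
  constructor
  · intro hμ0
    -- For `μ ≤ 0` the growth exponent is zero and the weight is bounded.
    rw [max_eq_right hμ0, zero_div] at hW
    refine ⟨fun T => (1 + T) * Real.exp T, fun f₀ hf₀ => ?_⟩
    obtain ⟨f, hf, hf0, hreg⟩ := hW.exists_isMild hf₀
    refine ⟨f, fun T hT => ⟨(hf T).isWeakSolution hW.toIsCollWeight hT.le,
      (hf T).contDiffOn hT.le, fun t ht => hf0 t ht.1,
      fun g hg => (hf T).eqOn_of_isWeakSolution hW hT hg,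
      fun h t ht => (hreg h).sameMomentumEnergy (integrable_kin_of_normV h) ht.1,
      fun h t ht => (hreg (le_add_self.trans_lt h)).normX_le hf₀ h ht,
      fun h he => (hreg (le_add_self.trans_lt h)).entropyInequality hf₀
        (integrable_kin_of_normV (le_add_self.trans_lt h))
        (integrable_pos_of_normX (le_self_add.trans_lt h)) he hT.le⟩⟩
  · intro hμ0
    rw [max_eq_left hμ0.le] at hW
    refine ⟨fun T => (1 + T) * Real.exp T, fun T => 6 * Λ * sphArea d * T, 1,
      fun f₀ hf₀ hfin he => ?_⟩
    have hx : normX 2 f₀ < ⊤ := le_self_add.trans_lt hfin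
    have hm : normV (2 + μ) f₀ < ⊤ := le_add_self.trans_lt hfin
    have hv : normV 2 f₀ < ⊤ := (normV_mono (by linarith) _).trans_lt hm
    have hxv : normXV 2 2 f₀ < ⊤ := ENNReal.add_lt_top.2 ⟨hx, hv⟩
    -- The condition `μ ≤ 1` becomes `ν = μ / 2 ≤ 1 / 2`, as the tail estimate requires.
    obtain ⟨f, hf⟩ := hW.exists_isRegular (by linarith) hf₀ (integrable_kin_rpow_of_normV hm)
    exact ⟨f, fun T hT => ⟨(hf.mild T).isWeakSolution hW.toIsCollWeight hT.le,
      (hf.mild T).contDiffOn hT.le, hf.isEssBounded hf₀ hμ0.le hfin T,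
      fun g hg hb => hf.eqOn_of_isWeakSolution hW hT hg hb,
      fun t ht => ⟨hf.nonneg t ht.1, hf.integral_eq ht.1⟩,
      fun t ht => hf.sameMomentumEnergy (integrable_kin_of_normV hv) ht.1,
      fun t ht => hf.normX_le hf₀ hxv ht, fun t ht => hf.normV_le hf₀ hv hm ht,
      hf.entropyInequality hf₀ (integrable_kin_of_normV hv) (integrable_pos_of_normX hx) he hT.le⟩⟩
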